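/- **Setting.** For each $n\ge1$ let $\mathcal C_n$ be a closed network with $n$ queues and $m_n$ customers, with an ergodic routing matrix whose normalised invariant measure is $(\pi_{k,n})_{1\le k\le n}$ and service rates $\mu_{k,n}(q)>0$ ($q\ge1$), having the product-form equilibrium law $$P(Q_{1,n}=q_1,\dots,Q_{n,n}=q_n)=Z_{m_n,n}^{-1}\prod_{k=1}^n\frac{\pi_{k,n}^{q_k}}{\mu_{k,n}(1)\cdots\mu_{k,n}(q_k)},\qquad q_1+\dots+q_n=m_n .$$ For $\lambda>0$ let $X_{1,n}(\lambda),\dots,X_{n,n}(\lambda)$ be independent with $P(X_{k,n}(\lambda)=x)\propto(\lambda\pi_{k,n})^x/(\mu_{k,n}(1)\cdots\mu_{k,n}(x))$. Write $m_{k,n}(\lambda)=E X_{k,n}(\lambda)$, $\beta^{(r)}_{k,n}(\lambda)=E|X_{k,n}(\lambda)-m_{k,n}(\lambda)|^r$, $\sigma_n^2(\lambda)=\sum_k\beta^{(2)}_{k,n}(\lambda)$ and $\gamma^2_{k,n}(\lambda)=\sum_{i\ge0}\frac{p_{2i}p_{2i+1}}{p_{2i}+p_{2i+1}}$, where $p_x=P(X_{k,n}(\lambda)=x)$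 and $0/0=0$; let $\phi_{k,n}(\cdot\,;\lambda)$ be the characteristic function of $X_{k,n}(\lambda)-m_{k,n}(\lambda)$. Let $\mathcal F_n$ be the set of queues with $\liminf_q(\mu_{k,n}(1)\cdots\mu_{k,n}(q))^{1/q}<\infty$, assumed non-empty; let $\mu_{k,n}$ be this liminf if $k\in\mathcal F_n$, and $\mu_{k,n}=\mu_{k,n}(1)$ otherwise. Put $\lambda^0_n=\min_{k\in\mathcal F_n}\mu_{k,n}/\pi_{k,n}$, let $\mathcal F^0_n$ be the set of $k\in\mathcal F_n$ attaining this minimum, and let $\rho_{k,n}(\lambda)=\lambda\pi_{k,n}/\mu_{k,n}$, $\hat m^0_n=\sum_{k\notin\mathcal F^0_n}m_{k,n}(\lambda^0_n)$. Let $\lambda_n\in(0,\lambda^0_n)$ be the intensity with $\sum_k m_{k,n}(\lambda_n)=m_n$, and $\rho^0_n=\lambda_n/\lambda^0_n$, $\alpha_n=\rho^0_n/(1-\rho^0_n)$. Below, $X_{k,n}$ and $\sigma_n$ are taken at $\lambda=\lambda_n$. In the assumptions, all bounds are uniform in $n$, in the queue $k$ and in $\lambda$, and $a=\Omega(b)$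 means that $cb\le a\le Cb$ for some constants $0<c\le C$. **Assumptions.** 1. (Poles) There are reals $\xi_{k,n}$ for $k\in\mathcal F^0_n$, with $1\le\xi_{k,n}<\xi_{\max}<\infty$, such that for all $0<\lambda<\lambda^0_n$ and real $t$, with $\rho=\lambda/\lambda^0_n$, $$\phi_{k,n}(t;\lambda)=e^{-\mathrm i m_{k,n}(\lambda)t}\Bigl(\frac{1-\rho}{1-\rho e^{\mathrm i t}}\Bigr)^{\xi_{k,n}}\psi_{k,n}(t;\lambda),$$ where $\partial_t\psi_{k,n}(t;\lambda)=O(1)$ uniformly in $k,n,\lambda,t$. Put $\xi_n=\sum_{k\in\mathcal F^0_n}\xi_{k,n}$. 2. (Negligibility) $\displaystyle\max_k\frac{\pi_{k,n}/\mu_{k,n}}{\sum_l\pi_{l,n}/\mu_{l,n}}\to0$ as $n\to\infty$. 3. (Service) For every $A<1$, for all $0<\lambda\le\lambda^0_n$ and $k\in\mathcal F_n$ with $\rho_{k,n}(\lambda)\le A$: $m_{k,n}(\lambda)=\Omega(\rho_{k,n}(\lambda))$, $\beta^{(r)}_{k,n}(\lambda)=\Omega(\rho_{k,n}(\lambda))$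 for $r=2,3,4$, and $\gamma^2_{k,n}(\lambda)=\Omega(\rho_{k,n}(\lambda))$. The same holds for all $k\notin\mathcal F_n$ and $0<\lambda\le\lambda^0_n$. 4. (Non-saturation) There is $A<1$ with $\lambda^0_n\pi_{k,n}/\mu_{k,n}\le A$ for all $n$ and all $k\in\mathcal F_n\setminus\mathcal F^0_n$. **Approximations.** For an error sequence $\varepsilon_n\to0$ consider $$\text{(M)}\quad E Q_{j,n}=E X_{j,n}\,[1+O(\varepsilon_n)],$$ $$\text{(D)}\quad P(Q_{j_1,n}=q_1,\dots,Q_{j_\ell,n}=q_\ell)=\prod_{i=1}^{\ell}P(X_{j_i,n}=q_i)\,[1+O(\varepsilon_n)]\quad(\ell\text{ and }q_1,\dots,q_\ell\text{ fixed}),$$ $$\text{(N)}\quad P(Q_{1,n}=q_1,\dots,Q_{n,n}=q_n)=\sqrt{2\pi}\,\sigma_n\prod_{k=1}^nP(X_{k,n}=q_k)\,[1+O(\varepsilon_n)],$$ $$\text{(G)}\quad P(Q_{1,n}=q_1,\dots,Q_{n,n}=q_n)=\frac{\alpha_n\Gamma(\xi_n)}{\xi_n^{\xi_n-1}e^{-\xi_n}}\prod_{k=1}^nP(X_{k,n}=q_k)\,[1+O(\varepsilon_n)].$$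 The $O$'s are uniform in $n$ (over those $n$ with $\hat m^0_n>0$) and in the (distinct) queue indices, and, in (N) and (G), over all $q_1+\dots+q_n=m_n$. **Theorem.** Let Assumptions 1–4 hold, with $\xi_n$ bounded, and let $\theta_n>0$. (i) If $m_n/\hat m^0_n\le1-\theta_n$ for all $n$ with $\hat m^0_n>0$, and $\theta_n^2m_n\to\infty$, then (N) holds, (M) holds for the queues $j\notin\mathcal F^0_n$, and (D) holds when no queue $j_1,\dots,j_\ell$ lies in $\mathcal F^0_n$, all with $\varepsilon_n=\dfrac1{m_n}+\dfrac1{m_n^2\theta_n^4}$. For $j\in\mathcal F^0_n$, (M) holds with $\varepsilon_n=\dfrac1{\theta_n^2m_n}$, and so does (D) when some $j_i\in\mathcal F^0_n$. (ii) If $m_n/\hat m^0_n\ge1+\theta_n$ for all $n$ with $\hat m^0_n>0$, and $\theta_n\hat m^0_n\to\infty$, $\theta_n^2\hat m^0_n\to\infty$, then (G) holds, (M) holds for all queues $j$, and (D) holds when no queue $j_1,\dots,j_\ell$ lies in $\mathcal F^0_n$, all with $$\varepsilon_n=\frac1{\theta_n^2\hat m^0_n}+\frac1{\theta_n\hat m^0_n}+\frac1{\sqrt{\hat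 m^0_n}}\Bigl[\frac1{\hat m^0_n\theta_n^2}\Bigr]^{\frac{\xi_n-1}2}.$$ -/

import Mathlib

open Filter Topology

/-- A closed single-chain product-form network with `n` queues: an ergodic routing matrix with its
normalised invariant measure, and the state-dependent service rates (`rate k q` is the rate of queue
`k` when it holds `q ≥ 1` customers; the value `rate k 0` is never used). -/
structure ClosedNetwork (n : ℕ) where
  routing : Matrix (Fin n) (Fin n) ℝ
  routing_stochastic : routing ∈ Matrix.rowStochastic ℝ (Fin n)
  routing_irreducible : routing.IsIrreducible
  visit : Fin n → ℝ
  visit_pos : ∀ k, 0 < visit k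
  visit_sum : ∑ k, visit k = 1
  visit_invariant : Matrix.vecMul visit routing = visit
  rate : Fin n → ℕ → ℝ
  rate_pos : ∀ k q, 1 ≤ q → 0 < rate k q

namespace ClosedNetwork

noncomputable section

variable {n : ℕ} (N : ClosedNetwork n)

/-- `μ_k(1) ⋯ μ_k(q)`. -/
def rateProd (k : Fin n) (q : ℕ) : ℝ := ∏ i ∈ Finset.Icc 1 q, N.rate k i

/-! ### The closed network at equilibrium -/

/-- The unnormalised product-form weight of the configuration `q`. -/
def weight (q : Fin n → ℕ) : ℝ := ∏ k, N.visit k ^ q k / N.rateProd k (q k)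

/-- The normalising constant `Z_m`: the sum of the weights of all configurations of `m` customers. -/
def normConst (m : ℕ) : ℝ := ∑ q ∈ Finset.piAntidiag Finset.univ m, N.weight q

/-- `P(Q₁ = q₁, …, Q_n = q_n)` for the network with `m` customers. -/
def closedProb (m : ℕ) (q : Fin n → ℕ) : ℝ :=
  if ∑ k, q k = m then N.weight q / N.normConst m else 0

open Classical in
/-- `P(Q_{e 0} = q 0, …, Q_{e (l-1)} = q (l-1))` for the network with `m` customers. -/
def closedMarginal (m : ℕ) {l : ℕ} (e : Fin l ↪ Fin n) (q : Fin l → ℕ) : ℝ :=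
  ∑ x ∈ (Finset.piAntidiag Finset.univ m : Finset (Fin n → ℕ)) with (∀ i, x (e i) = q i),
    N.closedProb m x

/-- `E Q_j` for the network with `m` customers. -/
def closedMean (m : ℕ) (j : Fin n) : ℝ :=
  ∑ x ∈ (Finset.piAntidiag Finset.univ m : Finset (Fin n → ℕ)), (x j : ℝ) * N.closedProb m x

/-! ### The open system of independent queues, with arrival rate `lam * visit k` at queue `k` -/

/-- The generating function `f_k(z) = ∑ z^q / (μ_k(1) ⋯ μ_k(q))`. -/
def genFun (k : Fin n) (z : ℝ) : ℝ := ∑' q : ℕ, z ^ q / N.rateProd k q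

/-- `P(X_k(lam) = x)`. -/
def openProb (lam : ℝ) (k : Fin n) (x : ℕ) : ℝ :=
  (lam * N.visit k) ^ x / N.rateProd k x / N.genFun k (lam * N.visit k)

/-- `m_k(lam) = E X_k(lam)`. -/
def openMean (lam : ℝ) (k : Fin n) : ℝ := ∑' x : ℕ, (x : ℝ) * N.openProb lam k x

/-- `E |X_k(lam) - m_k(lam)|^r`. -/
def centralMoment (lam : ℝ) (k : Fin n) (r : ℕ) : ℝ :=
  ∑' x : ℕ, |(x : ℝ) - N.openMean lam k| ^ r * N.openProb lam k x

/-- `σ(lam)`, the standard deviation of the sum of the independent variables `X_k(lam)`. -/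
def openSD (lam : ℝ) : ℝ := √(∑ k, N.centralMoment lam k 2)

/-- `γ_k²(lam) = ∑ p_{2i} p_{2i+1} / (p_{2i} + p_{2i+1})`, where `p_x = P(X_k(lam) = x)`. -/
def gammaSq (lam : ℝ) (k : Fin n) : ℝ :=
  ∑' i : ℕ, N.openProb lam k (2 * i) * N.openProb lam k (2 * i + 1) /
    (N.openProb lam k (2 * i) + N.openProb lam k (2 * i + 1))

/-- The characteristic function of `X_k(lam) - m_k(lam)`. -/
def charFn (lam : ℝ) (k : Fin n) (t : ℝ) : ℂ :=
  ∑' x : ℕ, (N.openProb lam k x : ℂ) *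
    Complex.exp (Complex.I * (((x : ℝ) - N.openMean lam k : ℝ) : ℂ) * t)

/-! ### Classification of the queues -/

/-- `liminf_q (μ_k(1) ⋯ μ_k(q))^{1/q}`, in `[0, ∞]`. -/
def asympRate (k : Fin n) : ENNReal :=
  liminf (fun q : ℕ => ENNReal.ofReal (N.rateProd k q ^ (1 / (q : ℝ)))) atTop

/-- The queues which can be saturated by a finite input flow. -/
def finiteQueues : Set (Fin n) := {k | N.asympRate k < ⊤}

open Classical in
/-- `μ_k`: the asymptotic rate if this is finite, and `μ_k(1)` otherwise. -/
def serviceRate (k : Fin n) : ℝ :=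
  if k ∈ N.finiteQueues then (N.asympRate k).toReal else N.rate k 1

/-- The load `ρ_k(lam) = lam π_k / μ_k`. -/
def load (lam : ℝ) (k : Fin n) : ℝ := lam * N.visit k / N.serviceRate k

/-- `λ⁰`, the minimum of `μ_k / π_k` over the queues of finite asymptotic rate. -/
def critIntensity : ℝ := sInf ((fun k => N.serviceRate k / N.visit k) '' N.finiteQueues)

/-- `𝓕⁰`: the queues of finite asymptotic rate that attain the minimum `λ⁰`, that is (for every
arrival intensity) those of maximal load. -/
def satQueues : Set (Fin n) :=
  {k | k ∈ N.finiteQueues ∧ N.serviceRate k / N.visit k = N.critIntensity}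

open Classical in
/-- `m̂⁰`: the mean number of customers outside `𝓕⁰` at intensity `λ⁰`. -/
def critMean : ℝ := ∑ k with k ∉ N.satQueues, N.openMean N.critIntensity k

/-- `ρ⁰(lam) = lam / λ⁰`, the maximal load of the queues of finite asymptotic rate. -/
def maxLoad (lam : ℝ) : ℝ := lam / N.critIntensity

/-- `α(lam) = ρ⁰ / (1 - ρ⁰)`. -/
def alpha (lam : ℝ) : ℝ := N.maxLoad lam / (1 - N.maxLoad lam)

/-- `ω(t) = (1 - ρ⁰) / (1 - ρ⁰ e^{it})`. -/
def omega (lam : ℝ) (t : ℝ) : ℂ :=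
  (1 - (N.maxLoad lam : ℂ)) / (1 - (N.maxLoad lam : ℂ) * Complex.exp (Complex.I * t))

open Classical in
/-- `ξ = ∑_{k ∈ 𝓕⁰} ξ_k`. -/
def totalOrder (ξ : Fin n → ℝ) : ℝ := ∑ k with k ∈ N.satQueues, ξ k

/-- `lam` is the intensity at which the open system is ergodic and holds `m` customers on average. -/
def IsIntensity (m : ℕ) (lam : ℝ) : Prop :=
  0 < lam ∧ lam < N.critIntensity ∧ ∑ k, N.openMean lam k = m

/-- The mean, the absolute central moments of order 2, 3, 4 and `γ²` of queue `k` at intensity `lam`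
all lie between `c ρ_k(lam)` and `C ρ_k(lam)`. -/
def LoadComparable (c C lam : ℝ) (k : Fin n) : Prop :=
  N.openMean lam k ∈ Set.Icc (c * N.load lam k) (C * N.load lam k) ∧
  (∀ r ∈ ({2, 3, 4} : Set ℕ),
    N.centralMoment lam k r ∈ Set.Icc (c * N.load lam k) (C * N.load lam k)) ∧
  N.gammaSq lam k ∈ Set.Icc (c * N.load lam k) (C * N.load lam k)

end

end ClosedNetwork

/-! ### Assumptions on a sequence of networks, the `n`-th one having `n` queues -/

/-- Algebraic singularities, of orders `ξ n k`, of the saturable queues: the characteristic function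
of such a queue is `e^{-imt} ω(t)^ξ ψ(t)` with `ψ'` bounded, uniformly. -/
def PoleAssumption (N : (n : ℕ+) → ClosedNetwork n) (ξ : (n : ℕ+) → Fin n → ℝ) : Prop :=
  ∃ (ψ : (n : ℕ+) → ℝ → Fin n → ℝ → ℂ) (C ξmax : ℝ), ∀ n, ∀ k ∈ (N n).satQueues,
    1 ≤ ξ n k ∧ ξ n k < ξmax ∧
    ∀ lam, 0 < lam → lam < (N n).critIntensity →
      Differentiable ℝ (ψ n lam k) ∧
      ∀ t : ℝ,
        (N n).charFn lam k t = Complex.exp (-(Complex.I * ((N n).openMean lam k : ℂ) * t)) *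
          (N n).omega lam t ^ (ξ n k : ℂ) * ψ n lam k t ∧
        ‖deriv (ψ n lam k) t‖ ≤ C

/-- Uniform asymptotic negligibility of the relative loads. -/
def UANAssumption (N : (n : ℕ+) → ClosedNetwork n) : Prop :=
  Tendsto (fun n : ℕ+ => ⨆ k : Fin n, ((N n).visit k / (N n).serviceRate k) /
    ∑ l, (N n).visit l / (N n).serviceRate l) atTop (𝓝 0)

/-- Means, central moments and `γ²` are of the order of the load, uniformly over the queues of
finite asymptotic rate with load at most `A < 1`, and over all queues of infinite asymptotic rate. -/
def ServiceAssumption (N : (n : ℕ+) → ClosedNetwork n) : Prop :=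
  (∀ A < (1 : ℝ), ∃ c C : ℝ, 0 < c ∧ ∀ n, ∀ k ∈ (N n).finiteQueues, ∀ lam, 0 < lam →
    lam ≤ (N n).critIntensity → (N n).load lam k ≤ A → (N n).LoadComparable c C lam k) ∧
  (∃ c C : ℝ, 0 < c ∧ ∀ n, ∀ k ∉ (N n).finiteQueues, ∀ lam, 0 < lam →
    lam ≤ (N n).critIntensity → (N n).LoadComparable c C lam k)

/-- The queues outside `𝓕⁰` that have a finite asymptotic rate stay away from saturation. -/
def NonsatAssumption (N : (n : ℕ+) → ClosedNetwork n) : Prop :=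
  ∃ A < (1 : ℝ), ∀ n, ∀ k ∈ (N n).finiteQueues \ (N n).satQueues,
    (N n).load (N n).critIntensity k ≤ A

/-! ### The approximations, on a set `I` of indices `n`

`m n` is the number of customers, `lam n` the intensity, `ε n` the error. Equalities of the form
`a = b [1 + O(ε)]`, with `b ≥ 0`, read `|a - b| ≤ K * ε * b`, `K` being uniform in `n` and in the
indices of the queues. -/

/-- `E Q_j = E X_j [1 + O(ε)]`, for the queues `j` in `D n`. -/
def MeanApprox (N : (n : ℕ+) → ClosedNetwork n) (m : ℕ+ → ℕ) (lam : ℕ+ → ℝ) (I : Set ℕ+)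
    (D : (n : ℕ+) → Set (Fin n)) (ε : ℕ+ → ℝ) : Prop :=
  ∃ K : ℝ, ∀ n ∈ I, ∀ j ∈ D n,
    |(N n).closedMean (m n) j - (N n).openMean (lam n) j| ≤ K * ε n * (N n).openMean (lam n) j

/-- `P(Q_{e 0} = q 0, …) = ∏ P(X_{e i} = q i) [1 + O(ε)]` for each finite number `l` of queues and
each `q`, uniformly over the `l`-tuples `e` of distinct queues whose range satisfies `D n`. -/
def MarginalApprox (N : (n : ℕ+) → ClosedNetwork n) (m : ℕ+ → ℕ) (lam : ℕ+ → ℝ) (I : Set ℕ+)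
    (D : (n : ℕ+) → Set (Fin n) → Prop) (ε : ℕ+ → ℝ) : Prop :=
  ∀ (l : ℕ) (q : Fin l → ℕ), ∃ K : ℝ, ∀ n ∈ I, ∀ e : Fin l ↪ Fin n, D n (Set.range e) →
    |(N n).closedMarginal (m n) e q - ∏ i, (N n).openProb (lam n) (e i) (q i)| ≤
      K * ε n * ∏ i, (N n).openProb (lam n) (e i) (q i)

/-- `P(Q₁ = q₁, …, Q_n = q_n) = s ∏ P(X_k = q_k) [1 + O(ε)]`, uniformly over all configurations of
`m` customers. -/
def JointApprox (N : (n : ℕ+) → ClosedNetwork n) (m : ℕ+ → ℕ) (lam : ℕ+ → ℝ) (I : Set ℕ+)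
    (s : ℕ+ → ℝ) (ε : ℕ+ → ℝ) : Prop :=
  ∃ K : ℝ, ∀ n ∈ I, ∀ q : Fin n → ℕ, ∑ k, q k = m n →
    |(N n).closedProb (m n) q - s n * ∏ k, (N n).openProb (lam n) k (q k)| ≤
      K * ε n * (s n * ∏ k, (N n).openProb (lam n) k (q k))

/-!
At every intensity `λ < λ⁰` the law of the closed network is the law of independent queues, those
of the open system, conditioned on holding `m` customers in total. Every quantity of the closed
network is therefore a ratio `P'(∑ X = m) / P(∑ X = m)`, where `P'` differs from the law `P` of
the open system at a few queues only: a mean calls for the size-biased law of one queue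
(`closedMean_eq`), a marginal for point masses at the queues concerned (`closedMarginal_eq`), and
the joint law for `P(∑ X = m)` itself (`closedProb_eq`). With `λ = λ_n` the sum has mean `m`, and
all these probabilities are integrals of products of characteristic functions
(`sum_piAntidiag_eq_integral`). The approximations say that these ratios are close to one, and
evaluate `P(∑ X = m)`.

The assumptions on the sequence of networks reduce to bounds on each network with one constant `B`
(`exists_uniformBounds`), the assumption of negligibility serving only to make `m̂⁰` tend to
infinity (`tendsto_critMean`). Near saturation, the moments of a saturable queue are bounded by
those powers of `1 + α` that its pole suggests, because its law at `λ` is an exponential tilt of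
its law halfway between `λ` and `λ⁰` (`expectation_openProb_pow_le`).

*Below criticality* the queues outside `𝓕⁰` can only absorb the customers if `(1 + α) θ = O(1)`
(`exists_one_add_alpha_mul_le`), so that the fluctuations of the saturable queues are negligible
against `√m` when `θ² m → ∞`. The product of the characteristic functions has an Edgeworth
expansion of first order near the origin (`norm_prod_sub_edgeworth_le`), and the pairing
`∑ p_{2i} p_{2i+1} / (p_{2i} + p_{2i+1})` gives it Gaussian decay on all of `[-π, π]`
(`norm_seqCF_le_exp`).
The third-order term of the expansion is odd and contributes nothing to the local probability,
hence an error `(m + (1 + α)⁴) / m²`; the effect of a replacement is of the same order when the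
replaced queues are not saturable, and of the order `(1 + α)² / m` otherwise
(`exists_edgeworth_bounds`, `exists_subcritical_regime`).

*Above criticality* the excess of customers sits in `𝓕⁰`, so that `α` is at least of the order of
`θ m̂⁰` and dominates the standard deviation, of order `√m̂⁰`, of the other queues
(`UniformBounds.supercritical_bounds`). The characteristic function of the content of `𝓕⁰` is
`ω^ξ ψ`. The factor `ω^ξ` belongs to a negative binomial law, a gamma mixture of Poisson laws, whose
local probabilities are values of the gamma density of shape `ξ` and scale `α`
(`exists_negBinom_local`); averaging over the other queues replaces the argument by its mean, `ξ`,
with an error of second order. The contribution of `ψ - 1` is small by an integration by parts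
when `ξ ≥ 3/2`, and by the decay of the characteristic function of the other queues when `ξ ≤ 3/2`
(`exists_pole_local`). The mean of a saturable queue comes from the same theorem, since the
derivative of its characteristic function is, up to a factor, that of the size-biased law and has
a pole of one order more; the ratio is still close to one because the gamma densities of shapes
`ξ` and `ξ + 1` agree at `ξ` (`gammaDensity_add_one`, `exists_pole_regime_sat`).

These estimates hold for all large `n`. Each of the remaining `n` involves finitely many indices
only and is absorbed by the constants (`exists_forall_le_of_eventually`).
-/

namespace ProductForm

open MeasureTheory Finset

/-! ### Probability laws on `ℕ` -/

/-- A probability sequence: the weights of a probability law on `ℕ`. -/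
structure IsProbSeq (p : ℕ → ℝ) : Prop where
  nonneg : ∀ x, 0 ≤ p x
  hasSum : HasSum p 1

/-- The law on `ℕ` with weights `p`. -/
noncomputable def seqLaw (p : ℕ → ℝ) : Measure ℕ :=
  Measure.sum fun x => ENNReal.ofReal (p x) • Measure.dirac x

/-- The characteristic function of the law with weights `p`, centred at the real number `c`. -/
noncomputable def seqCF (p : ℕ → ℝ) (c t : ℝ) : ℂ :=
  ∑' x : ℕ, (p x : ℂ) * Complex.exp (Complex.I * (((x : ℝ) - c : ℝ) : ℂ) * t)

theorem IsProbSeq.isProbabilityMeasure {p : ℕ → ℝ} (hp : IsProbSeq p) :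
    IsProbabilityMeasure (seqLaw p) :=
  hp.hasSum.isProbabilityMeasure_sum_dirac hp.nonneg

theorem IsProbSeq.summable {p : ℕ → ℝ} (hp : IsProbSeq p) : Summable p := hp.hasSum.summable

theorem IsProbSeq.integrable_iff {p : ℕ → ℝ} (hp : IsProbSeq p) {E : Type*}
    [NormedAddCommGroup E] {f : ℕ → E} :
    Integrable f (seqLaw p) ↔ Summable fun x => p x * ‖f x‖ := by
  rw [seqLaw, integrable_sum_dirac_iff (by simp)]
  congrm Summable (fun n ↦ ?_ * _)
  rw [ENNReal.toReal_ofReal (hp.nonneg _)]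

theorem IsProbSeq.integral_eq {p : ℕ → ℝ} (hp : IsProbSeq p) {E : Type*}
    [NormedAddCommGroup E] [NormedSpace ℝ E] [FiniteDimensional ℝ E] (f : ℕ → E) :
    ∫ x, f x ∂(seqLaw p) = ∑' x, p x • f x := by
  rw [seqLaw, integral_sum_dirac (by simp)]
  congr with n
  rw [ENNReal.toReal_ofReal (hp.nonneg _)]

theorem seqLaw_real_singleton {p : ℕ → ℝ} (hp : IsProbSeq p) (x : ℕ) :
    (seqLaw p).real {x} = p x := by
  rw [measureReal_def, seqLaw, Measure.sum_smul_dirac_singleton,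
    ENNReal.toReal_ofReal (hp.nonneg _)]

theorem seqCF_eq_integral {p : ℕ → ℝ} (hp : IsProbSeq p) (c t : ℝ) :
    seqCF p c t = ∫ x, Complex.exp (Complex.I * (((x : ℝ) - c : ℝ) : ℂ) * t) ∂(seqLaw p) := by
  rw [hp.integral_eq]
  simp [seqCF, Complex.real_smul]

theorem norm_exp_I_mul_mul (a t : ℝ) : ‖Complex.exp (Complex.I * (a : ℂ) * t)‖ = 1 := by
  rw [mul_assoc, ← Complex.ofReal_mul, mul_comm, Complex.norm_exp_ofReal_mul_I]

theorem norm_seqCF_le_one {p : ℕ → ℝ} (hp : IsProbSeq p) (c t : ℝ) : ‖seqCF p c t‖ ≤ 1 := by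
  have := hp.isProbabilityMeasure
  rw [seqCF_eq_integral hp]
  refine (norm_integral_le_of_norm_le_const (C := 1) (ae_of_all _ fun x => ?_)).trans (by simp)
  rw [norm_exp_I_mul_mul]

theorem summable_seqCF {p : ℕ → ℝ} (hp : IsProbSeq p) (c t : ℝ) :
    Summable fun x : ℕ => (p x : ℂ) * Complex.exp (Complex.I * (((x : ℝ) - c : ℝ) : ℂ) * t) := by
  refine Summable.of_norm_bounded hp.summable fun x => ?_
  rw [norm_mul, norm_exp_I_mul_mul, mul_one, Complex.norm_real, Real.norm_of_nonneg (hp.nonneg x)]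

theorem seqCF_eq_exp_mul {p : ℕ → ℝ} (c t : ℝ) :
    seqCF p c t = Complex.exp (-(Complex.I * (c : ℂ) * t)) * seqCF p 0 t := by
  rw [seqCF, seqCF, ← tsum_mul_left]
  congr with x
  rw [mul_left_comm, ← Complex.exp_add]
  congr 2
  push_cast
  ring

theorem norm_seqCF_eq {p : ℕ → ℝ} (c t : ℝ) : ‖seqCF p c t‖ = ‖seqCF p 0 t‖ := by
  rw [seqCF_eq_exp_mul, norm_mul, Complex.norm_exp]
  simp

theorem continuous_seqCF {p : ℕ → ℝ} (hp : IsProbSeq p) (c : ℝ) : Continuous (seqCF p c) := by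
  refine continuous_tsum (fun x => by fun_prop) hp.summable fun x t => ?_
  rw [norm_mul, norm_exp_I_mul_mul, mul_one, Complex.norm_real, Real.norm_of_nonneg (hp.nonneg x)]

/-! ### Fourier inversion for sums of independent variables -/

/-- A product of characteristic functions is the average of the exponentials of the sum of
independent variables; Fubini moves this average out of an integral over the frequency. -/
theorem integral_mul_prod_seqCF {ι : Type*} [Fintype ι] {p : ι → ℕ → ℝ}
    (hp : ∀ k, IsProbSeq (p k)) (c : ι → ℝ) {W : ℝ → ℂ} {a b : ℝ}
    (hW : IntervalIntegrable W volume a b) :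
    ∫ t in a..b, W t * ∏ k, seqCF (p k) (c k) t =
      ∫ x, (∫ t in a..b, W t * Complex.exp (Complex.I * ((∑ k, ((x k : ℝ) - c k) : ℝ) : ℂ) * t))
        ∂(Measure.pi fun k => seqLaw (p k)) := by
  have := fun k => (hp k).isProbabilityMeasure
  rw [← intervalIntegral_integral_swap]
  · refine intervalIntegral.integral_congr fun t _ => ?_
    rw [integral_const_mul]
    congr 1
    simp_rw [fun k => seqCF_eq_integral (hp k) (c k) t]
    rw [← integral_fintype_prod_eq_prod
      (fun k (x : ℕ) => Complex.exp (Complex.I * (((x : ℝ) - c k : ℝ) : ℂ) * t))]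
    congr with x
    rw [← Complex.exp_sum]
    congr 1
    push_cast
    rw [Finset.mul_sum, Finset.sum_mul]
  · have h1 : Integrable (fun z : ℝ × (ι → ℕ) => W z.1)
        ((volume.restrict (Set.uIoc a b)).prod (Measure.pi fun k => seqLaw (p k))) :=
      (intervalIntegrable_iff.1 hW).comp_fst _
    refine h1.mul_bdd (c := 1) ?_ (ae_of_all _ fun z => ?_)
    · apply Measurable.aestronglyMeasurable
      fun_prop
    · rw [norm_exp_I_mul_mul]

theorem integral_exp_int (y : ℤ) :
    ∫ t in -Real.pi..Real.pi, Complex.exp (Complex.I * ((y : ℝ) : ℂ) * t) =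
      if y = 0 then (2 * Real.pi : ℂ) else 0 := by
  split_ifs with h
  · subst h
    simp
    ring
  · have hc : Complex.I * ((y : ℝ) : ℂ) ≠ 0 := by
      simp [h]
    rw [integral_exp_mul_complex hc]
    have : Complex.exp (Complex.I * ((y : ℝ) : ℂ) * (Real.pi : ℝ)) =
        Complex.exp (Complex.I * ((y : ℝ) : ℂ) * ((-Real.pi : ℝ) : ℝ)) := by
      rw [Complex.exp_eq_exp_iff_exists_int]
      refine ⟨y, ?_⟩
      push_cast
      ring
    rw [this]
    simp

theorem pi_seqLaw_real_sum_eq {ι : Type*} [Fintype ι] [DecidableEq ι] {p : ι → ℕ → ℝ}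
    (hp : ∀ k, IsProbSeq (p k)) (m : ℕ) :
    (Measure.pi fun k => seqLaw (p k)).real {x | ∑ k, x k = m} =
      ∑ x ∈ piAntidiag univ m, ∏ k, p k (x k) := by
  have := fun k => (hp k).isProbabilityMeasure
  have h : {x : ι → ℕ | ∑ k, x k = m} = ↑(piAntidiag (univ : Finset ι) m) := by
    ext x
    simp [mem_piAntidiag]
  rw [h, ← sum_measureReal_singleton]
  refine sum_congr rfl fun x _ => ?_
  rw [measureReal_def, Measure.pi_singleton, ENNReal.toReal_prod]
  exact prod_congr rfl fun k _ => seqLaw_real_singleton (hp k) (x k)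

/-- The probability that independent `ℕ`-valued variables sum to `m`, as a Fourier integral. -/
theorem sum_piAntidiag_eq_integral {ι : Type*} [Fintype ι] [DecidableEq ι] {p : ι → ℕ → ℝ}
    (hp : ∀ k, IsProbSeq (p k)) (c : ι → ℝ) (m : ℕ) :
    (2 * Real.pi : ℂ) * ((∑ x ∈ piAntidiag univ m, ∏ k, p k (x k) : ℝ) : ℂ) =
      ∫ t in -Real.pi..Real.pi, Complex.exp (Complex.I * ((∑ k, c k - m : ℝ) : ℂ) * t) *
        ∏ k, seqCF (p k) (c k) t := by
  have := fun k => (hp k).isProbabilityMeasure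
  rw [integral_mul_prod_seqCF hp c (Continuous.intervalIntegrable (by fun_prop) _ _),
    ← pi_seqLaw_real_sum_eq hp]
  have key : ∀ x : ι → ℕ, (∫ t in -Real.pi..Real.pi,
      Complex.exp (Complex.I * ((∑ k, c k - m : ℝ) : ℂ) * t) *
        Complex.exp (Complex.I * ((∑ k, ((x k : ℝ) - c k) : ℝ) : ℂ) * t)) =
      Set.indicator {x : ι → ℕ | ∑ k, x k = m} (fun _ => (2 * Real.pi : ℂ)) x := by
    intro x
    have h := integral_exp_int (∑ k, (x k : ℤ) - m)
    rw [Set.indicator_apply]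
    have e : (∑ k, (x k : ℤ) - m = 0) ↔ x ∈ {x : ι → ℕ | ∑ k, x k = m} := by
      rw [Set.mem_ofPred_eq, sub_eq_zero]
      exact_mod_cast Iff.rfl
    simp only [e] at h
    rw [← h]
    refine intervalIntegral.integral_congr fun t _ => ?_
    rw [← Complex.exp_add]
    congr 1
    push_cast
    rw [sum_sub_distrib]
    ring
  simp_rw [key]
  rw [integral_indicator_const _ (by measurability), Complex.real_smul, mul_comm]

end ProductForm

namespace ProductForm

open MeasureTheory Finset

/-! ### Moments of laws on `ℕ` and Taylor expansion of characteristic functions -/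

/-- All moments of the law with weights `p` are finite. -/
def HasMoments (p : ℕ → ℝ) : Prop := ∀ r : ℕ, Summable fun x : ℕ => ((x : ℝ) + 1) ^ r * p x

/-- The expectation of `f` under the law with weights `p`. -/
noncomputable def expectation (p : ℕ → ℝ) (f : ℕ → ℝ) : ℝ := ∑' x, f x * p x

/-- The mean of the law with weights `p`. -/
noncomputable def mean (p : ℕ → ℝ) : ℝ := expectation p fun x => x

/-- The absolute central moment of order `r` of the law with weights `p`. -/
noncomputable def absMoment (p : ℕ → ℝ) (r : ℕ) : ℝ := expectation p fun x => |(x : ℝ) - mean p| ^ r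

/-- The size-biased law: the weight of `x` is proportional to `x * p x`. -/
noncomputable def sizeBias (p : ℕ → ℝ) (x : ℕ) : ℝ := (x : ℝ) * p x / mean p

theorem HasMoments.summable_of_le {p : ℕ → ℝ} (h : HasMoments p) (hp : IsProbSeq p) {f : ℕ → ℝ}
    {C : ℝ} {r : ℕ} (hf : ∀ x : ℕ, |f x| ≤ C * ((x : ℝ) + 1) ^ r) :
    Summable fun x => f x * p x := by
  refine Summable.of_norm_bounded ((h r).mul_left C) fun x => ?_
  rw [Real.norm_eq_abs, abs_mul, abs_of_nonneg (hp.nonneg x), ← mul_assoc]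
  exact mul_le_mul_of_nonneg_right (hf x) (hp.nonneg x)

theorem abs_natCast_sub_le (x : ℕ) (c : ℝ) : |(x : ℝ) - c| ≤ (1 + |c|) * ((x : ℝ) + 1) := by
  have h1 := abs_sub (x : ℝ) c
  rw [abs_of_nonneg (Nat.cast_nonneg x : (0 : ℝ) ≤ x)] at h1
  have := abs_nonneg c
  nlinarith [(Nat.cast_nonneg x : (0 : ℝ) ≤ x)]

theorem HasMoments.summable_pow_sub {p : ℕ → ℝ} (h : HasMoments p) (hp : IsProbSeq p) (c : ℝ)
    (r : ℕ) : Summable fun x : ℕ => ((x : ℝ) - c) ^ r * p x := by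
  refine h.summable_of_le hp (C := (1 + |c|) ^ r) (r := r) fun x => ?_
  rw [abs_pow, ← mul_pow]
  exact pow_le_pow_left₀ (abs_nonneg _) (abs_natCast_sub_le x c) r

theorem HasMoments.summable_abs_pow_sub {p : ℕ → ℝ} (h : HasMoments p) (hp : IsProbSeq p) (c : ℝ)
    (r : ℕ) : Summable fun x : ℕ => |(x : ℝ) - c| ^ r * p x := by
  refine h.summable_of_le hp (C := (1 + |c|) ^ r) (r := r) fun x => ?_
  rw [abs_pow, abs_abs, ← mul_pow]
  exact pow_le_pow_left₀ (abs_nonneg _) (abs_natCast_sub_le x c) r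

theorem HasMoments.summable_mul_pow_sub {p : ℕ → ℝ} (h : HasMoments p) (hp : IsProbSeq p) (c : ℝ)
    (r : ℕ) : Summable fun x : ℕ => ((x : ℝ) * ((x : ℝ) - c) ^ r) * p x := by
  refine h.summable_of_le hp (C := (1 + |c|) ^ r) (r := r + 1) fun x => ?_
  rw [abs_mul, abs_pow, pow_succ, ← mul_assoc, ← mul_pow, mul_comm]
  gcongr
  · exact abs_natCast_sub_le x c
  · rw [abs_of_nonneg (Nat.cast_nonneg x : (0 : ℝ) ≤ x)]
    linarith

theorem HasMoments.summable_id {p : ℕ → ℝ} (h : HasMoments p) (hp : IsProbSeq p) :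
    Summable fun x : ℕ => (x : ℝ) * p x := by
  simpa using h.summable_pow_sub hp 0 1

theorem IsProbSeq.expectation_const {p : ℕ → ℝ} (hp : IsProbSeq p) (c : ℝ) :
    expectation p (fun _ => c) = c := by
  rw [expectation, tsum_mul_left, hp.hasSum.tsum_eq, mul_one]

theorem expectation_nonneg {p : ℕ → ℝ} (hp : IsProbSeq p) {f : ℕ → ℝ} (hf : ∀ x, 0 ≤ f x) :
    0 ≤ expectation p f := tsum_nonneg fun x => mul_nonneg (hf x) (hp.nonneg x)

theorem mean_nonneg {p : ℕ → ℝ} (hp : IsProbSeq p) : 0 ≤ mean p :=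
  expectation_nonneg hp fun x => Nat.cast_nonneg x

theorem absMoment_nonneg {p : ℕ → ℝ} (hp : IsProbSeq p) (r : ℕ) : 0 ≤ absMoment p r :=
  expectation_nonneg hp fun _ => by positivity

theorem expectation_mono {p : ℕ → ℝ} (hp : IsProbSeq p) {f g : ℕ → ℝ}
    (hf : Summable fun x => f x * p x) (hg : Summable fun x => g x * p x) (h : ∀ x, f x ≤ g x) :
    expectation p f ≤ expectation p g :=
  hf.tsum_le_tsum (fun x => mul_le_mul_of_nonneg_right (h x) (hp.nonneg x)) hg

theorem expectation_add {p f g : ℕ → ℝ}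
    (hf : Summable fun x => f x * p x) (hg : Summable fun x => g x * p x) :
    expectation p (fun x => f x + g x) = expectation p f + expectation p g := by
  simp only [expectation, add_mul]
  exact hf.tsum_add hg

theorem expectation_sub {p f g : ℕ → ℝ}
    (hf : Summable fun x => f x * p x) (hg : Summable fun x => g x * p x) :
    expectation p (fun x => f x - g x) = expectation p f - expectation p g := by
  simp only [expectation, sub_mul]
  exact hf.tsum_sub hg

theorem expectation_const_mul {p f : ℕ → ℝ} (a : ℝ) :
    expectation p (fun x => a * f x) = a * expectation p f := by
  simp only [expectation, mul_assoc]
  exact tsum_mul_left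

theorem expectation_sub_mean {p : ℕ → ℝ} (h : HasMoments p) (hp : IsProbSeq p) (c : ℝ) :
    expectation p (fun x => (x : ℝ) - c) = mean p - c := by
  rw [expectation_sub (h.summable_id hp) (hp.summable.mul_left c), hp.expectation_const, mean]

/-- The Cauchy–Schwarz inequality between the central moments of orders two and four. -/
theorem absMoment_two_sq_le {p : ℕ → ℝ} (h : HasMoments p) (hp : IsProbSeq p) :
    absMoment p 2 ^ 2 ≤ absMoment p 4 := by
  have s4 := h.summable_abs_pow_sub hp (mean p) 4
  have s2 := h.summable_abs_pow_sub hp (mean p) 2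
  have key : 0 ≤ expectation p fun x => |(x : ℝ) - mean p| ^ 4 -
      (2 * absMoment p 2 * |(x : ℝ) - mean p| ^ 2 - absMoment p 2 ^ 2) := by
    refine expectation_nonneg hp fun x => ?_
    nlinarith [sq_nonneg (|(x : ℝ) - mean p| ^ 2 - absMoment p 2)]
  have s2' : Summable fun x : ℕ => 2 * absMoment p 2 * |(x : ℝ) - mean p| ^ 2 * p x := by
    simpa only [mul_assoc] using (s2.mul_left (2 * absMoment p 2))
  have s0 : Summable fun x : ℕ => absMoment p 2 ^ 2 * p x := hp.summable.mul_left _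
  rw [expectation_sub s4 (by simpa only [sub_mul] using s2'.sub s0), expectation_sub s2' s0,
    expectation_const_mul, hp.expectation_const] at key
  have e2 : expectation p (fun x => |(x : ℝ) - mean p| ^ 2) = absMoment p 2 := rfl
  have e4 : expectation p (fun x => |(x : ℝ) - mean p| ^ 4) = absMoment p 4 := rfl
  rw [e2, e4] at key
  nlinarith

theorem norm_exp_I_mul_sub_sum_le (x : ℝ) (n : ℕ) :
    ‖Complex.exp (Complex.I * x) - ∑ k ∈ range n, (Complex.I * x) ^ k / (k.factorial : ℂ)‖ ≤
      4 * |x| ^ n := by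
  have hn : ‖Complex.I * (x : ℂ)‖ = |x| := by simp
  have he : Real.exp 1 ≤ 3 := (Real.exp_one_lt_three).le
  rcases le_total |x| 1 with h | h
  · refine (Complex.norm_exp_sub_sum_le_norm_mul_exp _ _).trans ?_
    rw [hn, mul_comm]
    gcongr
    calc Real.exp |x| ≤ Real.exp 1 := Real.exp_le_exp.2 h
      _ ≤ 4 := by linarith
  · refine (norm_sub_le _ _).trans ?_
    have h1 : ‖Complex.exp (Complex.I * x)‖ ≤ |x| ^ n := by
      rw [mul_comm, Complex.norm_exp_ofReal_mul_I]
      exact one_le_pow₀ h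
    have h2 : ‖∑ k ∈ range n, (Complex.I * (x : ℂ)) ^ k / (k.factorial : ℂ)‖ ≤ 3 * |x| ^ n := by
      refine (norm_sum_le _ _).trans ?_
      calc ∑ k ∈ range n, ‖(Complex.I * (x : ℂ)) ^ k / (k.factorial : ℂ)‖
          ≤ ∑ k ∈ range n, |x| ^ n * (1 ^ k / (k.factorial : ℝ)) := by
            refine sum_le_sum fun k hk => ?_
            rw [norm_div, norm_pow, hn, Complex.norm_natCast, one_pow, mul_one_div]
            gcongr
            exact (mem_range.1 hk).le
        _ = |x| ^ n * ∑ k ∈ range n, (1 ^ k / (k.factorial : ℝ)) := by rw [mul_sum]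
        _ ≤ |x| ^ n * Real.exp 1 := by
            gcongr
            exact Real.sum_le_exp_of_nonneg zero_le_one n
        _ ≤ 3 * |x| ^ n := by
            rw [mul_comm]
            gcongr
    linarith

/-- Taylor expansion at the origin of a characteristic function, with an explicit remainder. -/
theorem norm_seqCF_sub_sum_le {p : ℕ → ℝ} (h : HasMoments p) (hp : IsProbSeq p) (c t : ℝ) (n : ℕ) :
    ‖seqCF p c t - ∑ k ∈ range n, (Complex.I * t) ^ k / (k.factorial : ℂ) *
        ((expectation p fun x => ((x : ℝ) - c) ^ k : ℝ) : ℂ)‖ ≤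
      4 * |t| ^ n * expectation p fun x => |(x : ℝ) - c| ^ n := by
  have hk : ∀ k : ℕ, HasSum (fun x : ℕ => (Complex.I * t) ^ k / (k.factorial : ℂ) *
      ((((x : ℝ) - c) ^ k * p x : ℝ) : ℂ)) ((Complex.I * t) ^ k / (k.factorial : ℂ) *
        ((expectation p fun x => ((x : ℝ) - c) ^ k : ℝ) : ℂ)) := fun k =>
    (Complex.hasSum_ofReal.2 (h.summable_pow_sub hp c k).hasSum).mul_left _
  have hs := (summable_seqCF hp c t).hasSum.sub (hasSum_sum fun k (_ : k ∈ range n) => hk k)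
  rw [seqCF, ← hs.tsum_eq, expectation, ← tsum_mul_left]
  refine tsum_of_norm_bounded ((h.summable_abs_pow_sub hp c n).mul_left _).hasSum fun x => ?_
  have e : (p x : ℂ) * Complex.exp (Complex.I * (((x : ℝ) - c : ℝ) : ℂ) * t) -
      ∑ k ∈ range n, (Complex.I * t) ^ k / (k.factorial : ℂ) * ((((x : ℝ) - c) ^ k * p x : ℝ) : ℂ) =
      (p x : ℂ) * (Complex.exp (Complex.I * ((((x : ℝ) - c) * t : ℝ) : ℂ)) -
        ∑ k ∈ range n, (Complex.I * ((((x : ℝ) - c) * t : ℝ) : ℂ)) ^ k / (k.factorial : ℂ)) := by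
    rw [mul_sub, mul_sum]
    congr 1
    · push_cast
      ring_nf
    · refine sum_congr rfl fun k _ => ?_
      push_cast
      simp only [mul_pow]
      ring
  rw [e, norm_mul, Complex.norm_real, Real.norm_of_nonneg (hp.nonneg x)]
  calc p x * _ ≤ p x * (4 * |((x : ℝ) - c) * t| ^ n) :=
        mul_le_mul_of_nonneg_left (norm_exp_I_mul_sub_sum_le _ _) (hp.nonneg x)
    _ = _ := by
        rw [abs_mul, mul_pow]
        ring

theorem norm_seqCF_sub_one_sub_le {p : ℕ → ℝ} (h : HasMoments p) (hp : IsProbSeq p) (c t : ℝ) :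
    ‖seqCF p c t - 1 - Complex.I * ((mean p - c : ℝ) : ℂ) * t‖ ≤
      4 * (expectation p fun x => ((x : ℝ) - c) ^ 2) * t ^ 2 := by
  have := norm_seqCF_sub_sum_le h hp c t 2
  simp only [sum_range_succ, range_zero, sum_empty, pow_zero, pow_one, hp.expectation_const, sq_abs,
    expectation_sub_mean h hp, Nat.factorial] at this
  refine le_trans (le_of_eq ?_) (this.trans (le_of_eq (by ring)))
  congr 1
  push_cast
  ring

theorem expectation_pow_one_sub_mean {p : ℕ → ℝ} (h : HasMoments p) (hp : IsProbSeq p) :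
    expectation p (fun x => ((x : ℝ) - mean p) ^ 1) = 0 := by
  simp [expectation_sub_mean h hp]

theorem absMoment_two_eq {p : ℕ → ℝ} :
    absMoment p 2 = expectation p fun x => ((x : ℝ) - mean p) ^ 2 := by
  simp [absMoment, sq_abs]

theorem norm_seqCF_sub_one_le {p : ℕ → ℝ} (h : HasMoments p) (hp : IsProbSeq p) (t : ℝ) :
    ‖seqCF p (mean p) t - 1‖ ≤ 4 * absMoment p 2 * t ^ 2 := by
  simpa [absMoment_two_eq] using norm_seqCF_sub_one_sub_le h hp (mean p) t

/-- The third central moment of the law with weights `p`. -/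
noncomputable def thirdMoment (p : ℕ → ℝ) : ℝ := expectation p fun x => ((x : ℝ) - mean p) ^ 3

theorem expectation_pow_three_sub_mean (p : ℕ → ℝ) :
    expectation p (fun x => ((x : ℝ) - mean p) ^ 3) = thirdMoment p := rfl

theorem abs_thirdMoment_le {p : ℕ → ℝ} (h : HasMoments p) (hp : IsProbSeq p) :
    |thirdMoment p| ≤ absMoment p 3 := by
  rw [thirdMoment, absMoment, expectation, expectation, ← Real.norm_eq_abs]
  refine tsum_of_norm_bounded (h.summable_abs_pow_sub hp (mean p) 3).hasSum fun x => ?_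
  rw [Real.norm_eq_abs, abs_mul, abs_pow, abs_of_nonneg (hp.nonneg x)]

theorem norm_seqCF_sub_cubic_le {p : ℕ → ℝ} (h : HasMoments p) (hp : IsProbSeq p) (t : ℝ) :
    ‖seqCF p (mean p) t - (1 - ((absMoment p 2 * t ^ 2 / 2 : ℝ) : ℂ) -
      Complex.I * ((thirdMoment p * t ^ 3 / 6 : ℝ) : ℂ))‖ ≤ 4 * absMoment p 4 * t ^ 4 := by
  have := norm_seqCF_sub_sum_le h hp (mean p) t 4
  simp only [sum_range_succ, range_zero, sum_empty, pow_zero, hp.expectation_const,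
    expectation_pow_one_sub_mean h hp, Nat.factorial, ← absMoment_two_eq,
    expectation_pow_three_sub_mean] at this
  have e4 : |t| ^ 4 = t ^ 4 := by rw [show 4 = 2 * 2 from rfl, pow_mul, sq_abs, ← pow_mul]
  rw [e4] at this
  refine le_trans (le_of_eq ?_) (this.trans (le_of_eq (by rw [absMoment]; ring)))
  congr 1
  push_cast
  have I3 : (Complex.I * (t : ℂ)) ^ 3 = - Complex.I * t ^ 3 := by
    rw [mul_pow, Complex.I_pow_three]
  have I2 : (Complex.I * (t : ℂ)) ^ 2 = - t ^ 2 := by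
    rw [mul_pow, Complex.I_sq]; ring
  rw [I3, I2]
  ring

/-! ### Decay of the characteristic function -/

/-- The loss of modulus in the sum of two masses at distance one, from the frequency `t`. -/
theorem norm_add_mul_exp_le {a b : ℝ} (ha : 0 ≤ a) (hb : 0 ≤ b) (t : ℝ) :
    ‖(a : ℂ) + b * Complex.exp (Complex.I * t)‖ ≤ a + b - (1 - Real.cos t) * (a * b / (a + b)) := by
  rcases (add_nonneg ha hb).eq_or_lt with h | h
  · obtain rfl : a = 0 := by linarith
    obtain rfl : b = 0 := by linarith
    simp
  · have hc1 := Real.cos_le_one t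
    have hc2 := Real.neg_one_le_cos t
    have e : ‖(a : ℂ) + b * Complex.exp (Complex.I * t)‖ ^ 2 =
        (a + b) ^ 2 - 2 * (a * b) * (1 - Real.cos t) := by
      have e1 : (a : ℂ) + b * Complex.exp (Complex.I * t) =
          ((a + b * Real.cos t : ℝ) : ℂ) + ((b * Real.sin t : ℝ) : ℂ) * Complex.I := by
        rw [mul_comm Complex.I, Complex.exp_mul_I]
        push_cast
        ring
      rw [← Complex.normSq_eq_norm_sq, e1, Complex.normSq_add_mul_I]
      linear_combination b ^ 2 * Real.sin_sq_add_cos_sq t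
    have h4 : a * b / (a + b) * (a + b) = a * b := by field_simp
    set w := a * b / (a + b) with hw
    have hw0 : 0 ≤ w := by positivity
    have hw1 : w * 2 ≤ a + b := by
      rw [hw, div_mul_eq_mul_div, div_le_iff₀ h]
      nlinarith [sq_nonneg (a - b)]
    refine le_of_sq_le_sq ?_ ?_
    · rw [e]
      nlinarith [sq_nonneg ((1 - Real.cos t) * w)]
    · nlinarith

/-- `∑ p_{2i} p_{2i+1} / (p_{2i} + p_{2i+1})`, which measures how far the law is from being
carried by a sublattice. -/
noncomputable def pairing (p : ℕ → ℝ) : ℝ :=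
  ∑' i : ℕ, p (2 * i) * p (2 * i + 1) / (p (2 * i) + p (2 * i + 1))

/-- Grouping the terms `2i` and `2i+1` of the characteristic function gives a Gaussian bound on the
whole period. -/
theorem norm_seqCF_le_exp {p : ℕ → ℝ} (hp : IsProbSeq p) (c : ℝ) {t : ℝ} (ht : |t| ≤ Real.pi) :
    ‖seqCF p c t‖ ≤ Real.exp (-(2 / Real.pi ^ 2 * pairing p) * t ^ 2) := by
  have hpi := Real.pi_pos
  have he : Summable fun i => p (2 * i) :=
    hp.summable.comp_injective (i := fun i => 2 * i) fun a b h => by simpa using h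
  have ho : Summable fun i => p (2 * i + 1) :=
    hp.summable.comp_injective (i := fun i => 2 * i + 1) fun a b h => by simpa using h
  have hpair0 : ∀ i, 0 ≤ p (2 * i) * p (2 * i + 1) / (p (2 * i) + p (2 * i + 1)) := fun i =>
    div_nonneg (mul_nonneg (hp.nonneg _) (hp.nonneg _)) (add_nonneg (hp.nonneg _) (hp.nonneg _))
  have hpair : Summable fun i => p (2 * i) * p (2 * i + 1) / (p (2 * i) + p (2 * i + 1)) := by
    refine Summable.of_nonneg_of_le hpair0 (fun i => ?_) he
    refine div_le_of_le_mul₀ (add_nonneg (hp.nonneg _) (hp.nonneg _)) (hp.nonneg _) ?_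
    nlinarith [hp.nonneg (2 * i), hp.nonneg (2 * i + 1), sq_nonneg (p (2 * i))]
  have hsum : (∑' i, p (2 * i)) + ∑' i, p (2 * i + 1) = 1 := by
    rw [tsum_even_add_odd he ho, hp.hasSum.tsum_eq]
  have h1 : ‖seqCF p 0 t‖ ≤ 1 - (1 - Real.cos t) * pairing p := by
    set F : ℕ → ℂ := fun x =>
      (p x : ℂ) * Complex.exp (Complex.I * (((x : ℝ) - 0 : ℝ) : ℂ) * t) with hF
    have hs : Summable F := summable_seqCF hp 0 t
    have hse : Summable fun i => F (2 * i) :=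
      hs.comp_injective (i := fun i => 2 * i) fun a b h => by simpa using h
    have hso : Summable fun i => F (2 * i + 1) :=
      hs.comp_injective (i := fun i => 2 * i + 1) fun a b h => by simpa using h
    have hsF : seqCF p 0 t = ∑' x, F x := rfl
    have e1 : 1 - (1 - Real.cos t) * pairing p = ∑' i, (p (2 * i) + p (2 * i + 1) -
        (1 - Real.cos t) * (p (2 * i) * p (2 * i + 1) / (p (2 * i) + p (2 * i + 1)))) := by
      rw [(he.add ho).tsum_sub (hpair.mul_left _), he.tsum_add ho, hsum, tsum_mul_left, pairing]
    rw [e1, hsF, ← tsum_even_add_odd hse hso, ← hse.tsum_add hso]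
    refine tsum_of_norm_bounded ((he.add ho).sub (hpair.mul_left _)).hasSum fun i => ?_
    refine le_trans (le_of_eq ?_)
      (norm_add_mul_exp_le (hp.nonneg (2 * i)) (hp.nonneg (2 * i + 1)) t)
    have e : ((p (2 * i) : ℂ) *
        Complex.exp (Complex.I * ((((2 * i : ℕ) : ℝ) - 0 : ℝ) : ℂ) * t)) + ((p (2 * i + 1) : ℂ) *
        Complex.exp (Complex.I * ((((2 * i + 1 : ℕ) : ℝ) - 0 : ℝ) : ℂ) * t)) =
        Complex.exp (Complex.I * ((((2 * i : ℕ) : ℝ) - 0 : ℝ) : ℂ) * t) *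
          ((p (2 * i) : ℂ) + p (2 * i + 1) * Complex.exp (Complex.I * t)) := by
      rw [mul_add, mul_left_comm _ (p (2 * i + 1) : ℂ), ← Complex.exp_add]
      push_cast
      ring_nf
    simp only [hF]
    rw [e, norm_mul, norm_exp_I_mul_mul, one_mul]
  rw [norm_seqCF_eq]
  have hg : 0 ≤ pairing p := tsum_nonneg hpair0
  have hc := Real.cos_le_one_sub_mul_cos_sq ht
  calc ‖seqCF p 0 t‖ ≤ 1 - (1 - Real.cos t) * pairing p := h1
    _ ≤ -(2 / Real.pi ^ 2 * pairing p) * t ^ 2 + 1 := by nlinarith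
    _ ≤ _ := Real.add_one_le_exp _

/-! ### Size-biased laws -/

theorem IsProbSeq.sizeBias {p : ℕ → ℝ} (hp : IsProbSeq p) (h : HasMoments p) (hm : 0 < mean p) :
    IsProbSeq (sizeBias p) where
  nonneg x := div_nonneg (mul_nonneg (Nat.cast_nonneg x) (hp.nonneg x)) hm.le
  hasSum := by
    have := (h.summable_id hp).hasSum.div_const (mean p)
    rwa [show (∑' x : ℕ, (x : ℝ) * p x) = mean p from rfl, div_self hm.ne'] at this

theorem HasMoments.sizeBias {p : ℕ → ℝ} (hp : IsProbSeq p) (h : HasMoments p) :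
    HasMoments (sizeBias p) := fun r => by
  have : Summable fun x : ℕ => (((x : ℝ) + 1) ^ r * x) * p x := by
    refine h.summable_of_le hp (C := 1) (r := r + 1) fun x => ?_
    rw [abs_of_nonneg (by positivity), one_mul, pow_succ]
    gcongr
    linarith
  refine (this.div_const (mean p)).congr fun x => ?_
  rw [ProductForm.sizeBias]
  ring

theorem expectation_sizeBias {p : ℕ → ℝ} (f : ℕ → ℝ) :
    expectation (sizeBias p) f = expectation p (fun x => (x : ℝ) * f x) / mean p := by
  rw [expectation, expectation, ← tsum_div_const]
  congr with x
  rw [sizeBias]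
  ring

/-- The second moment of the size-biased law about the original mean is `E (X - m)² + E (X - m)³ /
m`. -/
theorem expectation_sizeBias_sq_le {p : ℕ → ℝ} (hp : IsProbSeq p) (h : HasMoments p)
    (hm : 0 < mean p) :
    expectation (sizeBias p) (fun x => ((x : ℝ) - mean p) ^ 2) ≤
      absMoment p 3 / mean p + absMoment p 2 := by
  rw [expectation_sizeBias, div_add' _ _ _ hm.ne']
  refine div_le_div_of_nonneg_right ?_ hm.le
  have s3 := h.summable_abs_pow_sub hp (mean p) 3
  have s2 := h.summable_abs_pow_sub hp (mean p) 2
  have s2' : Summable fun x : ℕ => mean p * |(x : ℝ) - mean p| ^ 2 * p x := by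
    simpa only [mul_assoc] using s2.mul_left (mean p)
  have e : absMoment p 3 + absMoment p 2 * mean p =
      expectation p fun x => |(x : ℝ) - mean p| ^ 3 + mean p * |(x : ℝ) - mean p| ^ 2 := by
    rw [expectation_add s3 s2', expectation_const_mul, absMoment, absMoment]
    ring
  rw [e]
  refine expectation_mono hp (h.summable_mul_pow_sub hp _ 2)
    (by simpa only [add_mul] using s3.add s2') fun x => ?_
  rw [pow_succ |(x : ℝ) - mean p| 2, sq_abs]
  nlinarith [le_abs_self ((x : ℝ) - mean p), sq_nonneg ((x : ℝ) - mean p)]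

/-- The derivative of a characteristic function is that of the size-biased law, up to the factor `i
m` where `m` is the mean. -/
theorem hasDerivAt_seqCF {p : ℕ → ℝ} (hp : IsProbSeq p) (h : HasMoments p) (hm : 0 < mean p)
    (t : ℝ) :
    HasDerivAt (seqCF p 0) (Complex.I * mean p * seqCF (sizeBias p) 0 t) t := by
  have e : Complex.I * mean p * seqCF (sizeBias p) 0 t =
      ∑' x : ℕ, (p x : ℂ) * (Complex.exp (Complex.I * (((x : ℝ) - 0 : ℝ) : ℂ) * t) *
        (Complex.I * (((x : ℝ) - 0 : ℝ) : ℂ))) := by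
    rw [seqCF, ← tsum_mul_left]
    congr with x
    have : (mean p : ℂ) ≠ 0 := by exact_mod_cast hm.ne'
    rw [sizeBias]
    push_cast
    field_simp
    ring
  rw [e]
  refine hasDerivAt_tsum (𝕜 := ℝ) (F := ℂ) (y₀ := 0) (u := fun x : ℕ => (x : ℝ) * p x)
    (g := fun (x : ℕ) (s : ℝ) =>
      (p x : ℂ) * Complex.exp (Complex.I * (((x : ℝ) - 0 : ℝ) : ℂ) * s))
    (g' := fun (x : ℕ) (s : ℝ) =>
      (p x : ℂ) * (Complex.exp (Complex.I * (((x : ℝ) - 0 : ℝ) : ℂ) * s) *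
        (Complex.I * (((x : ℝ) - 0 : ℝ) : ℂ))))
    (h.summable_id hp) (fun x y => ?_) (fun x y => ?_) (summable_seqCF hp 0 0) t
  · have h1 : HasDerivAt (fun s : ℝ => Complex.I * (((x : ℝ) - 0 : ℝ) : ℂ) * (s : ℂ))
        (Complex.I * (((x : ℝ) - 0 : ℝ) : ℂ)) y := by
      simpa using (Complex.ofRealCLM.hasDerivAt (x := y)).const_mul
        (Complex.I * (((x : ℝ) - 0 : ℝ) : ℂ))
    exact h1.cexp.const_mul _
  · rw [norm_mul, norm_mul, norm_exp_I_mul_mul, one_mul, Complex.norm_real, norm_mul,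
      Complex.norm_I, one_mul, Complex.norm_real, Real.norm_of_nonneg (hp.nonneg x), sub_zero,
      Real.norm_of_nonneg (Nat.cast_nonneg x), mul_comm]

end ProductForm

namespace ProductForm

open MeasureTheory Finset

/-! ### Exponential tilting -/

/-- The law with weights `p x * exp (-L x)`, normalised. -/
noncomputable def tilt (p : ℕ → ℝ) (L : ℝ) (x : ℕ) : ℝ :=
  p x * Real.exp (-L * x) / expectation p fun x => Real.exp (-L * x)

theorem exp_neg_mul_natCast_le_one {L : ℝ} (hL : 0 ≤ L) (x : ℕ) : Real.exp (-L * x) ≤ 1 := by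
  rw [Real.exp_le_one_iff, neg_mul, neg_nonpos]
  positivity

theorem HasMoments.summable_pow_mul_exp {p : ℕ → ℝ} (h : HasMoments p) (hp : IsProbSeq p) {L : ℝ}
    (hL : 0 ≤ L) {f : ℕ → ℝ} {C : ℝ} {r : ℕ} (hf : ∀ x : ℕ, |f x| ≤ C * ((x : ℝ) + 1) ^ r) :
    Summable fun x : ℕ => (f x * Real.exp (-L * x)) * p x := by
  refine h.summable_of_le hp (C := C) (r := r) fun x => ?_
  rw [abs_mul, abs_of_pos (Real.exp_pos _)]
  exact (mul_le_of_le_one_right (abs_nonneg _) (exp_neg_mul_natCast_le_one hL x)).trans (hf x)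

theorem HasMoments.summable_exp {p : ℕ → ℝ} (h : HasMoments p) (hp : IsProbSeq p) {L : ℝ}
    (hL : 0 ≤ L) : Summable fun x : ℕ => Real.exp (-L * x) * p x := by
  simpa using h.summable_pow_mul_exp hp hL (f := fun _ => 1) (C := 1) (r := 0) (by simp)

/-- Jensen's inequality for the normalisation of a tilted law. -/
theorem exp_neg_mul_mean_le {p : ℕ → ℝ} (h : HasMoments p) (hp : IsProbSeq p) {L : ℝ}
    (hL : 0 ≤ L) : Real.exp (-L * mean p) ≤ expectation p fun x => Real.exp (-L * x) := by
  have s1 : Summable fun x : ℕ => (Real.exp (-L * mean p) * (1 + L * mean p)) * p x :=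
    hp.summable.mul_left _
  have s2 : Summable fun x : ℕ => ((Real.exp (-L * mean p) * L) * (x : ℝ)) * p x := by
    simpa only [mul_assoc] using (h.summable_id hp).mul_left (Real.exp (-L * mean p) * L)
  have e : Real.exp (-L * mean p) = expectation p fun x => Real.exp (-L * mean p) * (1 + L * mean p) -
      (Real.exp (-L * mean p) * L) * (x : ℝ) := by
    rw [expectation_sub s1 s2, hp.expectation_const, expectation_const_mul,
      show expectation p (fun x => (x : ℝ)) = mean p from rfl]
    ring
  rw [e]
  refine expectation_mono hp (by simpa only [sub_mul] using s1.sub s2) (h.summable_exp hp hL)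
      fun x => ?_
  calc Real.exp (-L * mean p) * (1 + L * mean p) - Real.exp (-L * mean p) * L * x
      = Real.exp (-L * mean p) * (L * (mean p - x) + 1) := by ring
    _ ≤ Real.exp (-L * mean p) * Real.exp (L * (mean p - x)) := by
        gcongr
        exact Real.add_one_le_exp _
    _ = Real.exp (-L * x) := by
        rw [← Real.exp_add]
        ring_nf

theorem expectation_exp_pos {p : ℕ → ℝ} (h : HasMoments p) (hp : IsProbSeq p) {L : ℝ}
    (hL : 0 ≤ L) : 0 < expectation p fun x => Real.exp (-L * x) :=
  (Real.exp_pos _).trans_le (exp_neg_mul_mean_le h hp hL)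

theorem expectation_tilt {p : ℕ → ℝ} {L : ℝ} (f : ℕ → ℝ) : expectation (tilt p L) f =
    expectation p (fun x => f x * Real.exp (-L * x)) / expectation p fun x => Real.exp (-L * x) := by
  rw [expectation, expectation, ← tsum_div_const]
  congr with x
  rw [tilt]
  ring

/-- Tilting lowers the mean, by at most the variance times the tilt, up to a factor. -/
theorem mean_sub_mean_tilt {p : ℕ → ℝ} (h : HasMoments p) (hp : IsProbSeq p) {L : ℝ}
    (hL : 0 ≤ L) : 0 ≤ mean p - mean (tilt p L) ∧
      mean p - mean (tilt p L) ≤ L * Real.exp (L * mean p) * absMoment p 2 := by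
  set D := expectation p fun x => Real.exp (-L * x) with hD
  have hDpos : 0 < D := expectation_exp_pos h hp hL
  set f : ℕ → ℝ := fun x => (mean p - x) * (Real.exp (-L * x) - Real.exp (-L * mean p)) with hf
  have sa : Summable fun x : ℕ => ((mean p - x) * Real.exp (-L * x)) * p x :=
    h.summable_pow_mul_exp hp hL (C := 1 + |mean p|) (r := 1) fun x => by
      rw [abs_sub_comm, pow_one]
      exact abs_natCast_sub_le x _
  have sb : Summable fun x : ℕ => (-Real.exp (-L * mean p) * ((x : ℝ) - mean p)) * p x := by
    simpa only [mul_assoc, pow_one] using (h.summable_pow_sub hp (mean p) 1).mul_left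
      (-Real.exp (-L * mean p))
  have sc : Summable fun x : ℕ => (mean p * Real.exp (-L * x)) * p x := by
    simpa only [mul_assoc] using (h.summable_exp hp hL).mul_left (mean p)
  have sd : Summable fun x : ℕ => ((x : ℝ) * Real.exp (-L * x)) * p x :=
    h.summable_pow_mul_exp hp hL (C := 1) (r := 1) fun x => by
      rw [abs_of_nonneg (by positivity)]
      linarith
  have ef : f = fun x : ℕ => (mean p - x) * Real.exp (-L * x) -
      -Real.exp (-L * mean p) * ((x : ℝ) - mean p) := by
    ext x
    rw [hf]
    ring
  have sf : Summable fun x => f x * p x := by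
    rw [ef]
    simpa only [sub_mul] using sa.sub sb
  have e : mean p - mean (tilt p L) = expectation p f / D := by
    rw [mean, mean, expectation_tilt, ← mean, ← hD, eq_div_iff hDpos.ne', sub_mul,
      div_mul_cancel₀ _ hDpos.ne', ef, expectation_sub sa sb, expectation_const_mul,
      expectation_sub_mean h hp,
      sub_self, mul_zero, sub_zero, hD, ← expectation_const_mul, ← expectation_sub sc sd]
    congr with x
    ring
  have h0 : ∀ x, 0 ≤ f x := fun x => by
    rw [hf]
    rcases le_total (x : ℝ) (mean p) with hx | hx
    · refine mul_nonneg (by linarith) (sub_nonneg.2 (Real.exp_le_exp.2 ?_))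
      nlinarith
    · refine mul_nonneg_of_nonpos_of_nonpos (by linarith) (sub_nonpos.2 (Real.exp_le_exp.2 ?_))
      nlinarith
  have lip : ∀ a b : ℝ, 0 ≤ a → a ≤ b →
      Real.exp (-L * a) - Real.exp (-L * b) ≤ L * (b - a) := fun a b ha hab => by
    have h1 : Real.exp (-L * a) ≤ 1 := Real.exp_le_one_iff.2 (by nlinarith)
    have h2 : Real.exp (-L * b) = Real.exp (-L * a) * Real.exp (-(L * (b - a))) := by
      rw [← Real.exp_add]
      ring_nf
    have h3 := Real.add_one_le_exp (-(L * (b - a)))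
    have h4 := Real.exp_pos (-L * a)
    have h5 : 0 ≤ L * (b - a) := mul_nonneg hL (sub_nonneg.2 hab)
    rw [h2]
    nlinarith
  have hm := mean_nonneg hp
  have h1 : ∀ x, f x ≤ L * ((x : ℝ) - mean p) ^ 2 := fun x => by
    rw [hf]
    rcases le_total (x : ℝ) (mean p) with hx | hx
    · have := lip x (mean p) (Nat.cast_nonneg x) hx
      nlinarith
    · have := lip (mean p) x hm hx
      nlinarith
  rw [e]
  refine ⟨div_nonneg (expectation_nonneg hp h0) hDpos.le, ?_⟩
  have h2 : expectation p f ≤ L * absMoment p 2 := by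
    rw [absMoment_two_eq, ← expectation_const_mul]
    exact expectation_mono hp sf
      (by simpa only [mul_assoc] using (h.summable_pow_sub hp _ 2).mul_left L) h1
  have h3 := exp_neg_mul_mean_le h hp hL
  rw [div_le_iff₀ hDpos]
  calc expectation p f ≤ L * absMoment p 2 := h2
    _ = L * absMoment p 2 * (Real.exp (L * mean p) * Real.exp (-L * mean p)) := by
        rw [← Real.exp_add, neg_mul, add_neg_cancel, Real.exp_zero, mul_one]
    _ ≤ L * absMoment p 2 * (Real.exp (L * mean p) * D) := by
        have := absMoment_nonneg hp 2
        gcongr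
    _ = _ := by ring

/-- A tilted law has moments of the order of the powers of the inverse tilt. -/
theorem expectation_tilt_pow_le {p : ℕ → ℝ} (h : HasMoments p) (hp : IsProbSeq p) {L : ℝ}
    (hL : 0 < L) (r : ℕ) : expectation (tilt p L) (fun x => (x : ℝ) ^ r) ≤
      r.factorial / L ^ r * Real.exp (L * mean p) := by
  have hDpos : 0 < expectation p fun x => Real.exp (-L * x) := expectation_exp_pos h hp hL.le
  rw [expectation_tilt, div_le_iff₀ hDpos]
  have h1 : expectation p (fun x => (x : ℝ) ^ r * Real.exp (-L * x)) ≤ r.factorial / L ^ r := by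
    rw [← hp.expectation_const (r.factorial / L ^ r)]
    refine expectation_mono hp (h.summable_pow_mul_exp hp hL.le (C := 1) (r := r) fun x => ?_)
      (hp.summable.mul_left _) fun x => ?_
    · rw [abs_of_nonneg (by positivity), one_mul]
      gcongr
      linarith
    · have := Real.pow_div_factorial_le_exp (L * x) (by positivity) r
      rw [neg_mul, Real.exp_neg, le_div_iff₀ (by positivity), ← div_eq_mul_inv, div_mul_eq_mul_div,
        div_le_iff₀ (Real.exp_pos _), ← mul_pow, mul_comm (x : ℝ)]
      rw [div_le_iff₀ (by positivity)] at this
      linarith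
  have h3 := exp_neg_mul_mean_le h hp hL.le
  calc expectation p (fun x => (x : ℝ) ^ r * Real.exp (-L * x)) ≤ r.factorial / L ^ r := h1
    _ = r.factorial / L ^ r * (Real.exp (L * mean p) * Real.exp (-L * mean p)) := by
        rw [← Real.exp_add, neg_mul, add_neg_cancel, Real.exp_zero, mul_one]
    _ ≤ r.factorial / L ^ r * (Real.exp (L * mean p) * expectation p fun x => Real.exp (-L * x)) := by
        gcongr
    _ = _ := by ring

theorem absMoment_le {p : ℕ → ℝ} (h : HasMoments p) (hp : IsProbSeq p) (r : ℕ) :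
    absMoment p r ≤ expectation p (fun x => (x : ℝ) ^ r) + mean p ^ r := by
  have hm := mean_nonneg hp
  have s1 : Summable fun x : ℕ => (x : ℝ) ^ r * p x := by
    simpa using h.summable_pow_sub hp 0 r
  rw [← hp.expectation_const (mean p ^ r), ← expectation_add s1 (hp.summable.mul_left _), absMoment]
  refine expectation_mono hp (h.summable_abs_pow_sub hp _ r)
    (by simpa only [add_mul] using s1.add (hp.summable.mul_left _)) fun x => ?_
  have hx : (0 : ℝ) ≤ x := Nat.cast_nonneg x
  rcases le_total (x : ℝ) (mean p) with hxm | hxm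
  · refine le_trans (pow_le_pow_left₀ (abs_nonneg _) ?_ r) (le_add_of_nonneg_left (by positivity))
    rw [abs_le]
    constructor <;> linarith
  · refine le_trans (pow_le_pow_left₀ (abs_nonneg _) ?_ r) (le_add_of_nonneg_right (by positivity))
    rw [abs_le]
    constructor <;> linarith

end ProductForm

/-! ### The open and the closed network -/

namespace ClosedNetwork

open MeasureTheory Finset ProductForm

variable {n : ℕ} (N : ClosedNetwork n)

/-- At arrival rate `lam * visit k` queue `k` stays below its asymptotic rate, so that its
generating function converges with room to spare. -/
def Stable (lam : ℝ) (k : Fin n) : Prop :=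
  0 < lam ∧ ENNReal.ofReal (lam * N.visit k) < N.asympRate k

theorem rateProd_pos (k : Fin n) (q : ℕ) : 0 < N.rateProd k q :=
  prod_pos fun i hi => N.rate_pos k i (mem_Icc.1 hi).1

theorem rateProd_zero (k : Fin n) : N.rateProd k 0 = 1 := by simp [rateProd]

variable {N} {lam lam' : ℝ} {k : Fin n}

theorem summable_succ_pow_mul_geometric {s : ℝ} (hs0 : 0 < s) (hs : s < 1) (r : ℕ) :
    Summable fun q : ℕ => ((q : ℝ) + 1) ^ r * s ^ q := by
  have h := summable_pow_mul_geometric_of_norm_lt_one r (r := s)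
    (by rwa [Real.norm_of_nonneg hs0.le])
  have h2 := ((summable_nat_add_iff 1).2 h).mul_right s⁻¹
  refine h2.congr fun q => ?_
  push_cast
  rw [pow_succ]
  field_simp

/-- By the root test: above a number that separates the arrival rate from the lower limit, the terms
are bounded by those of a geometric series. -/
theorem Stable.summable (h : N.Stable lam k) (r : ℕ) :
    Summable fun q : ℕ => ((q : ℝ) + 1) ^ r * ((lam * N.visit k) ^ q / N.rateProd k q) := by
  have hz : 0 < lam * N.visit k := mul_pos h.1 (N.visit_pos k)
  obtain ⟨w, hw1, hw2⟩ := exists_between h.2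
  have hwt : w ≠ ⊤ := hw2.ne_top
  have hzw : lam * N.visit k < w.toReal := (ENNReal.ofReal_lt_iff_lt_toReal hz.le hwt).1 hw1
  have hw0 : 0 < w.toReal := hz.trans hzw
  have hev : ∀ᶠ q : ℕ in atTop,
      (lam * N.visit k) ^ q / N.rateProd k q ≤ (lam * N.visit k / w.toReal) ^ q := by
    filter_upwards [eventually_lt_of_lt_liminf hw2, eventually_gt_atTop 0] with q hq hq0
    have h1 : w.toReal < N.rateProd k q ^ (1 / (q : ℝ)) :=
      (ENNReal.lt_ofReal_iff_toReal_lt hwt).1 hq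
    have h2 : w.toReal ^ q ≤ N.rateProd k q := by
      calc w.toReal ^ q ≤ (N.rateProd k q ^ (1 / (q : ℝ))) ^ q := by gcongr
        _ = N.rateProd k q := by
          rw [one_div, Real.rpow_inv_natCast_pow (N.rateProd_pos k q).le hq0.ne']
    rw [div_pow]
    gcongr
  have hs := summable_succ_pow_mul_geometric (div_pos hz hw0) ((div_lt_one hw0).2 hzw) r
  refine summable_of_isBigO_nat hs (Asymptotics.IsBigO.of_bound 1 ?_)
  filter_upwards [hev] with q hq
  have hr := N.rateProd_pos k q
  rw [one_mul, Real.norm_of_nonneg (by positivity), Real.norm_of_nonneg (by positivity)]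
  gcongr

theorem Stable.summable_genFun (h : N.Stable lam k) :
    Summable fun q : ℕ => (lam * N.visit k) ^ q / N.rateProd k q := by
  simpa using h.summable 0

theorem Stable.genFun_pos (h : N.Stable lam k) : 0 < N.genFun k (lam * N.visit k) := by
  have hz : 0 < lam * N.visit k := mul_pos h.1 (N.visit_pos k)
  refine h.summable_genFun.tsum_pos (fun q => ?_) 0 ?_
  · have := N.rateProd_pos k q
    positivity
  · simp [rateProd_zero]

theorem Stable.openProb_pos (h : N.Stable lam k) (x : ℕ) : 0 < N.openProb lam k x :=
  div_pos (div_pos (pow_pos (mul_pos h.1 (N.visit_pos k)) x) (N.rateProd_pos k x)) h.genFun_pos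

theorem Stable.isProbSeq (h : N.Stable lam k) : IsProbSeq (N.openProb lam k) where
  nonneg x := (h.openProb_pos x).le
  hasSum := by
    have := h.summable_genFun.hasSum.div_const (N.genFun k (lam * N.visit k))
    rwa [← genFun, div_self h.genFun_pos.ne'] at this

theorem Stable.hasMoments (h : N.Stable lam k) : HasMoments (N.openProb lam k) := fun r => by
  refine ((h.summable r).div_const (N.genFun k (lam * N.visit k))).congr fun x => ?_
  rw [openProb]
  ring

theorem openMean_eq : N.openMean lam k = mean (N.openProb lam k) := rfl

theorem centralMoment_eq (r : ℕ) : N.centralMoment lam k r = absMoment (N.openProb lam k) r := rfl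

theorem charFn_eq (t : ℝ) :
    N.charFn lam k t = seqCF (N.openProb lam k) (N.openMean lam k) t := rfl

theorem Stable.openMean_pos (h : N.Stable lam k) : 0 < N.openMean lam k := by
  refine (h.hasMoments.summable_id h.isProbSeq).tsum_pos
    (fun x => mul_nonneg (Nat.cast_nonneg x) (h.openProb_pos x).le) 1 ?_
  simpa using h.openProb_pos 1

/-- The laws of a queue at different intensities are exponential tilts of each other. -/
theorem Stable.openProb_eq_tilt (h : N.Stable lam' k) (h0 : 0 < lam) :
    N.openProb lam k = tilt (N.openProb lam' k) (Real.log (lam' / lam)) := by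
  have hz' : 0 < lam' * N.visit k := mul_pos h.1 (N.visit_pos k)
  have hexp : ∀ x : ℕ, Real.exp (-Real.log (lam' / lam) * x) = (lam / lam') ^ x := fun x => by
    rw [← Real.log_inv, inv_div, mul_comm, Real.exp_nat_mul, Real.exp_log (div_pos h0 h.1)]
  have hg := h.genFun_pos
  have key : ∀ x : ℕ, N.openProb lam' k x * (lam / lam') ^ x =
      (lam * N.visit k) ^ x / N.rateProd k x / N.genFun k (lam' * N.visit k) := fun x => by
    rw [openProb]
    have : (lam * N.visit k) ^ x = (lam' * N.visit k) ^ x * (lam / lam') ^ x := by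
      rw [← mul_pow]
      congr 1
      have := h.1.ne'
      field_simp
    rw [this]
    ring
  have hD : expectation (N.openProb lam' k) (fun x => Real.exp (-Real.log (lam' / lam) * x)) =
      N.genFun k (lam * N.visit k) / N.genFun k (lam' * N.visit k) := by
    rw [expectation, genFun, ← tsum_div_const]
    congr with x
    rw [hexp, mul_comm, key]
  ext x
  rw [tilt, hD, hexp, key, openProb, div_div_div_cancel_right₀ hg.ne']

/-! ### Saturable queues and the critical intensity -/

theorem serviceRate_of_mem (hk : k ∈ N.finiteQueues) :
    ENNReal.ofReal (N.serviceRate k) = N.asympRate k := by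
  rw [serviceRate, if_pos hk, ENNReal.ofReal_toReal (ne_of_lt hk)]

theorem critIntensity_le (hk : k ∈ N.finiteQueues) :
    N.critIntensity ≤ N.serviceRate k / N.visit k :=
  csInf_le (Set.toFinite _).bddBelow (Set.mem_image_of_mem _ hk)

theorem satQueues_nonempty (h : N.finiteQueues.Nonempty) : N.satQueues.Nonempty := by
  obtain ⟨k, hk, he⟩ := (h.image (fun k => N.serviceRate k / N.visit k)).csInf_mem (Set.toFinite _)
  exact ⟨k, hk, he⟩

theorem serviceRate_pos (hc : 0 < N.critIntensity) (k : Fin n) : 0 < N.serviceRate k := by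
  by_cases hk : k ∈ N.finiteQueues
  · have := hc.trans_le (critIntensity_le hk)
    exact (div_pos_iff_of_pos_right (N.visit_pos k)).1 this
  · rw [serviceRate, if_neg hk]
    exact N.rate_pos k 1 le_rfl

theorem load_pos (hc : 0 < N.critIntensity) (h0 : 0 < lam) (k : Fin n) : 0 < N.load lam k :=
  div_pos (mul_pos h0 (N.visit_pos k)) (serviceRate_pos hc k)

theorem load_mono (hc : 0 < N.critIntensity) (hl : lam ≤ lam') (k : Fin n) :
    N.load lam k ≤ N.load lam' k := by
  have := serviceRate_pos hc k
  have := (N.visit_pos k).le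
  rw [load, load]
  gcongr

theorem load_of_mem_satQueues (hk : k ∈ N.satQueues) (lam : ℝ) :
    N.load lam k = N.maxLoad lam := by
  rw [load, maxLoad, ← hk.2, div_div_eq_mul_div]

/-- Below the critical intensity every queue is stable. -/
theorem stable_of_lt (h0 : 0 < lam) (hl : lam < N.critIntensity) (k : Fin n) :
    N.Stable lam k := by
  refine ⟨h0, ?_⟩
  by_cases hk : k ∈ N.finiteQueues
  · rw [← serviceRate_of_mem hk, ENNReal.ofReal_lt_ofReal_iff (serviceRate_pos (h0.trans hl) k)]
    exact (lt_div_iff₀ (N.visit_pos k)).1 (hl.trans_le (critIntensity_le hk))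
  · have : N.asympRate k = ⊤ := by simpa [finiteQueues] using hk
    rw [this]
    exact ENNReal.ofReal_lt_top

/-- The queues outside `𝓕⁰` are still stable at the critical intensity. -/
theorem stable_crit (hc : 0 < N.critIntensity) (hk : k ∉ N.satQueues) :
    N.Stable N.critIntensity k := by
  refine ⟨hc, ?_⟩
  by_cases hf : k ∈ N.finiteQueues
  · rw [← serviceRate_of_mem hf, ENNReal.ofReal_lt_ofReal_iff (serviceRate_pos hc k)]
    exact (lt_div_iff₀ (N.visit_pos k)).1
      ((critIntensity_le hf).lt_of_ne fun h => hk ⟨hf, h.symm⟩)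
  · have : N.asympRate k = ⊤ := by simpa [finiteQueues] using hf
    rw [this]
    exact ENNReal.ofReal_lt_top

/-! ### The closed network as a conditioned open network -/

/-- The probability that independent variables with laws `p k` sum to `m`. -/
noncomputable def sumProb (p : Fin n → ℕ → ℝ) (m : ℕ) : ℝ :=
  ∑ x ∈ piAntidiag univ m, ∏ k, p k (x k)

theorem prod_openProb {m : ℕ} {x : Fin n → ℕ} (hx : ∑ k, x k = m) :
    ∏ k, N.openProb lam k (x k) =
      N.weight x * (lam ^ m / ∏ k, N.genFun k (lam * N.visit k)) := by
  rw [← hx, ← prod_pow_eq_pow_sum, ← prod_div_distrib, weight, ← prod_mul_distrib]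
  refine prod_congr rfl fun k _ => ?_
  rw [openProb, mul_pow]
  ring

/-- The closed network is the open system conditioned on holding `m` customers, at any intensity at
which the latter is stable. -/
theorem closedProb_eq (h : ∀ k, N.Stable lam k) (h0 : 0 < lam) {m : ℕ} {x : Fin n → ℕ}
    (hx : ∑ k, x k = m) : N.closedProb m x =
      (∏ k, N.openProb lam k (x k)) / sumProb (N.openProb lam) m := by
  have hc : lam ^ m / ∏ k, N.genFun k (lam * N.visit k) ≠ 0 :=
    (div_pos (pow_pos h0 m) (prod_pos fun k _ => (h k).genFun_pos)).ne'
  have h1 : sumProb (N.openProb lam) m =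
      N.normConst m * (lam ^ m / ∏ k, N.genFun k (lam * N.visit k)) := by
    rw [sumProb, normConst, sum_mul]
    exact sum_congr rfl fun y hy => prod_openProb (mem_piAntidiag.1 hy).1
  rw [closedProb, if_pos hx, h1, prod_openProb hx, mul_div_mul_right _ _ hc]

theorem sumProb_openProb_pos (h : ∀ k, N.Stable lam k) {m : ℕ} {x : Fin n → ℕ}
    (hx : ∑ k, x k = m) : 0 < sumProb (N.openProb lam) m :=
  sum_pos (fun y _ => prod_pos fun k _ => (h k).openProb_pos _)
    ⟨x, by simpa [mem_piAntidiag] using hx⟩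

/-- The mean of a queue of the closed network: since `x p(x)` is the mean of the open queue times
the weight of its size-biased law, it is a ratio of two local probabilities. -/
theorem closedMean_eq (h : ∀ k, N.Stable lam k) (h0 : 0 < lam) (m : ℕ) (j : Fin n) :
    N.closedMean m j = N.openMean lam j *
      (sumProb (Function.update (N.openProb lam) j (sizeBias (N.openProb lam j))) m /
        sumProb (N.openProb lam) m) := by
  rw [closedMean, ← mul_div_assoc, sumProb, mul_sum, sum_div]
  refine sum_congr rfl fun x hx => ?_
  rw [closedProb_eq h h0 (mem_piAntidiag.1 hx).1, ← mul_div_assoc]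
  congr 1
  rw [← mul_prod_erase univ _ (mem_univ j),
    ← mul_prod_erase univ (fun k => Function.update (N.openProb lam) j
      (sizeBias (N.openProb lam j)) k (x k)) (mem_univ j)]
  have e : ∏ k ∈ univ.erase j,
      Function.update (N.openProb lam) j (sizeBias (N.openProb lam j)) k (x k) =
      ∏ k ∈ univ.erase j, N.openProb lam k (x k) :=
    prod_congr rfl fun k hk => by rw [Function.update_of_ne (mem_erase.1 hk).1]
  have hm : N.openMean lam j ≠ 0 := (h j).openMean_pos.ne'
  rw [e, Function.update_self, sizeBias, ← openMean_eq]
  field_simp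

open Classical in
/-- The laws `p`, those of the queues in the range of `e` being replaced by Dirac masses. -/
noncomputable def pinned (p : Fin n → ℕ → ℝ) {l : ℕ} (e : Fin l ↪ Fin n) (q : Fin l → ℕ) :
    Fin n → ℕ → ℝ :=
  fun k => if h : ∃ i, e i = k then Pi.single (q h.choose) 1 else p k

theorem pinned_apply (p : Fin n → ℕ → ℝ) {l : ℕ} (e : Fin l ↪ Fin n) (q : Fin l → ℕ) (i : Fin l) :
    pinned p e q (e i) = Pi.single (q i) 1 := by
  have h : ∃ i', e i' = e i := ⟨i, rfl⟩
  rw [pinned, dif_pos h, e.injective h.choose_spec]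

theorem pinned_of_notMem (p : Fin n → ℕ → ℝ) {l : ℕ} (e : Fin l ↪ Fin n) (q : Fin l → ℕ)
    {k : Fin n} (hk : k ∉ Set.range e) : pinned p e q k = p k := by
  exact dif_neg hk

/-- The marginal laws of the closed network: fixing the contents of some queues amounts to replacing
their laws by Dirac masses in the local probability. -/
theorem closedMarginal_eq (h : ∀ k, N.Stable lam k) (h0 : 0 < lam) (m : ℕ) {l : ℕ}
    (e : Fin l ↪ Fin n) (q : Fin l → ℕ) :
    N.closedMarginal m e q = (∏ i, N.openProb lam (e i) (q i)) *
      (sumProb (pinned (N.openProb lam) e q) m / sumProb (N.openProb lam) m) := by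
  classical
  rw [closedMarginal, ← mul_div_assoc, sumProb, mul_sum, sum_div, sum_filter]
  refine sum_congr (by congr) fun x hx => ?_
  have split : ∀ f : Fin n → ℝ, ∏ k, f k =
      (∏ i, f (e i)) * ∏ k ∈ univ.filter (fun k => k ∉ Set.range e), f k := fun f => by
    rw [← prod_filter_mul_prod_filter_not univ (fun k => k ∈ Set.range e)]
    congr 1
    rw [← prod_map univ e f]
    refine prod_congr ?_ fun _ _ => rfl
    ext k
    simp
  rw [split fun k => pinned (N.openProb lam) e q k (x k)]
  simp only [pinned_apply]
  have e1 : ∏ k ∈ univ.filter (fun k => k ∉ Set.range e), pinned (N.openProb lam) e q k (x k) =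
      ∏ k ∈ univ.filter (fun k => k ∉ Set.range e), N.openProb lam k (x k) :=
    prod_congr rfl fun k hk => by rw [pinned_of_notMem _ _ _ (mem_filter.1 hk).2]
  rw [e1]
  split_ifs with hq
  · rw [closedProb_eq h h0 (mem_piAntidiag.1 hx).1, split fun k => N.openProb lam k (x k)]
    simp [hq]
  · obtain ⟨i, hi⟩ := not_forall.1 hq
    have hz : ∏ i, (Pi.single (q i) (1 : ℝ) : ℕ → ℝ) (x (e i)) = 0 :=
      prod_eq_zero (mem_univ i) (Pi.single_eq_of_ne hi _)
    rw [hz]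
    simp

end ClosedNetwork

namespace ProductForm

open MeasureTheory Finset

/-! ### Gaussian integrals -/

/-- The integral of `|u|^s exp (-u²)` over the real line. -/
noncomputable def gaussMoment (s : ℝ) : ℝ := ∫ u : ℝ, |u| ^ s * Real.exp (-u ^ 2)

theorem gaussMoment_nonneg (s : ℝ) : 0 ≤ gaussMoment s :=
  integral_nonneg fun u => by positivity

theorem integrable_abs_rpow_mul_exp {s : ℝ} (hs : -1 < s) :
    Integrable fun u : ℝ => |u| ^ s * Real.exp (-u ^ 2) := by
  have h : Integrable ((Set.Ioi (0 : ℝ)).indicator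
      fun u : ℝ => u ^ s * Real.exp (-1 * u ^ 2)) :=
    (integrable_rpow_mul_exp_neg_mul_sq one_pos hs).indicator measurableSet_Ioi
  refine (h.add h.comp_neg).congr ?_
  filter_upwards [compl_mem_ae_iff.2 (measure_singleton (0 : ℝ))] with u hu
  rcases lt_or_gt_of_ne (show u ≠ 0 from hu) with h0 | h0
  · simp [Set.indicator, h0, h0.le, abs_of_neg h0]
  · simp [Set.indicator, h0, h0.le, abs_of_pos h0]

theorem abs_rpow_mul_exp_comp {w : ℝ} (hw : 0 < w) (s t : ℝ) :
    |t| ^ s * Real.exp (-(w * t) ^ 2) = w ^ (-s) * (|w * t| ^ s * Real.exp (-(w * t) ^ 2)) := by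
  rw [abs_mul, abs_of_pos hw, Real.mul_rpow hw.le (abs_nonneg t), ← mul_assoc, ← mul_assoc,
    ← Real.rpow_add hw, neg_add_cancel, Real.rpow_zero, one_mul]

theorem integrable_abs_rpow_mul_exp_comp {s w : ℝ} (hs : -1 < s) (hw : 0 < w) :
    Integrable fun t : ℝ => |t| ^ s * Real.exp (-(w * t) ^ 2) := by
  simp_rw [abs_rpow_mul_exp_comp hw s]
  exact ((integrable_abs_rpow_mul_exp hs).comp_mul_left' hw.ne').const_mul _

theorem integral_abs_rpow_mul_exp_comp (s : ℝ) {w : ℝ} (hw : 0 < w) :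
    ∫ t : ℝ, |t| ^ s * Real.exp (-(w * t) ^ 2) = w ^ (-s - 1) * gaussMoment s := by
  simp_rw [abs_rpow_mul_exp_comp hw s]
  rw [integral_const_mul, Measure.integral_comp_mul_left
    (fun u : ℝ => |u| ^ s * Real.exp (-u ^ 2)), abs_of_pos (inv_pos.2 hw), smul_eq_mul,
    ← mul_assoc, ← Real.rpow_neg_one w, ← Real.rpow_add hw, gaussMoment, sub_eq_add_neg]

theorem integrable_abs_pow_mul_exp_comp (j : ℕ) {w : ℝ} (hw : 0 < w) :
    Integrable fun t : ℝ => |t| ^ j * Real.exp (-(w * t) ^ 2) := by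
  have := integrable_abs_rpow_mul_exp_comp (s := j) (by linarith [(Nat.cast_nonneg j : (0:ℝ) ≤ j)]) hw
  simpa only [Real.rpow_natCast] using this

theorem integral_abs_pow_mul_exp_comp (j : ℕ) {w : ℝ} (hw : 0 < w) :
    ∫ t : ℝ, |t| ^ j * Real.exp (-(w * t) ^ 2) = gaussMoment j / w ^ (j + 1) := by
  have := integral_abs_rpow_mul_exp_comp (j : ℝ) hw
  simp only [Real.rpow_natCast] at this
  rw [this, show -(j : ℝ) - 1 = -((j + 1 : ℕ) : ℝ) by push_cast; ring, Real.rpow_neg hw.le,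
    Real.rpow_natCast]
  ring

/-! ### Edgeworth expansion of a product of characteristic functions -/

/-- Near the origin the logarithm of the product is a sum of logarithms, each of which is expanded
to third order. -/
theorem norm_prod_sub_edgeworth_le {ι : Type*} (s : Finset ι) {φ : ι → ℂ} {β κ β₄ : ι → ℝ} {t : ℝ}
    (hβ₄ : ∀ k ∈ s, β k ^ 2 ≤ β₄ k)
    (h1 : ∀ k ∈ s, ‖φ k - 1‖ ≤ 4 * β k * t ^ 2)
    (h3 : ∀ k ∈ s, ‖φ k - (1 - ((β k * t ^ 2 / 2 : ℝ) : ℂ) -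
      Complex.I * ((κ k * t ^ 3 / 6 : ℝ) : ℂ))‖ ≤ 4 * β₄ k * t ^ 4)
    (hsmall : ∀ k ∈ s, 4 * β k * t ^ 2 ≤ 1 / 2)
    (hb : |∑ k ∈ s, κ k| * |t| / 6 + 20 * (∑ k ∈ s, β₄ k) * t ^ 2 ≤ (∑ k ∈ s, β k) / 4) :
    ‖∏ k ∈ s, φ k - Complex.exp (-(((∑ k ∈ s, β k) * t ^ 2 / 2 : ℝ) : ℂ)) *
        (1 - Complex.I * (((∑ k ∈ s, κ k) * t ^ 3 / 6 : ℝ) : ℂ))‖ ≤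
      Real.exp (-((∑ k ∈ s, β k) * t ^ 2 / 4)) * (20 * (∑ k ∈ s, β₄ k) * t ^ 4 +
        2 * ((∑ k ∈ s, κ k) ^ 2 * t ^ 6 + 400 * (∑ k ∈ s, β₄ k) ^ 2 * t ^ 8)) := by
  set b := ∑ k ∈ s, β k with hbdef
  set κs := ∑ k ∈ s, κ k with hκ
  set K := ∑ k ∈ s, β₄ k with hK
  have hK0 : 0 ≤ K := sum_nonneg fun k hk => (sq_nonneg _).trans (hβ₄ k hk)
  set z₀ : ℂ := -(Complex.I * ((κs * t ^ 3 / 6 : ℝ) : ℂ)) with hz₀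
  -- `ζ` is the logarithm of the quotient of the product by its Gaussian factor, and `z₀` its cubic
  -- part.
  set ζ : ℂ := ∑ k ∈ s, Complex.log (φ k) + ((b * t ^ 2 / 2 : ℝ) : ℂ) with hζ
  have hlog : ∀ k ∈ s, ‖Complex.log (φ k) + ((β k * t ^ 2 / 2 : ℝ) : ℂ) +
      Complex.I * ((κ k * t ^ 3 / 6 : ℝ) : ℂ)‖ ≤ 20 * β₄ k * t ^ 4 := by
    intro k hk
    have hw := (h1 k hk).trans (hsmall k hk)
    have hl := Complex.norm_log_one_add_sub_self_le (z := φ k - 1) (by linarith)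
    rw [add_sub_cancel] at hl
    have hl2 : ‖φ k - 1‖ ^ 2 * (1 - ‖φ k - 1‖)⁻¹ / 2 ≤ 16 * β₄ k * t ^ 4 := by
      have i1 : (1 - ‖φ k - 1‖)⁻¹ ≤ 2 := by
        rw [inv_le_comm₀ (by linarith) (by norm_num)]
        linarith
      calc ‖φ k - 1‖ ^ 2 * (1 - ‖φ k - 1‖)⁻¹ / 2 ≤ (4 * β k * t ^ 2) ^ 2 * 2 / 2 := by
            have := h1 k hk
            have i2 : 0 ≤ (1 - ‖φ k - 1‖)⁻¹ := inv_nonneg.2 (by linarith)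
            gcongr
        _ = 16 * β k ^ 2 * t ^ 4 := by ring
        _ ≤ 16 * β₄ k * t ^ 4 := by
            have := hβ₄ k hk
            gcongr
    calc _ = ‖(Complex.log (φ k) - (φ k - 1)) + (φ k - (1 - ((β k * t ^ 2 / 2 : ℝ) : ℂ) -
          Complex.I * ((κ k * t ^ 3 / 6 : ℝ) : ℂ)))‖ := by
          congr 1
          ring
      _ ≤ 16 * β₄ k * t ^ 4 + 4 * β₄ k * t ^ 4 := norm_add_le_of_le (hl.trans hl2) (h3 k hk)
      _ = _ := by ring
  have hζz : ‖ζ - z₀‖ ≤ 20 * K * t ^ 4 := by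
    have e : ζ - z₀ = ∑ k ∈ s, (Complex.log (φ k) + ((β k * t ^ 2 / 2 : ℝ) : ℂ) +
        Complex.I * ((κ k * t ^ 3 / 6 : ℝ) : ℂ)) := by
      rw [sum_add_distrib, sum_add_distrib, hζ, hz₀, sub_neg_eq_add, ← mul_sum, hbdef, hκ]
      congr 2
      · simp [sum_mul, sum_div]
      · simp [sum_mul, sum_div]
    rw [e, hK, mul_sum, sum_mul]
    exact (norm_sum_le _ _).trans (sum_le_sum hlog)
  have hz₀n : ‖z₀‖ = |κs| * |t| ^ 3 / 6 := by
    rw [hz₀, norm_neg, norm_mul, Complex.norm_I, one_mul, Complex.norm_real, Real.norm_eq_abs,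
      abs_div, abs_mul, abs_pow]
    norm_num
  have hζn : ‖ζ‖ ≤ |κs| * |t| ^ 3 / 6 + 20 * K * t ^ 4 := by
    calc ‖ζ‖ = ‖z₀ + (ζ - z₀)‖ := by rw [add_sub_cancel]
      _ ≤ _ := norm_add_le_of_le hz₀n.le hζz
  have hζb : ‖ζ‖ ≤ b * t ^ 2 / 4 := by
    refine hζn.trans ?_
    have e3 : |t| ^ 3 = |t| * t ^ 2 := by rw [pow_succ', sq_abs]
    calc |κs| * |t| ^ 3 / 6 + 20 * K * t ^ 4 =
          (|κs| * |t| / 6 + 20 * K * t ^ 2) * t ^ 2 := by rw [e3]; ring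
      _ ≤ b / 4 * t ^ 2 := by gcongr
      _ = _ := by ring
  have hζ2 : ‖ζ‖ ^ 2 ≤ 2 * (κs ^ 2 * t ^ 6 + 400 * K ^ 2 * t ^ 8) := by
    have e6 : |t| ^ 6 = t ^ 6 := by rw [show 6 = 2 * 3 from rfl, pow_mul, sq_abs, ← pow_mul]
    have e : (|κs| * |t| ^ 3 / 6) ^ 2 = κs ^ 2 * t ^ 6 / 36 := by
      rw [div_pow, mul_pow, sq_abs, ← pow_mul, e6]
      norm_num
    have : 0 ≤ κs ^ 2 * t ^ 6 := by positivity
    calc ‖ζ‖ ^ 2 ≤ (|κs| * |t| ^ 3 / 6 + 20 * K * t ^ 4) ^ 2 := by gcongr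
      _ ≤ 2 * ((|κs| * |t| ^ 3 / 6) ^ 2 + (20 * K * t ^ 4) ^ 2) := add_sq_le
      _ ≤ _ := by
        rw [e]
        nlinarith
  have hprod : ∏ k ∈ s, φ k = Complex.exp (-((b * t ^ 2 / 2 : ℝ) : ℂ)) * Complex.exp ζ := by
    rw [← Complex.exp_add, hζ, neg_add_cancel_comm_assoc, Complex.exp_sum]
    refine prod_congr rfl fun k hk => (Complex.exp_log fun h0 => ?_).symm
    have := (h1 k hk).trans (hsmall k hk)
    rw [h0] at this
    norm_num at this
  have hE : ‖Complex.exp ζ - (1 + ζ)‖ ≤ ‖ζ‖ ^ 2 * Real.exp ‖ζ‖ := by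
    simpa [sum_range_succ] using Complex.norm_exp_sub_sum_le_norm_mul_exp ζ 2
  have hne : ‖Complex.exp (-((b * t ^ 2 / 2 : ℝ) : ℂ))‖ = Real.exp (-(b * t ^ 2 / 2)) := by
    rw [← Complex.ofReal_neg, Complex.norm_exp_ofReal]
  calc _ = ‖Complex.exp (-((b * t ^ 2 / 2 : ℝ) : ℂ)) *
        ((Complex.exp ζ - (1 + ζ)) + (ζ - z₀))‖ := by
        rw [hprod, hz₀]
        congr 1
        ring
    _ ≤ Real.exp (-(b * t ^ 2 / 2)) * (‖ζ‖ ^ 2 * Real.exp ‖ζ‖ + 20 * K * t ^ 4) := by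
        rw [norm_mul, hne]
        gcongr
        exact norm_add_le_of_le hE hζz
    _ ≤ Real.exp (-(b * t ^ 2 / 2)) * ((2 * (κs ^ 2 * t ^ 6 + 400 * K ^ 2 * t ^ 8)) *
          Real.exp (b * t ^ 2 / 4) + 20 * K * t ^ 4 * Real.exp (b * t ^ 2 / 4)) := by
        have h1e : (1 : ℝ) ≤ Real.exp (b * t ^ 2 / 4) :=
          Real.one_le_exp ((norm_nonneg _).trans hζb)
        have h2e : 20 * K * t ^ 4 ≤ 20 * K * t ^ 4 * Real.exp (b * t ^ 2 / 4) :=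
          le_mul_of_one_le_right (by positivity) h1e
        gcongr
    _ = (Real.exp (-(b * t ^ 2 / 2)) * Real.exp (b * t ^ 2 / 4)) * (20 * K * t ^ 4 +
          2 * (κs ^ 2 * t ^ 6 + 400 * K ^ 2 * t ^ 8)) := by ring
    _ = _ := by
        rw [← Real.exp_add]
        ring_nf

end ProductForm

namespace ProductForm

open MeasureTheory Finset

/-! ### Integrals of a function close to its Edgeworth approximation -/

/-- The first-order Edgeworth approximation of a characteristic function with variance `b` and third
cumulant `κ`. -/
noncomputable def edgeworth (b κ t : ℝ) : ℂ :=
  Complex.exp (-((b * t ^ 2 / 2 : ℝ) : ℂ)) * (1 - Complex.I * ((κ * t ^ 3 / 6 : ℝ) : ℂ))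

theorem edgeworth_eq (b κ t : ℝ) : edgeworth b κ t = ((Real.exp (-(b / 2) * t ^ 2) : ℝ) : ℂ) -
    (Complex.I * κ / 6) * ((t ^ 3 * Real.exp (-(b / 2) * t ^ 2) : ℝ) : ℂ) := by
  rw [edgeworth, ← Complex.ofReal_neg, ← Complex.ofReal_exp,
    show -(b * t ^ 2 / 2) = -(b / 2) * t ^ 2 by ring]
  push_cast
  ring

theorem norm_edgeworth_le {b κ w t : ℝ} (hb : 4 * w ^ 2 ≤ b) :
    ‖edgeworth b κ t‖ ≤ Real.exp (-(w * t) ^ 2) * (2 + κ ^ 2 * t ^ 6) := by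
  rw [edgeworth, norm_mul, ← Complex.ofReal_neg, Complex.norm_exp_ofReal]
  gcongr
  · nlinarith [sq_nonneg t, sq_nonneg (w * t)]
  · refine (norm_sub_le _ _).trans ?_
    rw [norm_one, norm_mul, Complex.norm_I, one_mul, Complex.norm_real, Real.norm_eq_abs]
    have : |κ * t ^ 3 / 6| ^ 2 = κ ^ 2 * t ^ 6 / 36 := by
      rw [sq_abs]
      ring
    have h6 : 0 ≤ κ ^ 2 * t ^ 6 := by positivity
    nlinarith [sq_nonneg (|κ * t ^ 3 / 6| - 1)]

/-- A function with an Edgeworth approximation for `|t| ≤ η` and Gaussian decay on `[-π, π]` is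
approximated on the real line. Beyond `η` both it and its approximation are bounded by Gaussians, a
power of `t / η` being inserted to match the order of the remainder. -/
theorem norm_indicator_sub_edgeworth_le {Φ : ℝ → ℂ} {b κ K w η : ℝ} (hK : 0 ≤ K)
    (hη : 0 < η) (hηpi : η < Real.pi) (hb : 4 * w ^ 2 ≤ b)
    (hnear : ∀ t, |t| ≤ η → ‖Φ t - edgeworth b κ t‖ ≤
      Real.exp (-(b * t ^ 2 / 4)) * (20 * K * t ^ 4 + 2 * (κ ^ 2 * t ^ 6 + 400 * K ^ 2 * t ^ 8)))
    (hfar : ∀ t, |t| ≤ Real.pi → ‖Φ t‖ ≤ Real.exp (-(w * t) ^ 2)) (t : ℝ) :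
    ‖(Set.Ioc (-Real.pi) Real.pi).indicator Φ t - edgeworth b κ t‖ ≤
      Real.exp (-(w * t) ^ 2) *
        ((20 * K + 3 / η ^ 4) * t ^ 4 + 2 * κ ^ 2 * t ^ 6 + 800 * K ^ 2 * t ^ 8) := by
  rcases le_or_gt |t| η with ht | ht
  · have hmem : t ∈ Set.Ioc (-Real.pi) Real.pi := by
      have := abs_le.1 ht
      constructor <;> linarith
    rw [Set.indicator_of_mem hmem]
    refine (hnear t ht).trans (mul_le_mul (Real.exp_le_exp.2 ?_) ?_ (by positivity) (by positivity))
    · nlinarith [sq_nonneg t]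
    · have : 0 ≤ 3 / η ^ 4 * t ^ 4 := by positivity
      nlinarith
  · have h1 : ‖(Set.Ioc (-Real.pi) Real.pi).indicator Φ t‖ ≤ Real.exp (-(w * t) ^ 2) := by
      by_cases hmem : t ∈ Set.Ioc (-Real.pi) Real.pi
      · rw [Set.indicator_of_mem hmem]
        exact hfar t (abs_le.2 ⟨hmem.1.le, hmem.2⟩)
      · rw [Set.indicator_of_notMem hmem, norm_zero]
        positivity
    have h4 : 1 ≤ t ^ 4 / η ^ 4 := by
      rw [one_le_div (by positivity), ← (show |t| ^ 4 = t ^ 4 by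
        rw [show 4 = 2 * 2 from rfl, pow_mul, sq_abs, ← pow_mul])]
      gcongr
    refine (norm_sub_le _ _).trans ((add_le_add h1 (norm_edgeworth_le hb)).trans ?_)
    rw [← mul_one_add]
    refine mul_le_mul_of_nonneg_left ?_ (Real.exp_pos _).le
    have e : (20 * K + 3 / η ^ 4) * t ^ 4 = 20 * K * t ^ 4 + 3 * (t ^ 4 / η ^ 4) := by ring
    have : 0 ≤ 20 * K * t ^ 4 := by positivity
    have : 0 ≤ κ ^ 2 * t ^ 6 := by positivity
    have : 0 ≤ K ^ 2 * t ^ 8 := by positivity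
    rw [e]
    linarith

theorem integrable_pow_mul_exp_neg {b : ℝ} (hb : 0 < b) (j : ℕ) :
    Integrable fun t : ℝ => t ^ j * Real.exp (-b * t ^ 2) := by
  have := integrable_rpow_mul_exp_neg_mul_sq hb (s := j)
    (by linarith [(Nat.cast_nonneg j : (0:ℝ) ≤ j)])
  simpa only [Real.rpow_natCast] using this

theorem integral_odd_pow_mul_exp_neg (b : ℝ) {j : ℕ} (hj : Odd j) :
    ∫ t : ℝ, t ^ j * Real.exp (-b * t ^ 2) = 0 := by
  have h := integral_neg_eq_self (fun t : ℝ => t ^ j * Real.exp (-b * t ^ 2)) volume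
  simp only [hj.neg_pow, even_two.neg_pow, neg_mul, integral_neg] at h
  simp only [neg_mul]
  linarith

theorem integrable_pow_mul_edgeworth {b : ℝ} (hb : 0 < b) (κ : ℝ) (j : ℕ) :
    Integrable fun t : ℝ => ((t ^ j : ℝ) : ℂ) * edgeworth b κ t := by
  have h1 : Integrable fun t : ℝ => ((t ^ j * Real.exp (-(b / 2) * t ^ 2) : ℝ) : ℂ) :=
    (integrable_pow_mul_exp_neg (half_pos hb) j).ofReal
  have h2 : Integrable fun t : ℝ => (Complex.I * κ / 6) *
      ((t ^ (j + 3) * Real.exp (-(b / 2) * t ^ 2) : ℝ) : ℂ) :=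
    (integrable_pow_mul_exp_neg (half_pos hb) (j + 3)).ofReal.const_mul _
  refine (h1.sub h2).congr (ae_of_all _ fun t => ?_)
  simp only [Pi.sub_apply, edgeworth_eq]
  simp
  ring

theorem integral_pow_mul_edgeworth {b : ℝ} (hb : 0 < b) (κ : ℝ) (j : ℕ) :
    ∫ t : ℝ, ((t ^ j : ℝ) : ℂ) * edgeworth b κ t =
      ((∫ t : ℝ, t ^ j * Real.exp (-(b / 2) * t ^ 2) : ℝ) : ℂ) - (Complex.I * κ / 6) *
        ((∫ t : ℝ, t ^ (j + 3) * Real.exp (-(b / 2) * t ^ 2) : ℝ) : ℂ) := by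
  have h1 : Integrable fun t : ℝ => ((t ^ j * Real.exp (-(b / 2) * t ^ 2) : ℝ) : ℂ) :=
    (integrable_pow_mul_exp_neg (half_pos hb) j).ofReal
  have h2 : Integrable fun t : ℝ => (Complex.I * κ / 6) *
      ((t ^ (j + 3) * Real.exp (-(b / 2) * t ^ 2) : ℝ) : ℂ) :=
    (integrable_pow_mul_exp_neg (half_pos hb) (j + 3)).ofReal.const_mul _
  rw [← integral_complex_ofReal, ← integral_complex_ofReal, ← integral_const_mul,
    ← integral_sub h1 h2]
  refine integral_congr_ae (ae_of_all _ fun t => ?_)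
  simp only
  rw [edgeworth_eq]
  push_cast
  ring

/-- Integrals over `[-π, π]` are those of the Edgeworth approximation over the real line, up to the
Gaussian moments of the remainder. -/
theorem norm_integral_pow_mul_sub_le {Φ : ℝ → ℂ} (hΦ : Continuous Φ) {b κ K w η : ℝ} (hK : 0 ≤ K)
    (hη : 0 < η) (hηpi : η < Real.pi) (hw : 0 < w) (hb : 4 * w ^ 2 ≤ b)
    (hnear : ∀ t, |t| ≤ η → ‖Φ t - edgeworth b κ t‖ ≤
      Real.exp (-(b * t ^ 2 / 4)) * (20 * K * t ^ 4 + 2 * (κ ^ 2 * t ^ 6 + 400 * K ^ 2 * t ^ 8)))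
    (hfar : ∀ t, |t| ≤ Real.pi → ‖Φ t‖ ≤ Real.exp (-(w * t) ^ 2)) (j : ℕ) :
    ‖(∫ t in -Real.pi..Real.pi, ((t ^ j : ℝ) : ℂ) * Φ t) -
        ∫ t : ℝ, ((t ^ j : ℝ) : ℂ) * edgeworth b κ t‖ ≤
      (20 * K + 3 / η ^ 4) * (gaussMoment (j + 4 : ℕ) / w ^ (j + 5)) +
        2 * κ ^ 2 * (gaussMoment (j + 6 : ℕ) / w ^ (j + 7)) +
        800 * K ^ 2 * (gaussMoment (j + 8 : ℕ) / w ^ (j + 9)) := by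
  have hb0 : 0 < b := by nlinarith [sq_nonneg w, pow_pos hw 2]
  have hpi := Real.pi_pos
  have hΦi : Integrable ((Set.Ioc (-Real.pi) Real.pi).indicator
      fun t : ℝ => ((t ^ j : ℝ) : ℂ) * Φ t) := by
    rw [integrable_indicator_iff measurableSet_Ioc]
    exact (Continuous.integrableOn_Icc (by fun_prop)).mono_set Set.Ioc_subset_Icc_self
  rw [intervalIntegral.integral_of_le (by linarith), ← integral_indicator measurableSet_Ioc,
    ← integral_sub hΦi (integrable_pow_mul_edgeworth hb0 κ j)]
  have i4 := (integrable_abs_pow_mul_exp_comp (j + 4) hw).const_mul (20 * K + 3 / η ^ 4)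
  have i6 := (integrable_abs_pow_mul_exp_comp (j + 6) hw).const_mul (2 * κ ^ 2)
  have i8 := (integrable_abs_pow_mul_exp_comp (j + 8) hw).const_mul (800 * K ^ 2)
  have i46 : Integrable fun t : ℝ =>
      (20 * K + 3 / η ^ 4) * (|t| ^ (j + 4) * Real.exp (-(w * t) ^ 2)) +
        2 * κ ^ 2 * (|t| ^ (j + 6) * Real.exp (-(w * t) ^ 2)) := i4.add i6
  rw [← integral_abs_pow_mul_exp_comp (j + 4) hw, ← integral_abs_pow_mul_exp_comp (j + 6) hw,
    ← integral_abs_pow_mul_exp_comp (j + 8) hw, ← integral_const_mul, ← integral_const_mul,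
    ← integral_const_mul, ← integral_add i4 i6, ← integral_add i46 i8]
  refine norm_integral_le_of_norm_le (i46.add i8) (ae_of_all _ fun t => ?_)
  have e : (Set.Ioc (-Real.pi) Real.pi).indicator (fun t : ℝ => ((t ^ j : ℝ) : ℂ) * Φ t) t -
      ((t ^ j : ℝ) : ℂ) * edgeworth b κ t = ((t ^ j : ℝ) : ℂ) *
        ((Set.Ioc (-Real.pi) Real.pi).indicator Φ t - edgeworth b κ t) := by
    by_cases ht : t ∈ Set.Ioc (-Real.pi) Real.pi
    · simp only [Set.indicator_of_mem ht]
      ring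
    · simp only [Set.indicator_of_notMem ht]
      ring
  rw [e, norm_mul, Complex.norm_real, Real.norm_eq_abs, abs_pow]
  refine (mul_le_mul_of_nonneg_left (norm_indicator_sub_edgeworth_le hK hη hηpi hb hnear hfar t)
    (by positivity)).trans (le_of_eq ?_)
  have ev : ∀ i : ℕ, t ^ (2 * i) = |t| ^ (2 * i) := fun i => by rw [pow_mul, pow_mul, sq_abs]
  have e4 := ev 2
  have e6 := ev 3
  have e8 := ev 4
  norm_num at e4 e6 e8
  rw [e4, e6, e8]
  ring

theorem integral_sq_mul_norm_le {Φ : ℝ → ℂ} (hΦ : Continuous Φ) {w : ℝ} (hw : 0 < w)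
    (hfar : ∀ t, |t| ≤ Real.pi → ‖Φ t‖ ≤ Real.exp (-(w * t) ^ 2)) :
    ∫ t in -Real.pi..Real.pi, t ^ 2 * ‖Φ t‖ ≤ gaussMoment 2 / w ^ 3 := by
  have hpi := Real.pi_pos
  have hle : -Real.pi ≤ Real.pi := by linarith
  have h2 := integral_abs_pow_mul_exp_comp 2 hw
  norm_num at h2
  rw [← h2]
  have hi := integrable_abs_pow_mul_exp_comp 2 hw
  calc ∫ t in -Real.pi..Real.pi, t ^ 2 * ‖Φ t‖
      ≤ ∫ t in -Real.pi..Real.pi, |t| ^ 2 * Real.exp (-(w * t) ^ 2) := by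
        refine intervalIntegral.integral_mono_on hle
          (Continuous.intervalIntegrable (by fun_prop) _ _) hi.intervalIntegrable fun t ht => ?_
        rw [sq_abs]
        gcongr
        exact hfar t (abs_le.2 ht)
    _ ≤ ∫ t : ℝ, |t| ^ 2 * Real.exp (-(w * t) ^ 2) := by
        rw [intervalIntegral.integral_of_le hle]
        exact setIntegral_le_integral hi (ae_of_all _ fun t => by positivity)
    _ = _ := by simp

theorem integral_pow_zero_edgeworth {b : ℝ} (hb : 0 < b) (κ : ℝ) :
    ∫ t : ℝ, ((t ^ 0 : ℝ) : ℂ) * edgeworth b κ t = ((√(2 * Real.pi / b) : ℝ) : ℂ) := by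
  rw [integral_pow_mul_edgeworth hb, integral_odd_pow_mul_exp_neg _ (j := 0 + 3) (by decide)]
  simp only [pow_zero, one_mul, integral_gaussian, Complex.ofReal_zero, mul_zero, sub_zero]
  congr 2
  field_simp

theorem norm_integral_pow_one_edgeworth_le {b κ w : ℝ} (hw : 0 < w) (hb : 4 * w ^ 2 ≤ b) :
    ‖∫ t : ℝ, ((t ^ 1 : ℝ) : ℂ) * edgeworth b κ t‖ ≤ |κ| * (gaussMoment 4 / w ^ 5) := by
  have hb0 : 0 < b := by nlinarith [pow_pos hw 2]
  have h4 := integral_abs_pow_mul_exp_comp 4 hw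
  norm_num at h4
  have h5 : |∫ t : ℝ, t ^ 4 * Real.exp (-(b / 2) * t ^ 2)| ≤ gaussMoment 4 / w ^ 5 := by
    rw [← h4, abs_of_nonneg (integral_nonneg fun t => by positivity)]
    refine integral_mono (integrable_pow_mul_exp_neg (half_pos hb0) 4)
      (by simpa using integrable_abs_pow_mul_exp_comp 4 hw) fun t => ?_
    simp only
    rw [show |t| ^ 4 = t ^ 4 by rw [show 4 = 2 * 2 from rfl, pow_mul, sq_abs, ← pow_mul]]
    gcongr
    nlinarith [sq_nonneg t]
  rw [integral_pow_mul_edgeworth hb0, integral_odd_pow_mul_exp_neg _ (j := 1) (by decide)]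
  simp only [Complex.ofReal_zero, zero_sub, norm_neg, norm_mul, norm_div, Complex.norm_I, one_mul,
    Complex.norm_real, Real.norm_eq_abs]
  have := gaussMoment_nonneg 4
  calc _ ≤ |κ| / 1 * (gaussMoment 4 / w ^ 5) := by
        gcongr
        norm_num
    _ = _ := by rw [div_one]

end ProductForm

namespace ProductForm

open MeasureTheory Finset

/-- The remainder of the Edgeworth expansion in terms of the size `m` of the variance and the scale
`A` of the largest summands. -/
theorem edgeworth_remainder_le {m A C r c₁ κ K : ℝ} (hm : 1 ≤ m) (hA : 1 ≤ A) (hAm : A ^ 2 ≤ m)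
    (hC : 1 ≤ C) (hr : 0 < r) (hc₁ : 0 < c₁) (hκ : |κ| ≤ C * (m + A ^ 3)) (hK0 : 0 ≤ K)
    (hK : K ≤ C * (m + A ^ 4)) {G₁ G₂ G₃ : ℝ} (hG₁ : 0 ≤ G₁) (hG₂ : 0 ≤ G₂) (hG₃ : 0 ≤ G₃) (j : ℕ) :
    (20 * K + 3 / (c₁ / A) ^ 4) * (G₁ / (r * √m) ^ (j + 5)) +
        2 * κ ^ 2 * (G₂ / (r * √m) ^ (j + 7)) + 800 * K ^ 2 * (G₃ / (r * √m) ^ (j + 9)) ≤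
      ((20 * C + 3 / c₁ ^ 4) * G₁ / r ^ (j + 5) + 4 * C ^ 2 * G₂ / r ^ (j + 7) +
        1600 * C ^ 2 * G₃ / r ^ (j + 9)) * ((m + A ^ 4) / m ^ 2 / √m ^ (j + 1)) := by
  have hm0 : 0 < m := by linarith
  have hq : 0 < √m := Real.sqrt_pos.2 hm0
  have hq2 : √m ^ 2 = m := Real.sq_sqrt hm0.le
  have e5 : √m ^ (j + 5) = m ^ 2 * √m ^ (j + 1) := by
    calc √m ^ (j + 5) = (√m ^ 2) ^ 2 * √m ^ (j + 1) := by ring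
      _ = _ := by rw [hq2]
  have e7 : √m ^ (j + 7) = m ^ 3 * √m ^ (j + 1) := by
    calc √m ^ (j + 7) = (√m ^ 2) ^ 3 * √m ^ (j + 1) := by ring
      _ = _ := by rw [hq2]
  have e9 : √m ^ (j + 9) = m ^ 4 * √m ^ (j + 1) := by
    calc √m ^ (j + 9) = (√m ^ 2) ^ 4 * √m ^ (j + 1) := by ring
      _ = _ := by rw [hq2]
  have hA4 : A ^ 4 ≤ m ^ 2 := by
    calc A ^ 4 = (A ^ 2) ^ 2 := by ring
      _ ≤ m ^ 2 := by gcongr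
  have h1 : 20 * K + 3 / (c₁ / A) ^ 4 ≤ (20 * C + 3 / c₁ ^ 4) * (m + A ^ 4) := by
    have : 3 / (c₁ / A) ^ 4 = 3 / c₁ ^ 4 * A ^ 4 := by
      rw [div_pow, div_div_eq_mul_div]
      ring
    rw [this, add_mul]
    have h3 : 0 ≤ 3 / c₁ ^ 4 := by positivity
    nlinarith
  have h2 : κ ^ 2 ≤ 2 * C ^ 2 * (m * (m + A ^ 4)) := by
    have h6 : A ^ 6 ≤ m * A ^ 4 := by
      calc A ^ 6 = A ^ 2 * A ^ 4 := by ring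
        _ ≤ m * A ^ 4 := by gcongr
    calc κ ^ 2 = |κ| ^ 2 := (sq_abs κ).symm
      _ ≤ (C * (m + A ^ 3)) ^ 2 := by gcongr
      _ = C ^ 2 * (m + A ^ 3) ^ 2 := by ring
      _ ≤ C ^ 2 * (2 * (m * (m + A ^ 4))) := by
        gcongr
        nlinarith [sq_nonneg (m - A ^ 3)]
      _ = _ := by ring
  have h3 : K ^ 2 ≤ 2 * C ^ 2 * (m ^ 2 * (m + A ^ 4)) := by
    calc K ^ 2 ≤ (C * (m + A ^ 4)) ^ 2 := by gcongr
      _ = C ^ 2 * ((m + A ^ 4) * (m + A ^ 4)) := by ring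
      _ ≤ C ^ 2 * ((2 * m ^ 2) * (m + A ^ 4)) := by
        gcongr
        nlinarith
      _ = _ := by ring
  simp only [mul_pow]
  rw [e5, e7, e9]
  calc _ ≤ ((20 * C + 3 / c₁ ^ 4) * (m + A ^ 4)) * (G₁ / (r ^ (j + 5) * (m ^ 2 * √m ^ (j + 1)))) +
        2 * (2 * C ^ 2 * (m * (m + A ^ 4))) * (G₂ / (r ^ (j + 7) * (m ^ 3 * √m ^ (j + 1)))) +
        800 * (2 * C ^ 2 * (m ^ 2 * (m + A ^ 4))) *
          (G₃ / (r ^ (j + 9) * (m ^ 4 * √m ^ (j + 1)))) := by gcongr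
    _ = _ := by
      field_simp
      ring

set_option maxHeartbeats 1000000 in
/-- Integrals of a product of centred characteristic functions of total variance of order `m`, the
individual ones having moments of the order of powers of `A`. -/
theorem exists_edgeworth_bounds {c C : ℝ} (hc : 0 < c) (hc1 : c ≤ 1) (hC : 1 ≤ C) :
    ∃ K : ℝ, 0 ≤ K ∧ ∀ {ι : Type} (s : Finset ι) (p : ι → ℕ → ℝ) (m A : ℝ),
      (∀ k ∈ s, IsProbSeq (p k)) → (∀ k ∈ s, HasMoments (p k)) → 1 ≤ m → 1 ≤ A → A ^ 2 ≤ m →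
      (∀ k ∈ s, absMoment (p k) 2 ≤ C * A ^ 2) →
      ∑ k ∈ s, absMoment (p k) 3 ≤ C * (m + A ^ 3) →
      ∑ k ∈ s, absMoment (p k) 4 ≤ C * (m + A ^ 4) →
      c * m ≤ ∑ k ∈ s, absMoment (p k) 2 → c * m ≤ ∑ k ∈ s, pairing (p k) →
      ‖(∫ t in -Real.pi..Real.pi, ∏ k ∈ s, seqCF (p k) (mean (p k)) t) -
          ((√(2 * Real.pi / ∑ k ∈ s, absMoment (p k) 2) : ℝ) : ℂ)‖ ≤
        K * ((m + A ^ 4) / m ^ 2 / √m) ∧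
      ‖∫ t in -Real.pi..Real.pi, (t : ℂ) * ∏ k ∈ s, seqCF (p k) (mean (p k)) t‖ ≤
        K * ((m + A ^ 3) / m ^ 2 / √m + (m + A ^ 4) / m ^ 2 / √m ^ 2) ∧
      ∫ t in -Real.pi..Real.pi, t ^ 2 * ‖∏ k ∈ s, seqCF (p k) (mean (p k)) t‖ ≤
        K * (1 / m / √m) := by
  set r : ℝ := √(c / 8) with hr
  have hr0 : 0 < r := Real.sqrt_pos.2 (by positivity)
  have hr2 : r ^ 2 = c / 8 := Real.sq_sqrt (by positivity)
  -- Up to the frequency `c₁ / A` the terms of order three and four of the logarithm amount to at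
  -- most a quarter of the quadratic one; beyond it, the pairing gives the decay.
  set c₁ : ℝ := c / (400 * C) with hc₁
  have hC0 : 0 < C := by linarith
  have hc₁0 : 0 < c₁ := by positivity
  have hcc : C * c₁ = c / 400 := by
    rw [hc₁]
    field_simp
  have hc₁1 : c₁ ≤ 1 / 400 := by nlinarith
  set B : ℕ → ℝ := fun j => (20 * C + 3 / c₁ ^ 4) * gaussMoment (j + 4 : ℕ) / r ^ (j + 5) +
    4 * C ^ 2 * gaussMoment (j + 6 : ℕ) / r ^ (j + 7) +
      1600 * C ^ 2 * gaussMoment (j + 8 : ℕ) / r ^ (j + 9) with hB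
  have hg := gaussMoment_nonneg
  have hB0 : ∀ j, 0 ≤ B j := fun j => by
    have h1 := hg (j + 4 : ℕ)
    have h2 := hg (j + 6 : ℕ)
    have h3 := hg (j + 8 : ℕ)
    simp only [hB]
    positivity
  have hD0 : 0 ≤ C * gaussMoment 4 / r ^ 5 := by
    have := hg 4
    positivity
  have hF0 : 0 ≤ gaussMoment 2 / r ^ 3 := by
    have := hg 2
    positivity
  refine ⟨B 0 + B 1 + C * gaussMoment 4 / r ^ 5 + gaussMoment 2 / r ^ 3, by
    have := hB0 0
    have := hB0 1
    positivity, ?_⟩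
  intro ι s p m A hp hmom hm hA hAm h2 h3 h4 hvar hpair
  have hm0 : 0 < m := by linarith
  have hA0 : 0 < A := by linarith
  have hq : 0 < √m := Real.sqrt_pos.2 hm0
  have hq2 : √m ^ 2 = m := Real.sq_sqrt hm0.le
  have hw : 0 < r * √m := by positivity
  have hw2 : (r * √m) ^ 2 = c / 8 * m := by rw [mul_pow, hr2, hq2]
  set b := ∑ k ∈ s, absMoment (p k) 2 with hbdef
  set κ := ∑ k ∈ s, thirdMoment (p k) with hκdef
  set K4 := ∑ k ∈ s, absMoment (p k) 4 with hK4
  set Φ : ℝ → ℂ := fun t => ∏ k ∈ s, seqCF (p k) (mean (p k)) t with hΦdef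
  have hK0 : 0 ≤ K4 := sum_nonneg fun k hk => absMoment_nonneg (hp k hk) 4
  have hκ : |κ| ≤ C * (m + A ^ 3) := by
    refine (abs_sum_le_sum_abs _ _).trans ((sum_le_sum fun k hk => ?_).trans h3)
    exact abs_thirdMoment_le (hmom k hk) (hp k hk)
  have hΦ : Continuous Φ := continuous_finsetProd _ fun k hk => continuous_seqCF (hp k hk) _
  have hb : 4 * (r * √m) ^ 2 ≤ b := by
    rw [hw2]
    nlinarith
  have hη : 0 < c₁ / A := by positivity
  have hη1 : c₁ / A ≤ 1 / 400 := (div_le_self hc₁0.le hA).trans hc₁1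
  have hηpi : c₁ / A < Real.pi := by linarith [Real.pi_gt_three]
  have hηA : c₁ / A * A = c₁ := div_mul_cancel₀ _ hA0.ne'
  have hnear : ∀ t, |t| ≤ c₁ / A → ‖Φ t - edgeworth b κ t‖ ≤ Real.exp (-(b * t ^ 2 / 4)) *
      (20 * K4 * t ^ 4 + 2 * (κ ^ 2 * t ^ 6 + 400 * K4 ^ 2 * t ^ 8)) := by
    intro t ht
    have ht2 : t ^ 2 ≤ (c₁ / A) ^ 2 := by
      rw [← sq_abs]
      gcongr
    have hAt : A * |t| ≤ c₁ := by
      rw [← hηA, mul_comm]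
      gcongr
    have hAt2 : A ^ 2 * t ^ 2 ≤ c₁ ^ 2 := by
      rw [← sq_abs t, ← mul_pow]
      gcongr
    have ht1 : |t| ≤ c₁ := ht.trans (div_le_self hc₁0.le hA)
    have ht12 : t ^ 2 ≤ c₁ ^ 2 := by
      rw [← sq_abs]
      gcongr
    refine norm_prod_sub_edgeworth_le s
      (fun k hk => absMoment_two_sq_le (hmom k hk) (hp k hk))
      (fun k hk => norm_seqCF_sub_one_le (hmom k hk) (hp k hk) t)
      (fun k hk => norm_seqCF_sub_cubic_le (hmom k hk) (hp k hk) t) (fun k hk => ?_) ?_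
    · calc 4 * absMoment (p k) 2 * t ^ 2 ≤ 4 * (C * A ^ 2) * t ^ 2 := by
            have := h2 k hk
            gcongr
        _ = 4 * C * (A ^ 2 * t ^ 2) := by ring
        _ ≤ 4 * C * c₁ ^ 2 := by gcongr
        _ = 4 * (C * c₁) * c₁ := by ring
        _ ≤ 1 / 2 := by
            rw [hcc]
            nlinarith
    · have g1 : |κ| * |t| ≤ 2 * (c / 400) * m := by
        calc |κ| * |t| ≤ C * (m + A ^ 3) * |t| := by gcongr
          _ = C * (m * |t| + A ^ 2 * (A * |t|)) := by ring
          _ ≤ C * (m * c₁ + m * c₁) := by gcongr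
          _ = 2 * (C * c₁) * m := by ring
          _ = _ := by rw [hcc]
      have g2 : K4 * t ^ 2 ≤ 2 * (c / 400) * c₁ * m := by
        calc K4 * t ^ 2 ≤ C * (m + A ^ 4) * t ^ 2 := by gcongr
          _ = C * (m * t ^ 2 + A ^ 2 * (A ^ 2 * t ^ 2)) := by ring
          _ ≤ C * (m * c₁ ^ 2 + m * c₁ ^ 2) := by gcongr
          _ = 2 * (C * c₁) * c₁ * m := by ring
          _ = _ := by rw [hcc]
      have g3 : 2 * (c / 400) * c₁ * m ≤ 2 * (c / 400) * (1 / 400) * m := by gcongr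
      have : 0 < c * m := by positivity
      nlinarith
  have hfar : ∀ t, |t| ≤ Real.pi → ‖Φ t‖ ≤ Real.exp (-((r * √m) * t) ^ 2) := by
    intro t ht
    have h1 : ‖Φ t‖ ≤ ∏ k ∈ s, Real.exp (-(2 / Real.pi ^ 2 * pairing (p k)) * t ^ 2) := by
      rw [hΦdef, norm_prod]
      exact prod_le_prod (fun _ _ => norm_nonneg _) fun k hk => norm_seqCF_le_exp (hp k hk) _ ht
    refine h1.trans ?_
    rw [← Real.exp_sum, ← sum_mul, mul_pow (r * √m), hw2]
    refine Real.exp_le_exp.2 ?_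
    rw [sum_neg_distrib, ← mul_sum]
    have hpi2 : (1 : ℝ) / 8 ≤ 2 / Real.pi ^ 2 := by
      rw [div_le_div_iff₀ (by norm_num) (by positivity)]
      nlinarith [Real.pi_lt_four, Real.pi_pos]
    have : c / 8 * m ≤ 2 / Real.pi ^ 2 * ∑ k ∈ s, pairing (p k) := by
      calc c / 8 * m = 1 / 8 * (c * m) := by ring
        _ ≤ _ := by gcongr
    have h2 := mul_le_mul_of_nonneg_right this (sq_nonneg t)
    linarith
  have key := fun j => (norm_integral_pow_mul_sub_le hΦ hK0 hη hηpi hw hb hnear hfar j).trans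
    (edgeworth_remainder_le hm hA hAm hC hr0 hc₁0 hκ hK0 h4 (hg (j + 4 : ℕ)) (hg (j + 6 : ℕ))
      (hg (j + 8 : ℕ)) j)
  have hB0' := hB0 0
  have hB1' := hB0 1
  refine ⟨?_, ?_, ?_⟩
  · have h := key 0
    rw [integral_pow_zero_edgeworth (by nlinarith [pow_pos hw 2])] at h
    simp only [pow_zero, Complex.ofReal_one, one_mul, zero_add, pow_one] at h
    refine h.trans (mul_le_mul_of_nonneg_right ?_ (by positivity))
    simp only [hB] at hB1' ⊢
    norm_num at hB1' ⊢
    linarith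
  · have h := key 1
    have h5 := norm_integral_pow_one_edgeworth_le (κ := κ) hw hb
    simp only [pow_one] at h h5
    have e5 : (r * √m) ^ 5 = r ^ 5 * (m ^ 2 * √m) := by
      rw [mul_pow, show √m ^ 5 = (√m ^ 2) ^ 2 * √m by ring, hq2]
    have h6 : |κ| * (gaussMoment 4 / (r * √m) ^ 5) ≤
        C * gaussMoment 4 / r ^ 5 * ((m + A ^ 3) / m ^ 2 / √m) := by
      have := hg 4
      rw [e5]
      calc _ ≤ C * (m + A ^ 3) * (gaussMoment 4 / (r ^ 5 * (m ^ 2 * √m))) := by gcongr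
        _ = _ := by
          field_simp
    calc _ ≤ ‖(∫ t in -Real.pi..Real.pi, (t : ℂ) * Φ t) -
          ∫ t : ℝ, (t : ℂ) * edgeworth b κ t‖ + ‖∫ t : ℝ, (t : ℂ) * edgeworth b κ t‖ :=
          norm_le_norm_sub_add _ _
      _ ≤ B 1 * ((m + A ^ 4) / m ^ 2 / √m ^ (1 + 1)) +
          C * gaussMoment 4 / r ^ 5 * ((m + A ^ 3) / m ^ 2 / √m) := by
          exact add_le_add h (h5.trans h6)
      _ ≤ _ := by
          rw [mul_add, add_comm]
          gcongr
          · linarith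
          · linarith
  · refine (integral_sq_mul_norm_le hΦ hw hfar).trans ?_
    have e3 : (r * √m) ^ 3 = r ^ 3 * (m * √m) := by
      rw [mul_pow, show √m ^ 3 = (√m ^ 2) * √m by ring, hq2]
    have : gaussMoment 2 / (r * √m) ^ 3 = gaussMoment 2 / r ^ 3 * (1 / m / √m) := by
      rw [e3]
      field_simp
    rw [this]
    gcongr
    linarith

end ProductForm

namespace ProductForm

open MeasureTheory Finset

/-! ### Replacing a few of the summands -/

theorem expectation_abs_le_of_sq_le {p : ℕ → ℝ} (hp : IsProbSeq p) (h : HasMoments p) {c D : ℝ}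
    (hD : 0 < D) (hB : expectation p (fun x => ((x : ℝ) - c) ^ 2) ≤ D ^ 2) :
    expectation p (fun x => |(x : ℝ) - c| ^ 1) ≤ D := by
  have s1 : Summable fun x : ℕ => (D / 2) * p x := hp.summable.mul_left _
  have s2 : Summable fun x : ℕ => (1 / (2 * D) * ((x : ℝ) - c) ^ 2) * p x := by
    simpa only [mul_assoc] using (h.summable_pow_sub hp c 2).mul_left (1 / (2 * D))
  calc expectation p (fun x => |(x : ℝ) - c| ^ 1)
      ≤ expectation p (fun x => D / 2 + 1 / (2 * D) * ((x : ℝ) - c) ^ 2) := by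
        refine expectation_mono hp (h.summable_abs_pow_sub hp c 1)
          (by simpa only [add_mul] using s1.add s2) fun x => ?_
        rw [pow_one, ← sq_abs]
        have e : D / 2 + 1 / (2 * D) * |(x : ℝ) - c| ^ 2 - |(x : ℝ) - c| =
            (|(x : ℝ) - c| - D) ^ 2 / (2 * D) := by
          field_simp
          ring
        have : 0 ≤ (|(x : ℝ) - c| - D) ^ 2 / (2 * D) := by positivity
        linarith
    _ = D / 2 + 1 / (2 * D) * expectation p (fun x => ((x : ℝ) - c) ^ 2) := by
        rw [expectation_add s1 s2, hp.expectation_const, expectation_const_mul]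
    _ ≤ D / 2 + 1 / (2 * D) * D ^ 2 := by gcongr
    _ = D := by
        field_simp
        ring

theorem abs_mean_sub_le {p : ℕ → ℝ} (hp : IsProbSeq p) (h : HasMoments p) {c D : ℝ}
    (hD : 0 < D) (hB : expectation p (fun x => ((x : ℝ) - c) ^ 2) ≤ D ^ 2) : |mean p - c| ≤ D := by
  refine le_trans ?_ (expectation_abs_le_of_sq_le hp h hD hB)
  rw [← expectation_sub_mean h hp, expectation, expectation, ← Real.norm_eq_abs]
  refine tsum_of_norm_bounded (h.summable_abs_pow_sub hp c 1).hasSum fun x => ?_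
  rw [Real.norm_eq_abs, abs_mul, abs_of_nonneg (hp.nonneg x), pow_one]

theorem norm_seqCF_sub_one_le_of_sq_le {p : ℕ → ℝ} (hp : IsProbSeq p) (h : HasMoments p) {c D : ℝ}
    (hD : 0 < D) (hB : expectation p (fun x => ((x : ℝ) - c) ^ 2) ≤ D ^ 2) (t : ℝ) :
    ‖seqCF p c t - 1‖ ≤ 4 * D * |t| := by
  have h1 := norm_seqCF_sub_sum_le h hp c t 1
  simp only [range_one, sum_singleton, pow_zero, Nat.factorial, hp.expectation_const] at h1
  refine le_trans (le_of_eq ?_) (h1.trans ?_)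
  · simp
  · have := expectation_abs_le_of_sq_le hp h hD hB
    rw [pow_one]
    nlinarith [abs_nonneg t, mul_le_mul_of_nonneg_left this (abs_nonneg t)]

/-- A product of finitely many characteristic functions near the origin, to first order in the
frequency. -/
theorem norm_prod_seqCF_sub_le {ι : Type*} (J : Finset ι) {p : ι → ℕ → ℝ} {c : ι → ℝ} {D : ℝ}
    (hp : ∀ k ∈ J, IsProbSeq (p k)) (h : ∀ k ∈ J, HasMoments (p k)) (hD : 0 < D)
    (hB : ∀ k ∈ J, expectation (p k) (fun x => ((x : ℝ) - c k) ^ 2) ≤ D ^ 2) (t : ℝ) :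
    ‖∏ k ∈ J, seqCF (p k) (c k) t - 1 -
        Complex.I * ((∑ k ∈ J, (mean (p k) - c k) : ℝ) : ℂ) * t‖ ≤
      4 * (#J) ^ 2 * D ^ 2 * t ^ 2 := by
  classical
  induction J using Finset.induction_on with
  | empty => simp
  | insert k J hk ih =>
    have ih' := ih (fun i hi => hp i (mem_insert_of_mem hi))
      (fun i hi => h i (mem_insert_of_mem hi))
      (fun i hi => hB i (mem_insert_of_mem hi))
    have hpk := hp k (mem_insert_self k J)
    have hmk := h k (mem_insert_self k J)
    have hBk := hB k (mem_insert_self k J)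
    set z : ℂ := Complex.I * ((∑ k ∈ J, (mean (p k) - c k) : ℝ) : ℂ) * t with hz
    set P : ℂ := ∏ k ∈ J, seqCF (p k) (c k) t with hP
    have hzn : ‖z‖ ≤ #J * D * |t| := by
      rw [hz, norm_mul, norm_mul, Complex.norm_I, one_mul, Complex.norm_real, Complex.norm_real,
        Real.norm_eq_abs, Real.norm_eq_abs]
      gcongr
      refine (abs_sum_le_sum_abs _ _).trans ((sum_le_sum fun i hi => ?_).trans_eq
        (by rw [sum_const, nsmul_eq_mul]))
      exact abs_mean_sub_le (hp i (mem_insert_of_mem hi)) (h i (mem_insert_of_mem hi)) hD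
        (hB i (mem_insert_of_mem hi))
    have e : ∏ i ∈ insert k J, seqCF (p i) (c i) t - 1 -
        Complex.I * ((∑ i ∈ insert k J, (mean (p i) - c i) : ℝ) : ℂ) * t =
        seqCF (p k) (c k) t * (P - 1 - z) +
          (seqCF (p k) (c k) t - 1 - Complex.I * ((mean (p k) - c k : ℝ) : ℂ) * t) +
          (seqCF (p k) (c k) t - 1) * z := by
      rw [prod_insert hk, sum_insert hk, hz, hP]
      push_cast
      ring
    rw [e, card_insert_of_notMem hk]
    calc _ ≤ 1 * (4 * (#J) ^ 2 * D ^ 2 * t ^ 2) + 4 * D ^ 2 * t ^ 2 +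
          (4 * D * |t|) * (#J * D * |t|) := by
          refine norm_add_le_of_le (norm_add_le_of_le ?_ ?_) ?_
          · rw [norm_mul]
            exact mul_le_mul (norm_seqCF_le_one hpk _ _) ih' (norm_nonneg _) zero_le_one
          · refine (norm_seqCF_sub_one_sub_le hmk hpk _ _).trans ?_
            gcongr
          · rw [norm_mul]
            exact mul_le_mul (norm_seqCF_sub_one_le_of_sq_le hpk hmk hD hBk t) hzn (norm_nonneg _)
              (by positivity)
      _ ≤ _ := by
          have : (4 * D * |t|) * (#J * D * |t|) = 4 * #J * (D ^ 2 * t ^ 2) := by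
            rw [← sq_abs t]
            ring
          rw [this]
          push_cast
          have : 0 ≤ (#J : ℝ) * (D ^ 2 * t ^ 2) := by positivity
          nlinarith

end ProductForm

namespace ClosedNetwork

open MeasureTheory Finset ProductForm

/-! ### Local probabilities of a sum of independent variables -/

/-- The Edgeworth remainder controls the probability that the sum hits its mean. -/
theorem abs_sumProb_sub_le {n : ℕ} {p : Fin n → ℕ → ℝ} (hp : ∀ k, IsProbSeq (p k)) {m : ℕ}
    (hmean : ∑ k, mean (p k) = m) {E b : ℝ} (hb : 0 < b)
    (hE : ‖(∫ t in -Real.pi..Real.pi, ∏ k, seqCF (p k) (mean (p k)) t) -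
          ((√(2 * Real.pi / b) : ℝ) : ℂ)‖ ≤ E) :
    |sumProb p m - 1 / (√(2 * Real.pi) * √b)| ≤ E := by
  have hpi := Real.pi_pos
  have h := sum_piAntidiag_eq_integral hp (fun k => mean (p k)) m
  rw [hmean, sub_self] at h
  simp only [Complex.ofReal_zero, mul_zero, zero_mul, Complex.exp_zero, one_mul] at h
  rw [← h] at hE
  have e : (2 * Real.pi : ℂ) * ((∑ x ∈ piAntidiag univ m, ∏ k, p k (x k) : ℝ) : ℂ) -
      ((√(2 * Real.pi / b) : ℝ) : ℂ) =
      ((2 * Real.pi * (sumProb p m - 1 / (√(2 * Real.pi) * √b)) : ℝ) : ℂ) := by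
    have h2 : √(2 * Real.pi / b) = 2 * Real.pi * (1 / (√(2 * Real.pi) * √b)) := by
      rw [Real.sqrt_div (by positivity)]
      have hs : √(2 * Real.pi) ^ 2 = 2 * Real.pi := Real.sq_sqrt (by positivity)
      have hs0 : √(2 * Real.pi) ≠ 0 := by positivity
      have hb0 : √b ≠ 0 := by positivity
      field_simp
      exact hs
    rw [h2, sumProb]
    push_cast
    ring
  rw [e, Complex.norm_real, Real.norm_eq_abs, abs_mul, abs_of_pos (by positivity)] at hE
  nlinarith [abs_nonneg (sumProb p m - 1 / (√(2 * Real.pi) * √b)), Real.pi_gt_three]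

/-- Effect on the probability that the sum hits its mean of the replacement of the laws in `J`. -/
theorem abs_sumProb_sub_sumProb_le {n : ℕ} {p p' : Fin n → ℕ → ℝ} (hp : ∀ k, IsProbSeq (p k))
    (hp' : ∀ k, IsProbSeq (p' k)) (h : ∀ k, HasMoments (p k)) (h' : ∀ k, HasMoments (p' k)) {m : ℕ}
    (hmean : ∑ k, mean (p k) = m) (J : Finset (Fin n)) (heq : ∀ k ∉ J, p' k = p k) {D : ℝ}
    (hD : 0 < D) (hB : ∀ k ∈ J, absMoment (p k) 2 ≤ D ^ 2)
    (hB' : ∀ k ∈ J, expectation (p' k) (fun x => ((x : ℝ) - mean (p k)) ^ 2) ≤ D ^ 2)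
    {E₁ E₂ : ℝ}
    (h1 : ‖∫ t in -Real.pi..Real.pi, (t : ℂ) * ∏ k ∈ Jᶜ, seqCF (p k) (mean (p k)) t‖ ≤ E₁)
    (h2 : ∫ t in -Real.pi..Real.pi, t ^ 2 * ‖∏ k ∈ Jᶜ, seqCF (p k) (mean (p k)) t‖ ≤ E₂) :
    |sumProb p' m - sumProb p m| ≤ #J * D * E₁ + 8 * (#J) ^ 2 * D ^ 2 * E₂ := by
  have hpi := Real.pi_pos
  set Φ : ℝ → ℂ := fun t => ∏ k ∈ Jᶜ, seqCF (p k) (mean (p k)) t with hΦ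
  have hΦc : Continuous Φ := continuous_finsetProd _ fun k _ => continuous_seqCF (hp k) _
  set F : ℝ → ℂ := fun t => ∏ k ∈ J, seqCF (p k) (mean (p k)) t with hF
  set F' : ℝ → ℂ := fun t => ∏ k ∈ J, seqCF (p' k) (mean (p k)) t with hF'
  have hFc : Continuous F := continuous_finsetProd _ fun k _ => continuous_seqCF (hp k) _
  have hFc' : Continuous F' := continuous_finsetProd _ fun k _ => continuous_seqCF (hp' k) _
  have i1 := sum_piAntidiag_eq_integral hp (fun k => mean (p k)) m
  have i2 := sum_piAntidiag_eq_integral hp' (fun k => mean (p k)) m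
  rw [hmean, sub_self] at i1 i2
  simp only [Complex.ofReal_zero, mul_zero, zero_mul, Complex.exp_zero, one_mul] at i1 i2
  have e1 : ∀ t : ℝ, ∏ k, seqCF (p k) (mean (p k)) t = F t * Φ t := fun t =>
    (prod_mul_prod_compl J _).symm
  have e2 : ∀ t : ℝ, ∏ k, seqCF (p' k) (mean (p k)) t = F' t * Φ t := fun t => by
    rw [← prod_mul_prod_compl J, hΦ, hF']
    congr 1
    exact prod_congr rfl fun k hk => by rw [heq k (mem_compl.1 hk)]
  simp_rw [e1] at i1
  simp_rw [e2] at i2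
  set δ : ℝ := ∑ k ∈ J, (mean (p' k) - mean (p k)) with hδ
  have hδD : |δ| ≤ #J * D := by
    refine (abs_sum_le_sum_abs _ _).trans ((sum_le_sum fun i hi => ?_).trans_eq
        (by rw [sum_const, nsmul_eq_mul]))
    exact abs_mean_sub_le (hp' i) (h' i) hD (hB' i hi)
  -- The two products differ by `i δ t` to first order, `δ` being the difference of the means.
  have hFF : ∀ t : ℝ, ‖F' t - F t - Complex.I * δ * t‖ ≤ 8 * (#J) ^ 2 * D ^ 2 * t ^ 2 := by
    intro t
    have g1 := norm_prod_seqCF_sub_le J (fun k _ => hp k) (fun k _ => h k) hD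
      (c := fun k => mean (p k)) (fun k hk => by rw [← absMoment_two_eq]; exact hB k hk) t
    have g2 := norm_prod_seqCF_sub_le J (fun k _ => hp' k) (fun k _ => h' k) hD
      (c := fun k => mean (p k)) hB' t
    simp only [sub_self, sum_const_zero, Complex.ofReal_zero, mul_zero, zero_mul, sub_zero] at g1
    calc ‖F' t - F t - Complex.I * δ * t‖ =
          ‖(F' t - 1 - Complex.I * δ * t) - (F t - 1)‖ := by
          congr 1
          ring
      _ ≤ _ := norm_sub_le_of_le g2 g1
      _ = _ := by ring
  have key : (2 * Real.pi : ℂ) * ((sumProb p' m - sumProb p m : ℝ) : ℂ) =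
      Complex.I * δ * (∫ t in -Real.pi..Real.pi, (t : ℂ) * Φ t) +
        ∫ t in -Real.pi..Real.pi, (F' t - F t - Complex.I * δ * t) * Φ t := by
    rw [← intervalIntegral.integral_const_mul, ← intervalIntegral.integral_add
      (Continuous.intervalIntegrable (by fun_prop) _ _)
      (Continuous.intervalIntegrable (by fun_prop) _ _), Complex.ofReal_sub, mul_sub, sumProb,
      sumProb, i1, i2, ← intervalIntegral.integral_sub
      (Continuous.intervalIntegrable (by fun_prop) _ _)
      (Continuous.intervalIntegrable (by fun_prop) _ _)]
    refine intervalIntegral.integral_congr fun t _ => ?_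
    ring
  have hrest : ‖∫ t in -Real.pi..Real.pi, (F' t - F t - Complex.I * δ * t) * Φ t‖ ≤
      8 * (#J) ^ 2 * D ^ 2 * E₂ := by
    calc _ ≤ ∫ t in -Real.pi..Real.pi, 8 * (#J) ^ 2 * D ^ 2 * (t ^ 2 * ‖Φ t‖) := by
          refine intervalIntegral.norm_integral_le_of_norm_le (by linarith)
            (ae_of_all _ fun t _ => ?_) (Continuous.intervalIntegrable (by fun_prop) _ _)
          rw [norm_mul, ← mul_assoc]
          gcongr
          exact hFF t
      _ ≤ _ := by
          rw [intervalIntegral.integral_const_mul]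
          gcongr
  have hE₁ : 0 ≤ E₁ := (norm_nonneg _).trans h1
  have hfin : 2 * Real.pi * |sumProb p' m - sumProb p m| ≤
      #J * D * E₁ + 8 * (#J) ^ 2 * D ^ 2 * E₂ := by
    calc 2 * Real.pi * |sumProb p' m - sumProb p m| =
          ‖(2 * Real.pi : ℂ) * ((sumProb p' m - sumProb p m : ℝ) : ℂ)‖ := by
          rw [norm_mul, Complex.norm_real, Real.norm_eq_abs, norm_mul, Complex.norm_real,
            Real.norm_of_nonneg hpi.le]
          norm_num
      _ ≤ _ := by
          rw [key]
          refine norm_add_le_of_le ?_ hrest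
          rw [norm_mul, norm_mul, Complex.norm_I, one_mul, Complex.norm_real, Real.norm_eq_abs]
          gcongr
  nlinarith [abs_nonneg (sumProb p' m - sumProb p m), Real.pi_gt_three]

end ClosedNetwork

namespace ProductForm

open MeasureTheory Finset

/-! ### The gamma density -/

/-- The density of the gamma law of shape `ξ` and scale one. -/
noncomputable def gammaDensity (ξ x : ℝ) : ℝ := x ^ (ξ - 1) * Real.exp (-x) / Real.Gamma ξ

/-- The derivative of the gamma density on the positive half-line. -/
noncomputable def gammaSlope (ξ x : ℝ) : ℝ := gammaDensity ξ x * ((ξ - 1) / x - 1)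

theorem exists_gamma_bounds (B : ℝ) :
    ∃ c C : ℝ, 0 < c ∧ ∀ ξ, 1 ≤ ξ → ξ ≤ B → c ≤ Real.Gamma ξ ∧ Real.Gamma ξ ≤ C := by
  rcases lt_or_ge B 1 with hB | hB
  · exact ⟨1, 0, one_pos, fun ξ h1 h2 => by linarith⟩
  · have hc : ContinuousOn Real.Gamma (Set.Icc 1 B) := fun x hx =>
      (Real.differentiableAt_Gamma fun m => by
        have := (Nat.cast_nonneg m : (0 : ℝ) ≤ m)
        linarith [hx.1]).continuousAt.continuousWithinAt
    obtain ⟨a, ha, hmin⟩ := isCompact_Icc.exists_isMinOn ⟨1, le_rfl, hB⟩ hc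
    obtain ⟨b, hb, hmax⟩ := isCompact_Icc.exists_isMaxOn ⟨1, le_rfl, hB⟩ hc
    exact ⟨Real.Gamma a, Real.Gamma b, Real.Gamma_pos_of_pos (by linarith [ha.1]),
      fun ξ h1 h2 => ⟨hmin ⟨h1, h2⟩, hmax ⟨h1, h2⟩⟩⟩

theorem gammaDensity_nonneg {ξ x : ℝ} (hξ : 1 ≤ ξ) (hx : 0 ≤ x) : 0 ≤ gammaDensity ξ x := by
  have := Real.Gamma_pos_of_pos (by linarith : 0 < ξ)
  unfold gammaDensity
  positivity

theorem exists_gammaDensity_le (B : ℝ) :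
    ∃ F : ℝ, 0 ≤ F ∧ ∀ ξ, 1 ≤ ξ → ξ ≤ B → ∀ x, 0 ≤ x → gammaDensity ξ x ≤ F := by
  obtain ⟨c, C, hc, hG⟩ := exists_gamma_bounds B
  obtain ⟨N, hN⟩ := exists_nat_ge B
  refine ⟨(1 + N.factorial) / c, by positivity, fun ξ h1 h2 x hx => ?_⟩
  have hpow : x ^ (ξ - 1) * Real.exp (-x) ≤ 1 + N.factorial := by
    have hx1 : x ^ (ξ - 1) ≤ 1 + x ^ N := by
      rcases le_total x 1 with h | h
      · have : x ^ (ξ - 1) ≤ 1 := Real.rpow_le_one hx h (by linarith)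
        have : 0 ≤ x ^ N := by positivity
        linarith
      · have : x ^ (ξ - 1) ≤ x ^ (N : ℝ) := Real.rpow_le_rpow_of_exponent_le h (by linarith)
        rw [Real.rpow_natCast] at this
        linarith
    have hx2 := Real.pow_div_factorial_le_exp x hx N
    rw [div_le_iff₀ (by positivity)] at hx2
    calc x ^ (ξ - 1) * Real.exp (-x) ≤ (1 + x ^ N) * Real.exp (-x) := by gcongr
      _ = Real.exp (-x) + x ^ N * Real.exp (-x) := by ring
      _ ≤ 1 + (Real.exp x * N.factorial) * Real.exp (-x) := by
          gcongr
          exact Real.exp_le_one_iff.2 (by linarith)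
      _ = 1 + N.factorial * (Real.exp x * Real.exp (-x)) := by ring
      _ = _ := by rw [← Real.exp_add, add_neg_cancel, Real.exp_zero, mul_one]
  have hG1 := (hG ξ h1 h2).1
  unfold gammaDensity
  gcongr

theorem hasDerivAt_gammaDensity (ξ : ℝ) {x : ℝ} (hx : 0 < x) :
    HasDerivAt (gammaDensity ξ) (gammaSlope ξ x) x := by
  have h1 := Real.hasDerivAt_rpow_const (p := ξ - 1) (Or.inl hx.ne')
  have h2 : HasDerivAt (fun x : ℝ => Real.exp (-x)) (Real.exp (-x) * (-1)) x :=
    (hasDerivAt_neg x).exp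
  have h3 := (h1.mul h2).div_const (Real.Gamma ξ)
  convert! h3 using 1
  rw [gammaSlope, gammaDensity, Real.rpow_sub_one hx.ne' (ξ - 1)]
  ring

theorem hasDerivAt_gammaSlope (ξ : ℝ) {x : ℝ} (hx : 0 < x) :
    HasDerivAt (gammaSlope ξ)
      (gammaDensity ξ x * (((ξ - 1) / x - 1) ^ 2 - (ξ - 1) / x ^ 2)) x := by
  have h2 : HasDerivAt (fun x : ℝ => (ξ - 1) / x - 1) (-(ξ - 1) / x ^ 2) x := by
    have := ((hasDerivAt_inv hx.ne').const_mul (ξ - 1)).sub_const 1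
    convert! this using 1
    ring
  convert! (hasDerivAt_gammaDensity ξ hx).mul h2 using 1
  rw [gammaSlope]
  ring

/-- The gamma densities obey a quadratic Taylor estimate on the whole half-line, uniformly in the
shape and in the base point. -/
theorem exists_gammaDensity_taylor (B : ℝ) :
    ∃ C : ℝ, 0 ≤ C ∧ ∀ ξ, 1 ≤ ξ → ξ ≤ B → ∀ x₀, 1 ≤ x₀ → x₀ ≤ B →
      gammaDensity ξ x₀ ≤ C ∧ |gammaSlope ξ x₀| ≤ C ∧
      ∀ x, 0 ≤ x → |gammaDensity ξ x - gammaDensity ξ x₀ - gammaSlope ξ x₀ * (x - x₀)| ≤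
        C * (x - x₀) ^ 2 := by
  obtain ⟨F, hF0, hF⟩ := exists_gammaDensity_le B
  set M : ℝ := F * ((2 * |B| + 1) ^ 2 + 4 * |B|) with hM
  have hB0 := abs_nonneg B
  have hMF : F * (2 * |B| + 1) ≤ M := by
    rw [hM]
    exact mul_le_mul_of_nonneg_left (by nlinarith) hF0
  have hFM : F ≤ M := by
    refine le_trans ?_ hMF
    nlinarith
  have hM0 : 0 ≤ M := hF0.trans hFM
  refine ⟨M + (4 * F + 2 * M), by positivity, fun ξ h1 h2 x₀ hx₀ hx₀B => ?_⟩
  have hBa : B = |B| := (abs_of_nonneg (by linarith)).symm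
  have hfac : ∀ x : ℝ, 1 / 2 ≤ x → |(ξ - 1) / x - 1| ≤ 2 * |B| + 1 := fun x hx => by
    have hx0 : 0 < x := by linarith
    have h3 : (ξ - 1) / x ≤ 2 * |B| := by
      rw [div_le_iff₀ hx0]
      nlinarith
    have h4 : 0 ≤ (ξ - 1) / x := div_nonneg (by linarith) hx0.le
    rw [abs_le]
    constructor <;> linarith
  have hslope : ∀ x : ℝ, 1 / 2 ≤ x → |gammaSlope ξ x| ≤ M := fun x hx => by
    have hx0 : 0 ≤ x := by linarith
    rw [gammaSlope, abs_mul, abs_of_nonneg (gammaDensity_nonneg h1 hx0)]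
    exact (mul_le_mul (hF ξ h1 h2 x hx0) (hfac x hx) (abs_nonneg _) hF0).trans hMF
  have hcurv : ∀ x : ℝ, 1 / 2 ≤ x →
      |gammaDensity ξ x * (((ξ - 1) / x - 1) ^ 2 - (ξ - 1) / x ^ 2)| ≤ M := fun x hx => by
    have hx0 : 0 < x := by linarith
    rw [abs_mul, abs_of_nonneg (gammaDensity_nonneg h1 hx0.le), hM]
    refine mul_le_mul (hF ξ h1 h2 x hx0.le) ?_ (abs_nonneg _) hF0
    refine (abs_sub _ _).trans (add_le_add ?_ ?_)
    · rw [abs_pow]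
      exact pow_le_pow_left₀ (abs_nonneg _) (hfac x hx) 2
    · rw [abs_of_nonneg (div_nonneg (by linarith) (by positivity)), div_le_iff₀ (by positivity)]
      have h5 : 1 / 4 ≤ x ^ 2 := by nlinarith
      nlinarith
  refine ⟨?_, ?_, fun x hx => ?_⟩
  · have := hF ξ h1 h2 x₀ (by linarith)
    linarith
  · have := hslope x₀ (by linarith)
    linarith
  rcases le_or_gt (1 / 2) x with hx2 | hx2
  · have hconv : Convex ℝ (Set.uIcc x₀ x) := convex_uIcc _ _
    have hmem : ∀ y ∈ Set.uIcc x₀ x, 1 / 2 ≤ y := fun y hy => by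
      rcases Set.mem_uIcc.1 hy with h | h <;> linarith [h.1, h.2]
    have hlip : ∀ y ∈ Set.uIcc x₀ x, ‖gammaSlope ξ y - gammaSlope ξ x₀‖ ≤ M * |x - x₀| := by
      intro y hy
      have h3 := hconv.norm_image_sub_le_of_norm_hasDerivWithin_le
        (f := gammaSlope ξ)
        (fun z hz => (hasDerivAt_gammaSlope ξ (by linarith [hmem z hz])).hasDerivWithinAt)
        (fun z hz => hcurv z (hmem z hz)) Set.left_mem_uIcc hy
      refine h3.trans ?_
      gcongr
      rw [Real.norm_eq_abs]
      exact Set.abs_sub_left_of_mem_uIcc hy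
    have h4 := hconv.norm_image_sub_le_of_norm_hasDerivWithin_le
      (f := fun y => gammaDensity ξ y - gammaSlope ξ x₀ * y)
      (f' := fun y => gammaSlope ξ y - gammaSlope ξ x₀)
      (fun z hz => by
        have h5 := (hasDerivAt_gammaDensity ξ (by linarith [hmem z hz] : 0 < z)).sub
          ((hasDerivAt_id z).const_mul (gammaSlope ξ x₀))
        rw [mul_one] at h5
        exact h5.hasDerivWithinAt)
      hlip Set.left_mem_uIcc Set.right_mem_uIcc
    rw [Real.norm_eq_abs, Real.norm_eq_abs] at h4
    calc _ = |gammaDensity ξ x - gammaSlope ξ x₀ * x -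
          (gammaDensity ξ x₀ - gammaSlope ξ x₀ * x₀)| := by
          congr 1
          ring
      _ ≤ M * |x - x₀| * |x - x₀| := h4
      _ = M * (x - x₀) ^ 2 := by rw [← sq_abs (x - x₀)]; ring
      _ ≤ _ := by
          gcongr
          linarith
  -- Near zero the slope may be unbounded; but there `x` is away from `x₀` and boundedness suffices.
  · have hd : 1 / 2 ≤ x₀ - x := by linarith
    have e1 : |gammaDensity ξ x - gammaDensity ξ x₀| ≤ F := by
      have a1 := hF ξ h1 h2 x hx
      have a2 := hF ξ h1 h2 x₀ (by linarith)
      have a3 := gammaDensity_nonneg h1 hx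
      have a4 := gammaDensity_nonneg h1 (by linarith : 0 ≤ x₀)
      rw [abs_le]
      constructor <;> linarith
    have e2 : |gammaSlope ξ x₀ * (x - x₀)| ≤ M * (x₀ - x) := by
      rw [abs_mul, abs_sub_comm x x₀, abs_of_nonneg (by linarith : 0 ≤ x₀ - x)]
      have := hslope x₀ (by linarith)
      gcongr
    have e3 : (x - x₀) ^ 2 = (x₀ - x) ^ 2 := by ring
    rw [e3]
    refine (abs_sub _ _).trans ?_
    have h5 : F ≤ 4 * F * (x₀ - x) ^ 2 := by
      have : 1 / 4 ≤ (x₀ - x) ^ 2 := by nlinarith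
      nlinarith
    have h6 : M * (x₀ - x) ≤ 2 * M * (x₀ - x) ^ 2 := by
      have : x₀ - x ≤ 2 * (x₀ - x) ^ 2 := by nlinarith
      nlinarith
    have h7 : 0 ≤ M * (x₀ - x) ^ 2 := by positivity
    linarith

end ProductForm

namespace ProductForm

open MeasureTheory Finset

/-! ### The negative binomial law -/

/-- The characteristic function `ω(t) = (1 - ρ) / (1 - ρ e^{it})` of the geometric law. -/
noncomputable def geomCF (ρ t : ℝ) : ℂ :=
  (1 - (ρ : ℂ)) / (1 - (ρ : ℂ) * Complex.exp (Complex.I * t))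

/-- The negative binomial law of real order `ξ`. -/
noncomputable def negBinom (ρ ξ : ℝ) (y : ℕ) : ℝ :=
  Real.Gamma (ξ + y) / (Real.Gamma ξ * y.factorial) * ρ ^ y * (1 - ρ) ^ ξ

/-- The density of the gamma law of shape `y + 1` and scale `1 / α`. -/
noncomputable def erlangDensity (α : ℝ) (y : ℕ) (x : ℝ) : ℝ :=
  α ^ (y + 1) / y.factorial * (x ^ y * Real.exp (-(α * x)))

theorem ringChoose_add_sub_one {ξ : ℝ} (hξ : 0 < ξ) (y : ℕ) :
    Ring.choose ((ξ : ℂ) + y - 1) y =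
      ((Real.Gamma (ξ + y) / (Real.Gamma ξ * y.factorial) : ℝ) : ℂ) := by
  have h1 : Ring.choose ((ξ : ℂ) + y - 1) y = Ring.multichoose (ξ : ℂ) y := by
    rw [Ring.choose]
    congr 1
    ring
  have h2 := Ring.factorial_nsmul_multichoose_eq_ascPochhammer (ξ : ℂ) y
  rw [Polynomial.ascPochhammer_smeval_eq_eval, ← Complex.Gamma_add_nat_div_Gamma_eq] at h2
  · have hf : (y.factorial : ℂ) ≠ 0 := by exact_mod_cast y.factorial_ne_zero
    rw [h1]
    refine mul_left_cancel₀ hf ?_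
    rw [nsmul_eq_mul] at h2
    rw [h2, ← Complex.ofReal_natCast y, ← Complex.ofReal_add, Complex.Gamma_ofReal,
      Complex.Gamma_ofReal]
    push_cast
    field_simp
  · intro k hk
    have := congrArg Complex.re hk
    simp only [Complex.ofReal_re, Complex.neg_re, Complex.natCast_re] at this
    have hk0 : (0 : ℝ) ≤ k := Nat.cast_nonneg k
    linarith

theorem norm_mul_exp_I {ρ : ℝ} (h0 : 0 ≤ ρ) (t : ℝ) :
    ‖(ρ : ℂ) * Complex.exp (Complex.I * t)‖ = ρ := by
  rw [norm_mul, mul_comm Complex.I, Complex.norm_exp_ofReal_mul_I, mul_one, Complex.norm_real,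
    Real.norm_of_nonneg h0]

theorem one_sub_mul_exp_re_pos {ρ : ℝ} (h0 : 0 ≤ ρ) (h1 : ρ < 1) (t : ℝ) :
    0 < (1 - (ρ : ℂ) * Complex.exp (Complex.I * t)).re := by
  have h := (Complex.abs_re_le_norm ((ρ : ℂ) * Complex.exp (Complex.I * t))).trans_eq
    (norm_mul_exp_I h0 t)
  rw [Complex.sub_re, Complex.one_re]
  linarith [le_abs_self ((ρ : ℂ) * Complex.exp (Complex.I * t)).re]

theorem one_sub_mul_exp_ne_zero {ρ : ℝ} (h0 : 0 ≤ ρ) (h1 : ρ < 1) (t : ℝ) :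
    1 - (ρ : ℂ) * Complex.exp (Complex.I * t) ≠ 0 := fun h => by
  have := one_sub_mul_exp_re_pos h0 h1 t
  rw [h] at this
  simp at this

/-- The power `ω ^ ξ` splits into numerator and denominator, since all arguments lie in the right
half-plane. -/
theorem geomCF_cpow_eq {ρ : ℝ} (h0 : 0 ≤ ρ) (h1 : ρ < 1) (ξ t : ℝ) :
    geomCF ρ t ^ (ξ : ℂ) = (((1 - ρ) ^ ξ : ℝ) : ℂ) *
      (1 / (1 - (ρ : ℂ) * Complex.exp (Complex.I * t)) ^ (ξ : ℂ)) := by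
  have hz := one_sub_mul_exp_ne_zero h0 h1 t
  have hre := one_sub_mul_exp_re_pos h0 h1 t
  have h2 : (0 : ℝ) < 1 - ρ := by linarith
  have harg : (1 - (ρ : ℂ) * Complex.exp (Complex.I * t)).arg ≠ Real.pi := by
    have := Complex.mem_slitPlane_iff_arg.1 (Or.inl hre)
    exact this.1
  have hi := inv_ne_zero hz
  rw [geomCF, div_eq_mul_inv, one_div, ← Complex.inv_cpow _ _ harg, Complex.ofReal_cpow h2.le]
  push_cast
  have e : (1 - (ρ : ℂ)) = ((1 - ρ : ℝ) : ℂ) := by push_cast; rfl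
  have he : ((1 - ρ : ℝ) : ℂ) ≠ 0 := by exact_mod_cast h2.ne'
  rw [e, Complex.cpow_def_of_ne_zero (mul_ne_zero he hi), Complex.cpow_def_of_ne_zero he,
    Complex.cpow_def_of_ne_zero hi, ← Complex.exp_add, Complex.log_ofReal_mul h2 hi,
    Complex.ofReal_log h2.le]
  ring_nf

/-- The binomial series with exponent `-ξ`. -/
theorem hasSum_negBinom_mul_exp {ρ ξ : ℝ} (h0 : 0 ≤ ρ) (h1 : ρ < 1) (hξ : 0 < ξ) (t : ℝ) :
    HasSum (fun y : ℕ => (negBinom ρ ξ y : ℂ) *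
      Complex.exp (Complex.I * (((y : ℝ) - 0 : ℝ) : ℂ) * t)) (geomCF ρ t ^ (ξ : ℂ)) := by
  rw [geomCF_cpow_eq h0 h1]
  have h := (Complex.one_div_one_sub_cpow_hasFPowerSeriesOnBall_zero (ξ : ℂ)).hasSum
    (y := (ρ : ℂ) * Complex.exp (Complex.I * t)) (by
      rw [Metric.mem_eball, edist_zero_right, ← ofReal_norm, norm_mul_exp_I h0]
      simpa using h1)
  rw [zero_add] at h
  have h2 := h.mul_left (((1 - ρ) ^ ξ : ℝ) : ℂ)
  refine h2.congr_fun fun y => ?_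
  rw [FormalMultilinearSeries.ofScalars_apply_eq, ringChoose_add_sub_one hξ, smul_eq_mul, mul_pow,
    ← Complex.exp_nat_mul, negBinom]
  push_cast
  have e : Complex.I * ((y : ℂ) - 0) * t = y * (Complex.I * t) := by ring
  rw [e]
  ring

theorem geomCF_zero {ρ : ℝ} (h1 : ρ < 1) : geomCF ρ 0 = 1 := by
  have : (1 - (ρ : ℂ)) ≠ 0 := by
    have : (1 - ρ : ℝ) ≠ 0 := by linarith
    exact_mod_cast this
  simp [geomCF, this]

theorem isProbSeq_negBinom {ρ ξ : ℝ} (h0 : 0 ≤ ρ) (h1 : ρ < 1) (hξ : 0 < ξ) :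
    IsProbSeq (negBinom ρ ξ) where
  nonneg y := by
    have hy : (0 : ℝ) ≤ y := Nat.cast_nonneg y
    have := Real.Gamma_pos_of_pos hξ
    have := Real.Gamma_pos_of_pos (by linarith : 0 < ξ + y)
    have : (0 : ℝ) ≤ 1 - ρ := by linarith
    unfold negBinom
    positivity
  hasSum := by
    have h := hasSum_negBinom_mul_exp h0 h1 hξ 0
    simp only [Complex.ofReal_zero, mul_zero, Complex.exp_zero, mul_one, geomCF_zero h1,
      Complex.one_cpow] at h
    exact Complex.hasSum_ofReal.1 (by simpa using h)

theorem seqCF_negBinom {ρ ξ : ℝ} (h0 : 0 ≤ ρ) (h1 : ρ < 1) (hξ : 0 < ξ) (t : ℝ) :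
    seqCF (negBinom ρ ξ) 0 t = geomCF ρ t ^ (ξ : ℂ) :=
  (hasSum_negBinom_mul_exp h0 h1 hξ t).tsum_eq

/-- Fourier inversion on the integers. -/
theorem integral_exp_mul_seqCF {p : ℕ → ℝ} (hp : IsProbSeq p) (y : ℤ) :
    ∫ t in -Real.pi..Real.pi, Complex.exp (-(Complex.I * ((y : ℝ) : ℂ) * t)) * seqCF p 0 t =
      2 * Real.pi * ((if 0 ≤ y then p y.toNat else 0 : ℝ) : ℂ) := by
  have := hp.isProbabilityMeasure
  have h1 : ∀ t : ℝ, Complex.exp (-(Complex.I * ((y : ℝ) : ℂ) * t)) * seqCF p 0 t =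
      ∫ x, Complex.exp (Complex.I * ((((x : ℤ) - y : ℤ) : ℝ) : ℂ) * t) ∂(seqLaw p) := fun t => by
    rw [seqCF_eq_integral hp, ← integral_const_mul]
    congr with x
    rw [← Complex.exp_add]
    congr 1
    push_cast
    ring
  simp_rw [h1]
  rw [intervalIntegral_integral_swap]
  · simp_rw [integral_exp_int]
    rw [hp.integral_eq]
    by_cases hy : 0 ≤ y
    · rw [if_pos hy, tsum_eq_single y.toNat]
      · rw [if_pos (by omega), Complex.real_smul]
        ring
      · intro x hx
        rw [if_neg (by omega), smul_zero]
    · rw [if_neg hy]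
      simp only [Complex.ofReal_zero, mul_zero]
      refine (tsum_congr fun x => ?_).trans tsum_zero
      rw [if_neg (by omega), smul_zero]
  · have h1 : Integrable (fun _ : ℝ × ℕ => (1 : ℂ))
        ((volume.restrict (Set.uIoc (-Real.pi) Real.pi)).prod (seqLaw p)) :=
      (intervalIntegrable_iff.1 (intervalIntegrable_const (c := (1 : ℂ)))).comp_fst _
    have h2 := h1.mul_bdd (c := 1)
      (g := fun z : ℝ × ℕ => Complex.exp (Complex.I * ((((z.2 : ℤ) - y : ℤ) : ℝ) : ℂ) * z.1))
      (by
        apply Measurable.aestronglyMeasurable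
        fun_prop) (ae_of_all _ fun z => by rw [norm_exp_I_mul_mul])
    simpa [Function.uncurry_def] using h2

theorem integral_pow_mul_erlangDensity {α : ℝ} (hα : 0 < α) (y r : ℕ) :
    ∫ x in Set.Ioi 0, x ^ r * erlangDensity α y x =
      (y + r).factorial / (y.factorial * α ^ r) := by
  have h := Real.integral_rpow_mul_exp_neg_mul_Ioi (a := ((y + r : ℕ) : ℝ) + 1) (by positivity) hα
  rw [Real.Gamma_nat_eq_factorial] at h
  have e : ∀ x : ℝ, x ^ r * erlangDensity α y x = α ^ (y + 1) / y.factorial *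
      (x ^ (((y + r : ℕ) : ℝ) + 1 - 1) * Real.exp (-(α * x))) := fun x => by
    rw [add_sub_cancel_right, Real.rpow_natCast, erlangDensity, pow_add]
    ring
  simp_rw [e]
  rw [integral_const_mul, h]
  have e2 : (1 / α) ^ (((y + r : ℕ) : ℝ) + 1) = 1 / α ^ (y + r + 1) := by
    rw [← Nat.cast_add_one, Real.rpow_natCast, one_div_pow]
  rw [e2]
  field_simp
  ring

theorem integrableOn_pow_mul_erlangDensity {α : ℝ} (hα : 0 < α) (y r : ℕ) :
    IntegrableOn (fun x => x ^ r * erlangDensity α y x) (Set.Ioi 0) := by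
  refine Integrable.of_integral_ne_zero ?_
  rw [integral_pow_mul_erlangDensity hα]
  positivity

/-- The negative binomial law is a gamma mixture of Poisson laws. -/
theorem integral_gammaDensity_mul_erlangDensity {ρ ξ : ℝ} (h1 : ρ < 1) (hξ : 0 < ξ)
    (y : ℕ) :
    ∫ x in Set.Ioi 0, gammaDensity ξ x * erlangDensity (ρ / (1 - ρ)) y x =
      ρ / (1 - ρ) * negBinom ρ ξ y := by
  have h2 : 0 < 1 - ρ := by linarith
  have hy : (0 : ℝ) ≤ y := Nat.cast_nonneg y
  have h := Real.integral_rpow_mul_exp_neg_mul_Ioi (a := ξ + y) (r := 1 / (1 - ρ))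
    (by linarith) (by positivity)
  set α := ρ / (1 - ρ) with hα
  have hα1 : 1 / (1 - ρ) = 1 + α := by
    rw [hα]
    field_simp
    ring
  have e : ∀ x ∈ Set.Ioi (0 : ℝ), gammaDensity ξ x * erlangDensity α y x =
      α ^ (y + 1) / (Real.Gamma ξ * y.factorial) *
        (x ^ (ξ + y - 1) * Real.exp (-(1 / (1 - ρ) * x))) := fun x hx => by
    have e1 : x ^ (ξ + y - 1) = x ^ (ξ - 1) * x ^ y := by
      rw [← Real.rpow_add_natCast (Set.mem_Ioi.1 hx).ne']
      ring_nf
    have e2 : Real.exp (-(1 / (1 - ρ) * x)) = Real.exp (-x) * Real.exp (-(α * x)) := by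
      rw [← Real.exp_add, hα1]
      ring_nf
    rw [e1, e2, gammaDensity, erlangDensity]
    ring
  rw [setIntegral_congr_fun measurableSet_Ioi e, integral_const_mul, h, one_div_one_div,
    Real.rpow_add h2, Real.rpow_natCast, negBinom]
  have e3 : α ^ (y + 1) * (1 - ρ) ^ y = α * ρ ^ y := by
    rw [pow_succ, mul_right_comm, ← mul_pow, hα, div_mul_cancel₀ _ h2.ne', mul_comm]
  calc _ = (α ^ (y + 1) * (1 - ρ) ^ y) / (Real.Gamma ξ * y.factorial) *
        ((1 - ρ) ^ ξ * Real.Gamma (ξ + y)) := by ring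
    _ = _ := by
        rw [e3]
        ring

/-- The local limit theorem for the negative binomial law, with the first-order correction at a
fixed point of the limiting gamma law; it holds at all integers, the negative ones included. -/
theorem exists_negBinom_local (B : ℝ) :
    ∃ C : ℝ, 0 ≤ C ∧ ∀ ξ, 1 ≤ ξ → ξ ≤ B → ∀ x₀, 1 ≤ x₀ → x₀ ≤ B → ∀ ρ, 0 < ρ → ρ < 1 →
      1 ≤ ρ / (1 - ρ) → ∀ y : ℤ,
      |ρ / (1 - ρ) * (if 0 ≤ y then negBinom ρ ξ y.toNat else 0) - gammaDensity ξ x₀ -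
        gammaSlope ξ x₀ * ((y + 1) / (ρ / (1 - ρ)) - x₀)| ≤
        C * (1 / (ρ / (1 - ρ)) + ((y + 1) / (ρ / (1 - ρ)) - x₀) ^ 2) := by
  obtain ⟨C, hC, hT⟩ := exists_gammaDensity_taylor B
  refine ⟨C * (3 + |B|), by positivity, fun ξ h1 h2 x₀ hx1 hx2 ρ hρ0 hρ1 hα y => ?_⟩
  obtain ⟨hg, hs, hT⟩ := hT ξ h1 h2 x₀ hx1 hx2
  have hB := le_abs_self B
  set α := ρ / (1 - ρ) with hαd
  have hα0 : 0 < α := by linarith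
  have hα1 : 1 / α ≤ 1 := by
    rw [div_le_one hα0]
    exact hα
  have hαi : 0 < 1 / α := by positivity
  set g := gammaDensity ξ x₀
  set s := gammaSlope ξ x₀
  by_cases hy : 0 ≤ y
  · rw [if_pos hy]
    obtain ⟨k, rfl⟩ := Int.eq_ofNat_of_zero_le hy
    -- The Taylor expansion of the gamma density is averaged over the law of density `erlangDensity
    -- α k`, of mean `(k + 1) / α` and variance `(k + 1) / α²`.
    rw [Int.toNat_natCast, ← integral_gammaDensity_mul_erlangDensity hρ1 (by linarith)]
    rw [← hαd]
    have i0 := integrableOn_pow_mul_erlangDensity hα0 k 0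
    have i1 := integrableOn_pow_mul_erlangDensity hα0 k 1
    have i2 := integrableOn_pow_mul_erlangDensity hα0 k 2
    have v0 := integral_pow_mul_erlangDensity hα0 k 0
    have v1 := integral_pow_mul_erlangDensity hα0 k 1
    have v2 := integral_pow_mul_erlangDensity hα0 k 2
    have hk : (k.factorial : ℝ) ≠ 0 := by positivity
    rw [add_zero, pow_zero, mul_one, div_self hk] at v0
    have f1 : ((k + 1).factorial : ℝ) = (k + 1) * k.factorial := by
      rw [Nat.factorial_succ]; push_cast; ring
    have f2 : ((k + 2).factorial : ℝ) = (k + 2) * (k + 1) * k.factorial := by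
      rw [Nat.factorial_succ, Nat.factorial_succ]; push_cast; ring
    have v1' : ∫ x in Set.Ioi 0, x ^ 1 * erlangDensity α k x = (k + 1) / α := by
      rw [v1, f1]
      field_simp
    have v2' : ∫ x in Set.Ioi 0, x ^ 2 * erlangDensity α k x = (k + 2) * (k + 1) / α ^ 2 := by
      rw [v2, f2]
      field_simp
    have hpos : ∀ x ∈ Set.Ioi (0 : ℝ), 0 ≤ erlangDensity α k x := fun x hx => by
      have := Set.mem_Ioi.1 hx
      unfold erlangDensity
      positivity
    have ig : IntegrableOn (fun x => gammaDensity ξ x * erlangDensity α k x) (Set.Ioi 0) := by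
      refine Integrable.of_integral_ne_zero ?_
      rw [integral_gammaDensity_mul_erlangDensity hρ1 (by linarith)]
      have : 0 < 1 - ρ := by linarith
      have hk0 : (0 : ℝ) ≤ k := Nat.cast_nonneg k
      have := Real.Gamma_pos_of_pos (by linarith : 0 < ξ)
      have := Real.Gamma_pos_of_pos (by linarith : 0 < ξ + k)
      unfold negBinom
      positivity
    have elin : (∫ x in Set.Ioi 0, gammaDensity ξ x * erlangDensity α k x) - g -
        s * ((k + 1) / α - x₀) = ∫ x in Set.Ioi 0,
          (gammaDensity ξ x - g - s * (x - x₀)) * erlangDensity α k x := by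
      have : ∀ x, (gammaDensity ξ x - g - s * (x - x₀)) * erlangDensity α k x =
          gammaDensity ξ x * erlangDensity α k x - (g - s * x₀) * (x ^ 0 * erlangDensity α k x) -
            s * (x ^ 1 * erlangDensity α k x) := fun x => by ring
      simp_rw [this]
      have i3 : IntegrableOn (fun x => gammaDensity ξ x * erlangDensity α k x -
          (g - s * x₀) * (x ^ 0 * erlangDensity α k x)) (Set.Ioi 0) :=
        ig.sub (i0.const_mul (g - s * x₀))
      rw [integral_sub i3 (i1.const_mul s), integral_sub ig (i0.const_mul (g - s * x₀)),
        integral_const_mul, integral_const_mul, v0, v1']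
      ring
    have equad : (∫ x in Set.Ioi 0, C * (x - x₀) ^ 2 * erlangDensity α k x) =
        C * (((k + 1) / α - x₀) ^ 2 + (k + 1) / α ^ 2) := by
      have : ∀ x, C * (x - x₀) ^ 2 * erlangDensity α k x =
          C * (x ^ 2 * erlangDensity α k x) - (2 * C * x₀) * (x ^ 1 * erlangDensity α k x) +
            C * x₀ ^ 2 * (x ^ 0 * erlangDensity α k x) := fun x => by ring
      simp_rw [this]
      have i3 : IntegrableOn (fun x => C * (x ^ 2 * erlangDensity α k x) -
          2 * C * x₀ * (x ^ 1 * erlangDensity α k x)) (Set.Ioi 0) :=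
        (i2.const_mul C).sub (i1.const_mul (2 * C * x₀))
      rw [integral_add i3 (i0.const_mul (C * x₀ ^ 2)),
        integral_sub (i2.const_mul C) (i1.const_mul (2 * C * x₀)),
        integral_const_mul, integral_const_mul, integral_const_mul, v0, v1', v2']
      field_simp
      ring
    have iquad : IntegrableOn (fun x => C * (x - x₀) ^ 2 * erlangDensity α k x) (Set.Ioi 0) := by
      refine (((i2.const_mul C).sub (i1.const_mul (2 * C * x₀))).add
        (i0.const_mul (C * x₀ ^ 2))).congr (ae_of_all _ fun x => ?_)
      simp only [Pi.add_apply, Pi.sub_apply]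
      ring
    have hmain : |(∫ x in Set.Ioi 0, gammaDensity ξ x * erlangDensity α k x) - g -
        s * ((k + 1) / α - x₀)| ≤ C * (((k + 1) / α - x₀) ^ 2 + (k + 1) / α ^ 2) := by
      rw [elin, ← equad, ← Real.norm_eq_abs]
      refine norm_integral_le_of_norm_le iquad ?_
      rw [ae_restrict_iff' measurableSet_Ioi]
      refine ae_of_all _ fun x hx => ?_
      rw [norm_mul, Real.norm_of_nonneg (hpos x hx)]
      exact mul_le_mul_of_nonneg_right (hT x (Set.mem_Ioi.1 hx).le) (hpos x hx)
    push_cast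
    refine hmain.trans ?_
    set u := ((k : ℝ) + 1) / α - x₀ with hu
    have hku : ((k : ℝ) + 1) / α ^ 2 = (u + x₀) * (1 / α) := by
      rw [hu]
      field_simp
      ring
    rw [hku, mul_assoc]
    refine mul_le_mul_of_nonneg_left ?_ hC
    have h3 : u * (1 / α) ≤ u ^ 2 + 1 / α := by
      nlinarith [sq_nonneg (u - 1), sq_nonneg u]
    have h4 : x₀ * (1 / α) ≤ |B| * (1 / α) := by
      gcongr
      linarith
    have h5 : 0 ≤ |B| * u ^ 2 := by positivity
    have h6 := sq_nonneg u
    nlinarith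
  · rw [if_neg hy, mul_zero]
    set u := ((y : ℝ) + 1) / α - x₀ with hu
    have hy1 : (y : ℝ) + 1 ≤ 0 := by
      have : y + 1 ≤ 0 := by omega
      exact_mod_cast this
    -- At a negative integer the probability vanishes, and the argument is at distance at least one
    -- from `x₀`, so that the quadratic term dominates.
    have hu1 : u ≤ -1 := by
      have : ((y : ℝ) + 1) / α ≤ 0 := div_nonpos_of_nonpos_of_nonneg hy1 hα0.le
      linarith
    have hg0 : 0 ≤ g := gammaDensity_nonneg h1 (by linarith)
    have hu2 : 1 ≤ u ^ 2 := by nlinarith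
    have hu3 : |u| ≤ u ^ 2 := by
      rw [abs_of_nonpos (by linarith)]
      nlinarith
    calc |0 - g - s * u| ≤ |0 - g| + |s * u| := abs_sub _ _
      _ ≤ C + C * u ^ 2 := by
          rw [zero_sub, abs_neg, abs_of_nonneg hg0, abs_mul]
          have := mul_le_mul hs hu3 (abs_nonneg _) hC
          linarith
      _ ≤ _ := by
          have e1 : 0 ≤ C * (3 + |B|) * (1 / α) := by positivity
          have e2 : 0 ≤ |B| * u ^ 2 := by positivity
          have e3 : C + C * u ^ 2 ≤ C * (3 + |B|) * u ^ 2 := by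
            rw [mul_assoc, ← mul_one_add]
            refine mul_le_mul_of_nonneg_left ?_ hC
            nlinarith
          linarith

end ProductForm

namespace ProductForm

open MeasureTheory Finset

/-! ### Bounds for powers of the geometric characteristic function -/

theorem norm_one_sub_mul_exp_sq (ρ t : ℝ) :
    ‖1 - (ρ : ℂ) * Complex.exp (Complex.I * t)‖ ^ 2 = (1 - ρ) ^ 2 + 2 * ρ * (1 - Real.cos t) := by
  rw [← Complex.normSq_eq_norm_sq, Complex.normSq_apply, mul_comm Complex.I, Complex.exp_mul_I,
    ← Complex.ofReal_cos, ← Complex.ofReal_sin]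
  simp only [Complex.sub_re, Complex.one_re, Complex.mul_re, Complex.ofReal_re, Complex.add_re,
    Complex.I_re, Complex.ofReal_im, Complex.I_im, Complex.add_im, Complex.sub_im, Complex.one_im,
    Complex.mul_im]
  linear_combination ρ ^ 2 * Real.sin_sq_add_cos_sq t

theorem one_sub_le_norm {ρ : ℝ} (h0 : 0 ≤ ρ) (t : ℝ) :
    1 - ρ ≤ ‖1 - (ρ : ℂ) * Complex.exp (Complex.I * t)‖ := by
  have h := norm_sub_norm_le (1 : ℂ) ((ρ : ℂ) * Complex.exp (Complex.I * t))
  rwa [norm_one, norm_mul_exp_I h0] at h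

theorem norm_geomCF {ρ : ℝ} (h1 : ρ < 1) (t : ℝ) :
    ‖geomCF ρ t‖ = (1 - ρ) / ‖1 - (ρ : ℂ) * Complex.exp (Complex.I * t)‖ := by
  rw [geomCF, norm_div]
  congr 1
  rw [← Complex.ofReal_one, ← Complex.ofReal_sub, Complex.norm_real,
    Real.norm_of_nonneg (by linarith)]

theorem norm_geomCF_le_one {ρ : ℝ} (h0 : 0 ≤ ρ) (h1 : ρ < 1) (t : ℝ) : ‖geomCF ρ t‖ ≤ 1 := by
  rw [norm_geomCF h1, div_le_one (norm_pos_iff.2 (one_sub_mul_exp_ne_zero h0 h1 t))]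
  exact one_sub_le_norm h0 t

/-- The modulus of `ω` decays at least like `3 / (1 + α |t|)`. -/
theorem norm_geomCF_mul_le {ρ : ℝ} (h0 : 0 ≤ ρ) (h1 : ρ < 1) {t : ℝ} (ht : |t| ≤ Real.pi) :
    ‖geomCF ρ t‖ * (1 + ρ / (1 - ρ) * |t|) ≤ 3 := by
  have hpi := Real.pi_pos
  have hD := norm_pos_iff.2 (one_sub_mul_exp_ne_zero h0 h1 t)
  have h2 := one_sub_le_norm h0 t
  have h3 := norm_one_sub_mul_exp_sq ρ t
  have h4 := Real.cos_le_one_sub_mul_cos_sq ht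
  rw [norm_geomCF h1]
  set d := ‖1 - (ρ : ℂ) * Complex.exp (Complex.I * t)‖
  have h5 : ρ * |t| ≤ 2 * d := by
    refine abs_le_of_sq_le_sq' ?_ (by positivity) |>.2
    have h6 : 1 / 8 ≤ 2 / Real.pi ^ 2 := by
      rw [div_le_div_iff₀ (by norm_num) (by positivity)]
      nlinarith [Real.pi_lt_four]
    have h7 : ρ * ((1 / 8) * t ^ 2) ≤ ρ * (1 - Real.cos t) := by
      refine mul_le_mul_of_nonneg_left ?_ h0
      have : 1 / 8 * t ^ 2 ≤ 2 / Real.pi ^ 2 * t ^ 2 :=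
        mul_le_mul_of_nonneg_right h6 (sq_nonneg t)
      linarith
    rw [mul_pow, sq_abs, mul_pow, h3]
    nlinarith [sq_nonneg (1 - ρ),
      mul_nonneg (mul_nonneg h0 (by linarith : 0 ≤ 1 - ρ)) (sq_nonneg t)]
  have h6 : (1 - ρ) / d * (1 + ρ / (1 - ρ) * |t|) = ((1 - ρ) + ρ * |t|) / d := by
    have : 1 - ρ ≠ 0 := by linarith
    field_simp
  rw [h6, div_le_iff₀ hD]
  linarith

theorem geomCF_mem_slitPlane {ρ : ℝ} (h0 : 0 ≤ ρ) (h1 : ρ < 1) (t : ℝ) :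
    geomCF ρ t ∈ Complex.slitPlane := by
  refine Or.inl ?_
  have e : geomCF ρ t = ((1 - ρ : ℝ) : ℂ) * (1 - (ρ : ℂ) * Complex.exp (Complex.I * t))⁻¹ := by
    rw [geomCF, div_eq_mul_inv]
    push_cast
    rfl
  rw [e, Complex.re_ofReal_mul, Complex.inv_re]
  have := one_sub_mul_exp_re_pos h0 h1 t
  have h2 := Complex.normSq_pos.2 (one_sub_mul_exp_ne_zero h0 h1 t)
  have : 0 < 1 - ρ := by linarith
  positivity

theorem geomCF_ne_zero {ρ : ℝ} (h0 : 0 ≤ ρ) (h1 : ρ < 1) (t : ℝ) : geomCF ρ t ≠ 0 :=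
  Complex.slitPlane_ne_zero (geomCF_mem_slitPlane h0 h1 t)

theorem hasDerivAt_geomCF {ρ : ℝ} (h0 : 0 ≤ ρ) (h1 : ρ < 1) (t : ℝ) :
    HasDerivAt (geomCF ρ) (Complex.I * ((ρ / (1 - ρ) : ℝ) : ℂ) * Complex.exp (Complex.I * t) *
      geomCF ρ t ^ 2) t := by
  have hz := one_sub_mul_exp_ne_zero h0 h1 t
  have e1 : HasDerivAt (fun t : ℝ => Complex.exp (Complex.I * t))
      (Complex.exp (Complex.I * t) * (Complex.I * 1)) t :=
    ((Complex.ofRealCLM.hasDerivAt (x := t)).const_mul Complex.I).cexp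
  have e2 := ((e1.const_mul (ρ : ℂ)).const_sub 1).inv hz
  have e3 := e2.const_mul (1 - (ρ : ℂ))
  have hρ : (1 - (ρ : ℂ)) ≠ 0 := by
    have : (1 - ρ : ℝ) ≠ 0 := by linarith
    exact_mod_cast this
  convert! e3 using 1
  rw [geomCF]
  push_cast
  field_simp

theorem hasDerivAt_geomCF_cpow {ρ : ℝ} (h0 : 0 ≤ ρ) (h1 : ρ < 1) (ξ t : ℝ) :
    HasDerivAt (fun t => geomCF ρ t ^ (ξ : ℂ))
      (Complex.I * ((ξ * (ρ / (1 - ρ)) : ℝ) : ℂ) * Complex.exp (Complex.I * t) *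
        geomCF ρ t ^ ((ξ + 1 : ℝ) : ℂ)) t := by
  have h := ((hasDerivAt_id (geomCF ρ t)).cpow_const (c := (ξ : ℂ))
    (geomCF_mem_slitPlane h0 h1 t)).scomp t (hasDerivAt_geomCF h0 h1 t)
  convert! h using 1
  have hne := geomCF_ne_zero h0 h1 t
  have e : geomCF ρ t ^ ((ξ + 1 : ℝ) : ℂ) = geomCF ρ t ^ ((ξ : ℂ) - 1) * geomCF ρ t ^ 2 := by
    rw [← Complex.cpow_natCast, ← Complex.cpow_add _ _ hne]
    push_cast
    ring_nf
  rw [e, smul_eq_mul, id]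
  push_cast
  ring

theorem continuous_geomCF_cpow {ρ : ℝ} (h0 : 0 ≤ ρ) (h1 : ρ < 1) (ξ : ℝ) :
    Continuous fun t => geomCF ρ t ^ (ξ : ℂ) :=
  continuous_iff_continuousAt.2 fun t => (hasDerivAt_geomCF_cpow h0 h1 ξ t).continuousAt

theorem continuous_geomCF {ρ : ℝ} (h0 : 0 ≤ ρ) (h1 : ρ < 1) : Continuous (geomCF ρ) :=
  continuous_iff_continuousAt.2 fun t => (hasDerivAt_geomCF h0 h1 t).continuousAt

/-- A factor `α |t|` costs one power of `ω`. -/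
theorem mul_norm_geomCF_rpow_le {ρ : ℝ} (h0 : 0 ≤ ρ) (h1 : ρ < 1) (s : ℝ) {t : ℝ}
    (ht : |t| ≤ Real.pi) :
    ρ / (1 - ρ) * |t| * ‖geomCF ρ t‖ ^ (s + 1) ≤ 3 * ‖geomCF ρ t‖ ^ s := by
  have h := norm_geomCF_mul_le h0 h1 ht
  have hn := norm_nonneg (geomCF ρ t)
  have hpos : 0 < ‖geomCF ρ t‖ := norm_pos_iff.2 (geomCF_ne_zero h0 h1 t)
  rw [Real.rpow_add_one hpos.ne']
  have h2 : ρ / (1 - ρ) * |t| * ‖geomCF ρ t‖ ≤ 3 := by nlinarith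
  have h3 : 0 ≤ ‖geomCF ρ t‖ ^ s := by positivity
  nlinarith [mul_le_mul_of_nonneg_right h2 h3]

/-- The integral of `|ω|^s` is of the order of `1 / α`, for `s` away from one. -/
theorem exists_integral_norm_geomCF_rpow_le :
    ∃ C : ℝ, 0 ≤ C ∧ ∀ ρ, 0 < ρ → ρ < 1 → ∀ s : ℝ, 3 / 2 ≤ s →
      ∫ t in -Real.pi..Real.pi, ‖geomCF ρ t‖ ^ s ≤ C / (ρ / (1 - ρ)) := by
  have hpi := Real.pi_pos
  set M : ℝ := ∫ x : ℝ, (1 + ‖x‖) ^ (-(3 / 2) : ℝ) with hM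
  have hM0 : 0 ≤ M := integral_nonneg fun x => by positivity
  have hint : Integrable fun x : ℝ => (1 + ‖x‖) ^ (-(3 / 2) : ℝ) :=
    integrable_one_add_norm (by rw [Module.finrank_self]; norm_num)
  refine ⟨9 * M, by positivity, fun ρ h0 h1 s hs => ?_⟩
  have hα : 0 < ρ / (1 - ρ) := div_pos h0 (by linarith)
  set α := ρ / (1 - ρ) with hαd
  have hi : Integrable fun t : ℝ => 9 * (1 + ‖α * t‖) ^ (-(3 / 2) : ℝ) :=
    (hint.comp_mul_left' hα.ne').const_mul 9
  calc ∫ t in -Real.pi..Real.pi, ‖geomCF ρ t‖ ^ s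
      ≤ ∫ t in -Real.pi..Real.pi, 9 * (1 + ‖α * t‖) ^ (-(3 / 2) : ℝ) := by
        refine intervalIntegral.integral_mono_on (by linarith)
          (((continuous_geomCF h0.le h1).norm.rpow_const fun t =>
            Or.inr (by linarith : 0 ≤ s)).intervalIntegrable _ _) hi.intervalIntegrable fun t ht => ?_
        have hpos : 0 < ‖geomCF ρ t‖ := norm_pos_iff.2 (geomCF_ne_zero h0.le h1 t)
        have hb := norm_geomCF_mul_le h0.le h1 (abs_le.2 ht)
        rw [← hαd] at hb
        have hx : ‖α * t‖ = α * |t| := by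
          rw [norm_mul, Real.norm_of_nonneg hα.le, Real.norm_eq_abs]
        rw [hx]
        have hq : 0 < 1 + α * |t| := by positivity
        calc ‖geomCF ρ t‖ ^ s ≤ ‖geomCF ρ t‖ ^ (3 / 2 : ℝ) :=
              Real.rpow_le_rpow_of_exponent_ge hpos (norm_geomCF_le_one h0.le h1 t) hs
          _ ≤ (3 / (1 + α * |t|)) ^ (3 / 2 : ℝ) :=
              Real.rpow_le_rpow hpos.le ((le_div_iff₀ hq).2 hb) (by norm_num)
          _ = 3 ^ (3 / 2 : ℝ) * (1 + α * |t|) ^ (-(3 / 2) : ℝ) := by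
              rw [Real.div_rpow (by norm_num) hq.le, Real.rpow_neg hq.le, div_eq_mul_inv]
          _ ≤ 3 ^ (2 : ℝ) * (1 + α * |t|) ^ (-(3 / 2) : ℝ) := by
              gcongr <;> norm_num
          _ = _ := by norm_num
    _ ≤ ∫ t : ℝ, 9 * (1 + ‖α * t‖) ^ (-(3 / 2) : ℝ) := by
        rw [intervalIntegral.integral_of_le (by linarith)]
        exact setIntegral_le_integral hi (ae_of_all _ fun t => by positivity)
    _ = 9 * M / α := by
        rw [integral_const_mul, Measure.integral_comp_mul_left
          (fun x : ℝ => (1 + ‖x‖) ^ (-(3 / 2) : ℝ)), abs_of_pos (inv_pos.2 hα), smul_eq_mul, ← hM]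
        ring

/-- For small exponents the integral of `|ω|^s` is damped by a Gaussian factor. -/
theorem exists_integral_norm_geomCF_rpow_mul_exp_le {c : ℝ} (hc : 0 < c) :
    ∃ C : ℝ, 0 ≤ C ∧ ∀ ρ, 0 < ρ → ρ < 1 → ∀ s : ℝ, 0 ≤ s → s ≤ 1 / 2 → ∀ R, 0 < R →
      ∫ t in -Real.pi..Real.pi, ‖geomCF ρ t‖ ^ s * Real.exp (-(c * R) * t ^ 2) ≤
        C * (1 / √R * (√R / (ρ / (1 - ρ))) ^ s) := by
  have hpi := Real.pi_pos
  set G : ℝ := 2 * gaussMoment (-(1 / 2)) + 2 * gaussMoment 0 with hG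
  have hG0 : 0 ≤ G := by
    have := gaussMoment_nonneg (-(1 / 2))
    have := gaussMoment_nonneg 0
    positivity
  have hgm : ∀ s : ℝ, 0 ≤ s → s ≤ 1 / 2 → gaussMoment (-s) ≤ G := by
    intro s h0 h1
    have hI1 := integrable_abs_rpow_mul_exp (s := -(1 / 2)) (by norm_num)
    have hI0 := integrable_abs_rpow_mul_exp (s := 0) (by norm_num)
    have hle : gaussMoment (-s) ≤ gaussMoment (-(1 / 2)) + gaussMoment 0 := by
      rw [gaussMoment, gaussMoment, gaussMoment, ← integral_add hI1 hI0]
      refine integral_mono_ae (integrable_abs_rpow_mul_exp (by linarith)) (hI1.add hI0) ?_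
      filter_upwards [compl_mem_ae_iff.2 (measure_singleton (0 : ℝ))] with u hu
      have hu0 : 0 < |u| := abs_pos.2 hu
      rw [← add_mul, Real.rpow_zero]
      refine mul_le_mul_of_nonneg_right ?_ (Real.exp_nonneg _)
      have e1 : 0 ≤ |u| ^ (-(1 / 2) : ℝ) := by positivity
      rcases le_total |u| 1 with h | h
      · have := Real.rpow_le_rpow_of_exponent_ge hu0 h (by linarith : -(1 / 2) ≤ -s)
        linarith
      · have := Real.rpow_le_rpow_of_exponent_le h (by linarith : -s ≤ 0)
        rw [Real.rpow_zero] at this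
        linarith
    have := gaussMoment_nonneg (-(1 / 2))
    have := gaussMoment_nonneg 0
    linarith
  refine ⟨3 * G * (1 / √c) * (1 + √c), by positivity, fun ρ h0 h1 s hs0 hs1 R hR => ?_⟩
  have hα : 0 < ρ / (1 - ρ) := div_pos h0 (by linarith)
  set α := ρ / (1 - ρ) with hαd
  have hw : 0 < √(c * R) := Real.sqrt_pos.2 (by positivity)
  set w := √(c * R) with hwd
  have hw2 : ∀ t : ℝ, -(w * t) ^ 2 = -(c * R) * t ^ 2 := fun t => by
    rw [mul_pow, hwd, Real.sq_sqrt (by positivity)]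
    ring
  have hi : Integrable fun t : ℝ => 3 * α ^ (-s) * (|t| ^ (-s) * Real.exp (-(w * t) ^ 2)) :=
    (integrable_abs_rpow_mul_exp_comp (by linarith) hw).const_mul _
  calc ∫ t in -Real.pi..Real.pi, ‖geomCF ρ t‖ ^ s * Real.exp (-(c * R) * t ^ 2)
      ≤ ∫ t in -Real.pi..Real.pi, 3 * α ^ (-s) * (|t| ^ (-s) * Real.exp (-(w * t) ^ 2)) := by
        refine intervalIntegral.integral_mono_ae_restrict (by linarith) ?_ hi.intervalIntegrable ?_
        · exact (((continuous_geomCF h0.le h1).norm.rpow_const fun t => Or.inr hs0).mul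
            (by fun_prop)).intervalIntegrable _ _
        · filter_upwards [ae_restrict_mem measurableSet_Icc,
            ae_restrict_of_ae (compl_mem_ae_iff.2 (measure_singleton (0 : ℝ)))] with t ht ht0
          have ht1 : 0 < |t| := abs_pos.2 ht0
          rw [hw2, ← mul_assoc]
          refine mul_le_mul_of_nonneg_right ?_ (Real.exp_nonneg _)
          have hb := norm_geomCF_mul_le h0.le h1 (abs_le.2 ht)
          rw [← hαd] at hb
          have hq : 0 < α * |t| := by positivity
          have hb2 : ‖geomCF ρ t‖ ≤ 3 / (α * |t|) := by
            rw [le_div_iff₀ hq]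
            nlinarith [norm_nonneg (geomCF ρ t)]
          calc ‖geomCF ρ t‖ ^ s ≤ (3 / (α * |t|)) ^ s := Real.rpow_le_rpow (norm_nonneg _) hb2 hs0
            _ = 3 ^ s * (α ^ (-s) * |t| ^ (-s)) := by
                rw [Real.div_rpow (by norm_num) hq.le, Real.mul_rpow hα.le ht1.le,
                  Real.rpow_neg hα.le, Real.rpow_neg ht1.le, div_eq_mul_inv, mul_inv]
            _ ≤ 3 ^ (1 : ℝ) * (α ^ (-s) * |t| ^ (-s)) := by
                refine mul_le_mul_of_nonneg_right ?_ (by positivity)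
                exact Real.rpow_le_rpow_of_exponent_le (by norm_num) (by linarith)
            _ = 3 * α ^ (-s) * |t| ^ (-s) := by
                rw [Real.rpow_one]
                ring
    _ ≤ ∫ t : ℝ, 3 * α ^ (-s) * (|t| ^ (-s) * Real.exp (-(w * t) ^ 2)) := by
        rw [intervalIntegral.integral_of_le (by linarith)]
        exact setIntegral_le_integral hi (ae_of_all _ fun t => by positivity)
    _ = 3 * (1 / w * (w / α) ^ s) * gaussMoment (-s) := by
        rw [integral_const_mul, integral_abs_rpow_mul_exp_comp _ hw, neg_neg,
          Real.rpow_sub_one hw.ne', Real.div_rpow hw.le hα.le, Real.rpow_neg hα.le]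
        field_simp
    _ ≤ 3 * (1 / w * (w / α) ^ s) * G := by
        gcongr
        exact hgm s hs0 hs1
    _ ≤ _ := by
        have hsc : 0 < √c := Real.sqrt_pos.2 hc
        have hwc : w = √c * √R := Real.sqrt_mul hc.le R
        have h2 : (√c) ^ s ≤ 1 + √c := by
          calc (√c) ^ s ≤ (1 + √c) ^ s := Real.rpow_le_rpow hsc.le (by linarith) hs0
            _ ≤ (1 + √c) ^ (1 : ℝ) :=
                Real.rpow_le_rpow_of_exponent_le (by linarith) (by linarith)
            _ = _ := Real.rpow_one _
        have hsR : 0 < √R := Real.sqrt_pos.2 hR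
        rw [hwc, mul_div_assoc, Real.mul_rpow hsc.le (by positivity)]
        calc 3 * (1 / (√c * √R) * ((√c) ^ s * (√R / α) ^ s)) * G =
              3 * G * (1 / √c) * (1 / √R * (√R / α) ^ s) * (√c) ^ s := by
              field_simp
          _ ≤ 3 * G * (1 / √c) * (1 / √R * (√R / α) ^ s) * (1 + √c) := by gcongr
          _ = _ := by ring

/-- Fourier coefficients of `ω^ξ (ψ - 1)`: the bound by the integral of the modulus, and the one
obtained by an integration by parts. -/
theorem exists_fourier_coeff_le (B C₀ : ℝ) :
    ∃ C : ℝ, 0 ≤ C ∧ ∀ ξ, 3 / 2 ≤ ξ → ξ ≤ B → ∀ ρ, 0 < ρ → ρ < 1 → ∀ ψ : ℝ → ℂ,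
      Differentiable ℝ ψ → ψ 0 = 1 → (∀ t, |t| ≤ Real.pi → ‖deriv ψ t‖ ≤ C₀) → ∀ y : ℝ,
      ‖∫ t in -Real.pi..Real.pi, Complex.exp (Complex.I * (y : ℂ) * t) *
        (geomCF ρ t ^ (ξ : ℂ) * (ψ t - 1))‖ ≤ C / (ρ / (1 - ρ)) ∧
      |y| * ‖∫ t in -Real.pi..Real.pi, Complex.exp (Complex.I * (y : ℂ) * t) *
        (geomCF ρ t ^ (ξ : ℂ) * (ψ t - 1))‖ ≤ C / (ρ / (1 - ρ)) := by
  have hpi := Real.pi_pos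
  obtain ⟨M, hM0, hM⟩ := exists_integral_norm_geomCF_rpow_le
  refine ⟨|C₀| * 4 * M + (|C₀| * (1 + 3 * |B|) * M + 24 * |C₀|), by positivity,
    fun ξ hξ hξB ρ h0 h1 ψ hψ hψ0 hψ' y => ?_⟩
  have hα : 0 < ρ / (1 - ρ) := div_pos h0 (by linarith)
  set α := ρ / (1 - ρ) with hαd
  have hC0 : 0 ≤ C₀ := (norm_nonneg _).trans (hψ' 0 (by simpa using hpi.le))
  have hCa : |C₀| = C₀ := abs_of_nonneg hC0
  rw [hCa]
  have hψb : ∀ t, |t| ≤ Real.pi → ‖ψ t - 1‖ ≤ C₀ * |t| := fun t ht => by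
    have h2 := (convex_Icc (-Real.pi) Real.pi).norm_image_sub_le_of_norm_deriv_le
      (f := ψ) (C := C₀) (fun x _ => hψ x) (fun x hx => hψ' x (abs_le.2 hx))
      (x := 0) (y := t) ⟨by linarith, by linarith⟩ (abs_le.1 ht)
    rwa [hψ0, sub_zero, Real.norm_eq_abs] at h2
  have hωc := continuous_geomCF_cpow h0.le h1 ξ
  have hωn : ∀ s t : ℝ, ‖geomCF ρ t ^ (s : ℂ)‖ = ‖geomCF ρ t‖ ^ s := fun s t =>
    Complex.norm_cpow_real _ _
  have hrc : ∀ s : ℝ, 0 ≤ s → IntervalIntegrable (fun t => ‖geomCF ρ t‖ ^ s) volume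
      (-Real.pi) Real.pi := fun s hs =>
    ((continuous_geomCF h0.le h1).norm.rpow_const fun t => Or.inr hs).intervalIntegrable _ _
  have hMξ := hM ρ h0 h1 ξ hξ
  rw [← hαd] at hMξ
  have hB1 : ξ ≤ |B| := hξB.trans (le_abs_self B)
  have hle : 4 * C₀ * M / α ≤ (C₀ * 4 * M + (C₀ * (1 + 3 * |B|) * M + 24 * C₀)) / α := by
    gcongr
    have : 0 ≤ C₀ * (1 + 3 * |B|) * M + 24 * C₀ := by positivity
    linarith
  constructor
  · refine le_trans ?_ hle
    calc _ ≤ ∫ t in -Real.pi..Real.pi, (4 * C₀) * ‖geomCF ρ t‖ ^ ξ := by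
          refine intervalIntegral.norm_integral_le_of_norm_le (by linarith)
            (ae_of_all _ fun t ht => ?_) ((hrc ξ (by linarith)).const_mul _)
          have ht' : |t| ≤ Real.pi := abs_le.2 ⟨ht.1.le, ht.2⟩
          rw [norm_mul, norm_mul, norm_exp_I_mul_mul, one_mul, hωn, mul_comm]
          refine mul_le_mul_of_nonneg_right ((hψb t ht').trans ?_) (by positivity)
          nlinarith [Real.pi_lt_four]
      _ ≤ (4 * C₀) * (M / α) := by
          rw [intervalIntegral.integral_const_mul]
          gcongr
      _ = _ := by ring
  · -- `e^{iyt} H` is the derivative of `e^{iyt} H / (iy)` up to the term `e^{iyt} H' / (iy)`.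
    set H : ℝ → ℂ := fun t => geomCF ρ t ^ (ξ : ℂ) * (ψ t - 1) with hH
    set H' : ℝ → ℂ := fun t => (Complex.I * ((ξ * α : ℝ) : ℂ) * Complex.exp (Complex.I * t) *
        geomCF ρ t ^ ((ξ + 1 : ℝ) : ℂ)) * (ψ t - 1) + geomCF ρ t ^ (ξ : ℂ) * deriv ψ t with hH'
    have hHd : ∀ t, HasDerivAt H (H' t) t := fun t =>
      (hasDerivAt_geomCF_cpow h0.le h1 ξ t).mul ((hψ t).hasDerivAt.sub_const 1)
    have hHc : Continuous H := hωc.mul (hψ.continuous.sub continuous_const)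
    have hH'n : ∀ t, |t| ≤ Real.pi → ‖H' t‖ ≤ C₀ * (1 + 3 * |B|) * ‖geomCF ρ t‖ ^ ξ := by
      intro t ht
      have e1 : ‖Complex.exp (Complex.I * t)‖ = 1 := by
        rw [mul_comm, Complex.norm_exp_ofReal_mul_I]
      have e2 := mul_norm_geomCF_rpow_le h0.le h1 ξ ht
      rw [← hαd] at e2
      have e3 : 0 ≤ ‖geomCF ρ t‖ ^ (ξ + 1) := by positivity
      have e4 : 0 ≤ ‖geomCF ρ t‖ ^ ξ := by positivity
      calc ‖H' t‖ ≤ (ξ * α * ‖geomCF ρ t‖ ^ (ξ + 1)) * (C₀ * |t|) + ‖geomCF ρ t‖ ^ ξ * C₀ := by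
            refine norm_add_le_of_le ?_ ?_
            · rw [norm_mul, norm_mul, norm_mul, norm_mul, Complex.norm_I, e1, one_mul, mul_one,
                Complex.norm_real, Real.norm_of_nonneg (mul_nonneg (by linarith) hα.le), hωn]
              exact mul_le_mul_of_nonneg_left (hψb t ht)
                (mul_nonneg (mul_nonneg (by linarith) hα.le) e3)
            · rw [norm_mul, hωn]
              exact mul_le_mul_of_nonneg_left (hψ' t ht) e4
        _ = C₀ * (ξ * (α * |t| * ‖geomCF ρ t‖ ^ (ξ + 1))) + C₀ * ‖geomCF ρ t‖ ^ ξ := by ring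
        _ ≤ C₀ * (|B| * (3 * ‖geomCF ρ t‖ ^ ξ)) + C₀ * ‖geomCF ρ t‖ ^ ξ := by gcongr
        _ = _ := by ring
    have hbint : IntervalIntegrable (fun t => C₀ * (1 + 3 * |B|) * ‖geomCF ρ t‖ ^ ξ) volume
      (-Real.pi) Real.pi := (hrc ξ (by linarith)).const_mul _
    have hexpc : Continuous fun t : ℝ => Complex.exp (Complex.I * (y : ℂ) * t) := by fun_prop
    have hH'm : Measurable H' := by
      have h2 := continuous_geomCF_cpow h0.le h1 (ξ + 1)
      have h3 : Continuous fun t : ℝ => (Complex.I * ((ξ * α : ℝ) : ℂ) *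
          Complex.exp (Complex.I * t) * geomCF ρ t ^ ((ξ + 1 : ℝ) : ℂ)) * (ψ t - 1) :=
        (Continuous.mul (by fun_prop) h2).mul (hψ.continuous.sub continuous_const)
      exact h3.measurable.add (hωc.measurable.mul (measurable_deriv ψ))
    have hEH' : IntervalIntegrable (fun t : ℝ => Complex.exp (Complex.I * (y : ℂ) * t) * H' t)
        volume (-Real.pi) Real.pi := by
      refine hbint.mono_fun (hexpc.measurable.mul hH'm).aestronglyMeasurable ?_
      filter_upwards [ae_restrict_mem measurableSet_uIoc] with t ht
      rw [Set.uIoc_of_le (by linarith)] at ht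
      rw [norm_mul, norm_exp_I_mul_mul, one_mul]
      exact (hH'n t (abs_le.2 ⟨ht.1.le, ht.2⟩)).trans (le_abs_self _)
    have hder : ∀ t : ℝ, HasDerivAt (fun t : ℝ => Complex.exp (Complex.I * (y : ℂ) * t) * H t)
        (Complex.I * y * (Complex.exp (Complex.I * (y : ℂ) * t) * H t) +
          Complex.exp (Complex.I * (y : ℂ) * t) * H' t) t := fun t => by
      have e1 : HasDerivAt (fun t : ℝ => Complex.exp (Complex.I * (y : ℂ) * t))
          (Complex.exp (Complex.I * (y : ℂ) * t) * (Complex.I * (y : ℂ) * 1)) t :=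
        ((Complex.ofRealCLM.hasDerivAt (x := t)).const_mul (Complex.I * (y : ℂ))).cexp
      convert! e1.mul (hHd t) using 1
      ring
    have hEH : IntervalIntegrable (fun t : ℝ =>
        Complex.I * y * (Complex.exp (Complex.I * (y : ℂ) * t) * H t)) volume
        (-Real.pi) Real.pi :=
      (continuous_const.mul (hexpc.mul hHc)).intervalIntegrable _ _
    have hftc := intervalIntegral.integral_eq_sub_of_hasDerivAt (fun t _ => hder t) (hEH.add hEH')
    rw [intervalIntegral.integral_add hEH hEH', intervalIntegral.integral_const_mul] at hftc
    have hbd : ∀ t : ℝ, |t| = Real.pi →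
        ‖Complex.exp (Complex.I * (y : ℂ) * t) * H t‖ ≤ 12 * C₀ / α := fun t ht => by
      rw [norm_mul, norm_exp_I_mul_mul, one_mul, hH, norm_mul, hωn]
      have hb := norm_geomCF_mul_le h0.le h1 ht.le
      rw [← hαd, ht] at hb
      have hn := norm_nonneg (geomCF ρ t)
      have hn1 : ‖geomCF ρ t‖ ≤ 3 / α := by
        rw [le_div_iff₀ hα]
        nlinarith [Real.pi_gt_three, mul_nonneg hn hα.le]
      have hn2 : ‖geomCF ρ t‖ ^ ξ ≤ 3 / α := by
        refine le_trans ?_ hn1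
        conv_rhs => rw [← Real.rpow_one ‖geomCF ρ t‖]
        exact Real.rpow_le_rpow_of_exponent_ge
          (norm_pos_iff.2 (geomCF_ne_zero h0.le h1 t)) (norm_geomCF_le_one h0.le h1 t) (by linarith)
      have hn3 : ‖ψ t - 1‖ ≤ 4 * C₀ := (hψb t ht.le).trans (by
        rw [ht]
        nlinarith [Real.pi_lt_four])
      calc _ ≤ 3 / α * (4 * C₀) :=
            mul_le_mul hn2 hn3 (norm_nonneg _) (by positivity)
        _ = _ := by ring
    have key : Complex.I * y * ∫ t in -Real.pi..Real.pi,
        Complex.exp (Complex.I * (y : ℂ) * t) * H t =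
        Complex.exp (Complex.I * (y : ℂ) * (Real.pi : ℝ)) * H Real.pi -
        Complex.exp (Complex.I * (y : ℂ) * ((-Real.pi : ℝ) : ℂ)) * H (-Real.pi) -
        ∫ t in -Real.pi..Real.pi, Complex.exp (Complex.I * (y : ℂ) * t) * H' t := by
      rw [← hftc]
      ring
    calc |y| * ‖∫ t in -Real.pi..Real.pi, Complex.exp (Complex.I * (y : ℂ) * t) * H t‖
        = ‖Complex.I * y * ∫ t in -Real.pi..Real.pi,
            Complex.exp (Complex.I * (y : ℂ) * t) * H t‖ := by
          rw [norm_mul, norm_mul, Complex.norm_I, one_mul, Complex.norm_real, Real.norm_eq_abs]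
      _ ≤ 12 * C₀ / α + 12 * C₀ / α + C₀ * (1 + 3 * |B|) * (M / α) := by
          rw [key]
          refine norm_sub_le_of_le (norm_sub_le_of_le (hbd _ (abs_of_pos hpi)) (hbd _ ?_)) ?_
          · rw [abs_neg, abs_of_pos hpi]
          · refine (intervalIntegral.norm_integral_le_of_norm_le (by linarith)
              (ae_of_all _ fun t ht => ?_) hbint).trans ?_
            · rw [norm_mul, norm_exp_I_mul_mul, one_mul]
              exact hH'n t (abs_le.2 ⟨ht.1.le, ht.2⟩)
            · rw [intervalIntegral.integral_const_mul]
              gcongr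
      _ = (C₀ * (1 + 3 * |B|) * M + 24 * C₀) / α := by ring
      _ ≤ _ := by
          have : 0 ≤ C₀ * 4 * M := by positivity
          exact div_le_div_of_nonneg_right (by linarith) hα.le

end ProductForm

namespace ProductForm

open MeasureTheory Finset

/-! ### Averaging over the sum of independent variables -/

section Averaging

variable {ι : Type} [Fintype ι] {p : ι → ℕ → ℝ}

theorem memLp_two_seqLaw {q : ℕ → ℝ} (hq : IsProbSeq q) (h : HasMoments q) :
    MemLp (fun x : ℕ => (x : ℝ)) 2 (seqLaw q) := by
  rw [memLp_two_iff_integrable_sq (Measurable.of_discrete).aestronglyMeasurable,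
    hq.integrable_iff]
  have := h.summable_pow_sub hq 0 2
  refine this.congr fun x => ?_
  rw [sub_zero, Real.norm_of_nonneg (by positivity), mul_comm]

theorem integral_seqLaw_natCast {q : ℕ → ℝ} (hq : IsProbSeq q) :
    ∫ x : ℕ, (x : ℝ) ∂(seqLaw q) = mean q := by
  rw [hq.integral_eq, mean, expectation]
  exact tsum_congr fun x => by rw [smul_eq_mul, mul_comm]

theorem variance_seqLaw {q : ℕ → ℝ} (hq : IsProbSeq q) (h : HasMoments q) :
    ProbabilityTheory.variance (fun x : ℕ => (x : ℝ)) (seqLaw q) = absMoment q 2 := by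
  have := hq.isProbabilityMeasure
  rw [ProbabilityTheory.variance_eq_integral
    (memLp_two_seqLaw hq h).aestronglyMeasurable.aemeasurable,
    integral_seqLaw_natCast hq, hq.integral_eq, absMoment_two_eq, expectation]
  exact tsum_congr fun x => by rw [smul_eq_mul, mul_comm]

theorem memLp_two_sum (hp : ∀ k, IsProbSeq (p k)) (h : ∀ k, HasMoments (p k)) :
    MemLp (fun x : ι → ℕ => ∑ k, (x k : ℝ)) 2 (Measure.pi fun k => seqLaw (p k)) := by
  have := fun k => (hp k).isProbabilityMeasure
  refine memLp_finsetSum _ fun k _ => ?_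
  exact (memLp_two_seqLaw (hp k) (h k)).comp_measurePreserving
    (measurePreserving_eval (fun k => seqLaw (p k)) k)

theorem integrable_sum (hp : ∀ k, IsProbSeq (p k)) (h : ∀ k, HasMoments (p k)) :
    Integrable (fun x : ι → ℕ => ∑ k, (x k : ℝ)) (Measure.pi fun k => seqLaw (p k)) := by
  have := fun k => (hp k).isProbabilityMeasure
  exact (memLp_two_sum hp h).integrable (by norm_num)

theorem integral_sum (hp : ∀ k, IsProbSeq (p k)) (h : ∀ k, HasMoments (p k)) :
    ∫ x : ι → ℕ, ∑ k, (x k : ℝ) ∂(Measure.pi fun k => seqLaw (p k)) = ∑ k, mean (p k) := by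
  have := fun k => (hp k).isProbabilityMeasure
  have hi : ∀ k, Integrable (fun n : ℕ => (n : ℝ)) (seqLaw (p k)) := fun k =>
    (memLp_two_seqLaw (hp k) (h k)).integrable (by norm_num)
  rw [integral_finsetSum _ fun k _ => integrable_comp_eval (hi k)]
  refine sum_congr rfl fun k _ => ?_
  exact (integral_comp_eval (μ := fun k => seqLaw (p k)) (i := k) (f := fun n : ℕ => (n : ℝ))
    (hi k).aestronglyMeasurable).trans (integral_seqLaw_natCast (hp k))

theorem integrable_sum_sub_sq (hp : ∀ k, IsProbSeq (p k)) (h : ∀ k, HasMoments (p k)) (c : ℝ) :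
    Integrable (fun x : ι → ℕ => (∑ k, (x k : ℝ) - c) ^ 2)
      (Measure.pi fun k => seqLaw (p k)) := by
  have := fun k => (hp k).isProbabilityMeasure
  exact ((memLp_two_sum hp h).sub (memLp_const c)).integrable_sq

/-- The mean square distance of a sum of independent variables to `c`. -/
theorem integral_sum_sub_sq (hp : ∀ k, IsProbSeq (p k)) (h : ∀ k, HasMoments (p k)) (c : ℝ) :
    ∫ x : ι → ℕ, (∑ k, (x k : ℝ) - c) ^ 2 ∂(Measure.pi fun k => seqLaw (p k)) =
      ∑ k, absMoment (p k) 2 + (∑ k, mean (p k) - c) ^ 2 := by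
  have := fun k => (hp k).isProbabilityMeasure
  have hv := ProbabilityTheory.variance_sum_pi (μ := fun k => seqLaw (p k))
    (X := fun _ (n : ℕ) => (n : ℝ)) fun k => memLp_two_seqLaw (hp k) (h k)
  have e : (∑ k, fun x : ι → ℕ => (x k : ℝ)) = fun x => ∑ k, (x k : ℝ) := by
    ext x
    rw [Finset.sum_apply]
  rw [e, ProbabilityTheory.variance_eq_integral
    (integrable_sum hp h).aestronglyMeasurable.aemeasurable, integral_sum hp h] at hv
  simp_rw [variance_seqLaw (hp _) (h _)] at hv
  rw [← hv]
  set M := ∑ k, mean (p k) with hM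
  have i1 := integrable_sum_sub_sq hp h M
  have i2 : Integrable (fun x : ι → ℕ => 2 * (M - c) * (∑ k, (x k : ℝ)))
      (Measure.pi fun k => seqLaw (p k)) := (integrable_sum hp h).const_mul _
  have e2 : ∀ x : ι → ℕ, (∑ k, (x k : ℝ) - c) ^ 2 = (∑ k, (x k : ℝ) - M) ^ 2 +
      2 * (M - c) * (∑ k, (x k : ℝ)) + (c ^ 2 - M ^ 2) := fun x => by ring
  simp_rw [e2]
  have i3 : Integrable (fun x : ι → ℕ => (∑ k, (x k : ℝ) - M) ^ 2 +
      2 * (M - c) * (∑ k, (x k : ℝ))) (Measure.pi fun k => seqLaw (p k)) := i1.add i2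
  rw [integral_add i3 (integrable_const _), integral_add i1 i2, integral_const_mul,
    integral_sum hp h, ← hM, integral_const, probReal_univ, one_smul]
  ring

end Averaging

/-! ### The local limit theorem in the presence of a pole -/

/-- The local limit theorem in the case `ψ = 1`: the local probabilities of the negative binomial
law, expanded to first order in `exists_negBinom_local`, are averaged over the independent sum. The
mean of the latter cancels the linear term up to `O(1 / α)`, and its variance bounds the quadratic
one. -/
theorem exists_pole_main (B C₀ : ℝ) :
    ∃ K : ℝ, 0 ≤ K ∧ ∀ {ι : Type} [Fintype ι] (ξ x₀ ρ m R : ℝ) (N : ℕ) (p : ι → ℕ → ℝ),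
      1 ≤ ξ → ξ ≤ B → 1 ≤ x₀ → x₀ ≤ B → 0 < ρ → ρ < 1 → 1 ≤ ρ / (1 - ρ) → 0 < R → m = N →
      (∀ k, IsProbSeq (p k)) → (∀ k, HasMoments (p k)) →
      |∑ k, mean (p k) - m + x₀ * (ρ / (1 - ρ))| ≤ C₀ → ∑ k, absMoment (p k) 2 ≤ C₀ * R →
      ‖((ρ / (1 - ρ) / (2 * Real.pi) : ℝ) : ℂ) * (∫ t in -Real.pi..Real.pi,
          Complex.exp (Complex.I * ((-m : ℝ) : ℂ) * t) * geomCF ρ t ^ (ξ : ℂ) *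
            ∏ k, seqCF (p k) 0 t) - gammaDensity ξ x₀‖ ≤
        K * (1 / (ρ / (1 - ρ)) + R / (ρ / (1 - ρ)) ^ 2) := by
  have hpi := Real.pi_pos
  obtain ⟨C, hC, hloc⟩ := exists_negBinom_local B
  obtain ⟨C', hC', hT⟩ := exists_gammaDensity_taylor B
  refine ⟨C' * (|C₀| + 1) + C * (1 + |C₀| + (|C₀| + 1) ^ 2), by positivity, ?_⟩
  intro ι _ ξ x₀ ρ m R N p h1 h2 hx1 hx2 hρ0 hρ1 hα hR hmN hp hmom hmean hvar
  have := fun k => (hp k).isProbabilityMeasure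
  have hloc := hloc ξ h1 h2 x₀ hx1 hx2 ρ hρ0 hρ1 hα
  have hs := (hT ξ h1 h2 x₀ hx1 hx2).2.1
  have hC0 : 0 ≤ C₀ := (abs_nonneg _).trans hmean
  rw [abs_of_nonneg hC0]
  set α := ρ / (1 - ρ) with hαd
  set g := gammaDensity ξ x₀
  set s := gammaSlope ξ x₀
  have hα0 : 0 < α := by linarith
  have hξ0 : 0 < ξ := by linarith
  set P := Measure.pi fun k => seqLaw (p k) with hP
  have hnb := isProbSeq_negBinom hρ0.le hρ1 hξ0
  -- The content `Y` left to the negative binomial variable, of weights `f`, is negative when the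
  -- other variables exceed `m`.
  set f : ℤ → ℝ := fun y => if 0 ≤ y then negBinom ρ ξ y.toNat else 0 with hf
  set Y : (ι → ℕ) → ℤ := fun x => N - ∑ k, (x k : ℤ) with hY
  have hYr : ∀ x, (Y x : ℝ) = m - ∑ k, (x k : ℝ) := fun x => by
    rw [hY, hmN]
    push_cast
    rfl
  have hW : IntervalIntegrable (fun t : ℝ => Complex.exp (Complex.I * ((-m : ℝ) : ℂ) * t) *
      geomCF ρ t ^ (ξ : ℂ)) volume (-Real.pi) Real.pi := by
    have := continuous_geomCF_cpow hρ0.le hρ1 ξ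
    exact Continuous.intervalIntegrable (by fun_prop) _ _
  have hinner : ∀ x : ι → ℕ, (∫ t in -Real.pi..Real.pi,
      Complex.exp (Complex.I * ((-m : ℝ) : ℂ) * t) * geomCF ρ t ^ (ξ : ℂ) *
        Complex.exp (Complex.I * ((∑ k, ((x k : ℝ) - 0) : ℝ) : ℂ) * t)) =
      2 * Real.pi * ((f (Y x) : ℝ) : ℂ) := fun x => by
    rw [hf, ← integral_exp_mul_seqCF hnb]
    refine intervalIntegral.integral_congr fun t _ => ?_
    simp only [seqCF_negBinom hρ0.le hρ1 hξ0]
    rw [mul_right_comm, ← Complex.exp_add, hYr]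
    congr 2
    push_cast
    simp only [sub_zero]
    ring
  have hI : ((α / (2 * Real.pi) : ℝ) : ℂ) * (∫ t in -Real.pi..Real.pi,
      Complex.exp (Complex.I * ((-m : ℝ) : ℂ) * t) * geomCF ρ t ^ (ξ : ℂ) *
        ∏ k, seqCF (p k) 0 t) = ((∫ x, α * f (Y x) ∂P : ℝ) : ℂ) := by
    rw [integral_mul_prod_seqCF hp (fun _ => 0) hW]
    simp_rw [hinner]
    rw [integral_const_mul, integral_complex_ofReal, integral_const_mul, ← hP]
    push_cast
    field_simp
  have hf1 : ∀ y, ‖f y‖ ≤ 1 := fun y => by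
    rw [hf]
    dsimp only
    split_ifs
    · rw [Real.norm_of_nonneg (hnb.nonneg _)]
      exact le_hasSum hnb.hasSum _ fun i _ => hnb.nonneg i
    · simp
  have hfi : Integrable (fun x => α * f (Y x)) P :=
    (Integrable.of_bound (Measurable.of_discrete).aestronglyMeasurable 1
      (ae_of_all _ fun x => hf1 (Y x))).const_mul _
  -- The value of the sum at which the argument `(Y + 1) / α` of the gamma density equals `x₀`.
  set c : ℝ := m + 1 - x₀ * α with hc
  have hu : ∀ x, ((Y x : ℝ) + 1) / α - x₀ = -(∑ k, (x k : ℝ) - c) / α := fun x => by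
    rw [hYr, hc]
    field_simp
    ring
  have i1 := integrable_sum hp hmom
  have i2 := integrable_sum_sub_sq hp hmom c
  have hlin : Integrable (fun x : ι → ℕ => s * (-(∑ k, (x k : ℝ) - c) / α)) P :=
    (((i1.sub (integrable_const c)).neg).div_const α).const_mul s
  have hmc : |∑ k, mean (p k) - c| ≤ C₀ + 1 := by
    have e : ∑ k, mean (p k) - c = (∑ k, mean (p k) - m + x₀ * α) - 1 := by
      rw [hc]
      ring
    rw [e]
    refine (abs_sub _ _).trans ?_
    rw [abs_one]
    linarith
  have hlinv : ∫ x, s * (-(∑ k, (x k : ℝ) - c) / α) ∂P =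
      s * (-(∑ k, mean (p k) - c) / α) := by
    rw [integral_const_mul, integral_div, integral_neg, integral_sub i1 (integrable_const c),
      integral_sum hp hmom, integral_const, probReal_univ, one_smul]
  have hquad : Integrable (fun x : ι → ℕ => C * (1 / α + (-(∑ k, (x k : ℝ) - c) / α) ^ 2)) P := by
    refine Integrable.const_mul ?_ C
    refine (integrable_const _).add ?_
    refine (i2.div_const (α ^ 2)).congr (ae_of_all _ fun x => ?_)
    ring
  have hquadv : ∫ x, C * (1 / α + (-(∑ k, (x k : ℝ) - c) / α) ^ 2) ∂P =
      C * (1 / α + (∑ k, absMoment (p k) 2 + (∑ k, mean (p k) - c) ^ 2) / α ^ 2) := by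
    have e : ∀ x : ι → ℕ, C * (1 / α + (-(∑ k, (x k : ℝ) - c) / α) ^ 2) =
        C * (1 / α) + C / α ^ 2 * (∑ k, (x k : ℝ) - c) ^ 2 := fun x => by
      ring
    simp_rw [e]
    rw [integral_add (integrable_const _) (i2.const_mul _), integral_const_mul, integral_const_mul,
      integral_sum_sub_sq hp hmom, integral_const, probReal_univ, one_smul]
    ring
  have hmain : |(∫ x, α * f (Y x) ∂P) - g - s * (-(∑ k, mean (p k) - c) / α)| ≤
      C * (1 / α + (∑ k, absMoment (p k) 2 + (∑ k, mean (p k) - c) ^ 2) / α ^ 2) := by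
    rw [← hquadv, ← hlinv]
    have e : (∫ x, α * f (Y x) ∂P) - g - ∫ x, s * (-(∑ k, (x k : ℝ) - c) / α) ∂P =
        ∫ x, (α * f (Y x) - g - s * (-(∑ k, (x k : ℝ) - c) / α)) ∂P := by
      have i3 : Integrable (fun x => α * f (Y x) - g) P := hfi.sub (integrable_const g)
      rw [integral_sub i3 hlin, integral_sub hfi (integrable_const g), integral_const,
        probReal_univ, one_smul]
    rw [e, ← Real.norm_eq_abs]
    refine norm_integral_le_of_norm_le hquad (ae_of_all _ fun x => ?_)
    rw [Real.norm_eq_abs, ← hu]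
    exact hloc (Y x)
  rw [hI, ← Complex.ofReal_sub, Complex.norm_real, Real.norm_eq_abs]
  have hi1 : 1 / α ^ 2 ≤ 1 / α := by
    rw [div_le_div_iff₀ (by positivity) hα0]
    nlinarith
  have hsq : (∑ k, mean (p k) - c) ^ 2 ≤ (C₀ + 1) ^ 2 :=
    sq_le_sq' (by linarith [abs_le.1 hmc]) (abs_le.1 hmc).2
  have e1 : |s * (-(∑ k, mean (p k) - c) / α)| ≤ C' * (C₀ + 1) * (1 / α) := by
    rw [abs_mul, abs_div, abs_neg, abs_of_pos hα0]
    calc |s| * (|∑ k, mean (p k) - c| / α) ≤ C' * ((C₀ + 1) / α) := by gcongr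
      _ = _ := by ring
  have e2 : C * (1 / α + (∑ k, absMoment (p k) 2 + (∑ k, mean (p k) - c) ^ 2) / α ^ 2) ≤
      C * (1 / α + (C₀ * R + (C₀ + 1) ^ 2) / α ^ 2) := by gcongr
  have e3 : (C₀ + 1) ^ 2 * (1 / α ^ 2) ≤ (C₀ + 1) ^ 2 * (1 / α) := by gcongr
  have e4 : |(∫ x, α * f (Y x) ∂P) - g| ≤ C' * (C₀ + 1) * (1 / α) +
      C * (1 / α + (C₀ * R + (C₀ + 1) ^ 2) / α ^ 2) := by
    have := abs_add_le ((∫ x, α * f (Y x) ∂P) - g - s * (-(∑ k, mean (p k) - c) / α))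
      (s * (-(∑ k, mean (p k) - c) / α))
    rw [sub_add_cancel] at this
    linarith
  refine e4.trans ?_
  have e5 : (C₀ * R + (C₀ + 1) ^ 2) / α ^ 2 = C₀ * (R / α ^ 2) + (C₀ + 1) ^ 2 * (1 / α ^ 2) := by
    ring
  rw [e5]
  have hRn : 0 ≤ R / α ^ 2 := by positivity
  have hαn : 0 ≤ 1 / α := by positivity
  have e6 : C * (1 / α + (C₀ * (R / α ^ 2) + (C₀ + 1) ^ 2 * (1 / α ^ 2))) ≤
      C * (1 / α + (C₀ * (R / α ^ 2) + (C₀ + 1) ^ 2 * (1 / α))) := by gcongr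
  refine (add_le_add_right e6 _).trans ?_
  have e7 : 0 ≤ C * C₀ * (1 / α) := by positivity
  have e8 : 0 ≤ (C' * (C₀ + 1) + C * (1 + (C₀ + 1) ^ 2)) * (R / α ^ 2) := by positivity
  linear_combination e7 + e8

/-- The contribution of `ψ - 1` for `ξ ≥ 3/2`: the Fourier coefficients of `ω^ξ (ψ - 1)` at
frequencies of order `α` are smaller than those of `ω^ξ` by a factor `1 / α`, and the independent
sum stays away from the exceptional frequencies with high probability. -/
theorem exists_pole_correction (B C₀ : ℝ) :
    ∃ K : ℝ, 0 ≤ K ∧ ∀ {ι : Type} [Fintype ι] (ξ x₀ ρ m R : ℝ) (p : ι → ℕ → ℝ) (ψ : ℝ → ℂ),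
      3 / 2 ≤ ξ → ξ ≤ B → 1 ≤ x₀ → 0 < ρ → ρ < 1 → 1 ≤ ρ / (1 - ρ) → 0 < R →
      (∀ k, IsProbSeq (p k)) → (∀ k, HasMoments (p k)) →
      |∑ k, mean (p k) - m + x₀ * (ρ / (1 - ρ))| ≤ C₀ → ∑ k, absMoment (p k) 2 ≤ C₀ * R →
      Differentiable ℝ ψ → ψ 0 = 1 → (∀ t, |t| ≤ Real.pi → ‖deriv ψ t‖ ≤ C₀) →
      ‖∫ t in -Real.pi..Real.pi, Complex.exp (Complex.I * ((-m : ℝ) : ℂ) * t) *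
          (geomCF ρ t ^ (ξ : ℂ) * (ψ t - 1)) * ∏ k, seqCF (p k) 0 t‖ ≤
        K * (1 / (ρ / (1 - ρ)) + R / (ρ / (1 - ρ)) ^ 2) / (ρ / (1 - ρ)) := by
  obtain ⟨C, hC, hF⟩ := exists_fourier_coeff_le B C₀
  refine ⟨C * (2 + 4 * |C₀| + 4 * |C₀| ^ 2), by positivity, ?_⟩
  intro ι _ ξ x₀ ρ m R p ψ h1 h2 hx1 hρ0 hρ1 hα hR hp hmom hmean hvar hψ hψ0 hψ'
  have := fun k => (hp k).isProbabilityMeasure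
  have hF := hF ξ h1 h2 ρ hρ0 hρ1 ψ hψ hψ0 hψ'
  have hC0 : 0 ≤ C₀ := (abs_nonneg _).trans hmean
  rw [abs_of_nonneg hC0]
  set α := ρ / (1 - ρ) with hαd
  have hα0 : 0 < α := by linarith
  set P := Measure.pi fun k => seqLaw (p k) with hP
  have hW : IntervalIntegrable (fun t : ℝ => Complex.exp (Complex.I * ((-m : ℝ) : ℂ) * t) *
      (geomCF ρ t ^ (ξ : ℂ) * (ψ t - 1))) volume (-Real.pi) Real.pi := by
    have h3 := continuous_geomCF_cpow hρ0.le hρ1 ξ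
    have h4 := hψ.continuous
    exact Continuous.intervalIntegrable (by fun_prop) _ _
  rw [integral_mul_prod_seqCF hp (fun _ => 0) hW, ← hP]
  set c : ℝ := m - x₀ * α with hc
  have i2 := integrable_sum_sub_sq hp hmom c
  have hquad : Integrable (fun x : ι → ℕ => C / α * (2 / α + 4 / α ^ 2 *
      (∑ k, (x k : ℝ) - c) ^ 2)) P :=
    ((integrable_const (2 / α)).add (i2.const_mul (4 / α ^ 2))).const_mul (C / α)
  have hbound : ∀ x : ι → ℕ, ‖∫ t in -Real.pi..Real.pi,
      Complex.exp (Complex.I * ((-m : ℝ) : ℂ) * t) * (geomCF ρ t ^ (ξ : ℂ) * (ψ t - 1)) *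
        Complex.exp (Complex.I * ((∑ k, ((x k : ℝ) - 0) : ℝ) : ℂ) * t)‖ ≤
      C / α * (2 / α + 4 / α ^ 2 * (∑ k, (x k : ℝ) - c) ^ 2) := fun x => by
    obtain ⟨b1, b2⟩ := hF (∑ k, (x k : ℝ) - m)
    have e : (∫ t in -Real.pi..Real.pi,
        Complex.exp (Complex.I * ((-m : ℝ) : ℂ) * t) * (geomCF ρ t ^ (ξ : ℂ) * (ψ t - 1)) *
          Complex.exp (Complex.I * ((∑ k, ((x k : ℝ) - 0) : ℝ) : ℂ) * t)) =
        ∫ t in -Real.pi..Real.pi,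
          Complex.exp (Complex.I * ((∑ k, (x k : ℝ) - m : ℝ) : ℂ) * t) *
            (geomCF ρ t ^ (ξ : ℂ) * (ψ t - 1)) := by
      refine intervalIntegral.integral_congr fun t _ => ?_
      rw [mul_right_comm, ← Complex.exp_add]
      congr 2
      push_cast
      simp only [sub_zero]
      ring
    rw [e]
    set J := ‖∫ t in -Real.pi..Real.pi,
          Complex.exp (Complex.I * ((∑ k, (x k : ℝ) - m : ℝ) : ℂ) * t) *
            (geomCF ρ t ^ (ξ : ℂ) * (ψ t - 1))‖ with hJ
    have hJ0 : 0 ≤ J := norm_nonneg _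
    set v := ∑ k, (x k : ℝ) - c with hv
    have hCα : 0 ≤ C / α := by positivity
    have hy : ∑ k, (x k : ℝ) - m = v - x₀ * α := by
      rw [hv, hc]
      ring
    rw [hy] at b2
    -- Either the sum is near its typical value, and the frequency is large, or Chebyshev applies.
    rcases le_or_gt |v| (α / 2) with hvα | hvα
    · have h3 : α / 2 ≤ |v - x₀ * α| := by
        have := abs_le.1 hvα
        rw [abs_of_nonpos (by nlinarith)]
        nlinarith
      have h4 : α / 2 * J ≤ C / α := (mul_le_mul_of_nonneg_right h3 hJ0).trans b2
      have h5 : J ≤ C / α * (2 / α) := by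
        rw [← mul_div_assoc, le_div_iff₀ hα0]
        linarith
      have h6 : 0 ≤ C / α * (4 / α ^ 2 * v ^ 2) := by positivity
      linarith
    · have h3 : 1 ≤ 4 / α ^ 2 * v ^ 2 := by
        rw [div_mul_eq_mul_div, le_div_iff₀ (by positivity), ← sq_abs v]
        nlinarith
      have h4 : C / α * 1 ≤ C / α * (4 / α ^ 2 * v ^ 2) := mul_le_mul_of_nonneg_left h3 hCα
      have h6 : 0 ≤ C / α * (2 / α) := by positivity
      linarith
  refine (norm_integral_le_of_norm_le hquad (ae_of_all _ hbound)).trans ?_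
  rw [integral_const_mul, integral_add (integrable_const _) (i2.const_mul _), integral_const_mul,
    integral_sum_sub_sq hp hmom, integral_const, probReal_univ, one_smul]
  have hmc : (∑ k, mean (p k) - c) ^ 2 ≤ C₀ ^ 2 := by
    have e : ∑ k, mean (p k) - c = ∑ k, mean (p k) - m + x₀ * α := by
      rw [hc]
      ring
    rw [e]
    exact sq_le_sq' (abs_le.1 hmean).1 (abs_le.1 hmean).2
  have hi1 : 1 / α ^ 2 ≤ 1 / α := by
    rw [div_le_div_iff₀ (by positivity) hα0]
    nlinarith
  have hRn : 0 ≤ R / α ^ 2 := by positivity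
  have hαn : 0 ≤ 1 / α := by positivity
  calc C / α * (2 / α + 4 / α ^ 2 * (∑ k, absMoment (p k) 2 + (∑ k, mean (p k) - c) ^ 2))
      ≤ C / α * (2 / α + 4 / α ^ 2 * (C₀ * R + C₀ ^ 2)) := by gcongr
    _ = C / α * (2 * (1 / α) + 4 * C₀ * (R / α ^ 2) + 4 * C₀ ^ 2 * (1 / α ^ 2)) := by ring
    _ ≤ C / α * (2 * (1 / α) + 4 * C₀ * (R / α ^ 2) + 4 * C₀ ^ 2 * (1 / α)) := by gcongr
    _ ≤ C / α * ((2 + 4 * C₀ + 4 * C₀ ^ 2) * (1 / α + R / α ^ 2)) := by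
        refine mul_le_mul_of_nonneg_left ?_ (by positivity)
        have e7 : 0 ≤ 4 * C₀ * (1 / α) := by positivity
        have e8 : 0 ≤ (2 + 4 * C₀ ^ 2) * (R / α ^ 2) := by positivity
        linear_combination e7 + e8
    _ = _ := by ring

/-- The error term of the local limit theorem with a pole: `α` is the scale of the gamma part and
`R` the variance of the Gaussian part. -/
noncomputable def poleError (ξ α R : ℝ) : ℝ :=
  1 / α + R / α ^ 2 + 1 / √R * (√R / α) ^ (ξ - 1)

/-- The integral of the modulus of `ω^ξ Φ`: for `ξ ≥ 3/2` the factor `ω^ξ` is integrable on the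
scale `1 / α`, and for `ξ ≤ 3/2` the decay of `Φ` takes over. -/
theorem exists_integral_pole_le {c : ℝ} (hc : 0 < c) :
    ∃ K : ℝ, 0 ≤ K ∧ ∀ ξ : ℝ, 1 ≤ ξ → ∀ ρ, 0 < ρ → ρ < 1 → ∀ R, 0 < R → ∀ Φ : ℝ → ℂ,
      Continuous Φ → (∀ t, |t| ≤ Real.pi → ‖Φ t‖ ≤ Real.exp (-(c * R) * t ^ 2)) →
      ∫ t in -Real.pi..Real.pi, ‖geomCF ρ t‖ ^ ξ * ‖Φ t‖ ≤
        K * poleError ξ (ρ / (1 - ρ)) R := by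
  have hpi := Real.pi_pos
  obtain ⟨K₁, hK₁, h1⟩ := exists_integral_norm_geomCF_rpow_le
  obtain ⟨K₂, hK₂, h2⟩ := exists_integral_norm_geomCF_rpow_mul_exp_le hc
  refine ⟨K₁ + K₂, by positivity, fun ξ hξ ρ hρ0 hρ1 R hR Φ hΦ hΦd => ?_⟩
  have hα0 : 0 < ρ / (1 - ρ) := div_pos hρ0 (by linarith)
  have hcont := (continuous_geomCF hρ0.le hρ1).norm
  have hΦn := hΦ.norm
  unfold poleError
  set α := ρ / (1 - ρ)
  have p1 : 0 ≤ 1 / α := by positivity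
  have p2 : 0 ≤ R / α ^ 2 := by positivity
  have p3 : 0 ≤ 1 / √R * (√R / α) ^ (ξ - 1) := by positivity
  have hcξ : ∀ s : ℝ, 0 ≤ s → Continuous fun t => ‖geomCF ρ t‖ ^ s := fun s hs =>
    hcont.rpow_const fun t => Or.inr hs
  have hcξ0 := hcξ ξ (by linarith)
  rcases le_or_gt (3 / 2) ξ with h | h
  · have h3 : ∫ t in -Real.pi..Real.pi, ‖geomCF ρ t‖ ^ ξ * ‖Φ t‖ ≤ K₁ * (1 / α) := by
      have h4 := h1 ρ hρ0 hρ1 ξ h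
      rw [mul_one_div]
      refine le_trans ?_ h4
      refine intervalIntegral.integral_mono_on (by linarith)
        (Continuous.intervalIntegrable (by fun_prop) _ _) (hcξ0.intervalIntegrable _ _)
        fun t ht => ?_
      refine mul_le_of_le_one_right (by positivity) ((hΦd t (abs_le.2 ht)).trans ?_)
      refine Real.exp_le_one_iff.2 ?_
      have : 0 ≤ c * R * t ^ 2 := by positivity
      linarith
    have e1 : 0 ≤ K₁ * (R / α ^ 2 + 1 / √R * (√R / α) ^ (ξ - 1)) := by positivity
    have e2 : 0 ≤ K₂ * (1 / α + R / α ^ 2 + 1 / √R * (√R / α) ^ (ξ - 1)) := by positivity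
    linear_combination h3 + e1 + e2
  · have hcξ1 := hcξ (ξ - 1) (by linarith)
    have h3 : ∫ t in -Real.pi..Real.pi, ‖geomCF ρ t‖ ^ ξ * ‖Φ t‖ ≤
        K₂ * (1 / √R * (√R / α) ^ (ξ - 1)) := by
      refine le_trans ?_ (h2 ρ hρ0 hρ1 (ξ - 1) (by linarith) (by linarith) R hR)
      refine intervalIntegral.integral_mono_on (by linarith)
        (Continuous.intervalIntegrable (by fun_prop) _ _)
        (Continuous.intervalIntegrable (by fun_prop) _ _) fun t ht => ?_
      refine mul_le_mul ?_ (hΦd t (abs_le.2 ht)) (norm_nonneg _) (by positivity)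
      exact Real.rpow_le_rpow_of_exponent_ge (norm_pos_iff.2 (geomCF_ne_zero hρ0.le hρ1 t))
        (norm_geomCF_le_one hρ0.le hρ1 t) (by linarith)
    have e1 : 0 ≤ K₂ * (1 / α + R / α ^ 2) := by positivity
    have e2 : 0 ≤ K₁ * (1 / α + R / α ^ 2 + 1 / √R * (√R / α) ^ (ξ - 1)) := by positivity
    linear_combination h3 + e1 + e2

/-- The contribution of `ψ - 1 = O(t)` for `ξ ≤ 3/2`: the factor `t` lowers the order of the pole by
one, and the decay of `Φ` makes the remaining power integrable on the scale `1 / √R`. -/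
theorem exists_pole_small {c : ℝ} (hc : 0 < c) (C₀ : ℝ) :
    ∃ K : ℝ, 0 ≤ K ∧ ∀ ξ : ℝ, 1 ≤ ξ → ξ ≤ 3 / 2 → ∀ ρ, 0 < ρ → ρ < 1 → ∀ R, 0 < R →
      ∀ (m : ℝ) (Φ ψ : ℝ → ℂ), Continuous Φ →
      (∀ t, |t| ≤ Real.pi → ‖Φ t‖ ≤ Real.exp (-(c * R) * t ^ 2)) →
      Differentiable ℝ ψ → ψ 0 = 1 → (∀ t, |t| ≤ Real.pi → ‖deriv ψ t‖ ≤ C₀) →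
      ‖∫ t in -Real.pi..Real.pi, Complex.exp (Complex.I * ((-m : ℝ) : ℂ) * t) *
          (geomCF ρ t ^ (ξ : ℂ) * (ψ t - 1)) * Φ t‖ ≤
        K * (1 / √R * (√R / (ρ / (1 - ρ))) ^ (ξ - 1)) / (ρ / (1 - ρ)) := by
  have hpi := Real.pi_pos
  obtain ⟨K, hK, h2⟩ := exists_integral_norm_geomCF_rpow_mul_exp_le hc
  refine ⟨3 * |C₀| * K, by positivity, ?_⟩
  intro ξ h1 h3 ρ hρ0 hρ1 R hR m Φ ψ hΦ hΦd hψ hψ0 hψ'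
  have hα0 : 0 < ρ / (1 - ρ) := div_pos hρ0 (by linarith)
  have h2 := h2 ρ hρ0 hρ1 (ξ - 1) (by linarith) (by linarith) R hR
  have hbase := fun t ht => mul_norm_geomCF_rpow_le hρ0.le hρ1 (ξ - 1) (t := t) ht
  set α := ρ / (1 - ρ)
  have hC0 : 0 ≤ C₀ := (norm_nonneg _).trans (hψ' 0 (by simpa using hpi.le))
  rw [abs_of_nonneg hC0]
  have hψb : ∀ t, |t| ≤ Real.pi → ‖ψ t - 1‖ ≤ C₀ * |t| := fun t ht => by
    have h2 := (convex_Icc (-Real.pi) Real.pi).norm_image_sub_le_of_norm_deriv_le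
      (f := ψ) (C := C₀) (fun x _ => hψ x) (fun x hx => hψ' x (abs_le.2 hx))
      (x := 0) (y := t) ⟨by linarith, by linarith⟩ (abs_le.1 ht)
    rwa [hψ0, sub_zero, Real.norm_eq_abs] at h2
  have hcont : Continuous fun t => ‖geomCF ρ t‖ ^ (ξ - 1) :=
    (continuous_geomCF hρ0.le hρ1).norm.rpow_const fun t => Or.inr (by linarith)
  calc _ ≤ ∫ t in -Real.pi..Real.pi,
        3 * C₀ / α * (‖geomCF ρ t‖ ^ (ξ - 1) * Real.exp (-(c * R) * t ^ 2)) := by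
        refine intervalIntegral.norm_integral_le_of_norm_le (by linarith)
          (ae_of_all _ fun t ht => ?_) (Continuous.intervalIntegrable (by fun_prop) _ _)
        have ht' : |t| ≤ Real.pi := abs_le.2 ⟨ht.1.le, ht.2⟩
        have hb := hbase t ht'
        rw [sub_add_cancel] at hb
        rw [norm_mul, norm_mul, norm_mul, norm_exp_I_mul_mul, one_mul, Complex.norm_cpow_real,
          ← mul_assoc]
        refine mul_le_mul ?_ (hΦd t ht') (norm_nonneg _) (by positivity)
        calc ‖geomCF ρ t‖ ^ ξ * ‖ψ t - 1‖ ≤ ‖geomCF ρ t‖ ^ ξ * (C₀ * |t|) := by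
              gcongr
              exact hψb t ht'
          _ = C₀ / α * (α * |t| * ‖geomCF ρ t‖ ^ ξ) := by
              field_simp
          _ ≤ C₀ / α * (3 * ‖geomCF ρ t‖ ^ (ξ - 1)) := by gcongr
          _ = _ := by ring
    _ ≤ 3 * C₀ / α * (K * (1 / √R * (√R / α) ^ (ξ - 1))) := by
        rw [intervalIntegral.integral_const_mul]
        gcongr
    _ = _ := by ring

/-- The local limit theorem for the sum of a variable whose characteristic function is
`ω ^ ξ * ψ` and of an independent sum with Gaussian-type decay. -/
theorem exists_pole_local (B C₀ : ℝ) {c : ℝ} (hc : 0 < c) :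
    ∃ K : ℝ, 0 ≤ K ∧ ∀ {ι : Type} [Fintype ι] (ξ x₀ ρ R : ℝ) (m : ℕ) (p : ι → ℕ → ℝ)
      (ψ : ℝ → ℂ),
      1 ≤ ξ → ξ ≤ B → 1 ≤ x₀ → x₀ ≤ B → 0 < ρ → ρ < 1 → 1 ≤ ρ / (1 - ρ) → 0 < R →
      (∀ k, IsProbSeq (p k)) → (∀ k, HasMoments (p k)) →
      |∑ k, mean (p k) - m + x₀ * (ρ / (1 - ρ))| ≤ C₀ → ∑ k, absMoment (p k) 2 ≤ C₀ * R →
      (∀ t, |t| ≤ Real.pi → ‖∏ k, seqCF (p k) 0 t‖ ≤ Real.exp (-(c * R) * t ^ 2)) →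
      Differentiable ℝ ψ → ψ 0 = 1 → (∀ t, |t| ≤ Real.pi → ‖deriv ψ t‖ ≤ C₀) →
      ‖((ρ / (1 - ρ) / (2 * Real.pi) : ℝ) : ℂ) * (∫ t in -Real.pi..Real.pi,
          Complex.exp (Complex.I * ((-(m : ℝ) : ℝ) : ℂ) * t) * (geomCF ρ t ^ (ξ : ℂ) * ψ t) *
            ∏ k, seqCF (p k) 0 t) - gammaDensity ξ x₀‖ ≤ K * poleError ξ (ρ / (1 - ρ)) R := by
  have hpi := Real.pi_pos
  obtain ⟨K₁, hK₁, h1⟩ := exists_pole_main B C₀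
  obtain ⟨K₂, hK₂, h2⟩ := exists_pole_correction B C₀
  obtain ⟨K₃, hK₃, h3⟩ := exists_pole_small hc C₀
  refine ⟨K₁ + (K₂ + K₃), by positivity, ?_⟩
  intro ι _ ξ x₀ ρ R m p ψ hξ1 hξB hx1 hxB hρ0 hρ1 hα hR hp hmom hmean hvar hdec hψ hψ0 hψ'
  have h1 := h1 ξ x₀ ρ m R m p hξ1 hξB hx1 hxB hρ0 hρ1 hα hR rfl hp hmom hmean hvar
  have h2 := fun h => h2 ξ x₀ ρ m R p ψ h hξB hx1 hρ0 hρ1 hα hR hp hmom hmean hvar hψ hψ0 hψ'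
  have hΦc : Continuous fun t => ∏ k, seqCF (p k) 0 t :=
    continuous_finsetProd _ fun k _ => continuous_seqCF (hp k) _
  have h3 := fun h => h3 ξ hξ1 h ρ hρ0 hρ1 R hR m _ ψ hΦc hdec hψ hψ0 hψ'
  unfold poleError
  set α := ρ / (1 - ρ) with hαd
  have hα0 : 0 < α := by linarith
  have p1 : 0 ≤ 1 / α := by positivity
  have p2 : 0 ≤ R / α ^ 2 := by positivity
  have p3 : 0 ≤ 1 / √R * (√R / α) ^ (ξ - 1) := by positivity
  have hωc := continuous_geomCF_cpow hρ0.le hρ1 ξ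
  have hψc := hψ.continuous
  have hsplit : (∫ t in -Real.pi..Real.pi,
      Complex.exp (Complex.I * ((-(m : ℝ) : ℝ) : ℂ) * t) * (geomCF ρ t ^ (ξ : ℂ) * ψ t) *
        ∏ k, seqCF (p k) 0 t) =
      (∫ t in -Real.pi..Real.pi, Complex.exp (Complex.I * ((-(m : ℝ) : ℝ) : ℂ) * t) *
        geomCF ρ t ^ (ξ : ℂ) * ∏ k, seqCF (p k) 0 t) +
      ∫ t in -Real.pi..Real.pi, Complex.exp (Complex.I * ((-(m : ℝ) : ℝ) : ℂ) * t) *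
        (geomCF ρ t ^ (ξ : ℂ) * (ψ t - 1)) * ∏ k, seqCF (p k) 0 t := by
    rw [← intervalIntegral.integral_add (Continuous.intervalIntegrable (by fun_prop) _ _)
      (Continuous.intervalIntegrable (by fun_prop) _ _)]
    refine intervalIntegral.integral_congr fun t _ => ?_
    ring
  have hcorr : ‖∫ t in -Real.pi..Real.pi, Complex.exp (Complex.I * ((-(m : ℝ) : ℝ) : ℂ) * t) *
      (geomCF ρ t ^ (ξ : ℂ) * (ψ t - 1)) * ∏ k, seqCF (p k) 0 t‖ ≤
      (K₂ + K₃) * (1 / α + R / α ^ 2 + 1 / √R * (√R / α) ^ (ξ - 1)) / α := by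
    rcases le_total (3 / 2) ξ with h | h
    · refine (h2 h).trans (div_le_div_of_nonneg_right ?_ hα0.le)
      have e1 : 0 ≤ K₂ * (1 / √R * (√R / α) ^ (ξ - 1)) := by positivity
      have e2 : 0 ≤ K₃ * (1 / α + R / α ^ 2 + 1 / √R * (√R / α) ^ (ξ - 1)) := by positivity
      linear_combination e1 + e2
    · refine (h3 h).trans (div_le_div_of_nonneg_right ?_ hα0.le)
      have e1 : 0 ≤ K₃ * (1 / α + R / α ^ 2) := by positivity
      have e2 : 0 ≤ K₂ * (1 / α + R / α ^ 2 + 1 / √R * (√R / α) ^ (ξ - 1)) := by positivity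
      linear_combination e1 + e2
  rw [hsplit, mul_add, add_sub_right_comm]
  refine (norm_add_le_of_le h1 ?_).trans (b := K₁ * (1 / α + R / α ^ 2) +
    (K₂ + K₃) * (1 / α + R / α ^ 2 + 1 / √R * (√R / α) ^ (ξ - 1))) ?_
  · rw [norm_mul, Complex.norm_real, Real.norm_of_nonneg (by positivity)]
    set E := (K₂ + K₃) * (1 / α + R / α ^ 2 + 1 / √R * (√R / α) ^ (ξ - 1)) with hE
    have hE0 : 0 ≤ E := by positivity
    calc _ ≤ α / (2 * Real.pi) * (E / α) := by gcongr
      _ = E / (2 * Real.pi) := by field_simp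
      _ ≤ E := div_le_self hE0 (by linarith [Real.pi_gt_three])
  · have e1 : 0 ≤ K₁ * (1 / √R * (√R / α) ^ (ξ - 1)) := by positivity
    linear_combination e1

end ProductForm

namespace ClosedNetwork

open MeasureTheory Finset ProductForm

/-! ### Uniform bounds for the open queues -/

variable {n : ℕ} {N : ClosedNetwork n} {lam lam' : ℝ} {k : Fin n}

theorem maxLoad_pos (hc : 0 < N.critIntensity) (h0 : 0 < lam) : 0 < N.maxLoad lam :=
  div_pos h0 hc

theorem maxLoad_lt_one (hc : 0 < N.critIntensity) (hl : lam < N.critIntensity) :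
    N.maxLoad lam < 1 := (div_lt_one hc).2 hl

theorem one_add_alpha (hc : 0 < N.critIntensity) (hl : lam < N.critIntensity) :
    1 + N.alpha lam = 1 / (1 - N.maxLoad lam) := by
  have := maxLoad_lt_one hc hl
  have : 1 - N.maxLoad lam ≠ 0 := by linarith
  rw [alpha]
  field_simp
  ring

theorem alpha_pos (hc : 0 < N.critIntensity) (h0 : 0 < lam) (hl : lam < N.critIntensity) :
    0 < N.alpha lam :=
  div_pos (maxLoad_pos hc h0) (by linarith [maxLoad_lt_one hc hl])

/-- The bounds on the queues of one network that the asymptotic analysis uses, with a single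
constant `B`; the assumptions on a sequence of networks make `B` independent of the network. -/
structure UniformBounds (N : ClosedNetwork n) (ξ : Fin n → ℝ) (B : ℝ) : Prop where
  one_le : 1 ≤ B
  crit_pos : 0 < N.critIntensity
  sat_nonempty : N.satQueues.Nonempty
  comparable : ∀ k ∉ N.satQueues, ∀ lam, 0 < lam → lam ≤ N.critIntensity →
    N.LoadComparable B⁻¹ B lam k
  load_le : ∀ k ∉ N.satQueues, N.load N.critIntensity k ≤ B
  one_le_order : ∀ k ∈ N.satQueues, 1 ≤ ξ k
  order_le : N.totalOrder ξ ≤ B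
  mean_sat : ∀ k ∈ N.satQueues, ∀ lam, 0 < lam → lam < N.critIntensity →
    |N.openMean lam k - ξ k * N.alpha lam| ≤ B
  moment_sat : ∀ k ∈ N.satQueues, ∀ lam, 0 < lam → lam < N.critIntensity →
    ∀ r ∈ ({2, 3, 4} : Set ℕ), N.centralMoment lam k r ≤ B * (1 + N.alpha lam) ^ r
  third_sat : ∀ k ∈ N.satQueues, ∀ lam, 0 < lam → lam < N.critIntensity →
    N.centralMoment lam k 3 ≤ B * (1 + N.alpha lam) ^ 2 * N.openMean lam k
  pole : ∀ lam, 0 < lam → lam < N.critIntensity → ∃ ψ : Fin n → ℝ → ℂ, ∀ k ∈ N.satQueues,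
    Differentiable ℝ (ψ k) ∧ ψ k 0 = 1 ∧
      (∀ t, seqCF (N.openProb lam k) 0 t = geomCF (N.maxLoad lam) t ^ (ξ k : ℂ) * ψ k t) ∧
      ∀ t, ‖deriv (ψ k) t‖ ≤ B

theorem LoadComparable.mono {c C c' C' : ℝ} (h : N.LoadComparable c C lam k)
    (hl : 0 ≤ N.load lam k) (hc : c' ≤ c) (hC : C ≤ C') : N.LoadComparable c' C' lam k := by
  have h1 := mul_le_mul_of_nonneg_right hc hl
  have h2 := mul_le_mul_of_nonneg_right hC hl
  refine ⟨⟨h1.trans h.1.1, h.1.2.trans h2⟩, fun r hr => ?_, ?_⟩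
  · exact ⟨h1.trans (h.2.1 r hr).1, (h.2.1 r hr).2.trans h2⟩
  · exact ⟨h1.trans h.2.2.1, h.2.2.2.trans h2⟩

theorem LoadComparable.load_le {c C : ℝ} (h : N.LoadComparable c C lam k) (hc : 0 < c)
    (hs : N.Stable lam k) (hl : 0 < N.load lam k) : N.load lam k ≤ C / c ^ 2 := by
  have h2 := (h.2.1 2 (by simp)).1
  have h4 := (h.2.1 4 (by simp)).2
  rw [centralMoment_eq] at h2 h4
  have hJ := absMoment_two_sq_le hs.hasMoments hs.isProbSeq
  rw [le_div_iff₀ (by positivity)]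
  have h3 : (c * N.load lam k) ^ 2 ≤ C * N.load lam k :=
    (pow_le_pow_left₀ (by positivity) h2 2).trans (hJ.trans h4)
  nlinarith

/-- The mean of a saturable queue, read off from its characteristic function. -/
theorem abs_openMean_sub_le_of_pole {ξ C : ℝ} (hs : N.Stable lam k) (hc : 0 < N.critIntensity)
    (hl : lam < N.critIntensity) {ψ : ℝ → ℂ} (hψ : Differentiable ℝ ψ) (hψ0 : ψ 0 = 1)
    (he : ∀ t, seqCF (N.openProb lam k) 0 t = geomCF (N.maxLoad lam) t ^ (ξ : ℂ) * ψ t)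
    (hd : ‖deriv ψ 0‖ ≤ C) : |N.openMean lam k - ξ * N.alpha lam| ≤ C := by
  have hρ0 := maxLoad_pos hc hs.1
  have hρ1 := maxLoad_lt_one hc hl
  have hm := hs.openMean_pos
  rw [openMean_eq] at hm
  have h1 := hasDerivAt_seqCF hs.isProbSeq hs.hasMoments hm 0
  have h2 := (hasDerivAt_geomCF_cpow hρ0.le hρ1 ξ 0).mul (hψ 0).hasDerivAt
  have h3 : seqCF (N.openProb lam k) 0 =
      (fun t => geomCF (N.maxLoad lam) t ^ (ξ : ℂ)) * ψ := funext fun t => he t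
  rw [h3] at h1
  have h4 := h1.unique h2
  have hsb : seqCF (sizeBias (N.openProb lam k)) 0 0 = 1 := by
    have := (hs.isProbSeq.sizeBias hs.hasMoments hm).hasSum
    rw [seqCF]
    simp only [Complex.ofReal_zero, mul_zero, Complex.exp_zero, mul_one]
    exact_mod_cast (Complex.hasSum_ofReal.2 this).tsum_eq
  rw [hsb, geomCF_zero hρ1, Complex.one_cpow, Complex.one_cpow, hψ0, ← openMean_eq] at h4
  simp only [Complex.ofReal_zero, mul_zero, Complex.exp_zero, mul_one, one_mul] at h4
  have h5 : ((N.openMean lam k - ξ * N.alpha lam : ℝ) : ℂ) = -Complex.I * deriv ψ 0 := by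
    have : deriv ψ 0 = Complex.I * ((N.openMean lam k : ℝ) : ℂ) -
        Complex.I * ((ξ * (N.maxLoad lam / (1 - N.maxLoad lam)) : ℝ) : ℂ) := by
      rw [h4]
      ring
    rw [this, alpha]
    push_cast
    linear_combination (((N.openMean lam k : ℝ) : ℂ) -
      (ξ * (N.maxLoad lam / (1 - N.maxLoad lam)) : ℂ)) * Complex.I_sq
  rw [← Real.norm_eq_abs, ← Complex.norm_real, h5, norm_mul, norm_neg, Complex.norm_I, one_mul]
  exact hd

/-- The moments of a saturable queue are bounded by powers of `1 + α`: its law is a tilt, with a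
parameter of order `1 / α`, of its law at a higher intensity, at which the mean is of order `1 + α`
too. -/
theorem expectation_openProb_pow_le {C : ℝ} (hc : 0 < N.critIntensity) (h0 : 0 < lam)
    (hl : lam < N.critIntensity) (hhalf : 1 / 2 ≤ N.maxLoad lam)
    (hmean : ∀ lam, 0 < lam → lam < N.critIntensity → N.openMean lam k ≤ C * (1 + N.alpha lam))
    (r : ℕ) : expectation (N.openProb lam k) (fun x => (x : ℝ) ^ r) ≤
      r.factorial * 2 ^ r * Real.exp (2 * C) * (1 + N.alpha lam) ^ r := by
  -- The intensity is halfway between `lam` and the critical one; `openProb lam` is a tilt of it.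
  set lam' := (lam + N.critIntensity) / 2 with hlam'
  have hl' : lam' < N.critIntensity := by linarith
  have hll : lam < lam' := by linarith
  have h0' : 0 < lam' := h0.trans hll
  have hs' := stable_of_lt h0' hl' k
  have hρ1 := maxLoad_lt_one hc hl
  set ρ := N.maxLoad lam with hρ
  have hρ' : N.maxLoad lam' = (1 + ρ) / 2 := by
    rw [hρ, maxLoad, maxLoad, hlam']
    field_simp
    ring
  have hratio : lam' / lam = (1 + ρ) / (2 * ρ) := by
    have : lam = ρ * N.critIntensity := by rw [hρ, maxLoad]; field_simp
    have hρ0 : ρ ≠ 0 := by linarith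
    have hc0 := hc.ne'
    rw [hlam', this]
    field_simp
    ring
  have hlt : 1 < lam' / lam := (one_lt_div h0).2 hll
  have hL : 0 < Real.log (lam' / lam) := Real.log_pos hlt
  have hρ0 : 0 < ρ := by linarith
  have hLup : Real.log (lam' / lam) ≤ 1 - ρ := by
    refine (Real.log_le_sub_one_of_pos (by positivity)).trans ?_
    rw [hratio, div_sub_one (by positivity), div_le_iff₀ (by positivity)]
    nlinarith
  have hLlow : (1 - ρ) / 2 ≤ Real.log (lam' / lam) := by
    have h1 := Real.one_sub_inv_le_log_of_pos (x := lam' / lam) (by positivity)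
    refine le_trans ?_ h1
    rw [hratio, inv_div, le_sub_comm, div_le_iff₀ (by positivity)]
    nlinarith
  have hm := hmean lam' h0' hl'
  rw [one_add_alpha hc hl', hρ'] at hm
  rw [one_add_alpha hc hl, ← hρ, hs'.openProb_eq_tilt h0]
  refine (expectation_tilt_pow_le hs'.hasMoments hs'.isProbSeq hL r).trans ?_
  have h1ρ : 0 < 1 - ρ := by linarith
  have he : Real.log (lam' / lam) * mean (N.openProb lam' k) ≤ 2 * C := by
    rw [← openMean_eq]
    calc _ ≤ (1 - ρ) * (C * (1 / (1 - (1 + ρ) / 2))) :=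
          mul_le_mul hLup hm hs'.openMean_pos.le h1ρ.le
      _ = 2 * C := by
          have : 1 - (1 + ρ) / 2 = (1 - ρ) / 2 := by ring
          rw [this]
          field_simp
  calc (r.factorial : ℝ) / Real.log (lam' / lam) ^ r *
        Real.exp (Real.log (lam' / lam) * mean (N.openProb lam' k))
      ≤ r.factorial / ((1 - ρ) / 2) ^ r * Real.exp (2 * C) := by gcongr
    _ = _ := by
        rw [div_pow, div_pow, one_pow]
        field_simp

/-- The central moments of a saturable queue near saturation are of the order of the powers of `1 +
α`. -/
theorem centralMoment_le_of_half_le {C : ℝ} (hc : 0 < N.critIntensity) (h0 : 0 < lam)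
    (hl : lam < N.critIntensity) (hhalf : 1 / 2 ≤ N.maxLoad lam) (hC : 0 ≤ C)
    (hmean : ∀ lam, 0 < lam → lam < N.critIntensity → N.openMean lam k ≤ C * (1 + N.alpha lam))
    {r : ℕ} (hr : r ≤ 4) : N.centralMoment lam k r ≤
      (24 * 2 ^ 4 * Real.exp (2 * C) + (1 + C) ^ 4) * (1 + N.alpha lam) ^ r := by
  have hs := stable_of_lt h0 hl k
  have hα := alpha_pos hc h0 hl
  rw [centralMoment_eq, add_mul]
  refine (absMoment_le hs.hasMoments hs.isProbSeq r).trans (add_le_add ?_ ?_)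
  · refine (expectation_openProb_pow_le hc h0 hl hhalf hmean r).trans ?_
    have h1 : (r.factorial : ℝ) ≤ 24 := by
      have := Nat.factorial_le hr
      exact_mod_cast this
    have h2 : (2 : ℝ) ^ r ≤ 2 ^ 4 := pow_le_pow_right₀ (by norm_num) hr
    gcongr
  · have h1 := hmean lam h0 hl
    rw [openMean_eq] at h1
    calc mean (N.openProb lam k) ^ r ≤ (C * (1 + N.alpha lam)) ^ r :=
          pow_le_pow_left₀ (mean_nonneg hs.isProbSeq) h1 r
      _ = C ^ r * (1 + N.alpha lam) ^ r := mul_pow _ _ _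
      _ ≤ (1 + C) ^ 4 * (1 + N.alpha lam) ^ r := by
          refine mul_le_mul_of_nonneg_right ?_ (by positivity)
          calc C ^ r ≤ (1 + C) ^ r := pow_le_pow_left₀ hC (by linarith) r
            _ ≤ _ := pow_le_pow_right₀ (by linarith) hr

/-- The assumptions provide bounds with a single constant. For the saturable queues, the assumption
on the service rates is used for `ρ⁰` below a threshold `A₁ < 1`; above it, the pole gives a mean of
order `1 + α`, and tilting gives the moments. -/
theorem exists_uniformBounds {N : (n : ℕ+) → ClosedNetwork n} {ξ : (n : ℕ+) → Fin n → ℝ}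
    (hfin : ∀ n, (N n).finiteQueues.Nonempty) (hcrit : ∀ n, 0 < (N n).critIntensity)
    (hpole : PoleAssumption N ξ) (hservice : ServiceAssumption N) (hnonsat : NonsatAssumption N)
    (hξ : ∃ B : ℝ, ∀ n, (N n).totalOrder (ξ n) ≤ B) :
    ∃ B : ℝ, ∀ n, (N n).UniformBounds (ξ n) B := by
  obtain ⟨Bξ, hBξ⟩ := hξ
  obtain ⟨ψ, Cψ, ξmax, hψ⟩ := hpole
  obtain ⟨Ans, hAns1, hAns⟩ := hnonsat
  obtain ⟨hserv, c₂, C₂, hc₂, hinf⟩ := hservice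
  obtain ⟨c₁, C₁, hc₁, hfinq⟩ := hserv Ans hAns1
  -- queues outside the set of saturable ones
  set c := min c₁ c₂ with hcdef
  set C := max C₁ C₂ with hCdef
  have hcpos : 0 < c := lt_min hc₁ hc₂
  have hcomp : ∀ n, ∀ k ∉ (N n).satQueues, ∀ lam, 0 < lam → lam ≤ (N n).critIntensity →
      (N n).LoadComparable c C lam k := by
    intro n k hk lam h0 hl
    have hload := (load_pos (hcrit n) h0 k).le
    by_cases hkf : k ∈ (N n).finiteQueues
    · refine (hfinq n k hkf lam h0 hl ?_).mono hload (min_le_left _ _) (le_max_left _ _)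
      exact (load_mono (hcrit n) hl k).trans (hAns n k ⟨hkf, hk⟩)
    · exact (hinf n k hkf lam h0 hl).mono hload (min_le_right _ _) (le_max_right _ _)
  have hloadC : ∀ n, ∀ k ∉ (N n).satQueues,
      (N n).load (N n).critIntensity k ≤ C / c ^ 2 := fun n k hk =>
    (hcomp n k hk _ (hcrit n) le_rfl).load_le hcpos (stable_crit (hcrit n) hk)
      (load_pos (hcrit n) (hcrit n) k)
  -- saturable queues
  have hpole' : ∀ n, ∀ lam, 0 < lam → lam < (N n).critIntensity → ∀ k ∈ (N n).satQueues,
      Differentiable ℝ (ψ n lam k) ∧ ψ n lam k 0 = 1 ∧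
      (∀ t, seqCF ((N n).openProb lam k) 0 t =
        geomCF ((N n).maxLoad lam) t ^ (ξ n k : ℂ) * ψ n lam k t) ∧
      ∀ t, ‖deriv (ψ n lam k) t‖ ≤ Cψ := by
    intro n lam h0 hl k hk
    obtain ⟨-, -, h3⟩ := hψ n k hk
    obtain ⟨hd, ht⟩ := h3 lam h0 hl
    have he : ∀ t, seqCF ((N n).openProb lam k) 0 t =
        geomCF ((N n).maxLoad lam) t ^ (ξ n k : ℂ) * ψ n lam k t := fun t => by
      have h4 := (ht t).1
      rw [charFn_eq, seqCF_eq_exp_mul, mul_assoc (Complex.exp _)] at h4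
      exact mul_left_cancel₀ (Complex.exp_ne_zero _) h4
    refine ⟨hd, ?_, he, fun t => (ht t).2⟩
    have h5 := he 0
    have hs := stable_of_lt h0 hl k
    have h6 : seqCF ((N n).openProb lam k) 0 0 = 1 := by
      rw [seqCF]
      simp only [Complex.ofReal_zero, mul_zero, Complex.exp_zero, mul_one]
      exact_mod_cast (Complex.hasSum_ofReal.2 hs.isProbSeq.hasSum).tsum_eq
    rw [h6, geomCF_zero (maxLoad_lt_one (hcrit n) hl), Complex.one_cpow, one_mul] at h5
    exact h5.symm
  have hξB : ∀ n, ∀ k ∈ (N n).satQueues, ξ n k ≤ Bξ := by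
    classical
    intro n k hk
    refine le_trans ?_ (hBξ n)
    refine single_le_sum (f := ξ n) (fun i hi => ?_) (by simpa using hk)
    have := (hψ n i (by simpa using hi)).1
    linarith
  have hmean : ∀ n, ∀ k ∈ (N n).satQueues, ∀ lam, 0 < lam → lam < (N n).critIntensity →
      |(N n).openMean lam k - ξ n k * (N n).alpha lam| ≤ |Cψ| := by
    intro n k hk lam h0 hl
    obtain ⟨g1, g2, g3, g4⟩ := hpole' n lam h0 hl k hk
    exact abs_openMean_sub_le_of_pole (stable_of_lt h0 hl k) (hcrit n) hl g1 g2 g3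
      ((g4 0).trans (le_abs_self _))
  set D := |Bξ| + |Cψ| with hD
  have hD0 : 0 ≤ D := by positivity
  have hmeanD : ∀ n, ∀ k ∈ (N n).satQueues, ∀ lam, 0 < lam → lam < (N n).critIntensity →
      (N n).openMean lam k ≤ D * (1 + (N n).alpha lam) := by
    intro n k hk lam h0 hl
    have h1 := (abs_le.1 (hmean n k hk lam h0 hl)).2
    have hα := alpha_pos (hcrit n) h0 hl
    have h2 : ξ n k * (N n).alpha lam ≤ |Bξ| * (N n).alpha lam :=
      mul_le_mul_of_nonneg_right ((hξB n k hk).trans (le_abs_self _)) hα.le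
    have h3 := mul_nonneg (abs_nonneg Cψ) hα.le
    have h4 := abs_nonneg Bξ
    rw [hD]
    linarith
  -- the load below which the assumption on the service rates is used: it makes `1 + α` at least
  -- `2 Cψ + 2` above it
  set A₁ : ℝ := 1 - 1 / (2 * |Cψ| + 2) with hA₁
  have hA₁lt : A₁ < 1 := by
    have : 0 < 1 / (2 * |Cψ| + 2) := by positivity
    linarith
  have hA₁half : 1 / 2 ≤ A₁ := by
    have : 1 / (2 * |Cψ| + 2) ≤ 1 / 2 :=
      one_div_le_one_div_of_le (by norm_num) (by linarith [abs_nonneg Cψ])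
    linarith
  obtain ⟨c₃, C₃, hc₃, hsatq⟩ := hserv A₁ hA₁lt
  set M := 24 * 2 ^ 4 * Real.exp (2 * D) + (1 + D) ^ 4 with hM
  have hM0 : 0 ≤ M := by positivity
  have hlow : ∀ n, ∀ k ∈ (N n).satQueues, ∀ lam, 0 < lam → lam < (N n).critIntensity →
      (N n).maxLoad lam ≤ A₁ → (N n).LoadComparable c₃ C₃ lam k ∧
        0 < (N n).load lam k ∧ (N n).load lam k ≤ 1 := by
    intro n k hk lam h0 hl hle
    refine ⟨hsatq n k hk.1 lam h0 hl.le ?_, load_pos (hcrit n) h0 k, ?_⟩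
    · rw [load_of_mem_satQueues hk]
      exact hle
    · rw [load_of_mem_satQueues hk]
      linarith
  have hC₃ : ∀ n, ∀ k ∈ (N n).satQueues, ∀ lam, 0 < lam → lam < (N n).critIntensity →
      (N n).maxLoad lam ≤ A₁ → 0 ≤ C₃ := by
    intro n k hk lam h0 hl hle
    obtain ⟨g1, g2, -⟩ := hlow n k hk lam h0 hl hle
    have := g1.1.1.trans g1.1.2
    nlinarith
  -- Above `A₁`, `α` is so large that `α ≤ ξ α` dominates the error in the mean.
  have hhigh : ∀ n, ∀ k ∈ (N n).satQueues, ∀ lam, 0 < lam → lam < (N n).critIntensity →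
      A₁ < (N n).maxLoad lam → 1 + (N n).alpha lam ≤ 4 * (N n).openMean lam k := by
    intro n k hk lam h0 hl hlt
    have h1 := (abs_le.1 (hmean n k hk lam h0 hl)).1
    have hα := alpha_pos (hcrit n) h0 hl
    have hξ1 := (hψ n k hk).1
    have h2 : 2 * |Cψ| + 2 ≤ 1 + (N n).alpha lam := by
      rw [one_add_alpha (hcrit n) hl, le_div_iff₀ (by linarith [maxLoad_lt_one (hcrit n) hl])]
      have h3 : 1 - (N n).maxLoad lam ≤ 1 / (2 * |Cψ| + 2) := by
        rw [hA₁] at hlt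
        linarith
      have h4 := mul_le_mul_of_nonneg_left h3 (by positivity : 0 ≤ 2 * |Cψ| + 2)
      rwa [mul_one_div_cancel (by positivity)] at h4
    have h5 : 1 * (N n).alpha lam ≤ ξ n k * (N n).alpha lam :=
      mul_le_mul_of_nonneg_right hξ1 hα.le
    linarith [abs_nonneg Cψ]
  have hmom : ∀ n, ∀ k ∈ (N n).satQueues, ∀ lam, 0 < lam → lam < (N n).critIntensity →
      ∀ r ∈ ({2, 3, 4} : Set ℕ),
        (N n).centralMoment lam k r ≤ (M + |C₃|) * (1 + (N n).alpha lam) ^ r := by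
    intro n k hk lam h0 hl r hr
    have hα := alpha_pos (hcrit n) h0 hl
    have hpow : 1 ≤ (1 + (N n).alpha lam) ^ r := one_le_pow₀ (by linarith)
    rcases le_or_gt ((N n).maxLoad lam) A₁ with h | h
    · obtain ⟨g1, g2, g3⟩ := hlow n k hk lam h0 hl h
      have h1 := (g1.2.1 r hr).2
      have hC := hC₃ n k hk lam h0 hl h
      rw [abs_of_nonneg hC]
      have h2 : C₃ * (N n).load lam k ≤ C₃ * 1 := mul_le_mul_of_nonneg_left g3 hC
      have h3 : C₃ * 1 ≤ C₃ * (1 + (N n).alpha lam) ^ r := mul_le_mul_of_nonneg_left hpow hC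
      have h4 : 0 ≤ M * (1 + (N n).alpha lam) ^ r := by positivity
      linarith
    · have hr4 : r ≤ 4 := by
        rcases hr with rfl | rfl | rfl <;> norm_num
      have h1 := centralMoment_le_of_half_le (hcrit n) h0 hl (by linarith) hD0 (hmeanD n k hk) hr4
      have h4 : 0 ≤ |C₃| * (1 + (N n).alpha lam) ^ r := by positivity
      linarith
  have hrel : ∀ n, ∀ k ∈ (N n).satQueues, ∀ lam, 0 < lam → lam < (N n).critIntensity →
      ∀ r ∈ ({2, 3, 4} : Set ℕ), (N n).centralMoment lam k r ≤
        (4 * (M + |C₃|) + |C₃| / c₃) * (1 + (N n).alpha lam) ^ (r - 1) *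
          (N n).openMean lam k := by
    intro n k hk lam h0 hl r hr
    have hα := alpha_pos (hcrit n) h0 hl
    have hpow : 1 ≤ (1 + (N n).alpha lam) ^ (r - 1) := one_le_pow₀ (by linarith)
    have hm := (stable_of_lt h0 hl k).openMean_pos
    rcases le_or_gt ((N n).maxLoad lam) A₁ with h | h
    · obtain ⟨g1, g2, g3⟩ := hlow n k hk lam h0 hl h
      have h1 := (g1.2.1 r hr).2
      have h2 := g1.1.1
      have hC := hC₃ n k hk lam h0 hl h
      rw [abs_of_nonneg hC]
      have h3 : C₃ * (N n).load lam k ≤ C₃ / c₃ * (N n).openMean lam k := by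
        rw [div_mul_eq_mul_div, le_div_iff₀ hc₃]
        nlinarith
      have h4 : C₃ / c₃ * (N n).openMean lam k ≤
          C₃ / c₃ * (1 + (N n).alpha lam) ^ (r - 1) * (N n).openMean lam k := by
        refine mul_le_mul_of_nonneg_right ?_ hm.le
        exact le_mul_of_one_le_right (by positivity) hpow
      have h5 : 0 ≤ 4 * (M + C₃) * (1 + (N n).alpha lam) ^ (r - 1) * (N n).openMean lam k := by
        positivity
      linarith
    · have h1 := hmom n k hk lam h0 hl r hr
      have h2 := hhigh n k hk lam h0 hl h
      have hr1 : r = (r - 1) + 1 := by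
        rcases hr with rfl | rfl | rfl <;> norm_num
      rw [hr1, pow_succ] at h1
      rw [← hr1] at h1
      have h3 : (M + |C₃|) * ((1 + (N n).alpha lam) ^ (r - 1) * (1 + (N n).alpha lam)) ≤
          (M + |C₃|) * ((1 + (N n).alpha lam) ^ (r - 1) * (4 * (N n).openMean lam k)) := by
        gcongr
      have h5 : 0 ≤ |C₃| / c₃ * (1 + (N n).alpha lam) ^ (r - 1) * (N n).openMean lam k := by
        positivity
      linarith
  have hMC : 0 ≤ M + |C₃| := by positivity
  have hrc : 0 ≤ 4 * (M + |C₃|) + |C₃| / c₃ := by positivity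
  have hCc : 0 ≤ |C| / c ^ 2 := by positivity
  have hci : 0 ≤ c⁻¹ := by positivity
  set B : ℝ := 1 + |C| + c⁻¹ + |C| / c ^ 2 + |Bξ| + |Cψ| + (M + |C₃|) +
    (4 * (M + |C₃|) + |C₃| / c₃) with hB
  have hB1 : 1 ≤ B := by
    have := abs_nonneg C
    have := abs_nonneg Bξ
    have := abs_nonneg Cψ
    linarith
  have hB0 : 0 < B := by linarith
  have hlist : |C| ≤ B ∧ c⁻¹ ≤ B ∧ |C| / c ^ 2 ≤ B ∧ |Bξ| ≤ B ∧ |Cψ| ≤ B ∧ M + |C₃| ≤ B ∧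
      4 * (M + |C₃|) + |C₃| / c₃ ≤ B := by
    have := abs_nonneg C
    have := abs_nonneg Bξ
    have := abs_nonneg Cψ
    refine ⟨?_, ?_, ?_, ?_, ?_, ?_, ?_⟩ <;> linarith
  obtain ⟨b1, b2, b3, b4, b5, b6, b7⟩ := hlist
  refine ⟨B, fun n => ?_⟩
  refine ⟨hB1, hcrit n, satQueues_nonempty (hfin n), fun k hk lam h0 hl => ?_, fun k hk => ?_,
    fun k hk => (hψ n k hk).1, (hBξ n).trans ((le_abs_self _).trans b4),
    fun k hk lam h0 hl => (hmean n k hk lam h0 hl).trans b5, fun k hk lam h0 hl r hr => ?_,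
    fun k hk lam h0 hl => ?_, fun lam h0 hl => ?_⟩
  · refine (hcomp n k hk lam h0 hl).mono (load_pos (hcrit n) h0 k).le ?_
      ((le_abs_self _).trans b1)
    exact (inv_le_comm₀ hcpos hB0).1 b2
  · refine (hloadC n k hk).trans (le_trans ?_ b3)
    gcongr
    exact le_abs_self _
  · have hα := alpha_pos (hcrit n) h0 hl
    exact (hmom n k hk lam h0 hl r hr).trans (mul_le_mul_of_nonneg_right b6 (by positivity))
  · have hα := alpha_pos (hcrit n) h0 hl
    have hm := (stable_of_lt h0 hl k).openMean_pos
    have h1 := hrel n k hk lam h0 hl 3 (by simp)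
    norm_num only [Nat.reduceSub] at h1
    refine h1.trans ?_
    gcongr
  · refine ⟨ψ n lam, fun k hk => ?_⟩
    obtain ⟨g1, g2, g3, g4⟩ := hpole' n lam h0 hl k hk
    exact ⟨g1, g2, g3, fun t => (g4 t).trans ((le_abs_self _).trans b5)⟩

/-- Since the load of a saturable queue is one at the critical intensity, negligibility of the
largest share in the total load forces this total to infinity; the saturable queues contribute a
bounded amount. -/
theorem tendsto_critMean {N : (n : ℕ+) → ClosedNetwork n} {ξ : (n : ℕ+) → Fin n → ℝ} {B : ℝ}
    (hB : ∀ n, (N n).UniformBounds (ξ n) B) (huan : UANAssumption N) :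
    Tendsto (fun n => (N n).critMean) atTop atTop := by
  classical
  have hB1 := (hB 1).one_le
  have hB0 : 0 < B := by linarith
  -- a saturated queue has load one, hence the sum of the loads tends to infinity
  have hsum : ∀ n : ℕ+, 0 < ⨆ k : Fin n, ((N n).visit k / (N n).serviceRate k) /
      ∑ l, (N n).visit l / (N n).serviceRate l ∧
      1 / (⨆ k : Fin n, ((N n).visit k / (N n).serviceRate k) /
        ∑ l, (N n).visit l / (N n).serviceRate l) ≤ ∑ k, (N n).load (N n).critIntensity k := by
    intro n
    have hc := (hB n).crit_pos
    obtain ⟨j, hj⟩ := (hB n).sat_nonempty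
    have hv : ∀ k, 0 < (N n).visit k / (N n).serviceRate k := fun k =>
      div_pos ((N n).visit_pos k) (serviceRate_pos hc k)
    have hload : ∀ k, (N n).load (N n).critIntensity k =
        (N n).critIntensity * ((N n).visit k / (N n).serviceRate k) := fun k => by
      rw [load, mul_div_assoc]
    have hj1 : (N n).critIntensity * ((N n).visit j / (N n).serviceRate j) = 1 := by
      rw [← hload, load_of_mem_satQueues hj, maxLoad, div_self hc.ne']
    have hle := le_ciSup (f := fun k : Fin n => ((N n).visit k / (N n).serviceRate k) /
      ∑ l, (N n).visit l / (N n).serviceRate l) (Set.finite_range _).bddAbove j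
    have hS : 0 < ∑ l, (N n).visit l / (N n).serviceRate l :=
      sum_pos (fun l _ => hv l) ⟨j, mem_univ j⟩
    have hpos := (div_pos (hv j) hS).trans_le hle
    refine ⟨hpos, ?_⟩
    rw [div_le_iff₀ hpos, sum_congr rfl fun k _ => hload k, ← mul_sum]
    calc (1 : ℝ) = (N n).critIntensity * (∑ l, (N n).visit l / (N n).serviceRate l) *
          (((N n).visit j / (N n).serviceRate j) / ∑ l, (N n).visit l / (N n).serviceRate l) := by
          rw [mul_assoc, mul_div_cancel₀ _ hS.ne', hj1]
      _ ≤ _ := mul_le_mul_of_nonneg_left hle (by positivity)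
  have hlow : ∀ n : ℕ+, B⁻¹ * (∑ k, (N n).load (N n).critIntensity k - B) ≤ (N n).critMean := by
    intro n
    have hc := (hB n).crit_pos
    have h1 : ∑ k with k ∈ (N n).satQueues, (N n).load (N n).critIntensity k ≤ B := by
      refine le_trans (sum_le_sum fun k hk => ?_) (hB n).order_le
      have hk' : k ∈ (N n).satQueues := by simpa using hk
      rw [load_of_mem_satQueues hk', maxLoad, div_self hc.ne']
      exact (hB n).one_le_order k hk'
    have h2 := sum_filter_add_sum_filter_not univ (fun k => k ∈ (N n).satQueues)
      fun k => (N n).load (N n).critIntensity k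
    have h3 : B⁻¹ * ∑ k with k ∉ (N n).satQueues, (N n).load (N n).critIntensity k ≤
        (N n).critMean := by
      rw [critMean, mul_sum]
      have : ∀ k ∈ ({k | k ∉ (N n).satQueues} : Finset (Fin n)),
          B⁻¹ * (N n).load (N n).critIntensity k ≤ (N n).openMean (N n).critIntensity k :=
        fun k hk => ((hB n).comparable k (by simpa using hk) _ hc le_rfl).1.1
      refine (sum_le_sum this).trans_eq ?_
      congr
    refine le_trans (mul_le_mul_of_nonneg_left ?_ (by positivity)) h3
    linarith
  have hlim : Tendsto (fun n : ℕ+ => ∑ k, (N n).load (N n).critIntensity k) atTop atTop := by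
    refine tendsto_atTop_mono (fun n => (hsum n).2) ?_
    have h0 : Tendsto (fun n : ℕ+ => ⨆ k : Fin n, ((N n).visit k / (N n).serviceRate k) /
        ∑ l, (N n).visit l / (N n).serviceRate l) atTop (𝓝[>] 0) :=
      tendsto_nhdsWithin_iff.2 ⟨huan, Eventually.of_forall fun n => (hsum n).1⟩
    simp only [one_div]
    exact h0.inv_tendsto_nhdsGT_zero
  refine tendsto_atTop_mono hlow ?_
  exact (tendsto_atTop_add_const_right _ _ hlim).const_mul_atTop (by positivity)

end ClosedNetwork

namespace ClosedNetwork

open MeasureTheory Finset ProductForm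

/-! ### Sums over the queues of one network -/

open Classical in
/-- The total load of the queues outside `𝓕⁰`. -/
noncomputable def bulkLoad {n : ℕ} (N : ClosedNetwork n) (lam : ℝ) : ℝ :=
  ∑ k with k ∉ N.satQueues, N.load lam k

open Classical in
/-- The mean number of customers outside `𝓕⁰`. -/
noncomputable def bulkMean {n : ℕ} (N : ClosedNetwork n) (lam : ℝ) : ℝ :=
  ∑ k with k ∉ N.satQueues, N.openMean lam k

namespace UniformBounds

variable {n : ℕ} {N : ClosedNetwork n} {ξ : Fin n → ℝ} {B lam : ℝ} {k : Fin n}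

theorem pos (hB : N.UniformBounds ξ B) : 0 < B := lt_of_lt_of_le one_pos hB.one_le

open Classical in
theorem card_sat_le (hB : N.UniformBounds ξ B) : (#{k | k ∈ N.satQueues} : ℝ) ≤ B := by
  refine le_trans ?_ hB.order_le
  rw [totalOrder, ← nsmul_one, ← sum_const]
  exact sum_le_sum fun k hk => hB.one_le_order k (by simpa using hk)

theorem order_le_of_mem (hB : N.UniformBounds ξ B) (hk : k ∈ N.satQueues) : ξ k ≤ B := by
  classical
  refine le_trans ?_ hB.order_le
  refine single_le_sum (f := ξ) (fun i hi => ?_) (by simpa using hk)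
  linarith [hB.one_le_order i (by simpa using hi)]

theorem one_le_totalOrder (hB : N.UniformBounds ξ B) : 1 ≤ N.totalOrder ξ := by
  classical
  obtain ⟨j, hj⟩ := hB.sat_nonempty
  refine (hB.one_le_order j hj).trans ?_
  refine single_le_sum (f := ξ) (fun i hi => ?_) (by simpa using hj)
  linarith [hB.one_le_order i (by simpa using hi)]

theorem load_le_of_le (hB : N.UniformBounds ξ B) (hk : k ∉ N.satQueues)
    (hl : lam ≤ N.critIntensity) : N.load lam k ≤ B :=
  (load_mono hB.crit_pos hl k).trans (hB.load_le k hk)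

theorem openMean_le (hB : N.UniformBounds ξ B) (hk : k ∉ N.satQueues) (h0 : 0 < lam)
    (hl : lam ≤ N.critIntensity) : N.openMean lam k ≤ B ^ 2 := by
  refine ((hB.comparable k hk lam h0 hl).1.2).trans ?_
  rw [pow_two]
  exact mul_le_mul_of_nonneg_left (hB.load_le_of_le hk hl) hB.pos.le

theorem centralMoment_le (hB : N.UniformBounds ξ B) (hk : k ∉ N.satQueues) (h0 : 0 < lam)
    (hl : lam ≤ N.critIntensity) {r : ℕ} (hr : r ∈ ({2, 3, 4} : Set ℕ)) :
    N.centralMoment lam k r ≤ B ^ 2 := by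
  refine (((hB.comparable k hk lam h0 hl).2.1 r hr).2).trans ?_
  rw [pow_two]
  exact mul_le_mul_of_nonneg_left (hB.load_le_of_le hk hl) hB.pos.le

theorem openMean_sat_le (hB : N.UniformBounds ξ B) (hk : k ∈ N.satQueues) (h0 : 0 < lam)
    (hl : lam < N.critIntensity) : N.openMean lam k ≤ B * (1 + N.alpha lam) := by
  have h1 := (abs_le.1 (hB.mean_sat k hk lam h0 hl)).2
  have hα := alpha_pos hB.crit_pos h0 hl
  have h2 := mul_le_mul_of_nonneg_right (hB.order_le_of_mem hk) hα.le
  linarith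

theorem bulkLoad_nonneg (hB : N.UniformBounds ξ B) (h0 : 0 < lam) : 0 ≤ N.bulkLoad lam :=
  sum_nonneg fun k _ => (load_pos hB.crit_pos h0 k).le

theorem bulkLoad_le (hB : N.UniformBounds ξ B) (h0 : 0 < lam) (hl : lam ≤ N.critIntensity) :
    N.bulkLoad lam ≤ B * N.bulkMean lam := by
  rw [bulkLoad, bulkMean, mul_sum]
  refine sum_le_sum fun k hk => ?_
  have h1 := (hB.comparable k (by simpa using hk) lam h0 hl).1.1
  rwa [inv_mul_le_iff₀ hB.pos] at h1

theorem bulkMean_le (hB : N.UniformBounds ξ B) (h0 : 0 < lam) (hl : lam ≤ N.critIntensity) :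
    N.bulkMean lam ≤ B * N.bulkLoad lam := by
  rw [bulkLoad, bulkMean, mul_sum]
  exact sum_le_sum fun k hk => (hB.comparable k (by simpa using hk) lam h0 hl).1.2

/-- The mean number of customers of the open system: that of the queues outside `𝓕⁰` and `ξ α` for
the others, up to a bounded error. -/
theorem abs_sum_openMean_sub_le (hB : N.UniformBounds ξ B) (h0 : 0 < lam)
    (hl : lam < N.critIntensity) :
    |∑ k, N.openMean lam k - N.bulkMean lam - N.totalOrder ξ * N.alpha lam| ≤ B ^ 2 := by
  classical
  have h1 := sum_filter_add_sum_filter_not univ (fun k => k ∈ N.satQueues)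
    fun k => N.openMean lam k
  have h2 : ∑ k, N.openMean lam k - N.bulkMean lam - N.totalOrder ξ * N.alpha lam =
      ∑ k with k ∈ N.satQueues, (N.openMean lam k - ξ k * N.alpha lam) := by
    rw [sum_sub_distrib, ← sum_mul, ← h1, bulkMean, totalOrder]
    ring_nf
  rw [h2]
  calc _ ≤ ∑ k with k ∈ N.satQueues, B :=
        (abs_sum_le_sum_abs _ _).trans (sum_le_sum fun k hk =>
          hB.mean_sat k (by simpa using hk) lam h0 hl)
    _ = (#{k | k ∈ N.satQueues} : ℝ) * B := by rw [sum_const, nsmul_eq_mul]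
    _ ≤ B * B := mul_le_mul_of_nonneg_right hB.card_sat_le hB.pos.le
    _ = B ^ 2 := (pow_two B).symm

theorem sum_centralMoment_le (hB : N.UniformBounds ξ B) (h0 : 0 < lam)
    (hl : lam < N.critIntensity) {r : ℕ} (hr : r ∈ ({2, 3, 4} : Set ℕ)) (s : Finset (Fin n)) :
    ∑ k ∈ s, N.centralMoment lam k r ≤
      B * N.bulkLoad lam + B ^ 2 * (1 + N.alpha lam) ^ r := by
  classical
  have hα := alpha_pos hB.crit_pos h0 hl
  have hnn : ∀ k, 0 ≤ N.centralMoment lam k r := fun k =>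
    absMoment_nonneg (stable_of_lt h0 hl k).isProbSeq r
  refine (sum_le_univ_sum_of_nonneg hnn).trans ?_
  rw [← sum_filter_add_sum_filter_not univ (fun k => k ∈ N.satQueues), add_comm]
  refine add_le_add ?_ ?_
  · rw [bulkLoad, mul_sum]
    refine (sum_le_sum fun k hk =>
      ((hB.comparable k (by simpa using hk) lam h0 hl.le).2.1 r hr).2).trans_eq ?_
    congr
  · calc _ ≤ ∑ k with k ∈ N.satQueues, B * (1 + N.alpha lam) ^ r :=
          sum_le_sum fun k hk => hB.moment_sat k (by simpa using hk) lam h0 hl r hr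
      _ = (#{k | k ∈ N.satQueues} : ℝ) * (B * (1 + N.alpha lam) ^ r) := by
          rw [sum_const, nsmul_eq_mul]
      _ ≤ B * (B * (1 + N.alpha lam) ^ r) := by
          have := hB.pos
          exact mul_le_mul_of_nonneg_right hB.card_sat_le (by positivity)
      _ = _ := by ring

/-- Removing a few queues does not affect a sum of the order of the total load. -/
theorem le_sum_compl (hB : N.UniformBounds ξ B) (hl : lam ≤ N.critIntensity) {f : Fin n → ℝ}
    (hf : ∀ k, 0 ≤ f k) (hload : ∀ k ∉ N.satQueues, B⁻¹ * N.load lam k ≤ f k)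
    (J : Finset (Fin n)) : B⁻¹ * (N.bulkLoad lam - #J * B) ≤ ∑ k ∈ Jᶜ, f k := by
  classical
  have hBp := hB.pos
  set S : Finset (Fin n) := {k | k ∉ N.satQueues} with hS
  have h1 : N.bulkLoad lam - #J * B ≤ ∑ k ∈ S \ J, N.load lam k := by
    have e : N.bulkLoad lam = ∑ k ∈ S, N.load lam k := by
      rw [bulkLoad, hS]
    have h2 := sum_inter_add_sum_sdiff S J fun k => N.load lam k
    have h3 : ∑ k ∈ S ∩ J, N.load lam k ≤ #J * B := by
      calc ∑ k ∈ S ∩ J, N.load lam k ≤ ∑ k ∈ S ∩ J, B :=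
            sum_le_sum fun k hk => hB.load_le_of_le (by
              have := (mem_inter.1 hk).1
              simpa [hS] using this) hl
        _ = #(S ∩ J) * B := by rw [sum_const, nsmul_eq_mul]
        _ ≤ #J * B := by
            refine mul_le_mul_of_nonneg_right ?_ hBp.le
            exact_mod_cast card_le_card inter_subset_right
    rw [e]
    linarith
  calc _ ≤ B⁻¹ * ∑ k ∈ S \ J, N.load lam k := mul_le_mul_of_nonneg_left h1 (by positivity)
    _ = ∑ k ∈ S \ J, B⁻¹ * N.load lam k := mul_sum _ _ _
    _ ≤ ∑ k ∈ S \ J, f k := sum_le_sum fun k hk => hload k (by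
        have := (mem_sdiff.1 hk).1
        simpa [hS] using this)
    _ ≤ ∑ k ∈ Jᶜ, f k := by
        refine sum_le_sum_of_subset_of_nonneg (fun k hk => ?_) fun k _ _ => hf k
        exact mem_compl.2 (mem_sdiff.1 hk).2

theorem le_sum_secondMoment (hB : N.UniformBounds ξ B) (h0 : 0 < lam)
    (hl : lam < N.critIntensity) (J : Finset (Fin n)) :
    B⁻¹ * (N.bulkLoad lam - #J * B) ≤ ∑ k ∈ Jᶜ, absMoment (N.openProb lam k) 2 :=
  hB.le_sum_compl hl.le (fun k => absMoment_nonneg (stable_of_lt h0 hl k).isProbSeq 2)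
    (fun k hk => ((hB.comparable k hk lam h0 hl.le).2.1 2 (by simp)).1) J

theorem le_sum_pairing (hB : N.UniformBounds ξ B) (h0 : 0 < lam)
    (hl : lam < N.critIntensity) (J : Finset (Fin n)) :
    B⁻¹ * (N.bulkLoad lam - #J * B) ≤ ∑ k ∈ Jᶜ, pairing (N.openProb lam k) := by
  refine hB.le_sum_compl hl.le (fun k => ?_)
    (fun k hk => ((hB.comparable k hk lam h0 hl.le).2.2).1) J
  have h := fun x => ((stable_of_lt h0 hl k).openProb_pos x).le
  exact tsum_nonneg fun i => div_nonneg (mul_nonneg (h _) (h _)) (add_nonneg (h _) (h _))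

/-- Between an intensity and the critical one, the mean number of customers outside `𝓕⁰` varies by a
proportion of the order of `log (1 / ρ⁰)`, because the two laws of each queue are tilts of each
other. -/
theorem critMean_sub_bulkMean_le (hB : N.UniformBounds ξ B) (h0 : 0 < lam)
    (hl : lam < N.critIntensity) : 0 ≤ N.critMean - N.bulkMean lam ∧
      N.critMean - N.bulkMean lam ≤ Real.log (1 / N.maxLoad lam) *
        Real.exp (Real.log (1 / N.maxLoad lam) * B ^ 2) * B ^ 2 * N.critMean := by
  classical
  have hc := hB.crit_pos
  have hBp := hB.pos
  have hρ0 := maxLoad_pos hc h0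
  have hρ1 := maxLoad_lt_one hc hl
  have hLe : N.critIntensity / lam = 1 / N.maxLoad lam := by
    rw [maxLoad, one_div_div]
  have hL : 0 ≤ Real.log (1 / N.maxLoad lam) :=
    Real.log_nonneg ((one_le_div hρ0).2 hρ1.le)
  set L := Real.log (1 / N.maxLoad lam) with hLdef
  have key : ∀ k ∈ ({k | k ∉ N.satQueues} : Finset (Fin n)),
      0 ≤ N.openMean N.critIntensity k - N.openMean lam k ∧
      N.openMean N.critIntensity k - N.openMean lam k ≤
        L * Real.exp (L * B ^ 2) * B ^ 2 * N.openMean N.critIntensity k := by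
    intro k hk
    have hk' : k ∉ N.satQueues := by simpa using hk
    have hs := stable_crit hc hk'
    have h1 := mean_sub_mean_tilt hs.hasMoments hs.isProbSeq hL
    rw [hLdef, ← hLe, ← hs.openProb_eq_tilt h0, hLe, ← hLdef] at h1
    refine ⟨h1.1, h1.2.trans ?_⟩
    have hm := hB.openMean_le hk' hc le_rfl
    have hcmp := hB.comparable k hk' _ hc le_rfl
    have h2 : absMoment (N.openProb N.critIntensity k) 2 ≤
        B ^ 2 * N.openMean N.critIntensity k := by
      have h3 := hcmp.1.1
      rw [inv_mul_le_iff₀ hBp] at h3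
      calc _ ≤ B * N.load N.critIntensity k := (hcmp.2.1 2 (by simp)).2
        _ ≤ B * (B * N.openMean N.critIntensity k) := mul_le_mul_of_nonneg_left h3 hBp.le
        _ = _ := by ring
    rw [openMean_eq] at hm h2 ⊢
    rw [mul_assoc _ (B ^ 2)]
    have h4 := absMoment_nonneg hs.isProbSeq 2
    gcongr
  have e : N.critMean - N.bulkMean lam = ∑ k with k ∉ N.satQueues,
      (N.openMean N.critIntensity k - N.openMean lam k) := by
    rw [sum_sub_distrib, critMean, bulkMean]
  rw [e]
  refine ⟨sum_nonneg fun k hk => (key k hk).1, (sum_le_sum fun k hk => (key k hk).2).trans_eq ?_⟩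
  rw [← mul_sum, critMean]

end UniformBounds

/-! ### The subcritical regime -/

/-- Below the critical number of customers, the distance to saturation is at least of the order of
the relative distance `θ` to criticality. -/
theorem exists_one_add_alpha_mul_le (B : ℝ) :
    ∃ K : ℝ, 1 ≤ K ∧ ∀ {n : ℕ} {N : ClosedNetwork n} {ξ : Fin n → ℝ}, N.UniformBounds ξ B →
      ∀ {m : ℕ} {lam θ : ℝ}, N.IsIntensity m lam → 0 < N.critMean →
      (m : ℝ) / N.critMean ≤ 1 - θ → (1 + N.alpha lam) * θ ≤ K := by
  refine ⟨2 + 2 * Real.exp (B ^ 2) * B ^ 2, ?_, ?_⟩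
  · have : 0 ≤ 2 * Real.exp (B ^ 2) * B ^ 2 := by positivity
    linarith
  intro n N ξ hB m lam θ hI hcm hm
  obtain ⟨h0, hl, hmean⟩ := hI
  have hc := hB.crit_pos
  have hρ0 := maxLoad_pos hc h0
  have hρ1 := maxLoad_lt_one hc hl
  have hE : 0 ≤ 2 * Real.exp (B ^ 2) * B ^ 2 := by positivity
  rw [one_add_alpha hc hl, one_div_mul_eq_div, div_le_iff₀ (by linarith)]
  have hθ1 : θ ≤ 1 := by
    have : 0 ≤ (m : ℝ) / N.critMean := by positivity
    linarith
  rcases lt_or_ge (N.maxLoad lam) (1 / 2) with hh | hh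
  · have h1 : 1 / 2 < 1 - N.maxLoad lam := by linarith
    nlinarith
  · have h1 := (hB.critMean_sub_bulkMean_le h0 hl).2
    have h2 : N.bulkMean lam ≤ m := by
      classical
      rw [← hmean, bulkMean]
      exact sum_le_sum_of_subset_of_nonneg (filter_subset _ _) fun k _ _ =>
        (stable_of_lt h0 hl k).openMean_pos.le
    rw [div_le_iff₀ hcm] at hm
    have hLup : Real.log (1 / N.maxLoad lam) ≤ 2 * (1 - N.maxLoad lam) := by
      refine (Real.log_le_sub_one_of_pos (by positivity)).trans ?_
      rw [div_sub_one hρ0.ne', div_le_iff₀ hρ0]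
      nlinarith
    have hL0 : 0 ≤ Real.log (1 / N.maxLoad lam) :=
      Real.log_nonneg ((one_le_div hρ0).2 hρ1.le)
    set L := Real.log (1 / N.maxLoad lam)
    have h3 : θ * N.critMean ≤ L * Real.exp (L * B ^ 2) * B ^ 2 * N.critMean := by linarith
    have h4 : θ ≤ L * Real.exp (L * B ^ 2) * B ^ 2 := le_of_mul_le_mul_right h3 hcm
    have h5 : L * Real.exp (L * B ^ 2) * B ^ 2 ≤
        2 * (1 - N.maxLoad lam) * Real.exp (1 * B ^ 2) * B ^ 2 := by
      have : L ≤ 1 := by linarith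
      gcongr
    rw [one_mul] at h5
    have h6 : 0 ≤ 2 * (1 - N.maxLoad lam) := by linarith
    linarith

/-- The total load of the queues outside `𝓕⁰` is of the order of the number of customers, when the
latter is large compared with `1 + α`. -/
theorem UniformBounds.bulkLoad_bounds {n : ℕ} {N : ClosedNetwork n} {ξ : Fin n → ℝ} {B lam : ℝ}
    (hB : N.UniformBounds ξ B) {m : ℕ} (hI : N.IsIntensity m lam)
    (hm : 4 * B ^ 2 * (1 + N.alpha lam) ≤ m) :
    N.bulkLoad lam ≤ B * m ∧ (m : ℝ) / (2 * B) ≤ N.bulkLoad lam := by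
  obtain ⟨h0, hl, hmean⟩ := hI
  have hBp := hB.pos
  have hα := alpha_pos hB.crit_pos h0 hl
  have h1 := abs_le.1 (hB.abs_sum_openMean_sub_le h0 hl)
  have h2 := hB.bulkLoad_le h0 hl.le
  have h3 := hB.bulkMean_le h0 hl.le
  have h4 : N.bulkMean lam ≤ ∑ k, N.openMean lam k := by
    classical
    exact sum_le_sum_of_subset_of_nonneg (filter_subset _ _) fun k _ _ =>
      (stable_of_lt h0 hl k).openMean_pos.le
  rw [hmean] at h1 h4
  refine ⟨h2.trans (mul_le_mul_of_nonneg_left h4 hBp.le), ?_⟩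
  have h5 : N.totalOrder ξ * N.alpha lam ≤ B * N.alpha lam :=
    mul_le_mul_of_nonneg_right hB.order_le hα.le
  have h6 : B * N.alpha lam ≤ B ^ 2 * N.alpha lam := by
    refine mul_le_mul_of_nonneg_right ?_ hα.le
    nlinarith [hB.one_le]
  have h7 : 0 ≤ B ^ 2 * N.alpha lam := by positivity
  rw [div_le_iff₀ (by positivity)]
  nlinarith

/-- The Gaussian approximation for one network: the probability that the open system holds `m`
customers, and the effect on it of the replacement of the laws of at most `ℓ` queues. -/
theorem exists_gaussian_regime {B : ℝ} (hB1 : 1 ≤ B) (ℓ : ℕ) :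
    ∃ K : ℝ, 0 ≤ K ∧ ∀ {n : ℕ} {N : ClosedNetwork n} {ξ : Fin n → ℝ}, N.UniformBounds ξ B →
      ∀ {m : ℕ} {lam A : ℝ}, N.IsIntensity m lam → A = 1 + N.alpha lam → 1 ≤ m → A ^ 2 ≤ m →
      4 * B ^ 2 * A ≤ m → 4 * B ^ 2 * ℓ ≤ m →
      |sumProb (N.openProb lam) m * (√(2 * Real.pi) * N.openSD lam) - 1| ≤
        K * ((m + A ^ 4) / m ^ 2) ∧ N.openSD lam ≤ K * √m ∧
      ∀ (J : Finset (Fin n)) (p' : Fin n → ℕ → ℝ) (D : ℝ), #J ≤ ℓ → 0 < D →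
        (∀ k, IsProbSeq (p' k)) → (∀ k, HasMoments (p' k)) →
        (∀ k ∉ J, p' k = N.openProb lam k) → (∀ k ∈ J, N.centralMoment lam k 2 ≤ D ^ 2) →
        (∀ k ∈ J, expectation (p' k) (fun x => ((x : ℝ) - N.openMean lam k) ^ 2) ≤ D ^ 2) →
        |sumProb p' m - sumProb (N.openProb lam) m| ≤
          K * (D * ((m + A ^ 3) / m ^ 2 / √m + (m + A ^ 4) / m ^ 2 / √m ^ 2) +
            D ^ 2 * (1 / m / √m)) := by
  have hBp : 0 < B := by linarith
  have hc : 0 < 1 / (4 * B ^ 2) := by positivity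
  have hc1 : 1 / (4 * B ^ 2) ≤ 1 := by
    rw [div_le_one (by positivity)]
    nlinarith
  obtain ⟨K, hK, hedge⟩ := exists_edgeworth_bounds hc hc1 (C := B ^ 2) (by nlinarith)
  refine ⟨8 * B * K + (ℓ + 8 * ℓ ^ 2) * K + 2 * B, by positivity, ?_⟩
  intro n N ξ hB m lam A hI hA hm1 hAm hBA hBl
  have h0 := hI.1
  have hl := hI.2.1
  have hst : ∀ k, N.Stable lam k := fun k => stable_of_lt h0 hl k
  have hα := alpha_pos hB.crit_pos h0 hl
  have hA1 : 1 ≤ A := by linarith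
  have hm1' : (1 : ℝ) ≤ m := by exact_mod_cast hm1
  have hm0 : (0 : ℝ) < m := by linarith
  obtain ⟨hR1, hR2⟩ := hB.bulkLoad_bounds hI (by rw [← hA]; exact hBA)
  have hsq : 0 < √(m : ℝ) := Real.sqrt_pos.2 hm0
  have hB2 : 1 ≤ B ^ 2 := one_le_pow₀ hB1
  -- the hypotheses of the Edgeworth estimate, for the complement of a small set of queues
  have hlower : ∀ J : Finset (Fin n), #J ≤ ℓ →
      1 / (4 * B ^ 2) * (m : ℝ) ≤ B⁻¹ * (N.bulkLoad lam - #J * B) := by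
    intro J hJ
    have h1 : (#J : ℝ) ≤ ℓ := by exact_mod_cast hJ
    have h2 : (#J : ℝ) * B ≤ m / (4 * B) := by
      rw [le_div_iff₀ (by positivity)]
      calc (#J : ℝ) * B * (4 * B) = 4 * B ^ 2 * #J := by ring
        _ ≤ 4 * B ^ 2 * ℓ := by gcongr
        _ ≤ m := hBl
    calc 1 / (4 * B ^ 2) * (m : ℝ) = B⁻¹ * (m / (2 * B) - m / (4 * B)) := by
          field_simp
          ring
      _ ≤ _ := by gcongr
  have hmomsum : ∀ J : Finset (Fin n), ∀ r ∈ ({2, 3, 4} : Set ℕ),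
      ∑ k ∈ J, absMoment (N.openProb lam k) r ≤ B ^ 2 * (m + A ^ r) := by
    intro J r hr
    have h1 := hB.sum_centralMoment_le h0 hl hr J
    rw [← hA] at h1
    simp_rw [centralMoment_eq] at h1
    refine h1.trans ?_
    have h2 := mul_le_mul_of_nonneg_left hR1 hBp.le
    linarith
  have hsecond : ∀ k, absMoment (N.openProb lam k) 2 ≤ B ^ 2 * A ^ 2 := by
    intro k
    rw [← centralMoment_eq]
    by_cases hk : k ∈ N.satQueues
    · refine (hB.moment_sat k hk lam h0 hl 2 (by simp)).trans ?_
      rw [← hA]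
      refine mul_le_mul_of_nonneg_right ?_ (by positivity)
      nlinarith
    · refine (hB.centralMoment_le hk h0 hl.le (by simp)).trans ?_
      exact le_mul_of_one_le_right (by positivity) (one_le_pow₀ hA1)
  have happly := fun (J : Finset (Fin n)) (hJ : #J ≤ ℓ) =>
    hedge Jᶜ (N.openProb lam) m A (fun k _ => (hst k).isProbSeq) (fun k _ => (hst k).hasMoments)
      hm1' hA1 hAm (fun k _ => hsecond k) (hmomsum _ 3 (by simp)) (hmomsum _ 4 (by simp))
      ((hlower J hJ).trans (hB.le_sum_secondMoment h0 hl J))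
      ((hlower J hJ).trans (hB.le_sum_pairing h0 hl J))
  have hmean : ∑ k, mean (N.openProb lam k) = m := hI.2.2
  have hEa := (happly ∅ (Nat.zero_le _)).1
  rw [compl_empty] at hEa
  -- the variance is of the order of `m`
  have hSD : N.openSD lam = √(∑ k, absMoment (N.openProb lam k) 2) := rfl
  have hvlow : 1 / (4 * B ^ 2) * (m : ℝ) ≤ ∑ k, absMoment (N.openProb lam k) 2 := by
    have := (hlower ∅ (Nat.zero_le _)).trans (hB.le_sum_secondMoment h0 hl ∅)
    rwa [compl_empty] at this
  have hvup : ∑ k, absMoment (N.openProb lam k) 2 ≤ (2 * B) ^ 2 * m := by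
    refine (hmomsum univ 2 (by simp)).trans ?_
    calc B ^ 2 * (m + A ^ 2) ≤ B ^ 2 * (m + m) := by gcongr
      _ ≤ _ := by nlinarith
  set b := ∑ k, absMoment (N.openProb lam k) 2 with hb
  have hb0 : 0 < b := lt_of_lt_of_le (by positivity) hvlow
  have hsb : 0 < √b := Real.sqrt_pos.2 hb0
  have hsbup : √b ≤ 2 * B * √m := by
    rw [← Real.sqrt_sq (by positivity : 0 ≤ 2 * B), ← Real.sqrt_mul (by positivity)]
    exact Real.sqrt_le_sqrt hvup
  have hE4 : 0 ≤ ((m : ℝ) + A ^ 4) / m ^ 2 := by positivity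
  have hpi := Real.pi_pos
  have h2pi : √(2 * Real.pi) ≤ 4 := by
    rw [Real.sqrt_le_left (by norm_num)]
    linarith [Real.pi_lt_four]
  have h2pi0 : 0 < √(2 * Real.pi) := Real.sqrt_pos.2 (by positivity)
  refine ⟨?_, ?_, ?_⟩
  · have h1 := abs_sumProb_sub_le (fun k => (hst k).isProbSeq) hmean hb0 hEa
    rw [hSD]
    have e : sumProb (N.openProb lam) m * (√(2 * Real.pi) * √b) - 1 =
        (sumProb (N.openProb lam) m - 1 / (√(2 * Real.pi) * √b)) * (√(2 * Real.pi) * √b) := by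
      rw [sub_mul, one_div_mul_cancel (by positivity)]
    rw [e, abs_mul, abs_of_pos (by positivity : 0 < √(2 * Real.pi) * √b)]
    calc _ ≤ K * (((m : ℝ) + A ^ 4) / m ^ 2 / √m) * (4 * (2 * B * √m)) := by gcongr
      _ = 8 * B * K * (((m : ℝ) + A ^ 4) / m ^ 2) := by
          field_simp
          ring
      _ ≤ _ := by
          refine mul_le_mul_of_nonneg_right ?_ hE4
          have : 0 ≤ ((ℓ : ℝ) + 8 * ℓ ^ 2) * K := by positivity
          linarith
  · rw [hSD]
    refine hsbup.trans (mul_le_mul_of_nonneg_right ?_ hsq.le)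
    have : 0 ≤ 8 * B * K + ((ℓ : ℝ) + 8 * ℓ ^ 2) * K := by positivity
    linarith
  · intro J p' D hJ hD hp' hmom' heq hβ hβ'
    obtain ⟨-, hEb, hEc⟩ := happly J hJ
    have hJ' : (#J : ℝ) ≤ ℓ := by exact_mod_cast hJ
    have h1 := abs_sumProb_sub_sumProb_le (fun k => (hst k).isProbSeq) hp'
      (fun k => (hst k).hasMoments) hmom' hmean J heq hD hβ hβ' hEb hEc
    refine h1.trans ?_
    set X : ℝ := ((m : ℝ) + A ^ 3) / m ^ 2 / √m + ((m : ℝ) + A ^ 4) / m ^ 2 / √m ^ 2 with hX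
    set Y : ℝ := 1 / (m : ℝ) / √m with hY
    have hX0 : 0 ≤ X := by positivity
    have hY0 : 0 ≤ Y := by positivity
    calc (#J : ℝ) * D * (K * X) + 8 * (#J : ℝ) ^ 2 * D ^ 2 * (K * Y)
        ≤ ℓ * D * (K * X) + 8 * (ℓ : ℝ) ^ 2 * D ^ 2 * (K * Y) := by gcongr
      _ ≤ _ := by
          have e1 : 0 ≤ (8 * B * K + 8 * (ℓ : ℝ) ^ 2 * K + 2 * B) * (D * X) := by positivity
          have e2 : 0 ≤ (8 * B * K + ℓ * K + 2 * B) * (D ^ 2 * Y) := by positivity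
          linear_combination e1 + e2

end ClosedNetwork

namespace ProductForm

/-! ### Dirac masses -/

theorem isProbSeq_single (q : ℕ) : IsProbSeq (Pi.single q 1 : ℕ → ℝ) where
  nonneg x := by
    rw [Pi.single_apply]
    split_ifs <;> norm_num
  hasSum := hasSum_pi_single q 1

theorem hasMoments_single (q : ℕ) : HasMoments (Pi.single q 1 : ℕ → ℝ) := fun r => by
  refine summable_of_ne_finset_zero (s := {q}) fun x hx => ?_
  rw [Pi.single_eq_of_ne (by simpa using hx), mul_zero]

theorem expectation_single (q : ℕ) (f : ℕ → ℝ) :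
    expectation (Pi.single q 1 : ℕ → ℝ) f = f q := by
  rw [expectation, tsum_eq_single q fun x hx => by rw [Pi.single_eq_of_ne hx, mul_zero]]
  simp

end ProductForm

namespace ClosedNetwork

open MeasureTheory Finset ProductForm

/-! ### The laws that describe one or several queues -/

section

variable {n : ℕ} {N : ClosedNetwork n} {ξ : Fin n → ℝ} {B lam : ℝ} {k : Fin n}

theorem update_sizeBias_isProbSeq (h : ∀ k, N.Stable lam k) (j k : Fin n) :
    IsProbSeq (Function.update (N.openProb lam) j (sizeBias (N.openProb lam j)) k) := by
  rcases eq_or_ne k j with rfl | hk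
  · rw [Function.update_self]
    exact (h k).isProbSeq.sizeBias (h k).hasMoments (h k).openMean_pos
  · rw [Function.update_of_ne hk]
    exact (h k).isProbSeq

theorem update_sizeBias_hasMoments (h : ∀ k, N.Stable lam k) (j k : Fin n) :
    HasMoments (Function.update (N.openProb lam) j (sizeBias (N.openProb lam j)) k) := by
  rcases eq_or_ne k j with rfl | hk
  · rw [Function.update_self]
    exact (h k).hasMoments.sizeBias (h k).isProbSeq
  · rw [Function.update_of_ne hk]
    exact (h k).hasMoments

theorem pinned_isProbSeq (h : ∀ k, N.Stable lam k) {l : ℕ} (e : Fin l ↪ Fin n) (q : Fin l → ℕ)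
    (k : Fin n) : IsProbSeq (pinned (N.openProb lam) e q k) := by
  by_cases hk : k ∈ Set.range e
  · obtain ⟨i, rfl⟩ := hk
    rw [pinned_apply]
    exact isProbSeq_single _
  · rw [pinned_of_notMem _ _ _ hk]
    exact (h k).isProbSeq

theorem pinned_hasMoments (h : ∀ k, N.Stable lam k) {l : ℕ} (e : Fin l ↪ Fin n) (q : Fin l → ℕ)
    (k : Fin n) : HasMoments (pinned (N.openProb lam) e q k) := by
  by_cases hk : k ∈ Set.range e
  · obtain ⟨i, rfl⟩ := hk
    rw [pinned_apply]
    exact hasMoments_single _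
  · rw [pinned_of_notMem _ _ _ hk]
    exact (h k).hasMoments

/-- The size-biased law of a queue lives within a distance of order `A` of the mean, where `A` is `1
+ α` for a saturable queue, and may be taken to be one for the other queues. -/
theorem UniformBounds.expectation_sizeBias_le (hB : N.UniformBounds ξ B) (h0 : 0 < lam)
    (hl : lam < N.critIntensity) {A : ℝ} (hA : 1 ≤ A)
    (hk : k ∈ N.satQueues → A = 1 + N.alpha lam) :
    expectation (sizeBias (N.openProb lam k)) (fun x => ((x : ℝ) - N.openMean lam k) ^ 2) ≤
      (2 * B * A) ^ 2 := by
  have hs := stable_of_lt h0 hl k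
  have hm := hs.openMean_pos
  have hBp := hB.pos
  have hB1 := hB.one_le
  refine (expectation_sizeBias_sq_le hs.isProbSeq hs.hasMoments hm).trans ?_
  rw [← centralMoment_eq, ← centralMoment_eq, ← openMean_eq]
  by_cases hk' : k ∈ N.satQueues
  · have h3 := hB.third_sat k hk' lam h0 hl
    have h2 := hB.moment_sat k hk' lam h0 hl 2 (by simp)
    rw [← hk hk'] at h2 h3
    have h4 : N.centralMoment lam k 3 / N.openMean lam k ≤ B * A ^ 2 := by
      rwa [div_le_iff₀ hm]
    have h5 : B * A ^ 2 ≤ B ^ 2 * A ^ 2 := by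
      refine mul_le_mul_of_nonneg_right ?_ (by positivity)
      nlinarith
    have h6 : 0 ≤ B ^ 2 * A ^ 2 := by positivity
    linarith
  · have hc := hB.comparable k hk' lam h0 hl.le
    have h3 := (hc.2.1 3 (by simp)).2
    have h2 := hB.centralMoment_le hk' h0 hl.le (r := 2) (by simp)
    have h1 := hc.1.1
    rw [inv_mul_le_iff₀ hBp] at h1
    have h4 : N.centralMoment lam k 3 / N.openMean lam k ≤ B ^ 2 := by
      rw [div_le_iff₀ hm]
      nlinarith
    have h5 : B ^ 2 * 1 ≤ B ^ 2 * A ^ 2 :=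
      mul_le_mul_of_nonneg_left (one_le_pow₀ hA) (by positivity)
    have h6 : 0 ≤ B ^ 2 * A ^ 2 := by positivity
    linarith

theorem UniformBounds.secondMoment_le (hB : N.UniformBounds ξ B) (h0 : 0 < lam)
    (hl : lam < N.critIntensity) {A : ℝ} (hA : 1 ≤ A)
    (hk : k ∈ N.satQueues → A = 1 + N.alpha lam) : N.centralMoment lam k 2 ≤ (B * A) ^ 2 := by
  have hB1 := hB.one_le
  by_cases hk' : k ∈ N.satQueues
  · have h2 := hB.moment_sat k hk' lam h0 hl 2 (by simp)
    rw [← hk hk'] at h2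
    refine h2.trans ?_
    rw [mul_pow]
    refine mul_le_mul_of_nonneg_right ?_ (by positivity)
    nlinarith
  · refine (hB.centralMoment_le hk' h0 hl.le (r := 2) (by simp)).trans ?_
    rw [mul_pow]
    exact le_mul_of_one_le_right (by positivity) (one_le_pow₀ hA)

theorem UniformBounds.sub_openMean_sq_le (hB : N.UniformBounds ξ B) (h0 : 0 < lam)
    (hl : lam < N.critIntensity) {A : ℝ} (hA : 1 ≤ A)
    (hk : k ∈ N.satQueues → A = 1 + N.alpha lam) (q : ℕ) :
    ((q : ℝ) - N.openMean lam k) ^ 2 ≤ ((q + B ^ 2) * A) ^ 2 := by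
  have hB1 := hB.one_le
  have hm := (stable_of_lt h0 hl k).openMean_pos
  have h1 : N.openMean lam k ≤ B ^ 2 * A := by
    by_cases hk' : k ∈ N.satQueues
    · have h2 := hB.openMean_sat_le hk' h0 hl
      rw [← hk hk'] at h2
      refine h2.trans (mul_le_mul_of_nonneg_right ?_ (by linarith))
      nlinarith
    · exact (hB.openMean_le hk' h0 hl.le).trans (le_mul_of_one_le_right (by positivity) hA)
  have hq : (q : ℝ) ≤ q * A := le_mul_of_one_le_right (by positivity) hA
  have hq0 : (0 : ℝ) ≤ q := by positivity
  rw [sq_le_sq, abs_of_nonneg (by positivity : (0 : ℝ) ≤ (q + B ^ 2) * A), abs_le]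
  constructor <;> nlinarith

end

/-! ### The approximations below criticality -/

set_option maxHeartbeats 800000 in
/-- The Gaussian approximation below criticality, with the error terms in the relative distance `θ`
to criticality. -/
theorem exists_subcritical_regime {B : ℝ} (hB1 : 1 ≤ B) (ℓ : ℕ) {Q : ℝ} (hQ : 1 ≤ Q) :
    ∃ K M₀ : ℝ, 0 ≤ K ∧ ∀ {n : ℕ} {N : ClosedNetwork n} {ξ : Fin n → ℝ}, N.UniformBounds ξ B →
      ∀ {m : ℕ} {lam θ A : ℝ}, N.IsIntensity m lam → A = 1 + N.alpha lam → 0 < N.critMean →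
      0 < θ → (m : ℝ) / N.critMean ≤ 1 - θ → M₀ ≤ θ ^ 2 * m →
      1 / 2 ≤ sumProb (N.openProb lam) m * (√(2 * Real.pi) * N.openSD lam) ∧
      |sumProb (N.openProb lam) m * (√(2 * Real.pi) * N.openSD lam) - 1| ≤
        K * (1 / m + 1 / (m ^ 2 * θ ^ 4)) ∧
      ∀ (J : Finset (Fin n)) (p' : Fin n → ℕ → ℝ), #J ≤ ℓ →
        (∀ k, IsProbSeq (p' k)) → (∀ k, HasMoments (p' k)) →
        (∀ k ∉ J, p' k = N.openProb lam k) →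
        ((∀ k ∈ J, N.centralMoment lam k 2 ≤ Q ^ 2) →
          (∀ k ∈ J, expectation (p' k) (fun x => ((x : ℝ) - N.openMean lam k) ^ 2) ≤ Q ^ 2) →
          |sumProb p' m - sumProb (N.openProb lam) m| ≤
            K * (1 / m + 1 / (m ^ 2 * θ ^ 4)) * sumProb (N.openProb lam) m) ∧
        ((∀ k ∈ J, N.centralMoment lam k 2 ≤ (Q * A) ^ 2) →
          (∀ k ∈ J, expectation (p' k) (fun x => ((x : ℝ) - N.openMean lam k) ^ 2) ≤
            (Q * A) ^ 2) →
          |sumProb p' m - sumProb (N.openProb lam) m| ≤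
            K * (1 / (θ ^ 2 * m)) * sumProb (N.openProb lam) m) := by
  obtain ⟨K, hK, hgauss⟩ := exists_gaussian_regime hB1 ℓ
  obtain ⟨K₁, hK₁, hαθ⟩ := exists_one_add_alpha_mul_le B
  have hK₁4 : 1 ≤ K₁ ^ 4 := one_le_pow₀ hK₁
  have hK₁2 : 1 ≤ K₁ ^ 2 := one_le_pow₀ hK₁
  refine ⟨K * K₁ ^ 4 + 40 * Q ^ 2 * K ^ 2 * K₁ ^ 4,
    K₁ ^ 2 * (4 * B ^ 2 + 4 * B ^ 2 * ℓ + 4 * K + 1), by positivity, ?_⟩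
  intro n N ξ hB m lam θ A hI hA hcm hθ hm hM
  have hAθ := hαθ hB hI hcm hm
  rw [← hA] at hAθ
  have hα := alpha_pos hB.crit_pos hI.1 hI.2.1
  have hA1 : 1 ≤ A := by linarith
  have hAA : A ≤ A ^ 2 := by nlinarith
  have hθ1 : θ ≤ 1 := by
    have : 0 ≤ (m : ℝ) / N.critMean := by positivity
    linarith
  have hθ2 : θ ^ 2 ≤ 1 := pow_le_one₀ hθ.le hθ1
  have hBK : ∀ x : ℝ, x ≤ 4 * B ^ 2 + 4 * B ^ 2 * ℓ + 4 * K + 1 → K₁ ^ 2 * x ≤ θ ^ 2 * m :=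
    fun x hx => (mul_le_mul_of_nonneg_left hx (by positivity)).trans hM
  have hb0 : 0 ≤ 4 * B ^ 2 := by positivity
  have hb1 : 0 ≤ 4 * B ^ 2 * ℓ := by positivity
  have hA2 : A ^ 2 * θ ^ 2 ≤ K₁ ^ 2 := by
    rw [← mul_pow]
    exact pow_le_pow_left₀ (by positivity) hAθ 2
  have hθm : θ ^ 2 * m ≤ (m : ℝ) := mul_le_of_le_one_left (by positivity) hθ2
  have hmul : ∀ x : ℝ, 0 ≤ x → x ≤ 4 * B ^ 2 + 4 * B ^ 2 * ℓ + 4 * K + 1 → x * A ^ 2 ≤ m := by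
    intro x hx0 hx
    have h1 := hBK x hx
    have h2 := mul_le_mul_of_nonneg_left hA2 hx0
    refine le_of_mul_le_mul_left ?_ (by positivity : 0 < θ ^ 2)
    linarith
  have hm1' : (1 : ℝ) ≤ m := by
    have := hBK 1 (by linarith)
    linarith
  have hm1 : 1 ≤ m := by exact_mod_cast hm1'
  have hm0 : (0 : ℝ) < m := by linarith
  have hAm : A ^ 2 ≤ m := by simpa using hmul 1 zero_le_one (by linarith)
  have hBA : 4 * B ^ 2 * A ≤ m := by
    refine le_trans ?_ (hmul (4 * B ^ 2) hb0 (by linarith))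
    exact mul_le_mul_of_nonneg_left hAA hb0
  have hBl : 4 * B ^ 2 * ℓ ≤ m := by
    refine le_trans ?_ (hmul (4 * B ^ 2 * ℓ) hb1 (by linarith))
    exact le_mul_of_one_le_right hb1 (one_le_pow₀ hA1)
  obtain ⟨hx, hSD, hcomp⟩ := hgauss hB hI hA hm1 hAm hBA hBl
  set x := sumProb (N.openProb lam) m * (√(2 * Real.pi) * N.openSD lam) with hxdef
  set P := sumProb (N.openProb lam) m with hP
  -- `u` is the order of the relative error for the saturable queues
  set u : ℝ := A ^ 2 / m with hu
  have hu0 : 0 ≤ u := by positivity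
  have hu1 : u ≤ 1 := by rwa [hu, div_le_one hm0]
  have huε : u ≤ K₁ ^ 2 * (1 / (θ ^ 2 * m)) := by
    rw [hu, mul_one_div, div_le_div_iff₀ hm0 (by positivity)]
    have := mul_le_mul_of_nonneg_right hA2 hm0.le
    linarith
  have hmu : 1 / (m : ℝ) ≤ u := div_le_div_of_nonneg_right (one_le_pow₀ hA1) hm0.le
  have he4 : ((m : ℝ) + A ^ 4) / m ^ 2 = 1 / m + u ^ 2 := by
    rw [hu]
    field_simp
  have he4ε : ((m : ℝ) + A ^ 4) / m ^ 2 ≤ K₁ ^ 4 * (1 / m + 1 / (m ^ 2 * θ ^ 4)) := by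
    rw [he4, mul_add]
    refine add_le_add (le_mul_of_one_le_left (by positivity) hK₁4) ?_
    refine (pow_le_pow_left₀ hu0 huε 2).trans_eq ?_
    field_simp
  have he4u : ((m : ℝ) + A ^ 4) / m ^ 2 ≤ 2 * u := by
    rw [he4, pow_two]
    have := mul_le_of_le_one_left hu0 hu1
    linarith
  have hKu : K * (((m : ℝ) + A ^ 4) / m ^ 2) ≤ 1 / 2 := by
    have h1 := hmul (4 * K) (by positivity) (by linarith)
    have h2 : 4 * K * u ≤ 1 := by
      rw [hu, ← mul_div_assoc, div_le_one hm0]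
      exact h1
    have := mul_le_mul_of_nonneg_left he4u hK
    linarith
  have hxhalf : 1 / 2 ≤ x := by
    have := (abs_le.1 (hx.trans hKu)).1
    linarith
  have hQ4 : 0 ≤ 40 * Q ^ 2 * K ^ 2 * K₁ ^ 4 := by positivity
  have hε0 : 0 ≤ 1 / (m : ℝ) + 1 / (m ^ 2 * θ ^ 4) := by positivity
  refine ⟨hxhalf, ?_, ?_⟩
  · refine hx.trans ?_
    refine (mul_le_mul_of_nonneg_left he4ε hK).trans ?_
    have := mul_nonneg hQ4 hε0
    linarith
  -- a lower bound for the probability that the open system holds `m` customers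
  have hP0 : 0 ≤ P := by
    rw [hP, sumProb]
    exact sum_nonneg fun y _ => prod_nonneg fun k _ =>
      ((stable_of_lt hI.1 hI.2.1 k).openProb_pos _).le
  set s := √(m : ℝ) with hs
  have hs0 : 0 < s := Real.sqrt_pos.2 hm0
  have hss : s ^ 2 = m := Real.sq_sqrt hm0.le
  have hs1 : 1 ≤ s := Real.one_le_sqrt.2 hm1'
  have hAs : A ≤ s := Real.le_sqrt_of_sq_le hAm
  have hPs : 1 / s ≤ 8 * K * P := by
    rw [div_le_iff₀ hs0]
    have h2pi : √(2 * Real.pi) ≤ 4 := by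
      rw [Real.sqrt_le_left (by norm_num)]
      linarith [Real.pi_lt_four]
    have h1 : √(2 * Real.pi) * N.openSD lam ≤ 4 * (K * s) :=
      mul_le_mul h2pi hSD (Real.sqrt_nonneg _) (by norm_num)
    have h2 := mul_le_mul_of_nonneg_left h1 hP0
    linarith
  -- the effect of a change of laws at scale `D`, relative to `P`
  have hX : ∀ D : ℝ, 0 < D → D * (((m : ℝ) + A ^ 3) / m ^ 2 / s + (m + A ^ 4) / m ^ 2 / s ^ 2) +
      D ^ 2 * (1 / m / s) = (D * (1 / m + A * u / m + (1 / m + u ^ 2) / s) + D ^ 2 / m) * (1 / s) := by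
    intro D _
    rw [he4, hu]
    field_simp
  have hfin : ∀ D E : ℝ, 0 < D → 0 ≤ E →
      D * (1 / m + A * u / m + (1 / m + u ^ 2) / s) + D ^ 2 / m ≤ 5 * Q ^ 2 * E →
      ∀ J : Finset (Fin n), #J ≤ ℓ → ∀ p' : Fin n → ℕ → ℝ, (∀ k, IsProbSeq (p' k)) →
        (∀ k, HasMoments (p' k)) → (∀ k ∉ J, p' k = N.openProb lam k) →
        (∀ k ∈ J, N.centralMoment lam k 2 ≤ D ^ 2) →
        (∀ k ∈ J, expectation (p' k) (fun x => ((x : ℝ) - N.openMean lam k) ^ 2) ≤ D ^ 2) →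
        |sumProb p' m - P| ≤ 40 * Q ^ 2 * K ^ 2 * E * P := by
    intro D E hD hE hDE J hJ p' hp' hmom hoff h2 h3
    refine (hcomp J p' D hJ hD hp' hmom hoff h2 h3).trans ?_
    rw [hX D hD]
    calc _ ≤ K * (5 * Q ^ 2 * E * (8 * K * P)) := by
          refine mul_le_mul_of_nonneg_left ?_ hK
          exact mul_le_mul hDE hPs (by positivity) (by positivity)
      _ = _ := by ring
  have hQ2 : Q ≤ Q ^ 2 := by nlinarith
  have hE4 : 0 ≤ 1 / (m : ℝ) + u ^ 2 := by positivity
  have hAu : A * u / m ≤ u ^ 2 := by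
    rw [hu, mul_div_assoc', div_div, div_pow, ← pow_two]
    refine div_le_div_of_nonneg_right ?_ (by positivity)
    rw [pow_two (A ^ 2)]
    exact mul_le_mul_of_nonneg_right hAA (by positivity)
  intro J p' hJ hp' hmom hoff
  constructor
  · intro h2 h3
    refine (hfin Q (1 / m + u ^ 2) (by linarith) hE4 ?_ J hJ p' hp' hmom hoff h2 h3).trans ?_
    · have h4 : (1 / (m : ℝ) + u ^ 2) / s ≤ 1 / m + u ^ 2 := div_le_self hE4 hs1
      have h5 : 1 / (m : ℝ) + A * u / m + (1 / m + u ^ 2) / s ≤ 2 * (1 / m + u ^ 2) := by linarith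
      have h6 : Q ^ 2 / (m : ℝ) ≤ Q ^ 2 * (1 / m + u ^ 2) := by
        rw [div_eq_mul_one_div]
        refine mul_le_mul_of_nonneg_left ?_ (by positivity)
        have := sq_nonneg u
        linarith
      have h7 : Q * (1 / (m : ℝ) + A * u / m + (1 / m + u ^ 2) / s) ≤
          Q ^ 2 * (2 * (1 / m + u ^ 2)) := mul_le_mul hQ2 h5 (by positivity) (by positivity)
      have h8 : 0 ≤ Q ^ 2 * (1 / (m : ℝ) + u ^ 2) := by positivity
      linarith
    · rw [← he4]
      refine mul_le_mul_of_nonneg_right ?_ hP0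
      have h4 : 0 ≤ K * K₁ ^ 4 * (1 / (m : ℝ) + 1 / (m ^ 2 * θ ^ 4)) := by positivity
      have h5 := mul_le_mul_of_nonneg_left he4ε (by positivity : 0 ≤ 40 * Q ^ 2 * K ^ 2)
      linarith
  · intro h2 h3
    refine (hfin (Q * A) u (by positivity) hu0 ?_ J hJ p' hp' hmom hoff h2 h3).trans ?_
    · have h4 : A * (1 / (m : ℝ)) ≤ u := by
        rw [mul_one_div]
        exact div_le_div_of_nonneg_right hAA hm0.le
      have h5 : A * (A * u / m) ≤ u := by
        have : A * (A * u / m) = u * u := by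
          rw [hu]
          field_simp
        rw [this]
        exact mul_le_of_le_one_left hu0 hu1
      have h6 : A * ((1 / (m : ℝ) + u ^ 2) / s) ≤ 2 * u := by
        rw [mul_div_assoc', div_le_iff₀ hs0, ← he4]
        have := mul_le_mul hAs he4u (by positivity) hs0.le
        linarith
      have h7 : Q * (A * (1 / (m : ℝ)) + A * (A * u / m) + A * ((1 / m + u ^ 2) / s)) ≤
          Q ^ 2 * (4 * u) := mul_le_mul hQ2 (by linarith) (by positivity) (by positivity)
      have h8 : (Q * A) ^ 2 / m = Q ^ 2 * u := by
        rw [hu]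
        ring
      rw [h8]
      linarith
    · refine mul_le_mul_of_nonneg_right ?_ hP0
      have hε' : 0 ≤ 1 / (θ ^ 2 * (m : ℝ)) := by positivity
      have h4 : 0 ≤ K * K₁ ^ 4 * (1 / (θ ^ 2 * (m : ℝ))) := by positivity
      have h5 : u ≤ K₁ ^ 4 * (1 / (θ ^ 2 * m)) :=
        huε.trans (mul_le_mul_of_nonneg_right (pow_le_pow_right₀ hK₁ (by norm_num)) hε')
      have h6 := mul_le_mul_of_nonneg_left h5 (by positivity : 0 ≤ 40 * Q ^ 2 * K ^ 2)
      linarith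

end ClosedNetwork

namespace ClosedNetwork

open MeasureTheory Finset ProductForm

/-! ### From ratios of probabilities to the approximations of the closed network -/

section

variable {n : ℕ} {N : ClosedNetwork n} {lam δ : ℝ} {m : ℕ}

theorem abs_closedMean_sub_le (h : ∀ k, N.Stable lam k) (h0 : 0 < lam)
    (hP : 0 < sumProb (N.openProb lam) m) {j : Fin n}
    (hδ : |sumProb (Function.update (N.openProb lam) j (sizeBias (N.openProb lam j))) m -
      sumProb (N.openProb lam) m| ≤ δ * sumProb (N.openProb lam) m) :
    |N.closedMean m j - N.openMean lam j| ≤ δ * N.openMean lam j := by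
  have hm := (h j).openMean_pos
  rw [closedMean_eq h h0 m j, ← mul_sub_one, div_sub_one hP.ne', abs_mul, abs_of_pos hm, abs_div,
    abs_of_pos hP, mul_comm δ]
  exact mul_le_mul_of_nonneg_left ((div_le_iff₀ hP).2 hδ) hm.le

theorem abs_closedMarginal_sub_le (h : ∀ k, N.Stable lam k) (h0 : 0 < lam)
    (hP : 0 < sumProb (N.openProb lam) m) {l : ℕ} {e : Fin l ↪ Fin n} {q : Fin l → ℕ}
    (hδ : |sumProb (pinned (N.openProb lam) e q) m - sumProb (N.openProb lam) m| ≤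
      δ * sumProb (N.openProb lam) m) :
    |N.closedMarginal m e q - ∏ i, N.openProb lam (e i) (q i)| ≤
      δ * ∏ i, N.openProb lam (e i) (q i) := by
  have hm : 0 < ∏ i, N.openProb lam (e i) (q i) := prod_pos fun i _ => (h _).openProb_pos _
  rw [closedMarginal_eq h h0 m e q, ← mul_sub_one, div_sub_one hP.ne', abs_mul, abs_of_pos hm,
    abs_div, abs_of_pos hP, mul_comm δ]
  exact mul_le_mul_of_nonneg_left ((div_le_iff₀ hP).2 hδ) hm.le

theorem abs_closedProb_sub_le (h : ∀ k, N.Stable lam k) (h0 : 0 < lam) {x : Fin n → ℕ}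
    (hx : ∑ k, x k = m) {s : ℝ} (hs : 1 / 2 ≤ sumProb (N.openProb lam) m * s)
    (hδ : |sumProb (N.openProb lam) m * s - 1| ≤ δ) :
    |N.closedProb m x - s * ∏ k, N.openProb lam k (x k)| ≤
      2 * δ * (s * ∏ k, N.openProb lam k (x k)) := by
  have hP := sumProb_openProb_pos h hx
  have hm : 0 < ∏ k, N.openProb lam k (x k) := prod_pos fun i _ => (h _).openProb_pos _
  have hs0 : 0 < s := pos_of_mul_pos_right (lt_of_lt_of_le (by norm_num) hs) hP.le
  rw [closedProb_eq h h0 hx]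
  set P := sumProb (N.openProb lam) m
  set W := ∏ k, N.openProb lam k (x k)
  have e : W / P - s * W = s * W * ((1 - P * s) / (P * s)) := by field_simp
  have hδ0 : 0 ≤ δ := (abs_nonneg _).trans hδ
  rw [e, abs_mul, abs_of_pos (by positivity : 0 < s * W), abs_div,
    abs_of_pos (by positivity : 0 < P * s), abs_sub_comm, mul_comm (2 * δ)]
  refine mul_le_mul_of_nonneg_left ?_ (by positivity)
  rw [div_le_iff₀ (by positivity)]
  nlinarith

theorem IsIntensity.stable (hI : N.IsIntensity m lam) (k : Fin n) : N.Stable lam k :=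
  stable_of_lt hI.1 hI.2.1 k

theorem IsIntensity.sumProb_pos (hI : N.IsIntensity m lam) (k : Fin n) :
    0 < sumProb (N.openProb lam) m := by
  classical
  refine sumProb_openProb_pos (x := Pi.single k m) hI.stable ?_
  rw [sum_pi_single']
  simp

theorem IsIntensity.pos (hI : N.IsIntensity m lam) (k : Fin n) : 0 < m := by
  have : 0 < ∑ k, N.openMean lam k :=
    sum_pos (fun k _ => (hI.stable k).openMean_pos) ⟨k, mem_univ k⟩
  rw [hI.2.2] at this
  exact_mod_cast this

theorem UniformBounds.openSD_pos {ξ : Fin n → ℝ} {B : ℝ} (hB : N.UniformBounds ξ B) (h0 : 0 < lam)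
    (hl : lam < N.critIntensity) (hcm : 0 < N.critMean) : 0 < N.openSD lam := by
  classical
  obtain ⟨k, hk⟩ : ∃ k, k ∉ N.satQueues := by
    by_contra! h
    rw [critMean, filter_false_of_mem fun k _ => not_not.2 (h k), sum_empty] at hcm
    exact hcm.false
  have h1 := ((hB.comparable k hk lam h0 hl.le).2.1 2 (by simp)).1
  have h2 := mul_pos (inv_pos.2 hB.pos) (load_pos hB.crit_pos h0 k)
  refine Real.sqrt_pos.2 (sum_pos' (fun i _ => ?_) ⟨k, mem_univ k, h2.trans_le h1⟩)
  exact absMoment_nonneg (stable_of_lt h0 hl i).isProbSeq 2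

end

/-! ### Uniform bounds from eventual bounds -/

/-- A bound that holds eventually, with finitely many indices for each `n`, holds for all `n` with
another constant. -/
theorem exists_forall_le_of_eventually {X : ℕ+ → Type*} [∀ n, Finite (X n)] {I : Set ℕ+}
    {a b : ∀ n, X n → ℝ} (hb : ∀ n ∈ I, ∀ x, 0 < b n x) {K : ℝ}
    (h : ∀ᶠ n in atTop, n ∈ I → ∀ x, a n x ≤ K * b n x) :
    ∃ K, ∀ n ∈ I, ∀ x, a n x ≤ K * b n x := by
  obtain ⟨n₀, hn₀⟩ := eventually_atTop.1 h
  have h1 : ∀ n, ∃ C, 0 ≤ C ∧ (n ∈ I → ∀ x, a n x ≤ C * b n x) := by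
    intro n
    have := Fintype.ofFinite (X n)
    refine ⟨∑ x, |a n x / b n x|, sum_nonneg fun x _ => abs_nonneg _, fun hn x => ?_⟩
    rw [← div_le_iff₀ (hb n hn x)]
    exact (le_abs_self _).trans
      (single_le_sum (f := fun x => |a n x / b n x|) (fun _ _ => abs_nonneg _) (mem_univ x))
  choose C hC0 hC using h1
  refine ⟨|K| + ∑ n ∈ Icc 1 n₀, C n, fun n hn x => ?_⟩
  have hS : 0 ≤ ∑ n ∈ Icc 1 n₀, C n := sum_nonneg fun n _ => hC0 n
  rcases le_total n₀ n with hle | hle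
  · refine (hn₀ n hle hn x).trans (mul_le_mul_of_nonneg_right ?_ (hb n hn x).le)
    linarith [le_abs_self K]
  · refine (hC n hn x).trans (mul_le_mul_of_nonneg_right ?_ (hb n hn x).le)
    have := single_le_sum (f := C) (fun n _ => hC0 n) (mem_Icc.2 ⟨one_le, hle⟩)
    linarith [abs_nonneg K]

section

variable {N : (n : ℕ+) → ClosedNetwork n} {m : ℕ+ → ℕ} {lam : ℕ+ → ℝ} {I : Set ℕ+} {ε : ℕ+ → ℝ}

theorem meanApprox_of_eventually (hI : ∀ n, (N n).IsIntensity (m n) (lam n))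
    (hε : ∀ n ∈ I, 0 < ε n) {D : (n : ℕ+) → Set (Fin n)} {K : ℝ}
    (h : ∀ᶠ n in atTop, n ∈ I → ∀ j ∈ D n,
      |(N n).closedMean (m n) j - (N n).openMean (lam n) j| ≤
        K * ε n * (N n).openMean (lam n) j) : MeanApprox N m lam I D ε := by
  obtain ⟨K', hK'⟩ := exists_forall_le_of_eventually (X := fun n => {j // j ∈ D n}) (I := I)
    (a := fun n j => |(N n).closedMean (m n) j - (N n).openMean (lam n) j|)
    (b := fun n j => ε n * (N n).openMean (lam n) j)
    (fun n hn j => mul_pos (hε n hn) ((hI n).stable j).openMean_pos) (K := K)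
    (h.mono fun n hn hnI j => by
      rw [← mul_assoc]
      exact hn hnI j j.2)
  exact ⟨K', fun n hn j hj => by
    rw [mul_assoc]
    exact hK' n hn ⟨j, hj⟩⟩

theorem marginalApprox_of_eventually (hI : ∀ n, (N n).IsIntensity (m n) (lam n))
    (hε : ∀ n ∈ I, 0 < ε n) {D : (n : ℕ+) → Set (Fin n) → Prop}
    (h : ∀ (l : ℕ) (q : Fin l → ℕ), ∃ K : ℝ, ∀ᶠ n in atTop, n ∈ I → ∀ e : Fin l ↪ Fin n,
      D n (Set.range e) →
      |(N n).closedMarginal (m n) e q - ∏ i, (N n).openProb (lam n) (e i) (q i)| ≤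
        K * ε n * ∏ i, (N n).openProb (lam n) (e i) (q i)) : MarginalApprox N m lam I D ε := by
  intro l q
  obtain ⟨K, hK⟩ := h l q
  obtain ⟨K', hK'⟩ := exists_forall_le_of_eventually
    (X := fun n : ℕ+ => {e : Fin l ↪ Fin n // D n (Set.range e)}) (I := I)
    (a := fun n e => |(N n).closedMarginal (m n) e q - ∏ i, (N n).openProb (lam n) (e.1 i) (q i)|)
    (b := fun n e => ε n * ∏ i, (N n).openProb (lam n) (e.1 i) (q i))
    (fun n hn e => mul_pos (hε n hn) (prod_pos fun i _ => ((hI n).stable _).openProb_pos _))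
    (K := K)
    (hK.mono fun n hn hnI e => by
      rw [← mul_assoc]
      exact hn hnI e e.2)
  exact ⟨K', fun n hn e he => by
    rw [mul_assoc]
    exact hK' n hn ⟨e, he⟩⟩

theorem jointApprox_of_eventually (hI : ∀ n, (N n).IsIntensity (m n) (lam n))
    (hε : ∀ n ∈ I, 0 < ε n) {s : ℕ+ → ℝ} (hs : ∀ n ∈ I, 0 < s n) {K : ℝ}
    (h : ∀ᶠ n in atTop, n ∈ I → ∀ q : Fin n → ℕ, ∑ k, q k = m n →
      |(N n).closedProb (m n) q - s n * ∏ k, (N n).openProb (lam n) k (q k)| ≤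
        K * ε n * (s n * ∏ k, (N n).openProb (lam n) k (q k))) : JointApprox N m lam I s ε := by
  have : ∀ n : ℕ+, Finite {q : Fin n → ℕ // ∑ k, q k = m n} := fun n =>
    Set.Finite.subset (finite_toSet (piAntidiag univ (m n))) fun q hq => by
      rw [mem_coe, mem_piAntidiag]
      exact ⟨hq, fun i _ => mem_univ i⟩
  obtain ⟨K', hK'⟩ := exists_forall_le_of_eventually
    (X := fun n : ℕ+ => {q : Fin n → ℕ // ∑ k, q k = m n}) (I := I)
    (a := fun n q => |(N n).closedProb (m n) q.1 - s n * ∏ k, (N n).openProb (lam n) k (q.1 k)|)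
    (b := fun n q => ε n * (s n * ∏ k, (N n).openProb (lam n) k (q.1 k)))
    (fun n hn q => mul_pos (hε n hn) (mul_pos (hs n hn)
      (prod_pos fun i _ => ((hI n).stable _).openProb_pos _))) (K := K)
    (h.mono fun n hn hnI q => by
      rw [← mul_assoc]
      exact hn hnI q q.2)
  exact ⟨K', fun n hn q hq => by
    rw [mul_assoc]
    exact hK' n hn ⟨q, hq⟩⟩

end

/-! ### The theorem below criticality -/

/-- The approximations below criticality, under uniform bounds and `m̂⁰ → ∞`. -/
theorem subcritical_approx {N : (n : ℕ+) → ClosedNetwork n} {m : ℕ+ → ℕ} {lam : ℕ+ → ℝ}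
    {ξ : (n : ℕ+) → Fin n → ℝ} {B : ℝ} (hB : ∀ n, (N n).UniformBounds (ξ n) B)
    (hlam : ∀ n, (N n).IsIntensity (m n) (lam n))
    (hcm : Tendsto (fun n => (N n).critMean) atTop atTop)
    {θ : ℕ+ → ℝ} (hθ : ∀ n, 0 < θ n)
    (hsub : ∀ n, 0 < (N n).critMean → (m n : ℝ) / (N n).critMean ≤ 1 - θ n)
    (hθm : Tendsto (fun n => θ n ^ 2 * (m n : ℝ)) atTop atTop) :
    ∃ ε ε' : ℕ+ → ℝ,
      (∀ n, ε n = 1 / (m n : ℝ) + 1 / ((m n : ℝ) ^ 2 * θ n ^ 4)) ∧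
      (∀ n, ε' n = 1 / (θ n ^ 2 * (m n : ℝ))) ∧
      Tendsto ε atTop (𝓝 0) ∧ Tendsto ε' atTop (𝓝 0) ∧
      MeanApprox N m lam {n | 0 < (N n).critMean} (fun n => (N n).satQueuesᶜ) ε ∧
      MeanApprox N m lam {n | 0 < (N n).critMean} (fun n => (N n).satQueues) ε' ∧
      MarginalApprox N m lam {n | 0 < (N n).critMean}
        (fun n J => Disjoint J (N n).satQueues) ε ∧
      MarginalApprox N m lam {n | 0 < (N n).critMean}
        (fun n J => ¬ Disjoint J (N n).satQueues) ε' ∧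
      JointApprox N m lam {n | 0 < (N n).critMean}
        (fun n => √(2 * Real.pi) * (N n).openSD (lam n)) ε := by
  classical
  have hB1 : 1 ≤ B := (hB 1).one_le
  have hk : ∀ n : ℕ+, Fin n := fun n => ⟨0, n.pos⟩
  have hm0 : ∀ n, (0 : ℝ) < m n := fun n => by exact_mod_cast (hlam n).pos (hk n)
  have hP : ∀ n, 0 < sumProb ((N n).openProb (lam n)) (m n) := fun n => (hlam n).sumProb_pos (hk n)
  have hε : ∀ n, 0 < 1 / (m n : ℝ) + 1 / ((m n : ℝ) ^ 2 * θ n ^ 4) := fun n => by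
    have := hm0 n
    have := hθ n
    positivity
  have hε' : ∀ n, 0 < 1 / (θ n ^ 2 * (m n : ℝ)) := fun n => by
    have := hm0 n
    have := hθ n
    positivity
  have hA1 : ∀ n, 1 ≤ 1 + (N n).alpha (lam n) := fun n => by
    linarith [alpha_pos (hB n).crit_pos (hlam n).1 (hlam n).2.1]
  have hε'lim : Tendsto (fun n => 1 / (θ n ^ 2 * (m n : ℝ))) atTop (𝓝 0) := by
    simp_rw [one_div]
    exact hθm.inv_tendsto_atTop
  refine ⟨_, _, fun n => rfl, fun n => rfl, ?_, hε'lim, ?_, ?_, ?_, ?_, ?_⟩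
  · have hlim := hε'lim.add (hε'lim.pow 2)
    rw [zero_pow two_ne_zero, add_zero] at hlim
    refine squeeze_zero' (Eventually.of_forall fun n => (hε n).le) ?_ hlim
    filter_upwards [hcm.eventually_gt_atTop 0] with n hn
    have h1 := hsub n hn
    have hmn := hm0 n
    have hθn := hθ n
    have hθ1 : θ n ≤ 1 := by
      have : 0 ≤ (m n : ℝ) / (N n).critMean := by positivity
      linarith
    refine add_le_add (one_div_le_one_div_of_le (by positivity) ?_) (le_of_eq ?_)
    · exact mul_le_of_le_one_left hmn.le (pow_le_one₀ hθn.le hθ1)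
    · field_simp
  · obtain ⟨K, M₀, hK, hreg⟩ := exists_subcritical_regime hB1 1 (Q := 2 * B) (by linarith)
    refine meanApprox_of_eventually (K := K) hlam (fun n _ => hε n) ?_
    filter_upwards [hθm.eventually_ge_atTop M₀] with n hn hcrit j hj
    obtain ⟨h0, hl, -⟩ := hlam n
    obtain ⟨-, -, hcomp⟩ := hreg (hB n) (hlam n) rfl hcrit (hθ n) (hsub n hcrit) hn
    refine abs_closedMean_sub_le (hlam n).stable h0 (hP n) ?_
    refine (hcomp {j} _ (by simp) (update_sizeBias_isProbSeq (hlam n).stable j)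
      (update_sizeBias_hasMoments (hlam n).stable j)
      fun k hk => Function.update_of_ne (by simpa using hk) _ _).1 ?_ ?_
    · intro k hk
      obtain rfl := mem_singleton.1 hk
      have h1 := (hB n).secondMoment_le h0 hl le_rfl (fun h => absurd h hj)
      rw [mul_one] at h1
      exact h1.trans (pow_le_pow_left₀ (by linarith) (by linarith) 2)
    · intro k hk
      obtain rfl := mem_singleton.1 hk
      rw [Function.update_self]
      have h1 := (hB n).expectation_sizeBias_le h0 hl le_rfl (fun h => absurd h hj)
      rwa [mul_one] at h1
  · obtain ⟨K, M₀, hK, hreg⟩ := exists_subcritical_regime hB1 1 (Q := 2 * B) (by linarith)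
    refine meanApprox_of_eventually (K := K) hlam (fun n _ => hε' n) ?_
    filter_upwards [hθm.eventually_ge_atTop M₀] with n hn hcrit j hj
    obtain ⟨h0, hl, -⟩ := hlam n
    have hA := hA1 n
    obtain ⟨-, -, hcomp⟩ := hreg (hB n) (hlam n) rfl hcrit (hθ n) (hsub n hcrit) hn
    refine abs_closedMean_sub_le (hlam n).stable h0 (hP n) ?_
    refine (hcomp {j} _ (by simp) (update_sizeBias_isProbSeq (hlam n).stable j)
      (update_sizeBias_hasMoments (hlam n).stable j)
      fun k hk => Function.update_of_ne (by simpa using hk) _ _).2 ?_ ?_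
    · intro k hk
      obtain rfl := mem_singleton.1 hk
      have h1 := (hB n).secondMoment_le (k := k) h0 hl hA (fun _ => rfl)
      exact h1.trans (pow_le_pow_left₀ (by positivity)
        (mul_le_mul_of_nonneg_right (by linarith) (by linarith)) 2)
    · intro k hk
      obtain rfl := mem_singleton.1 hk
      rw [Function.update_self]
      exact (hB n).expectation_sizeBias_le h0 hl hA (fun _ => rfl)
  · refine marginalApprox_of_eventually hlam (fun n _ => hε n) fun l q => ?_
    have hQ : ∀ i, (q i : ℝ) ≤ ∑ i, (q i : ℝ) := fun i =>
      single_le_sum (f := fun i => (q i : ℝ)) (fun _ _ => Nat.cast_nonneg _) (mem_univ i)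
    have hQ0 : 0 ≤ ∑ i, (q i : ℝ) := sum_nonneg fun i _ => Nat.cast_nonneg _
    obtain ⟨K, M₀, hK, hreg⟩ := exists_subcritical_regime hB1 l (Q := ∑ i, (q i : ℝ) + B ^ 2)
      (by nlinarith)
    refine ⟨K, ?_⟩
    filter_upwards [hθm.eventually_ge_atTop M₀] with n hn hcrit e he
    obtain ⟨h0, hl, -⟩ := hlam n
    obtain ⟨-, -, hcomp⟩ := hreg (hB n) (hlam n) rfl hcrit (hθ n) (hsub n hcrit) hn
    have hns : ∀ i, e i ∉ (N n).satQueues := fun i hi => Set.disjoint_left.1 he ⟨i, rfl⟩ hi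
    refine abs_closedMarginal_sub_le (hlam n).stable h0 (hP n) ?_
    refine (hcomp (univ.map e) _ (by simp) (pinned_isProbSeq (hlam n).stable e q)
      (pinned_hasMoments (hlam n).stable e q)
      fun k hk => pinned_of_notMem _ _ _ (by simpa using hk)).1 ?_ ?_
    · intro k hk
      obtain ⟨i, -, rfl⟩ := mem_map.1 hk
      have h1 := (hB n).secondMoment_le h0 hl le_rfl (fun h => absurd h (hns i))
      rw [mul_one] at h1
      exact h1.trans (pow_le_pow_left₀ (by linarith) (by nlinarith) 2)
    · intro k hk
      obtain ⟨i, -, rfl⟩ := mem_map.1 hk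
      rw [pinned_apply, expectation_single]
      have h1 := (hB n).sub_openMean_sq_le h0 hl le_rfl (fun h => absurd h (hns i)) (q i)
      rw [mul_one] at h1
      exact h1.trans (pow_le_pow_left₀ (by positivity) (by linarith [hQ i]) 2)
  · refine marginalApprox_of_eventually hlam (fun n _ => hε' n) fun l q => ?_
    have hQ : ∀ i, (q i : ℝ) ≤ ∑ i, (q i : ℝ) := fun i =>
      single_le_sum (f := fun i => (q i : ℝ)) (fun _ _ => Nat.cast_nonneg _) (mem_univ i)
    have hQ0 : 0 ≤ ∑ i, (q i : ℝ) := sum_nonneg fun i _ => Nat.cast_nonneg _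
    have hBQ : B ≤ ∑ i, (q i : ℝ) + B ^ 2 := by nlinarith
    obtain ⟨K, M₀, hK, hreg⟩ := exists_subcritical_regime hB1 l (Q := ∑ i, (q i : ℝ) + B ^ 2)
      (by linarith)
    refine ⟨K, ?_⟩
    filter_upwards [hθm.eventually_ge_atTop M₀] with n hn hcrit e _
    obtain ⟨h0, hl, -⟩ := hlam n
    have hA := hA1 n
    obtain ⟨-, -, hcomp⟩ := hreg (hB n) (hlam n) rfl hcrit (hθ n) (hsub n hcrit) hn
    refine abs_closedMarginal_sub_le (hlam n).stable h0 (hP n) ?_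
    refine (hcomp (univ.map e) _ (by simp) (pinned_isProbSeq (hlam n).stable e q)
      (pinned_hasMoments (hlam n).stable e q)
      fun k hk => pinned_of_notMem _ _ _ (by simpa using hk)).2 ?_ ?_
    · intro k hk
      obtain ⟨i, -, rfl⟩ := mem_map.1 hk
      have h1 := (hB n).secondMoment_le (k := e i) h0 hl hA (fun _ => rfl)
      exact h1.trans (pow_le_pow_left₀ (by positivity)
        (mul_le_mul_of_nonneg_right hBQ (by linarith)) 2)
    · intro k hk
      obtain ⟨i, -, rfl⟩ := mem_map.1 hk
      rw [pinned_apply, expectation_single]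
      have h1 := (hB n).sub_openMean_sq_le (k := e i) h0 hl hA (fun _ => rfl) (q i)
      exact h1.trans (pow_le_pow_left₀ (by positivity)
        (mul_le_mul_of_nonneg_right (by linarith [hQ i]) (by linarith)) 2)
  · obtain ⟨K, M₀, hK, hreg⟩ := exists_subcritical_regime hB1 0 (Q := 1) le_rfl
    refine jointApprox_of_eventually (K := 2 * K) hlam (fun n _ => hε n) (fun n hn => ?_) ?_
    · exact mul_pos (Real.sqrt_pos.2 (by positivity))
        ((hB n).openSD_pos (hlam n).1 (hlam n).2.1 hn)
    · filter_upwards [hθm.eventually_ge_atTop M₀] with n hn hcrit q hq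
      obtain ⟨hhalf, hx, -⟩ := hreg (hB n) (hlam n) rfl hcrit (hθ n) (hsub n hcrit) hn
      rw [mul_assoc 2 K]
      exact abs_closedProb_sub_le (hlam n).stable (hlam n).1 hq hhalf hx

end ClosedNetwork

namespace ProductForm

open MeasureTheory Finset

/-! ### Auxiliary bounds for the pole factor -/

theorem absMoment_two_le_expectation_sq {p : ℕ → ℝ} (h : HasMoments p) (hp : IsProbSeq p) (c : ℝ) :
    absMoment p 2 ≤ expectation p (fun x => ((x : ℝ) - c) ^ 2) := by
  have s1 : Summable fun x : ℕ => (2 * (mean p - c) * ((x : ℝ) - c)) * p x := by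
    simpa only [mul_assoc, pow_one] using (h.summable_pow_sub hp c 1).mul_left (2 * (mean p - c))
  have s2 : Summable fun x : ℕ => (mean p - c) ^ 2 * p x := hp.summable.mul_left _
  have s3 : Summable fun x : ℕ =>
      (((x : ℝ) - c) ^ 2 - 2 * (mean p - c) * ((x : ℝ) - c)) * p x := by
    simpa only [sub_mul] using (h.summable_pow_sub hp c 2).sub s1
  have e : absMoment p 2 =
      expectation p (fun x => ((x : ℝ) - c) ^ 2) - (mean p - c) ^ 2 := by
    rw [absMoment_two_eq]
    calc expectation p (fun x => ((x : ℝ) - mean p) ^ 2)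
        = expectation p fun x => ((x : ℝ) - c) ^ 2 - 2 * (mean p - c) * ((x : ℝ) - c) +
            (mean p - c) ^ 2 := by
          congr 1 with x
          ring
      _ = _ := by
          rw [expectation_add s3 s2, expectation_sub (h.summable_pow_sub hp c 2) s1,
            hp.expectation_const, expectation_const_mul, expectation_sub_mean h hp]
          ring
  rw [e]
  linarith [sq_nonneg (mean p - c)]

/-- The gamma densities of shapes `ξ` and `ξ + 1` agree at `ξ`. This is why the size-biased law of a
saturable queue, whose pole has one order more, leads to the same local probability. -/
theorem gammaDensity_add_one {ξ : ℝ} (hξ : 0 < ξ) :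
    gammaDensity (ξ + 1) ξ = gammaDensity ξ ξ := by
  have hG := (Real.Gamma_pos_of_pos hξ).ne'
  rw [gammaDensity, gammaDensity, Real.Gamma_add_one hξ.ne', add_sub_cancel_right,
    Real.rpow_sub_one hξ.ne']
  field_simp

theorem exists_le_gammaDensity_self (B : ℝ) :
    ∃ c : ℝ, 0 < c ∧ ∀ ξ, 1 ≤ ξ → ξ ≤ B → c ≤ gammaDensity ξ ξ := by
  obtain ⟨a, C, ha, hG⟩ := exists_gamma_bounds B
  refine ⟨Real.exp (-B) / (|C| + 1), by positivity, fun ξ h1 h2 => ?_⟩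
  obtain ⟨hl, hu⟩ := hG ξ h1 h2
  have h3 : Real.Gamma ξ ≤ |C| + 1 := by linarith [le_abs_self C]
  have h4 : 1 ≤ ξ ^ (ξ - 1) := Real.one_le_rpow h1 (by linarith)
  have h5 : Real.exp (-B) ≤ Real.exp (-ξ) := Real.exp_le_exp.2 (by linarith)
  rw [gammaDensity]
  refine div_le_div₀ (by positivity) ?_ (lt_of_lt_of_le ha hl) h3
  exact h5.trans (le_mul_of_one_le_left (Real.exp_pos _).le h4)

theorem prod_cpow {ι : Type*} (s : Finset ι) (f : ι → ℝ) {z : ℂ} (hz : z ≠ 0) :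
    ∏ k ∈ s, z ^ (f k : ℂ) = z ^ ((∑ k ∈ s, f k : ℝ) : ℂ) := by
  classical
  induction s using Finset.induction_on with
  | empty => simp
  | insert a s ha ih =>
    rw [prod_insert ha, sum_insert ha, ih, Complex.ofReal_add, Complex.cpow_add _ _ hz]

theorem norm_le_of_norm_deriv_le {f : ℝ → ℂ} (hf : Differentiable ℝ f) (h0 : f 0 = 1) {B : ℝ}
    (hB : ∀ t, ‖deriv f t‖ ≤ B) {t : ℝ} (ht : |t| ≤ Real.pi) : ‖f t‖ ≤ 1 + Real.pi * B := by
  have h1 := convex_univ.norm_image_sub_le_of_norm_deriv_le (f := f) (C := B)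
    (fun x _ => hf x) (fun x _ => hB x) (Set.mem_univ 0) (Set.mem_univ t)
  rw [h0, sub_zero, Real.norm_eq_abs] at h1
  have hB0 : 0 ≤ B := (norm_nonneg _).trans (hB 0)
  calc ‖f t‖ = ‖1 + (f t - 1)‖ := by rw [add_sub_cancel]
    _ ≤ 1 + ‖f t - 1‖ := (norm_add_le _ _).trans_eq (by rw [norm_one])
    _ ≤ 1 + B * Real.pi := by
        have := h1.trans (mul_le_mul_of_nonneg_left ht hB0)
        linarith
    _ = _ := by ring

theorem norm_prod_le_of_norm_deriv_le {ι : Type*} {s : Finset ι} {M : ℕ} (hs : #s ≤ M)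
    {f : ι → ℝ → ℂ} {B : ℝ} (hf : ∀ k ∈ s, Differentiable ℝ (f k)) (h0 : ∀ k ∈ s, f k 0 = 1)
    (hB0 : 0 ≤ B) (hB : ∀ k ∈ s, ∀ t, ‖deriv (f k) t‖ ≤ B) {t : ℝ} (ht : |t| ≤ Real.pi) :
    ‖∏ k ∈ s, f k t‖ ≤ (1 + Real.pi * B) ^ M := by
  have hpi := Real.pi_pos
  have h1 : 1 ≤ 1 + Real.pi * B := by
    have := mul_nonneg hpi.le hB0
    linarith
  rw [norm_prod]
  calc ∏ k ∈ s, ‖f k t‖ ≤ ∏ k ∈ s, (1 + Real.pi * B) :=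
        prod_le_prod (fun _ _ => norm_nonneg _) fun k hk =>
          norm_le_of_norm_deriv_le (hf k hk) (h0 k hk) (hB k hk) ht
    _ = (1 + Real.pi * B) ^ #s := by rw [prod_const]
    _ ≤ _ := pow_le_pow_right₀ h1 hs

theorem norm_deriv_prod_le {ι : Type*} {s : Finset ι} {M : ℕ} (hs : #s ≤ M)
    {f : ι → ℝ → ℂ} {B : ℝ} (hf : ∀ k ∈ s, Differentiable ℝ (f k)) (h0 : ∀ k ∈ s, f k 0 = 1)
    (hB0 : 0 ≤ B) (hB : ∀ k ∈ s, ∀ t, ‖deriv (f k) t‖ ≤ B) {t : ℝ} (ht : |t| ≤ Real.pi) :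
    ‖deriv (fun t => ∏ k ∈ s, f k t) t‖ ≤ M * ((1 + Real.pi * B) ^ M * B) := by
  classical
  have hpi := Real.pi_pos
  rw [(HasDerivAt.fun_finsetProd fun k hk => (hf k hk t).hasDerivAt).deriv]
  refine (norm_sum_le _ _).trans ?_
  calc _ ≤ ∑ k ∈ s, (1 + Real.pi * B) ^ M * B := by
        refine sum_le_sum fun k hk => ?_
        rw [norm_smul]
        refine mul_le_mul ?_ (hB k hk t) (norm_nonneg _) (by positivity)
        exact norm_prod_le_of_norm_deriv_le ((card_le_card (erase_subset k s)).trans hs)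
          (fun i hi => hf i (mem_of_mem_erase hi)) (fun i hi => h0 i (mem_of_mem_erase hi)) hB0
          (fun i hi => hB i (mem_of_mem_erase hi)) ht
    _ = #s * ((1 + Real.pi * B) ^ M * B) := by rw [sum_const, nsmul_eq_mul]
    _ ≤ _ := by
        refine mul_le_mul_of_nonneg_right ?_ (by positivity)
        exact_mod_cast hs

end ProductForm

namespace ClosedNetwork

open MeasureTheory Finset ProductForm

/-! ### The queues outside `𝓕⁰` -/

section

variable {n : ℕ} {N : ClosedNetwork n} {ξ : Fin n → ℝ} {B lam : ℝ}

open Classical in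
/-- The queues outside `𝓕⁰`, with at most `ℓ` laws replaced: the mean and the variance of their sum,
and the Gaussian decay of its characteristic function. -/
theorem UniformBounds.bulk_bounds (hB : N.UniformBounds ξ B) (h0 : 0 < lam)
    (hl : lam < N.critIntensity) {ℓ : ℕ} {Q : ℝ} (hQ : 0 < Q) (hR : 1 ≤ N.bulkLoad lam)
    (hℓR : 2 * ℓ * B ≤ N.bulkLoad lam) {J : Finset (Fin n)} (hJ : #J ≤ ℓ) {p : Fin n → ℕ → ℝ}
    (hp : ∀ k, IsProbSeq (p k)) (hmom : ∀ k, HasMoments (p k))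
    (hoff : ∀ k ∉ J, p k = N.openProb lam k)
    (hE : ∀ k ∈ J, expectation (p k) (fun x => ((x : ℝ) - N.openMean lam k) ^ 2) ≤ Q ^ 2) :
    |∑ k : {k // k ∉ N.satQueues}, mean (p k) - N.bulkMean lam| ≤ ℓ * Q ∧
    ∑ k : {k // k ∉ N.satQueues}, absMoment (p k) 2 ≤ (B + ℓ * Q ^ 2) * N.bulkLoad lam ∧
    ∀ t, |t| ≤ Real.pi → ‖∏ k : {k // k ∉ N.satQueues}, seqCF (p k) 0 t‖ ≤
      Real.exp (-(1 / (Real.pi ^ 2 * B) * N.bulkLoad lam) * t ^ 2) := by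
  have hpi := Real.pi_pos
  have hBp := hB.pos
  have hst := fun k => stable_of_lt h0 hl k
  set S : Finset (Fin n) := {k | k ∉ N.satQueues} with hS
  have hmem : ∀ k, k ∈ S ↔ k ∉ N.satQueues := fun k => by simp [hS]
  have hJ' : (#J : ℝ) ≤ ℓ := by exact_mod_cast hJ
  have hcard : ∀ x : ℝ, 0 ≤ x → ∑ k ∈ S, (if k ∈ J then x else 0) ≤ ℓ * x := by
    intro x hx
    rw [sum_ite_mem, sum_const, nsmul_eq_mul]
    refine mul_le_mul_of_nonneg_right (le_trans ?_ hJ') hx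
    exact_mod_cast card_le_card inter_subset_right
  refine ⟨?_, ?_, ?_⟩
  · rw [← sum_subtype S hmem fun k => mean (p k), bulkMean, ← sum_sub_distrib]
    refine (abs_sum_le_sum_abs _ _).trans (le_trans (sum_le_sum fun k _ => ?_) (hcard Q hQ.le))
    split_ifs with hk
    · exact abs_mean_sub_le (hp k) (hmom k) hQ (hE k hk)
    · rw [hoff k hk, openMean_eq, sub_self, abs_zero]
  · rw [← sum_subtype S hmem fun k => absMoment (p k) 2]
    calc _ ≤ ∑ k ∈ S, (B * N.load lam k + if k ∈ J then Q ^ 2 else 0) := by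
          refine sum_le_sum fun k hk => ?_
          have hld := (load_pos hB.crit_pos h0 k).le
          split_ifs with hkJ
          · have h1 := (absMoment_two_le_expectation_sq (hmom k) (hp k) _).trans (hE k hkJ)
            have := mul_nonneg hBp.le hld
            linarith
          · rw [hoff k hkJ, add_zero]
            exact ((hB.comparable k ((hmem k).1 hk) lam h0 hl.le).2.1 2 (by simp)).2
      _ ≤ B * N.bulkLoad lam + ℓ * Q ^ 2 := by
          rw [sum_add_distrib, ← mul_sum, bulkLoad]
          exact add_le_add_right (hcard _ (by positivity)) _
      _ ≤ _ := by
          have : ℓ * Q ^ 2 * 1 ≤ ℓ * Q ^ 2 * N.bulkLoad lam :=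
            mul_le_mul_of_nonneg_left hR (by positivity)
          linarith
  · intro t ht
    rw [← prod_subtype S hmem fun k => seqCF (p k) 0 t, norm_prod]
    set f : Fin n → ℝ := fun k => if k ∈ S then pairing (N.openProb lam k) else 0 with hf
    have hpair : ∀ k, 0 ≤ pairing (N.openProb lam k) := fun k => by
      have h := fun x => ((hst k).openProb_pos x).le
      exact tsum_nonneg fun i => div_nonneg (mul_nonneg (h _) (h _)) (add_nonneg (h _) (h _))
    have hf0 : ∀ k, 0 ≤ f k := fun k => by
      simp only [hf]
      split_ifs
      exacts [hpair k, le_rfl]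
    have hsum := hB.le_sum_compl hl.le hf0 (fun k hk => by
      simp only [hf, if_pos ((hmem k).2 hk)]
      exact (hB.comparable k hk lam h0 hl.le).2.2.1) J
    calc ∏ k ∈ S, ‖seqCF (p k) 0 t‖
        ≤ ∏ k ∈ S, Real.exp (-(2 / Real.pi ^ 2 * (if k ∈ Jᶜ then f k else 0)) * t ^ 2) := by
          refine prod_le_prod (fun _ _ => norm_nonneg _) fun k hk => ?_
          split_ifs with hkJ
          · have h1 := norm_seqCF_le_exp (hst k).isProbSeq 0 ht
            rw [hoff k (mem_compl.1 hkJ)]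
            simpa only [hf, if_pos hk] using h1
          · simpa using norm_seqCF_le_one (hp k) 0 t
      _ = Real.exp (-(2 / Real.pi ^ 2 * ∑ k ∈ Jᶜ, f k) * t ^ 2) := by
          have h2 : ∑ k ∈ Jᶜ, f k = ∑ k ∈ Jᶜ ∩ S, f k := by
            rw [← sum_ite_mem]
            exact sum_congr rfl fun k _ => by
              simp only [hf]
              split_ifs <;> rfl
          rw [← Real.exp_sum, ← sum_mul, sum_neg_distrib, ← mul_sum, sum_ite_mem, h2,
            inter_comm S]
      _ ≤ _ := by
          refine Real.exp_le_exp.2 (mul_le_mul_of_nonneg_right (neg_le_neg ?_) (sq_nonneg t))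
          have h3 : (#J : ℝ) * B ≤ N.bulkLoad lam / 2 := by
            have := mul_le_mul_of_nonneg_right hJ' hBp.le
            linarith
          calc 1 / (Real.pi ^ 2 * B) * N.bulkLoad lam =
                2 / Real.pi ^ 2 * (B⁻¹ * (N.bulkLoad lam - N.bulkLoad lam / 2)) := by
                field_simp
                ring
            _ ≤ 2 / Real.pi ^ 2 * (B⁻¹ * (N.bulkLoad lam - #J * B)) := by gcongr
            _ ≤ _ := mul_le_mul_of_nonneg_left hsum (by positivity)

open Classical in
/-- The probability that the sum of the queues is `m`, as an integral in which the characteristic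
functions of the saturable queues and of the others are separated. -/
theorem sumProb_eq_integral {p : Fin n → ℕ → ℝ} (hp : ∀ k, IsProbSeq (p k)) (m : ℕ) :
    (2 * Real.pi : ℂ) * (sumProb p m : ℂ) = ∫ t in -Real.pi..Real.pi,
      Complex.exp (Complex.I * ((-(m : ℝ) : ℝ) : ℂ) * t) *
        (∏ k with k ∈ N.satQueues, seqCF (p k) 0 t) *
        ∏ k : {k // k ∉ N.satQueues}, seqCF (p k) 0 t := by
  have h := sum_piAntidiag_eq_integral hp (fun _ => 0) m
  rw [sum_const_zero, zero_sub] at h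
  rw [sumProb, h]
  refine intervalIntegral.integral_congr fun t _ => ?_
  have hS : ∀ k, k ∈ ({k | k ∉ N.satQueues} : Finset (Fin n)) ↔ k ∉ N.satQueues := fun k => by simp
  simp only [← prod_subtype _ hS fun k => seqCF (p k) 0 t]
  rw [← prod_filter_mul_prod_filter_not univ (fun k => k ∈ N.satQueues)]
  ring

end

end ClosedNetwork

namespace ClosedNetwork

open MeasureTheory Finset ProductForm

/-! ### The local limit theorem above criticality -/

section

variable {n : ℕ} {N : ClosedNetwork n} {ξ : Fin n → ℝ} {B lam : ℝ}

theorem alpha_eq : N.alpha lam = N.maxLoad lam / (1 - N.maxLoad lam) := rfl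

open Classical in
theorem UniformBounds.card_sat_le_nat (hB : N.UniformBounds ξ B) {M : ℕ} (hM : B ≤ M) :
    #{k | k ∈ N.satQueues} ≤ M := by
  exact_mod_cast hB.card_sat_le.trans hM

open Classical in
/-- The characteristic function of the number of customers in `𝓕⁰`, its pole being of the total
order. -/
theorem prod_seqCF_sat {ψ : Fin n → ℝ → ℂ} (hρ0 : 0 ≤ N.maxLoad lam) (hρ1 : N.maxLoad lam < 1)
    (hψ : ∀ k ∈ N.satQueues, ∀ t, seqCF (N.openProb lam k) 0 t =
      geomCF (N.maxLoad lam) t ^ (ξ k : ℂ) * ψ k t) (t : ℝ) :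
    ∏ k with k ∈ N.satQueues, seqCF (N.openProb lam k) 0 t =
      geomCF (N.maxLoad lam) t ^ ((N.totalOrder ξ : ℝ) : ℂ) *
        ∏ k with k ∈ N.satQueues, ψ k t := by
  rw [totalOrder, ← prod_cpow _ _ (geomCF_ne_zero hρ0 hρ1 t), ← prod_mul_distrib]
  exact prod_congr rfl fun k hk => hψ k (by simpa using hk) t

end

/-- Near saturation, the probability that the open system holds `m` customers, the laws of a few
queues outside `𝓕⁰` being replaced. -/
theorem exists_pole_regime {B : ℝ} (hB1 : 1 ≤ B) (ℓ : ℕ) {Q : ℝ} (hQ : 0 < Q) :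
    ∃ K : ℝ, 0 ≤ K ∧ ∀ {n : ℕ} {N : ClosedNetwork n} {ξ : Fin n → ℝ}, N.UniformBounds ξ B →
      ∀ {m : ℕ} {lam : ℝ}, N.IsIntensity m lam → 1 ≤ N.alpha lam → 1 ≤ N.bulkLoad lam →
      2 * ℓ * B ≤ N.bulkLoad lam → ∀ (J : Finset (Fin n)) (p : Fin n → ℕ → ℝ), #J ≤ ℓ →
        (∀ k ∈ J, k ∉ N.satQueues) → (∀ k, IsProbSeq (p k)) → (∀ k, HasMoments (p k)) →
        (∀ k ∉ J, p k = N.openProb lam k) →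
        (∀ k ∈ J, expectation (p k) (fun x => ((x : ℝ) - N.openMean lam k) ^ 2) ≤ Q ^ 2) →
        |N.alpha lam * sumProb p m - gammaDensity (N.totalOrder ξ) (N.totalOrder ξ)| ≤
          K * poleError (N.totalOrder ξ) (N.alpha lam) (N.bulkLoad lam) := by
  classical
  obtain ⟨M, hM⟩ := exists_nat_ge B
  have hpi := Real.pi_pos
  have hBp : 0 < B := by linarith
  set D : ℝ := M * ((1 + Real.pi * B) ^ M * B) with hD
  have hD0 : 0 ≤ D := by positivity
  obtain ⟨K, hK, hpole⟩ := exists_pole_local B (B ^ 2 + ℓ * Q + (B + ℓ * Q ^ 2) + D)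
    (c := 1 / (Real.pi ^ 2 * B)) (by positivity)
  refine ⟨K, hK, ?_⟩
  intro n N ξ hB m lam hI hα hR hℓR J p hJ hJs hp hmom hoff hE
  obtain ⟨h0, hl, hmean⟩ := hI
  have hρ0 := maxLoad_pos hB.crit_pos h0
  have hρ1 := maxLoad_lt_one hB.crit_pos hl
  obtain ⟨ψ, hψ⟩ := hB.pole lam h0 hl
  obtain ⟨hb1, hb2, hb3⟩ := hB.bulk_bounds h0 hl hQ hR hℓR hJ hp hmom hoff hE
  have hsat : ∀ {k}, k ∈ ({k | k ∈ N.satQueues} : Finset (Fin n)) → k ∈ N.satQueues :=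
    fun hk => by simpa using hk
  have hm := abs_le.1 (hB.abs_sum_openMean_sub_le h0 hl)
  rw [hmean] at hm
  have hb1' := abs_le.1 hb1
  have hQ' : 0 ≤ ℓ * Q := by positivity
  have hQ'' : 0 ≤ B + ℓ * Q ^ 2 := by positivity
  have key := hpole (ι := {k // k ∉ N.satQueues}) (N.totalOrder ξ) (N.totalOrder ξ)
    (N.maxLoad lam) (N.bulkLoad lam) m (fun k => p k)
    (fun t => ∏ k with k ∈ N.satQueues, ψ k t) hB.one_le_totalOrder hB.order_le
    hB.one_le_totalOrder hB.order_le hρ0 hρ1 hα (by linarith) (fun k => hp k) (fun k => hmom k)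
    (by
      rw [← alpha_eq, abs_le]
      constructor <;> linarith)
    (hb2.trans (mul_le_mul_of_nonneg_right (by nlinarith) (by linarith))) hb3
    (by
      have : ∀ k ∈ ({k | k ∈ N.satQueues} : Finset (Fin n)), Differentiable ℝ (ψ k) :=
        fun k hk => (hψ k (hsat hk)).1
      fun_prop (disch := assumption))
    (prod_eq_one fun k hk => (hψ k (hsat hk)).2.1)
    (fun t ht => (norm_deriv_prod_le (hB.card_sat_le_nat hM) (fun k hk => (hψ k (hsat hk)).1)
      (fun k hk => (hψ k (hsat hk)).2.1) hBp.le (fun k hk => (hψ k (hsat hk)).2.2.2) ht).trans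
        (by nlinarith))
  have hint := sumProb_eq_integral (N := N) hp m
  have hcongr : ∀ t, ∏ k with k ∈ N.satQueues, seqCF (p k) 0 t =
      geomCF (N.maxLoad lam) t ^ ((N.totalOrder ξ : ℝ) : ℂ) *
        ∏ k with k ∈ N.satQueues, ψ k t := fun t => by
    rw [← prod_seqCF_sat hρ0.le hρ1 (fun k hk => (hψ k hk).2.2.1) t]
    exact prod_congr rfl fun k hk => by rw [hoff k fun h => hJs k h (hsat hk)]
  simp_rw [hcongr] at hint
  rw [← hint, ← alpha_eq] at key
  have e : ((N.alpha lam / (2 * Real.pi) : ℝ) : ℂ) * (2 * Real.pi * (sumProb p m : ℂ)) -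
      (gammaDensity (N.totalOrder ξ) (N.totalOrder ξ) : ℂ) =
      ((N.alpha lam * sumProb p m - gammaDensity (N.totalOrder ξ) (N.totalOrder ξ) : ℝ) : ℂ) := by
    have : (Real.pi : ℂ) ≠ 0 := by exact_mod_cast hpi.ne'
    push_cast
    field_simp
  rwa [e, Complex.norm_real, Real.norm_eq_abs] at key

end ClosedNetwork

namespace ClosedNetwork

open MeasureTheory Finset ProductForm

section

variable {n : ℕ} {N : ClosedNetwork n} {ξ : Fin n → ℝ} {B lam : ℝ} {j : Fin n}

/-! ### The mean of a saturable queue above criticality -/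

/-- The characteristic function of the size-biased law of a saturable queue has a pole of order one
more than that of the queue itself. -/
theorem openMean_mul_seqCF_sizeBias {x : ℝ} {ψ : ℝ → ℂ} (hs : N.Stable lam j)
    (hρ0 : 0 ≤ N.maxLoad lam) (hρ1 : N.maxLoad lam < 1) (hψ : Differentiable ℝ ψ)
    (he : ∀ t, seqCF (N.openProb lam j) 0 t = geomCF (N.maxLoad lam) t ^ (x : ℂ) * ψ t) (t : ℝ) :
    (N.openMean lam j : ℂ) * seqCF (sizeBias (N.openProb lam j)) 0 t =
      ((x * N.alpha lam : ℝ) : ℂ) * Complex.exp (Complex.I * t) *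
          geomCF (N.maxLoad lam) t ^ ((x + 1 : ℝ) : ℂ) * ψ t -
        Complex.I * (geomCF (N.maxLoad lam) t ^ (x : ℂ) * deriv ψ t) := by
  have hm := hs.openMean_pos
  rw [openMean_eq] at hm
  have h1 := hasDerivAt_seqCF hs.isProbSeq hs.hasMoments hm t
  have h2 := (hasDerivAt_geomCF_cpow hρ0 hρ1 x t).mul (hψ t).hasDerivAt
  have h3 : seqCF (N.openProb lam j) 0 =
      (fun t => geomCF (N.maxLoad lam) t ^ (x : ℂ)) * ψ := funext fun t => he t
  rw [h3] at h1
  have h4 := h1.unique h2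
  rw [← alpha_eq, ← openMean_eq] at h4
  linear_combination (-Complex.I) * h4 + ((N.openMean lam j : ℂ) *
    seqCF (sizeBias (N.openProb lam j)) 0 t - ((x * N.alpha lam : ℝ) : ℂ) *
    Complex.exp (Complex.I * t) * geomCF (N.maxLoad lam) t ^ ((x + 1 : ℝ) : ℂ) * ψ t) * Complex.I_sq

end

/-- A pole of one order more does not worsen the error, as long as the gamma part has the larger
scale. -/
theorem poleError_add_one_le {ξ α R : ℝ} (hα : 0 < α) (hR : 0 < R) (h : √R ≤ α) :
    poleError (ξ + 1) α R ≤ poleError ξ α R := by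
  have hs : 0 < √R := Real.sqrt_pos.2 hR
  have h1 : √R / α ≤ 1 := (div_le_one hα).2 h
  unfold poleError
  refine add_le_add_right (mul_le_mul_of_nonneg_left ?_ (by positivity)) _
  exact Real.rpow_le_rpow_of_exponent_ge (by positivity) h1 (by linarith)

/-- Near saturation, the mean of a saturable queue: the law of the queue is replaced by its
size-biased law. -/
theorem exists_pole_regime_sat {B : ℝ} (hB1 : 1 ≤ B) :
    ∃ K : ℝ, 0 ≤ K ∧ ∀ {n : ℕ} {N : ClosedNetwork n} {ξ : Fin n → ℝ}, N.UniformBounds ξ B →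
      ∀ {m : ℕ} {lam : ℝ}, N.IsIntensity m lam → 2 * B ≤ N.alpha lam → 1 ≤ N.bulkLoad lam →
      √(N.bulkLoad lam) ≤ N.alpha lam → ∀ j ∈ N.satQueues,
        |N.alpha lam *
              sumProb (Function.update (N.openProb lam) j (sizeBias (N.openProb lam j))) m -
            gammaDensity (N.totalOrder ξ) (N.totalOrder ξ)| ≤
          K * poleError (N.totalOrder ξ) (N.alpha lam) (N.bulkLoad lam) := by
  classical
  obtain ⟨M, hM⟩ := exists_nat_ge B
  have hpi := Real.pi_pos
  have hBp : 0 < B := by linarith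
  set D : ℝ := M * ((1 + Real.pi * B) ^ M * B) with hD
  have hD0 : 0 ≤ D := by positivity
  set D' : ℝ := (1 + Real.pi * B) ^ M with hD'
  have hD'0 : 0 ≤ D' := by positivity
  have hc : 0 < 1 / (Real.pi ^ 2 * B) := by positivity
  obtain ⟨K, hK, hpole⟩ := exists_pole_local (B + 1) (B ^ 2 + B + (D' + D)) hc
  obtain ⟨K', hK', hsmall⟩ := exists_integral_pole_le hc
  obtain ⟨F, hF0, hF⟩ := exists_gammaDensity_le B
  refine ⟨2 * (B * D' * K' + B * K + B * F), by positivity, ?_⟩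
  intro n N ξ hB m lam hI hα2 hR hRα j hj
  obtain ⟨h0, hl, hmean⟩ := hI
  have hst := fun k => stable_of_lt h0 hl k
  have hρ0 := maxLoad_pos hB.crit_pos h0
  have hρ1 := maxLoad_lt_one hB.crit_pos hl
  have hα1 : 1 ≤ N.alpha lam := by linarith
  have hα0 : 0 < N.alpha lam := by linarith
  have hξ1 := hB.one_le_totalOrder
  have hξB := hB.order_le
  obtain ⟨ψ, hψ⟩ := hB.pole lam h0 hl
  obtain ⟨hb1, hb2, hb3⟩ := hB.bulk_bounds h0 hl (ℓ := 0) (Q := 1) (J := ∅)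
    (p := N.openProb lam) one_pos hR (by simpa using hB.bulkLoad_nonneg h0) (by simp)
    (fun k => (hst k).isProbSeq) (fun k => (hst k).hasMoments) (fun _ _ => rfl) (by simp)
  set S : Finset (Fin n) := {k | k ∈ N.satQueues} with hS
  have hsat : ∀ {k}, k ∈ S → k ∈ N.satQueues := fun hk => by simpa [hS] using hk
  have hjS : j ∈ S := by simpa [hS] using hj
  set Ψ : ℝ → ℂ := fun t => ∏ k ∈ S, ψ k t with hΨ
  set Φ : ℝ → ℂ := fun t => ∏ k : {k // k ∉ N.satQueues}, seqCF (N.openProb lam k) 0 t with hΦ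
  have hΨd : Differentiable ℝ Ψ := by
    have : ∀ k ∈ S, Differentiable ℝ (ψ k) := fun k hk => (hψ k (hsat hk)).1
    fun_prop (disch := assumption)
  have hΨ' : ∀ t, |t| ≤ Real.pi → ‖deriv Ψ t‖ ≤ D := fun t ht =>
    norm_deriv_prod_le (hB.card_sat_le_nat hM) (fun k hk => (hψ k (hsat hk)).1)
      (fun k hk => (hψ k (hsat hk)).2.1) hBp.le (fun k hk => (hψ k (hsat hk)).2.2.2) ht
  have hΨb : ∀ t, |t| ≤ Real.pi → ‖Ψ t‖ ≤ D' := fun t ht =>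
    norm_prod_le_of_norm_deriv_le (hB.card_sat_le_nat hM) (fun k hk => (hψ k (hsat hk)).1)
      (fun k hk => (hψ k (hsat hk)).2.1) hBp.le (fun k hk => (hψ k (hsat hk)).2.2.2) ht
  have hexp : ∀ t : ℝ, HasDerivAt (fun t : ℝ => Complex.exp (Complex.I * t))
      (Complex.exp (Complex.I * t) * (Complex.I * 1)) t := fun t =>
    ((Complex.ofRealCLM.hasDerivAt (x := t)).const_mul Complex.I).cexp
  have hexpn : ∀ t : ℝ, ‖Complex.exp (Complex.I * t)‖ = 1 := fun t => by
    rw [mul_comm, Complex.norm_exp_ofReal_mul_I]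
  have hm := abs_le.1 (hB.abs_sum_openMean_sub_le h0 hl)
  rw [hmean] at hm
  have hb1' := abs_le.1 hb1
  rw [Nat.cast_zero, zero_mul] at hb1'
  rw [Nat.cast_zero, zero_mul, add_zero] at hb2
  -- the principal term, whose pole is of order `ξ + 1`
  have key := hpole (ι := {k // k ∉ N.satQueues}) (N.totalOrder ξ + 1) (N.totalOrder ξ)
    (N.maxLoad lam) (N.bulkLoad lam) m (fun k => N.openProb lam k)
    (fun t => Complex.exp (Complex.I * t) * Ψ t) (by linarith) (by linarith)
    hξ1 (by linarith) hρ0 hρ1 hα1 (by linarith) (fun k => (hst k).isProbSeq)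
    (fun k => (hst k).hasMoments)
    (by
      rw [← alpha_eq, abs_le]
      constructor <;> nlinarith)
    (hb2.trans (mul_le_mul_of_nonneg_right (by nlinarith) (by linarith))) hb3
    (fun t => ((hexp t).mul (hΨd t).hasDerivAt).differentiableAt)
    (by
      have : Ψ 0 = 1 := prod_eq_one fun k hk => (hψ k (hsat hk)).2.1
      simp [this])
    (fun t ht => by
      rw [((hexp t).fun_mul (hΨd t).hasDerivAt).deriv]
      refine (norm_add_le _ _).trans ?_
      simp only [norm_mul, hexpn, Complex.norm_I, one_mul, mul_one]
      have h1 := hΨb t ht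
      have h2 := hΨ' t ht
      have h3 : 0 ≤ B ^ 2 + B := by positivity
      linarith)
  rw [gammaDensity_add_one (by linarith), ← alpha_eq] at key
  have key := key.trans (mul_le_mul_of_nonneg_left
    (poleError_add_one_le hα0 (by linarith) hRα) hK)
  -- the representation of the probability for the size-biased law
  set p' := Function.update (N.openProb lam) j (sizeBias (N.openProb lam j)) with hp'
  have hp'P := update_sizeBias_isProbSeq hst j
  rw [← hp'] at hp'P
  have hint := sumProb_eq_integral (N := N) hp'P m
  rw [← hS] at hint
  set G : ℝ → ℂ := geomCF (N.maxLoad lam) with hG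
  have hGc : Continuous G := continuous_geomCF hρ0.le hρ1
  have hΦc : Continuous Φ := continuous_finsetProd _ fun k _ => continuous_seqCF (hst k).isProbSeq _
  set W : ℝ → ℂ := fun t => Complex.exp (Complex.I * ((-(m : ℝ) : ℝ) : ℂ) * t) with hW
  have hWc : Continuous W := by fun_prop
  set X : ℝ → ℂ := fun t => (N.openMean lam j : ℂ) *
    (W t * (∏ k ∈ S, seqCF (p' k) 0 t) * ∏ k : {k // k ∉ N.satQueues}, seqCF (p' k) 0 t) with hX
  set Y : ℝ → ℂ := fun t => W t * (G t ^ ((N.totalOrder ξ + 1 : ℝ) : ℂ) *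
    (Complex.exp (Complex.I * t) * Ψ t)) * Φ t with hY
  have hXc : Continuous X := by
    have h1 : Continuous fun t => ∏ k ∈ S, seqCF (p' k) 0 t :=
      continuous_finsetProd _ fun k _ => continuous_seqCF (hp'P k) _
    have h2 : Continuous fun t => ∏ k : {k // k ∉ N.satQueues}, seqCF (p' k) 0 t :=
      continuous_finsetProd _ fun k _ => continuous_seqCF (hp'P k) _
    fun_prop
  have hYc : Continuous Y := by
    have h1 := continuous_geomCF_cpow hρ0.le hρ1 (N.totalOrder ξ + 1)
    have h2 := hΨd.continuous
    fun_prop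
  have hXY : ∀ t, X t - ((ξ j * N.alpha lam : ℝ) : ℂ) * Y t =
      W t * (-(Complex.I * (G t ^ ((N.totalOrder ξ : ℝ) : ℂ) *
        (deriv (ψ j) t * ∏ k ∈ S.erase j, ψ k t)))) * Φ t := by
    intro t
    have hz : G t ≠ 0 := geomCF_ne_zero hρ0.le hρ1 t
    have h1 := openMean_mul_seqCF_sizeBias (hst j) hρ0.le hρ1 (hψ j hj).1 (hψ j hj).2.2.1 t
    rw [← hG] at h1
    have h2 : ∏ k ∈ S, seqCF (p' k) 0 t = seqCF (sizeBias (N.openProb lam j)) 0 t *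
        (G t ^ ((∑ k ∈ S.erase j, ξ k : ℝ) : ℂ) * ∏ k ∈ S.erase j, ψ k t) := by
      rw [← mul_prod_erase S _ hjS, ← prod_cpow _ _ hz, ← prod_mul_distrib, hp',
        Function.update_self]
      congr 1
      refine prod_congr rfl fun k hk => ?_
      rw [Function.update_of_ne (ne_of_mem_erase hk),
        (hψ k (hsat (mem_of_mem_erase hk))).2.2.1 t]
    have h3 : ∏ k : {k // k ∉ N.satQueues}, seqCF (p' k) 0 t = Φ t :=
      prod_congr rfl fun k _ => by
        have : (k : Fin n) ≠ j := fun h => k.2 (by rwa [h])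
        rw [hp', Function.update_of_ne this]
    have h4 : N.totalOrder ξ = ξ j + ∑ k ∈ S.erase j, ξ k := by
      rw [totalOrder, ← hS, add_sum_erase S _ hjS]
    have h5 : Ψ t = ψ j t * ∏ k ∈ S.erase j, ψ k t := (mul_prod_erase S _ hjS).symm
    have h6 : G t ^ ((N.totalOrder ξ : ℝ) : ℂ) =
        G t ^ (ξ j : ℂ) * G t ^ ((∑ k ∈ S.erase j, ξ k : ℝ) : ℂ) := by
      rw [h4, Complex.ofReal_add, Complex.cpow_add _ _ hz]
    have h7 : G t ^ ((N.totalOrder ξ + 1 : ℝ) : ℂ) =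
        G t ^ ((ξ j + 1 : ℝ) : ℂ) * G t ^ ((∑ k ∈ S.erase j, ξ k : ℝ) : ℂ) := by
      rw [h4, add_right_comm, Complex.ofReal_add (ξ j + 1), Complex.cpow_add _ _ hz]
    simp only [hX, hY]
    rw [h2, h3, h6, h7, h5]
    linear_combination (W t * (G t ^ ((∑ k ∈ S.erase j, ξ k : ℝ) : ℂ) *
      ∏ k ∈ S.erase j, ψ k t) * Φ t) * h1
  set E := poleError (N.totalOrder ξ) (N.alpha lam) (N.bulkLoad lam) with hE
  have hE0 : 1 / N.alpha lam ≤ E := by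
    have h1 : 0 ≤ N.bulkLoad lam / N.alpha lam ^ 2 := by positivity
    have h2 : 0 ≤ 1 / √(N.bulkLoad lam) *
      (√(N.bulkLoad lam) / N.alpha lam) ^ (N.totalOrder ξ - 1) := by positivity
    rw [hE, poleError]
    linarith
  have hE0' : 0 ≤ E := le_trans (by positivity) hE0
  have hdiff : ‖∫ t in -Real.pi..Real.pi, (X t - ((ξ j * N.alpha lam : ℝ) : ℂ) * Y t)‖ ≤
      B * D' * (K' * E) := by
    have h1 := hsmall (N.totalOrder ξ) hξ1 _ hρ0 hρ1 _ (by linarith) Φ hΦc hb3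
    rw [← alpha_eq] at h1
    have hcont : Continuous fun t => B * D' * (‖G t‖ ^ N.totalOrder ξ * ‖Φ t‖) := by
      have h2 : Continuous fun t => ‖G t‖ ^ N.totalOrder ξ :=
        hGc.norm.rpow_const fun t => Or.inr (by linarith)
      fun_prop
    calc _ ≤ ∫ t in -Real.pi..Real.pi, B * D' * (‖G t‖ ^ N.totalOrder ξ * ‖Φ t‖) := by
          refine intervalIntegral.norm_integral_le_of_norm_le (by linarith)
            (ae_of_all _ fun t ht => ?_) (hcont.intervalIntegrable _ _)
          have ht' : |t| ≤ Real.pi := abs_le.2 ⟨ht.1.le, ht.2⟩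
          have h2 : ‖∏ k ∈ S.erase j, ψ k t‖ ≤ D' :=
            norm_prod_le_of_norm_deriv_le
              ((card_le_card (erase_subset j S)).trans (hB.card_sat_le_nat hM))
              (fun k hk => (hψ k (hsat (mem_of_mem_erase hk))).1)
              (fun k hk => (hψ k (hsat (mem_of_mem_erase hk))).2.1) hBp.le
              (fun k hk => (hψ k (hsat (mem_of_mem_erase hk))).2.2.2) ht'
          rw [hXY, norm_mul, norm_mul, norm_neg, norm_mul, norm_mul, norm_mul, Complex.norm_I,
            one_mul, hW, norm_exp_I_mul_mul, one_mul, Complex.norm_cpow_real]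
          have h3 : ‖deriv (ψ j) t‖ * ‖∏ k ∈ S.erase j, ψ k t‖ ≤ B * D' :=
            mul_le_mul ((hψ j hj).2.2.2 t) h2 (norm_nonneg _) hBp.le
          have h4 : 0 ≤ ‖G t‖ ^ N.totalOrder ξ := by positivity
          calc _ ≤ ‖G t‖ ^ N.totalOrder ξ * (B * D') * ‖Φ t‖ :=
                mul_le_mul_of_nonneg_right (mul_le_mul_of_nonneg_left h3 h4) (norm_nonneg _)
            _ = _ := by ring
      _ ≤ _ := by
          rw [intervalIntegral.integral_const_mul]
          exact mul_le_mul_of_nonneg_left h1 (by positivity)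
  have hYc' : Continuous fun t => ((ξ j * N.alpha lam : ℝ) : ℂ) * Y t := continuous_const.mul hYc
  have hXi : ∫ t in -Real.pi..Real.pi, X t =
      (N.openMean lam j : ℂ) * (2 * Real.pi * (sumProb p' m : ℂ)) := by
    rw [hint, ← intervalIntegral.integral_const_mul]
  rw [intervalIntegral.integral_sub (hXc.intervalIntegrable _ _)
    (hYc'.intervalIntegrable _ _), hXi, intervalIntegral.integral_const_mul] at hdiff
  set g := gammaDensity (N.totalOrder ξ) (N.totalOrder ξ) with hg
  have hgF : g ≤ F := hF _ hξ1 hξB _ (by linarith)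
  have hg0 : 0 ≤ g := gammaDensity_nonneg hξ1 (by linarith)
  set Z : ℂ := ∫ t in -Real.pi..Real.pi, Y t with hZ
  have hπ : (Real.pi : ℂ) ≠ 0 := by exact_mod_cast hpi.ne'
  have hαC : (N.alpha lam : ℂ) ≠ 0 := by exact_mod_cast hα0.ne'
  -- comparison of the mean of the queue with its principal part
  have hms := abs_le.1 (hB.mean_sat j hj lam h0 hl)
  have hξj1 := hB.one_le_order j hj
  have hξjB := hB.order_le_of_mem hj
  have hid : ((N.openMean lam j * (N.alpha lam * sumProb p' m - g) : ℝ) : ℂ) =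
      ((N.alpha lam / (2 * Real.pi) : ℝ) : ℂ) *
        ((N.openMean lam j : ℂ) * (2 * Real.pi * (sumProb p' m : ℂ)) -
          ((ξ j * N.alpha lam : ℝ) : ℂ) * Z) +
      ((ξ j * N.alpha lam : ℝ) : ℂ) * (((N.alpha lam / (2 * Real.pi) : ℝ) : ℂ) * Z - (g : ℂ)) +
      (((ξ j * N.alpha lam - N.openMean lam j) * g : ℝ) : ℂ) := by
    push_cast
    field_simp
    ring
  have hfin : |N.openMean lam j * (N.alpha lam * sumProb p' m - g)| ≤
      N.alpha lam * ((B * D' * K' + B * K + B * F) * E) := by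
    rw [← Real.norm_eq_abs, ← Complex.norm_real, hid]
    refine (norm_add₃_le).trans ?_
    rw [norm_mul, norm_mul, Complex.norm_real, Complex.norm_real, Complex.norm_real,
      Real.norm_of_nonneg (by positivity), Real.norm_of_nonneg (by positivity), Real.norm_eq_abs,
      abs_mul, abs_of_nonneg hg0]
    have t1 : N.alpha lam / (2 * Real.pi) * ‖(N.openMean lam j : ℂ) *
        (2 * Real.pi * (sumProb p' m : ℂ)) - ((ξ j * N.alpha lam : ℝ) : ℂ) * Z‖ ≤
        N.alpha lam * (B * D' * (K' * E)) :=
      mul_le_mul (div_le_self hα0.le (by linarith [Real.pi_gt_three])) hdiff (norm_nonneg _) hα0.le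
    have t2 : ξ j * N.alpha lam * ‖((N.alpha lam / (2 * Real.pi) : ℝ) : ℂ) * Z - (g : ℂ)‖ ≤
        B * N.alpha lam * (K * E) :=
      mul_le_mul (mul_le_mul_of_nonneg_right hξjB hα0.le) key (norm_nonneg _) (by positivity)
    have t3 : |ξ j * N.alpha lam - N.openMean lam j| * g ≤ N.alpha lam * (B * F * E) := by
      have h1 : |ξ j * N.alpha lam - N.openMean lam j| * g ≤ B * F := by
        refine mul_le_mul ?_ hgF hg0 hBp.le
        rw [abs_sub_comm]
        exact abs_le.2 hms
      have h2 : 1 ≤ N.alpha lam * E := by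
        rwa [div_le_iff₀' hα0] at hE0
      have h3 := mul_le_mul_of_nonneg_left h2 (by positivity : 0 ≤ B * F)
      linarith
    linarith
  have hmlow : N.alpha lam / 2 ≤ N.openMean lam j := by
    have := mul_le_mul_of_nonneg_right hξj1 hα0.le
    linarith
  have hm0 : 0 < N.openMean lam j := by linarith
  rw [abs_mul, abs_of_pos hm0] at hfin
  have h6 := (mul_le_mul_of_nonneg_right hmlow
    (abs_nonneg (N.alpha lam * sumProb p' m - g))).trans hfin
  refine le_of_mul_le_mul_left ?_ hα0
  linarith

end ClosedNetwork

namespace ClosedNetwork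

open MeasureTheory Finset ProductForm

/-! ### The approximations above criticality -/

/-- Above criticality, a lower bound for `α` and the order of the total load of the queues outside
`𝓕⁰`. -/
theorem UniformBounds.supercritical_bounds {n : ℕ} {N : ClosedNetwork n} {ξ : Fin n → ℝ}
    {B lam θ : ℝ} (hB : N.UniformBounds ξ B) {m : ℕ} (hI : N.IsIntensity m lam)
    (hcm : 0 < N.critMean) (hm : 1 + θ ≤ (m : ℝ) / N.critMean)
    (h1 : 2 * B ^ 2 ≤ θ * N.critMean)
    (h2 : 4 * B * (Real.exp (B ^ 2) * B ^ 2) ≤ θ * N.critMean) :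
    θ * N.critMean / (2 * B) ≤ N.alpha lam ∧ N.critMean / (2 * B) ≤ N.bulkLoad lam ∧
      N.bulkLoad lam ≤ B * N.critMean := by
  obtain ⟨h0, hl, hmean⟩ := hI
  have hBp := hB.pos
  have hB1 := hB.one_le
  have hα := alpha_pos hB.crit_pos h0 hl
  have h3 := abs_le.1 (hB.abs_sum_openMean_sub_le h0 hl)
  have h4 := hB.critMean_sub_bulkMean_le h0 hl
  rw [hmean] at h3
  rw [le_div_iff₀ hcm] at hm
  have hαlow : θ * N.critMean / (2 * B) ≤ N.alpha lam := by
    rw [div_le_iff₀ (by positivity)]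
    have h5 := mul_le_mul_of_nonneg_right hB.order_le hα.le
    linarith
  have hρ0 := maxLoad_pos hB.crit_pos h0
  have hρ1 := maxLoad_lt_one hB.crit_pos hl
  have hα1 : 1 ≤ N.alpha lam := by
    refine le_trans ?_ hαlow
    rw [le_div_iff₀ (by positivity)]
    nlinarith
  have hL : Real.log (1 / N.maxLoad lam) ≤ 1 / N.alpha lam := by
    refine (Real.log_le_sub_one_of_pos (by positivity)).trans_eq ?_
    rw [alpha_eq, one_div_div]
    field_simp
  have hL0 : 0 ≤ Real.log (1 / N.maxLoad lam) :=
    Real.log_nonneg ((one_le_div hρ0).2 hρ1.le)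
  set L := Real.log (1 / N.maxLoad lam)
  have hα' : 1 / N.alpha lam ≤ 1 := (div_le_one hα).2 hα1
  have h5 : L * Real.exp (L * B ^ 2) * B ^ 2 ≤ 1 / 2 := by
    calc L * Real.exp (L * B ^ 2) * B ^ 2 ≤
          1 / N.alpha lam * Real.exp (1 * B ^ 2) * B ^ 2 := by
          have : L ≤ 1 := hL.trans hα'
          gcongr
      _ = Real.exp (B ^ 2) * B ^ 2 / N.alpha lam := by
          rw [one_mul]
          ring
      _ ≤ 1 / 2 := by
          rw [div_le_iff₀ hα]
          rw [div_le_iff₀ (by positivity)] at hαlow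
          refine le_of_mul_le_mul_left ?_ (by positivity : 0 < 4 * B)
          linarith
  have h6 := mul_le_mul_of_nonneg_right h5 hcm.le
  have h7 : N.critMean / 2 ≤ N.bulkMean lam := by linarith [h4.2]
  have h8 := hB.bulkMean_le h0 hl.le
  refine ⟨hαlow, ?_, (hB.bulkLoad_le h0 hl.le).trans ?_⟩
  · rw [div_le_iff₀ (by positivity)]
    linarith
  · exact mul_le_mul_of_nonneg_left (by linarith [h4.1]) hBp.le

/-- The error of the local limit theorem with a pole in terms of `θ` and of the number `c` of
customers outside `𝓕⁰` at criticality, `α` being at least of order `θ c` and `R` of order `c`. -/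
theorem exists_poleError_le {B : ℝ} (hB1 : 1 ≤ B) :
    ∃ K : ℝ, 0 ≤ K ∧ ∀ ξ α R θ c : ℝ, 1 ≤ ξ → ξ ≤ B → 0 < c → 0 < θ → θ * c / (2 * B) ≤ α →
      c / (2 * B) ≤ R → R ≤ B * c → poleError ξ α R ≤
        K * (1 / (θ ^ 2 * c) + 1 / (θ * c) + 1 / √c * (1 / (c * θ ^ 2)) ^ ((ξ - 1) / 2)) := by
  have hBp : 0 < B := by linarith
  have hB2 : 1 ≤ 2 * B ^ 2 := by nlinarith
  refine ⟨2 * B + 4 * B ^ 3 + 2 * B * (2 * B ^ 2) ^ B, by positivity, ?_⟩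
  intro ξ α R θ c h1 h2 hc hθ hα hR1 hR2
  have hα0 : 0 < α := lt_of_lt_of_le (by positivity) hα
  have hR0 : 0 < R := lt_of_lt_of_le (by positivity) hR1
  have hs : 0 < √c := Real.sqrt_pos.2 hc
  have hss : √c ^ 2 = c := Real.sq_sqrt hc.le
  have e1 : 1 / α ≤ 2 * B * (1 / (θ * c)) := by
    refine (one_div_le_one_div_of_le (by positivity) hα).trans_eq ?_
    field_simp
  have e2 : R / α ^ 2 ≤ 4 * B ^ 3 * (1 / (θ ^ 2 * c)) := by
    calc R / α ^ 2 ≤ B * c / (θ * c / (2 * B)) ^ 2 := by gcongr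
      _ = _ := by
          field_simp
          ring
  have hRs : √R ≤ B * √c := by
    rw [Real.sqrt_le_left (by positivity), mul_pow, hss]
    refine hR2.trans (mul_le_mul_of_nonneg_right ?_ hc.le)
    nlinarith
  have hRl : √c / (2 * B) ≤ √R := by
    refine Real.le_sqrt_of_sq_le (le_trans ?_ hR1)
    rw [div_pow, hss]
    exact div_le_div_of_nonneg_left hc.le (by positivity) (by nlinarith)
  have hsR : 0 < √R := Real.sqrt_pos.2 hR0
  set z : ℝ := 1 / (c * θ ^ 2) with hz
  have hz0 : 0 < z := by positivity
  have hzs : √z = 1 / (θ * √c) := by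
    rw [hz, Real.sqrt_div zero_le_one, Real.sqrt_one, Real.sqrt_mul hc.le, Real.sqrt_sq hθ.le,
      mul_comm]
  have e3 : √R / α ≤ 2 * B ^ 2 * √z := by
    calc √R / α ≤ B * √c / (θ * c / (2 * B)) := by gcongr
      _ = B * √c / (θ * √c ^ 2 / (2 * B)) := by rw [hss]
      _ = _ := by
          rw [hzs]
          field_simp
  have e4 : (√R / α) ^ (ξ - 1) ≤ (2 * B ^ 2) ^ B * z ^ ((ξ - 1) / 2) := by
    refine (Real.rpow_le_rpow (by positivity) e3 (by linarith)).trans ?_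
    rw [Real.mul_rpow (by positivity) (by positivity), Real.sqrt_eq_rpow, ← Real.rpow_mul hz0.le]
    refine mul_le_mul (Real.rpow_le_rpow_of_exponent_le hB2 (by linarith)) (le_of_eq ?_)
      (by positivity) (by positivity)
    congr 1
    ring
  have e5 : 1 / √R ≤ 2 * B * (1 / √c) := by
    refine (one_div_le_one_div_of_le (by positivity) hRl).trans_eq ?_
    field_simp
  have e6 : 1 / √R * (√R / α) ^ (ξ - 1) ≤
      2 * B * (1 / √c) * ((2 * B ^ 2) ^ B * z ^ ((ξ - 1) / 2)) :=
    mul_le_mul e5 e4 (by positivity) (by positivity)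
  have p1 : 0 ≤ 1 / (θ ^ 2 * c) := by positivity
  have p2 : 0 ≤ 1 / (θ * c) := by positivity
  have p3 : 0 ≤ 1 / √c * z ^ ((ξ - 1) / 2) := by positivity
  have q1 : 0 ≤ (2 * B + 2 * B * (2 * B ^ 2) ^ B) * (1 / (θ ^ 2 * c)) := by positivity
  have q2 : 0 ≤ (4 * B ^ 3 + 2 * B * (2 * B ^ 2) ^ B) * (1 / (θ * c)) := by positivity
  have q3 : 0 ≤ (2 * B + 4 * B ^ 3) * (1 / √c * z ^ ((ξ - 1) / 2)) := by positivity
  unfold poleError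
  linear_combination e1 + e2 + e6 + q1 + q2 + q3

/-- The gamma approximation above criticality, with the error terms in the relative distance `θ`
to criticality. -/
theorem exists_supercritical_regime {B : ℝ} (hB1 : 1 ≤ B) (ℓ : ℕ) {Q : ℝ} (hQ : 0 < Q) :
    ∃ K M₀ δ : ℝ, 0 ≤ K ∧ 0 < δ ∧ ∀ {n : ℕ} {N : ClosedNetwork n} {ξ : Fin n → ℝ},
      N.UniformBounds ξ B → ∀ {m : ℕ} {lam θ ε : ℝ}, N.IsIntensity m lam → 0 < N.critMean →
      0 < θ → 1 + θ ≤ (m : ℝ) / N.critMean → M₀ ≤ N.critMean → M₀ ≤ θ * N.critMean →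
      M₀ ≤ θ ^ 2 * N.critMean →
      ε = 1 / (θ ^ 2 * N.critMean) + 1 / (θ * N.critMean) +
        1 / √(N.critMean) * (1 / (N.critMean * θ ^ 2)) ^ ((N.totalOrder ξ - 1) / 2) → ε ≤ δ →
      1 / 2 ≤ sumProb (N.openProb lam) m * (N.alpha lam * Real.Gamma (N.totalOrder ξ) /
        (N.totalOrder ξ ^ (N.totalOrder ξ - 1) * Real.exp (-N.totalOrder ξ))) ∧
      |sumProb (N.openProb lam) m * (N.alpha lam * Real.Gamma (N.totalOrder ξ) /
        (N.totalOrder ξ ^ (N.totalOrder ξ - 1) * Real.exp (-N.totalOrder ξ))) - 1| ≤ K * ε ∧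
      (∀ j ∈ N.satQueues,
        |sumProb (Function.update (N.openProb lam) j (sizeBias (N.openProb lam j))) m -
          sumProb (N.openProb lam) m| ≤ K * ε * sumProb (N.openProb lam) m) ∧
      ∀ (J : Finset (Fin n)) (p : Fin n → ℕ → ℝ), #J ≤ ℓ →
        (∀ k ∈ J, k ∉ N.satQueues) → (∀ k, IsProbSeq (p k)) → (∀ k, HasMoments (p k)) →
        (∀ k ∉ J, p k = N.openProb lam k) →
        (∀ k ∈ J, expectation (p k) (fun x => ((x : ℝ) - N.openMean lam k) ^ 2) ≤ Q ^ 2) →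
        |sumProb p m - sumProb (N.openProb lam) m| ≤ K * ε * sumProb (N.openProb lam) m := by
  have hBp : 0 < B := by linarith
  obtain ⟨K₁, hK₁, hpole⟩ := exists_pole_regime hB1 ℓ hQ
  obtain ⟨K₂, hK₂, hsat⟩ := exists_pole_regime_sat hB1
  obtain ⟨K₃, hK₃, herr⟩ := exists_poleError_le hB1
  obtain ⟨g₀, hg₀, hgl⟩ := exists_le_gammaDensity_self B
  set C := (K₁ + K₂) * K₃ with hC
  have hC0 : 0 ≤ C := by positivity
  refine ⟨4 * C / g₀, 4 * B ^ 4 + 4 * B * (Real.exp (B ^ 2) * B ^ 2) + 4 * B ^ 2 +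
    2 * B * (2 * ℓ * B), g₀ / (2 * C + 1), by positivity, by positivity, ?_⟩
  intro n N ξ hB m lam θ ε hI hcm hθ hm hM1 hM2 hM3 hε hεδ
  have p1 : 0 ≤ 4 * B ^ 4 := by positivity
  have p2 : 0 ≤ 4 * B * (Real.exp (B ^ 2) * B ^ 2) := by positivity
  have p3 : 0 ≤ 4 * B ^ 2 := by positivity
  have p4 : 0 ≤ 2 * B * (2 * ℓ * B) := by positivity
  obtain ⟨hα, hR1, hR2⟩ := hB.supercritical_bounds hI hcm hm (by linarith) (by linarith)
  have hB2 : B ≤ B ^ 2 := by nlinarith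
  have hα2 : 2 * B ≤ N.alpha lam := by
    refine le_trans ?_ hα
    rw [le_div_iff₀ (by positivity)]
    linarith
  have hR : 1 ≤ N.bulkLoad lam := by
    refine le_trans ?_ hR1
    rw [le_div_iff₀ (by positivity)]
    linarith
  have hℓR : 2 * ℓ * B ≤ N.bulkLoad lam := by
    refine le_trans ?_ hR1
    rw [le_div_iff₀ (by positivity)]
    linarith
  have hRα : √(N.bulkLoad lam) ≤ N.alpha lam := by
    have hs0 : 0 < √N.critMean := Real.sqrt_pos.2 hcm
    have hss : √N.critMean ^ 2 = N.critMean := Real.sq_sqrt hcm.le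
    have h1 : 2 * B ^ 2 ≤ θ * √N.critMean := by
      refine le_of_sq_le_sq ?_ (by positivity)
      rw [mul_pow θ, hss]
      linarith
    refine le_trans ?_ hα
    rw [Real.sqrt_le_left (by positivity)]
    refine hR2.trans ?_
    calc B * N.critMean = (B * 1) * N.critMean := by ring
      _ ≤ (B * B) * N.critMean := by gcongr
      _ = (2 * B ^ 2) ^ 2 * √N.critMean ^ 2 / (2 * B) ^ 2 := by
          rw [hss]
          field_simp
      _ ≤ (θ * √N.critMean) ^ 2 * √N.critMean ^ 2 / (2 * B) ^ 2 := by gcongr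
      _ = (θ * √N.critMean ^ 2 / (2 * B)) ^ 2 := by ring
      _ = _ := by rw [hss]
  have hξ1 := hB.one_le_totalOrder
  have hE := herr _ _ _ θ _ hξ1 hB.order_le hcm hθ hα hR1 hR2
  rw [← hε] at hE
  have hα0 : 0 < N.alpha lam := by linarith
  have hε0 : 0 < ε := by
    rw [hε]
    positivity
  set g := gammaDensity (N.totalOrder ξ) (N.totalOrder ξ) with hg
  have hgg : g₀ ≤ g := hgl _ hξ1 hB.order_le
  have hg0 : 0 < g := by linarith
  set P := sumProb (N.openProb lam) m with hP
  set E := poleError (N.totalOrder ξ) (N.alpha lam) (N.bulkLoad lam)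
  have hKE : ∀ x K : ℝ, K ≤ K₁ + K₂ → 0 ≤ K → x ≤ K * E → x ≤ C * ε := by
    intro x K hK hK0 hx
    calc x ≤ K * (K₃ * ε) := hx.trans (mul_le_mul_of_nonneg_left hE hK0)
      _ ≤ (K₁ + K₂) * (K₃ * ε) := mul_le_mul_of_nonneg_right hK (by positivity)
      _ = _ := by rw [hC]; ring
  have hst := hI.stable
  have hmain : |N.alpha lam * P - g| ≤ C * ε :=
    hKE _ K₁ (by linarith) hK₁ (hpole hB hI (by linarith) hR hℓR ∅ (N.openProb lam) (by simp)
      (by simp) (fun k => (hst k).isProbSeq) (fun k => (hst k).hasMoments) (fun _ _ => rfl)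
      (by simp))
  have hCε : C * ε ≤ g₀ / 2 := by
    rw [le_div_iff₀ (by positivity)] at hεδ
    linarith
  have hPg : g / 2 ≤ N.alpha lam * P := by
    have := (abs_le.1 hmain).1
    linarith
  have hcomp : ∀ P' : ℝ, |N.alpha lam * P' - g| ≤ C * ε → |P' - P| ≤ 4 * C / g₀ * ε * P := by
    intro P' h'
    have h1 : N.alpha lam * |P' - P| ≤ 2 * (C * ε) := by
      rw [← abs_of_pos hα0, ← abs_mul]
      have e : N.alpha lam * (P' - P) = (N.alpha lam * P' - g) - (N.alpha lam * P - g) := by ring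
      rw [e]
      exact (abs_sub _ _).trans (by linarith)
    have h2 : g₀ / 2 ≤ N.alpha lam * P := by linarith
    refine le_of_mul_le_mul_left (h1.trans ?_) hα0
    calc 2 * (C * ε) = 4 * C / g₀ * ε * (g₀ / 2) := by
          field_simp
          ring
      _ ≤ 4 * C / g₀ * ε * (N.alpha lam * P) := mul_le_mul_of_nonneg_left h2 (by positivity)
      _ = _ := by ring
  have hs : P * (N.alpha lam * Real.Gamma (N.totalOrder ξ) /
      (N.totalOrder ξ ^ (N.totalOrder ξ - 1) * Real.exp (-N.totalOrder ξ))) =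
      N.alpha lam * P / g := by
    rw [hg, gammaDensity, div_div_eq_mul_div]
    ring
  rw [hs]
  refine ⟨?_, ?_, ?_, ?_⟩
  · rw [le_div_iff₀ hg0]
    linarith
  · rw [div_sub_one hg0.ne', abs_div, abs_of_pos hg0, div_le_iff₀ hg0]
    calc _ ≤ C * ε := hmain
      _ = C / g₀ * ε * g₀ := by field_simp
      _ ≤ C / g₀ * ε * g := mul_le_mul_of_nonneg_left hgg (by positivity)
      _ ≤ _ := by
          have : 0 ≤ C / g₀ * ε * g := by positivity
          linear_combination 3 * this
  · intro j hj
    exact hcomp _ (hKE _ K₂ (by linarith) hK₂ (hsat hB hI hα2 hR hRα j hj))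
  · intro J p hJ hJs hp hmom hoff hE'
    exact hcomp _ (hKE _ K₁ (by linarith) hK₁
      (hpole hB hI (by linarith) hR hℓR J p hJ hJs hp hmom hoff hE'))

/-! ### The theorem above criticality -/

/-- The approximations above criticality, under uniform bounds and `m̂⁰ → ∞`. -/
theorem supercritical_approx {N : (n : ℕ+) → ClosedNetwork n} {m : ℕ+ → ℕ} {lam : ℕ+ → ℝ}
    {ξ : (n : ℕ+) → Fin n → ℝ} {B : ℝ} (hB : ∀ n, (N n).UniformBounds (ξ n) B)
    (hlam : ∀ n, (N n).IsIntensity (m n) (lam n))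
    (hcm : Tendsto (fun n => (N n).critMean) atTop atTop)
    {θ : ℕ+ → ℝ} (hθ : ∀ n, 0 < θ n)
    (hsup : ∀ n, 0 < (N n).critMean → 1 + θ n ≤ (m n : ℝ) / (N n).critMean)
    (hθ1 : Tendsto (fun n => θ n * (N n).critMean) atTop atTop)
    (hθ2 : Tendsto (fun n => θ n ^ 2 * (N n).critMean) atTop atTop) :
    ∃ ε : ℕ+ → ℝ,
      (∀ n, ε n = 1 / (θ n ^ 2 * (N n).critMean) + 1 / (θ n * (N n).critMean) +
        1 / √((N n).critMean) *
          (1 / ((N n).critMean * θ n ^ 2)) ^ (((N n).totalOrder (ξ n) - 1) / 2)) ∧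
      Tendsto ε atTop (𝓝 0) ∧
      MeanApprox N m lam {n | 0 < (N n).critMean} (fun _ => Set.univ) ε ∧
      MarginalApprox N m lam {n | 0 < (N n).critMean}
        (fun n J => Disjoint J (N n).satQueues) ε ∧
      JointApprox N m lam {n | 0 < (N n).critMean}
        (fun n => (N n).alpha (lam n) * Real.Gamma ((N n).totalOrder (ξ n)) /
          ((N n).totalOrder (ξ n) ^ ((N n).totalOrder (ξ n) - 1) *
            Real.exp (-(N n).totalOrder (ξ n)))) ε := by
  classical
  have hB1 : 1 ≤ B := (hB 1).one_le
  have hBp : 0 < B := by linarith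
  have hk : ∀ n : ℕ+, Fin n := fun n => ⟨0, n.pos⟩
  have hP : ∀ n, 0 < sumProb ((N n).openProb (lam n)) (m n) := fun n => (hlam n).sumProb_pos (hk n)
  have hξ1 := fun n => (hB n).one_le_totalOrder
  obtain ⟨ε, hε⟩ : ∃ ε : ℕ+ → ℝ, ∀ n,
      ε n = 1 / (θ n ^ 2 * (N n).critMean) + 1 / (θ n * (N n).critMean) +
        1 / √((N n).critMean) *
          (1 / ((N n).critMean * θ n ^ 2)) ^ (((N n).totalOrder (ξ n) - 1) / 2) := ⟨_, fun _ => rfl⟩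
  have hε0 : ∀ n ∈ {n | 0 < (N n).critMean}, 0 < ε n := fun n hn => by
    have hn' : 0 < (N n).critMean := hn
    have := hθ n
    rw [hε]
    positivity
  have hlim : Tendsto ε atTop (𝓝 0) := by
    have l1 : Tendsto (fun n => 1 / (θ n ^ 2 * (N n).critMean)) atTop (𝓝 0) := by
      simp_rw [one_div]
      exact hθ2.inv_tendsto_atTop
    have l2 : Tendsto (fun n => 1 / (θ n * (N n).critMean)) atTop (𝓝 0) := by
      simp_rw [one_div]
      exact hθ1.inv_tendsto_atTop
    have l3 : Tendsto (fun n => 1 / √((N n).critMean)) atTop (𝓝 0) := by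
      simp_rw [one_div]
      exact (Real.tendsto_sqrt_atTop.comp hcm).inv_tendsto_atTop
    have l4 := (l1.add l2).add l3
    rw [add_zero, add_zero] at l4
    refine squeeze_zero' ?_ ?_ l4
    · filter_upwards [hcm.eventually_gt_atTop 0] with n hn using (hε0 n hn).le
    · filter_upwards [hcm.eventually_gt_atTop 0, hθ2.eventually_ge_atTop 1] with n hn hn2
      have := hθ n
      rw [hε]
      refine add_le_add_right (mul_le_of_le_one_right (by positivity) ?_) _
      refine Real.rpow_le_one (by positivity) ?_ (by linarith [hξ1 n])
      rw [div_le_one (by positivity), mul_comm]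
      exact hn2
  -- what `exists_supercritical_regime` gives for all large `n`
  have hlarge : ∀ M₀ δ : ℝ, 0 < δ → ∀ᶠ n in atTop, M₀ ≤ (N n).critMean ∧
      M₀ ≤ θ n * (N n).critMean ∧ M₀ ≤ θ n ^ 2 * (N n).critMean ∧ ε n ≤ δ := fun M₀ δ hδ =>
    (hcm.eventually_ge_atTop M₀).and ((hθ1.eventually_ge_atTop M₀).and
      ((hθ2.eventually_ge_atTop M₀).and (hlim.eventually_le_const hδ)))
  refine ⟨ε, hε, hlim, ?_, ?_, ?_⟩
  · obtain ⟨K, M₀, δ, hK, hδ, hreg⟩ := exists_supercritical_regime hB1 1 (Q := 2 * B) (by linarith)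
    refine meanApprox_of_eventually (K := K) hlam hε0 ?_
    filter_upwards [hlarge M₀ δ hδ] with n ⟨h1, h2, h3, h4⟩ hcrit j _
    obtain ⟨h0, hl, -⟩ := hlam n
    obtain ⟨-, -, hsat, hcomp⟩ :=
      hreg (hB n) (hlam n) hcrit (hθ n) (hsup n hcrit) h1 h2 h3 (hε n) h4
    refine abs_closedMean_sub_le (hlam n).stable h0 (hP n) ?_
    by_cases hj : j ∈ (N n).satQueues
    · exact hsat j hj
    · refine hcomp {j} _ (by simp) (by simpa using hj)
        (update_sizeBias_isProbSeq (hlam n).stable j)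
        (update_sizeBias_hasMoments (hlam n).stable j)
        (fun k hk => Function.update_of_ne (by simpa using hk) _ _) fun k hk => ?_
      obtain rfl := mem_singleton.1 hk
      rw [Function.update_self]
      have h5 := (hB n).expectation_sizeBias_le h0 hl le_rfl (fun h => absurd h hj)
      rwa [mul_one] at h5
  · refine marginalApprox_of_eventually hlam hε0 fun l q => ?_
    have hQ : ∀ i, (q i : ℝ) ≤ ∑ i, (q i : ℝ) := fun i =>
      single_le_sum (f := fun i => (q i : ℝ)) (fun _ _ => Nat.cast_nonneg _) (mem_univ i)
    have hQ0 : 0 ≤ ∑ i, (q i : ℝ) := sum_nonneg fun i _ => Nat.cast_nonneg _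
    obtain ⟨K, M₀, δ, hK, hδ, hreg⟩ := exists_supercritical_regime hB1 l
      (Q := ∑ i, (q i : ℝ) + B ^ 2) (by positivity)
    refine ⟨K, ?_⟩
    filter_upwards [hlarge M₀ δ hδ] with n ⟨h1, h2, h3, h4⟩ hcrit e he
    obtain ⟨h0, hl, -⟩ := hlam n
    obtain ⟨-, -, -, hcomp⟩ :=
      hreg (hB n) (hlam n) hcrit (hθ n) (hsup n hcrit) h1 h2 h3 (hε n) h4
    have hns : ∀ i, e i ∉ (N n).satQueues := fun i hi => Set.disjoint_left.1 he ⟨i, rfl⟩ hi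
    refine abs_closedMarginal_sub_le (hlam n).stable h0 (hP n) ?_
    refine hcomp (univ.map e) _ (by simp) (by simpa using hns)
      (pinned_isProbSeq (hlam n).stable e q) (pinned_hasMoments (hlam n).stable e q)
      (fun k hk => pinned_of_notMem _ _ _ (by simpa using hk)) fun k hk => ?_
    obtain ⟨i, -, rfl⟩ := mem_map.1 hk
    rw [pinned_apply, expectation_single]
    have h5 := (hB n).sub_openMean_sq_le h0 hl le_rfl (fun h => absurd h (hns i)) (q i)
    rw [mul_one] at h5
    exact h5.trans (pow_le_pow_left₀ (by positivity) (by linarith [hQ i]) 2)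
  · obtain ⟨K, M₀, δ, hK, hδ, hreg⟩ := exists_supercritical_regime hB1 0 (Q := 1) one_pos
    refine jointApprox_of_eventually (K := 2 * K) hlam hε0 (fun n _ => ?_) ?_
    · have h1 : 0 < (N n).totalOrder (ξ n) := by linarith [hξ1 n]
      have h2 := Real.Gamma_pos_of_pos h1
      have h3 := alpha_pos (hB n).crit_pos (hlam n).1 (hlam n).2.1
      positivity
    · filter_upwards [hlarge M₀ δ hδ] with n ⟨h1, h2, h3, h4⟩ hcrit q hq
      obtain ⟨hhalf, hx, -, -⟩ :=
        hreg (hB n) (hlam n) hcrit (hθ n) (hsup n hcrit) h1 h2 h3 (hε n) h4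
      rw [mul_assoc 2 K]
      exact abs_closedProb_sub_le (hlam n).stable (hlam n).1 hq hhalf hx

end ClosedNetwork

theorem mainTheorem2
    (N : (n : ℕ+) → ClosedNetwork n) (m : ℕ+ → ℕ) (lam : ℕ+ → ℝ) (ξ : (n : ℕ+) → Fin n → ℝ)
    (hfin : ∀ n, (N n).finiteQueues.Nonempty)
    (hlam : ∀ n, (N n).IsIntensity (m n) (lam n))
    (hpole : PoleAssumption N ξ) (huan : UANAssumption N)
    (hservice : ServiceAssumption N) (hnonsat : NonsatAssumption N)
    (hξ : ∃ B : ℝ, ∀ n, (N n).totalOrder (ξ n) ≤ B)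
    (θ : ℕ+ → ℝ) (hθ : ∀ n, 0 < θ n) :
    ((∀ n, 0 < (N n).critMean → (m n : ℝ) / (N n).critMean ≤ 1 - θ n) →
      Tendsto (fun n => θ n ^ 2 * (m n : ℝ)) atTop atTop →
      ∃ ε ε' : ℕ+ → ℝ,
        (∀ n, ε n = 1 / (m n : ℝ) + 1 / ((m n : ℝ) ^ 2 * θ n ^ 4)) ∧
        (∀ n, ε' n = 1 / (θ n ^ 2 * (m n : ℝ))) ∧
        Tendsto ε atTop (𝓝 0) ∧ Tendsto ε' atTop (𝓝 0) ∧
        MeanApprox N m lam {n | 0 < (N n).critMean} (fun n => (N n).satQueuesᶜ) ε ∧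
        MeanApprox N m lam {n | 0 < (N n).critMean} (fun n => (N n).satQueues) ε' ∧
        MarginalApprox N m lam {n | 0 < (N n).critMean}
          (fun n J => Disjoint J (N n).satQueues) ε ∧
        MarginalApprox N m lam {n | 0 < (N n).critMean}
          (fun n J => ¬ Disjoint J (N n).satQueues) ε' ∧
        JointApprox N m lam {n | 0 < (N n).critMean}
          (fun n => √(2 * Real.pi) * (N n).openSD (lam n)) ε) ∧
    ((∀ n, 0 < (N n).critMean → 1 + θ n ≤ (m n : ℝ) / (N n).critMean) →
      Tendsto (fun n => θ n * (N n).critMean) atTop atTop →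
      Tendsto (fun n => θ n ^ 2 * (N n).critMean) atTop atTop →
      ∃ ε : ℕ+ → ℝ,
        (∀ n, ε n = 1 / (θ n ^ 2 * (N n).critMean) + 1 / (θ n * (N n).critMean) +
          1 / √((N n).critMean) *
            (1 / ((N n).critMean * θ n ^ 2)) ^ (((N n).totalOrder (ξ n) - 1) / 2)) ∧
        Tendsto ε atTop (𝓝 0) ∧
        MeanApprox N m lam {n | 0 < (N n).critMean} (fun _ => Set.univ) ε ∧
        MarginalApprox N m lam {n | 0 < (N n).critMean}
          (fun n J => Disjoint J (N n).satQueues) ε ∧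
        JointApprox N m lam {n | 0 < (N n).critMean}
          (fun n => (N n).alpha (lam n) * Real.Gamma ((N n).totalOrder (ξ n)) /
            ((N n).totalOrder (ξ n) ^ ((N n).totalOrder (ξ n) - 1) *
              Real.exp (-(N n).totalOrder (ξ n)))) ε) := by
  have hcrit : ∀ n, 0 < (N n).critIntensity := fun n => (hlam n).1.trans (hlam n).2.1
  obtain ⟨B, hB⟩ := ClosedNetwork.exists_uniformBounds hfin hcrit hpole hservice hnonsat hξ
  have hcm := ClosedNetwork.tendsto_critMean hB huan
  exact ⟨fun hsub hθm => ClosedNetwork.subcritical_approx hB hlam hcm hθ hsub hθm,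
    fun hsup hθ1 hθ2 => ClosedNetwork.supercritical_approx hB hlam hcm hθ hsup hθ1 hθ2⟩
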